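/- All vector spaces are over $\mathbb C$. A DGLA is an $\mathbb N$-graded differential graded Lie algebra; a DGLA pair $(C,M)$ is a DGLA $C$ with an $\mathbb N$-graded differential graded $C$-module $M$, and pairs are assumed to satisfy: $M^i=0$ for $i\gg 0$ and $\dim H^j(M)<\infty$ for all $j$. A morphism of complexes is a $q$-equivalence if it is an isomorphism on $H^j$ for $j\le q$ and injective on $H^{q+1}$. A morphism of pairs $(C,M)\to(D,N)$ is a $q$-equivalence if $C\to D$ is a $1$-equivalence and $M\to N$ is a $q$-equivalence. The pair $(C,M)$ is $q$-formal if it is connected by a zig-zag of $q$-equivalences of pairs to $(H^\bullet(C),H^\bullet(M))$ with zero differentials. For a Noetherian ring $R$ and a bounded above complex $E$ of $R$-modules with finitely generated cohomology, $J^i_k(E)=I_{\operatorname{rank}F^i-k+1}(d_F^{i-1}\oplus d_F^i)$, where $F\to E$ is any quasi-isomorphism from a bounded above complex of finitely generated free modules and $I_r$ denotes the ideal of $r\times r$ minors. For an Artinian local $\mathbb C$-algebra $A$ of finite type with maximal ideal $m$, $\mathrm{Def}(C)(A)$ is the set of solutions $\omega\in C^1\otimes m$ of $d\omega+\frac12[\omega,\omega]=0$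 modulo the gauge action $\lambda\cdot\omega=e^{\operatorname{ad}\lambda}\omega+\frac{1-e^{\operatorname{ad}\lambda}}{\operatorname{ad}\lambda}(d\lambda)$ of $\lambda\in C^0\otimes m$, and $\mathrm{Def}^i_k(C,M)(A)\subseteq \mathrm{Def}(C)(A)$ consists of the classes of those $\omega$ with $J^i_k(M\otimes A,\,d+\omega)=0$. When $\dim H^1(C)<\infty$, $\mathcal Q(C)=\{\eta\in H^1(C): [\eta,\eta]=0\}$ is regarded as an affine scheme with tautological section $\zeta\in H^1(C)\otimes\mathcal O_{\mathcal Q(C)}$, and ${}^h\mathcal R^i_k(C,M)\subseteq \mathcal Q(C)$ is the closed subscheme defined by $J^i_k(H^\bullet(M)\otimes\mathcal O_{\mathcal Q(C)},\zeta)$. A functor on Artinian local algebras is prorepresented by a pointed affine scheme germ $X_{(0)}$ if it is naturally isomorphic to $\operatorname{Hom}(\widehat{\mathcal O}_{X,0},-)$. **Theorem.** Let $1\le q\le\infty$, let $(C,M)$ be a $q$-formal DGLA pair (so in particular $C$ is $1$-formal) with $\dim H^1(C)<\infty$, let $\mathfrak g$ be a Lie algebra and $\varepsilon:C\to\mathfrak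 g$ a DGLA map, where $\mathfrak g$ is placed in degree $0$. Suppose that $\varepsilon^0:C^0\to\mathfrak g$ is surjective, that the restriction of $\varepsilon^0$ to $H^0(C)=\ker(d|_{C^0})$ is injective, and that $W=\mathfrak g/\varepsilon(H^0(C))$ is finite-dimensional. Let $C_0=\ker\varepsilon$, $\mathrm{Def}(C;\varepsilon)=\mathrm{Def}(C_0)$ and $\mathrm{Def}^i_k(C,M;\varepsilon)=\mathrm{Def}^i_k(C_0,M)$. Then there is a natural isomorphism $\mathrm{Def}(C;\varepsilon)\cong(\mathcal Q(C)\times W)_{(0)}$ such that for all $0\le i\le q$ and all $k\ge 0$, $\mathrm{Def}^i_k(C,M;\varepsilon)$ is a subfunctor of $\mathrm{Def}(C;\varepsilon)$ and there is a natural isomorphism $\mathrm{Def}^i_k(C,M;\varepsilon)\cong({}^h\mathcal R^i_k(C,M)\times W)_{(0)}$ for which the square $$\begin{array}{ccc}\mathrm{Def}^i_k(C,M;\varepsilon)&\longrightarrow&({}^h\mathcal R^i_k(C,M)\times W)_{(0)}\\ \downarrow&&\downarrow\\ \mathrm{Def}(C;\varepsilon)&\longrightarrow&(\mathcal Q(C)\times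 W)_{(0)}\end{array}$$ commutes, the vertical maps being the inclusions; here $(-)_{(0)}$ denotes the functor prorepresented by the formal germ at the origin. -/

import Mathlib

open scoped TensorProduct
open CategoryTheory

universe s t u v w

/-- A complex of complex vector spaces `V = ⨁_{i ∈ ℕ} Vⁱ`, given by the total space, the
graded pieces and the total differential. -/
structure GrComplex where
  carrier : Type u
  [addCommGroup : AddCommGroup carrier]
  [module : Module ℂ carrier]
  gr : ℕ → Submodule ℂ carrier
  internal : DirectSum.IsInternal gr
  d : carrier →ₗ[ℂ] carrier
  d_mem : ∀ {i : ℕ} {x : carrier}, x ∈ gr i → d x ∈ gr (i + 1)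
  d_d : ∀ x : carrier, d (d x) = 0

attribute [instance] GrComplex.addCommGroup GrComplex.module

section Grading

variable {V : Type u} [AddCommGroup V] [Module ℂ V]

lemma isInternal_of_proj (gr : ℕ → Submodule ℂ V) (p : ℕ → V →ₗ[ℂ] V)
    (h₁ : ∀ i x, x ∈ gr i → p i x = x) (h₂ : ∀ i j x, x ∈ gr j → j ≠ i → p i x = 0)
    (h₃ : ∀ x, x ∈ ⨆ i, gr i) : DirectSum.IsInternal gr := by
  refine DirectSum.isInternal_submodule_of_iSupIndep_of_iSup_eq_top ?_ (eq_top_iff.2 fun x _ => h₃ x)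
  intro i
  rw [Submodule.disjoint_def]
  intro x hx hx'
  have : (⨆ j, ⨆ (_ : j ≠ i), gr j) ≤ LinearMap.ker (p i) :=
    iSup_le fun j => iSup_le fun hj => fun y hy => h₂ i j y hy hj
  rw [← h₁ i x hx]
  exact this hx'

lemma exists_proj (gr : ℕ → Submodule ℂ V) (h : DirectSum.IsInternal gr) :
    ∃ p : ℕ → V →ₗ[ℂ] V, (∀ i x, p i x ∈ gr i) ∧ (∀ i x, x ∈ gr i → p i x = x) ∧
      (∀ i j x, x ∈ gr j → j ≠ i → p i x = 0) ∧ ∀ x, ∃ s : Finset ℕ, x = ∑ i ∈ s, p i x := by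
  classical
  let e := LinearEquiv.ofBijective (DirectSum.coeLinearMap gr) h
  have he : ∀ j (x : gr j), e.symm (x : V) = DirectSum.lof ℂ ℕ (fun i => gr i) j x := by
    intro j x
    rw [LinearEquiv.symm_apply_eq]
    exact (DirectSum.coeLinearMap_lof gr j x).symm
  refine ⟨fun i => (gr i).subtype ∘ₗ DirectSum.component ℂ ℕ (fun i => gr i) i ∘ₗ e.symm.toLinearMap,
    fun i x => ?_, fun i x hx => ?_, fun i j x hx hj => ?_, fun x => ?_⟩
  · exact Submodule.coe_mem _
  · have := he i ⟨x, hx⟩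
    simp only [LinearMap.comp_apply, LinearEquiv.coe_coe]
    erw [this, DirectSum.component.lof_self]
    rfl
  · have := he j ⟨x, hx⟩
    simp only [LinearMap.comp_apply, LinearEquiv.coe_coe]
    erw [this, DirectSum.component.of, dif_neg hj]
    rfl
  · refine ⟨(e.symm x).support, ?_⟩
    conv_lhs => rw [← e.apply_symm_apply x]
    have := DirectSum.coeLinearMap_eq_dfinsuppSum gr (e.symm x)
    exact this

/-- A submodule that contains the homogeneous components of its elements is graded. -/
lemma le_iSup_inf_of_proj (gr : ℕ → Submodule ℂ V) (p : ℕ → V →ₗ[ℂ] V)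
    (h₀ : ∀ i x, p i x ∈ gr i) (h₃ : ∀ x, ∃ s : Finset ℕ, x = ∑ i ∈ s, p i x)
    (P : Submodule ℂ V) (hP : ∀ i x, x ∈ P → p i x ∈ P) : P ≤ ⨆ i, P ⊓ gr i := by
  intro x hx
  obtain ⟨s, hs⟩ := h₃ x
  rw [hs]
  exact Submodule.sum_mem _ fun i _ =>
    (le_iSup (fun i => P ⊓ gr i) i) ⟨hP i x hx, h₀ i x⟩

lemma isInternal_comap_subtype (gr : ℕ → Submodule ℂ V) (p : ℕ → V →ₗ[ℂ] V)
    (h₀ : ∀ i x, p i x ∈ gr i) (h₁ : ∀ i x, x ∈ gr i → p i x = x)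
    (h₂ : ∀ i j x, x ∈ gr j → j ≠ i → p i x = 0)
    (h₃ : ∀ x, ∃ s : Finset ℕ, x = ∑ i ∈ s, p i x)
    (P : Submodule ℂ V) (hP : ∀ i x, x ∈ P → p i x ∈ P) :
    DirectSum.IsInternal fun i => (gr i).comap P.subtype := by
  refine isInternal_of_proj _ (fun i => (p i).restrict (hP i)) ?_ ?_ ?_
  · intro i x hx
    exact Subtype.ext (h₁ i x hx)
  · intro i j x hx hj
    exact Subtype.ext (h₂ i j x hx hj)
  · intro x
    obtain ⟨s, hs⟩ := h₃ x
    have : x = ∑ i ∈ s, (p i).restrict (hP i) x := by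
      apply Subtype.ext
      simpa using hs
    rw [this]
    exact Submodule.sum_mem _ fun i _ =>
      (le_iSup (fun i => (gr i).comap P.subtype) i) (h₀ i x)

lemma isInternal_map_mkQ (gr : ℕ → Submodule ℂ V) (p : ℕ → V →ₗ[ℂ] V)
    (h₀ : ∀ i x, p i x ∈ gr i) (h₁ : ∀ i x, x ∈ gr i → p i x = x)
    (h₂ : ∀ i j x, x ∈ gr j → j ≠ i → p i x = 0)
    (h₃ : ∀ x, ∃ s : Finset ℕ, x = ∑ i ∈ s, p i x)
    (P : Submodule ℂ V) (hP : ∀ i x, x ∈ P → p i x ∈ P) :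
    DirectSum.IsInternal fun i => (gr i).map P.mkQ := by
  refine isInternal_of_proj _ (fun i => P.mapQ P (p i) (hP i)) ?_ ?_ ?_
  · rintro i _ ⟨x, hx, rfl⟩
    simp [h₁ i x hx]
  · rintro i j _ ⟨x, hx, rfl⟩ hj
    simp [h₂ i j x hx hj]
  · intro x
    obtain ⟨x, rfl⟩ := P.mkQ_surjective x
    obtain ⟨s, hs⟩ := h₃ x
    rw [hs, map_sum]
    exact Submodule.sum_mem _ fun i _ =>
      (le_iSup (fun i => (gr i).map P.mkQ) i) ⟨_, h₀ i x, rfl⟩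

end Grading

namespace GrComplex

variable (E : GrComplex.{u})

lemma exists_proj : ∃ p : ℕ → E.carrier →ₗ[ℂ] E.carrier, (∀ i x, p i x ∈ E.gr i) ∧
    (∀ i x, x ∈ E.gr i → p i x = x) ∧ (∀ i j x, x ∈ E.gr j → j ≠ i → p i x = 0) ∧
    (∀ x, ∃ s : Finset ℕ, x = ∑ i ∈ s, p i x) ∧ (∀ i x, p (i + 1) (E.d x) = E.d (p i x)) ∧
    ∀ x, p 0 (E.d x) = 0 := by
  obtain ⟨p, h₀, h₁, h₂, h₃⟩ := _root_.exists_proj E.gr E.internal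
  refine ⟨p, h₀, h₁, h₂, h₃, fun i x => ?_, fun x => ?_⟩
  · have : (⊤ : Submodule ℂ E.carrier) ≤ LinearMap.ker (p (i + 1) ∘ₗ E.d - E.d ∘ₗ p i) := by
      rw [← E.internal.submodule_iSup_eq_top]
      refine iSup_le fun j y hy => ?_
      rw [LinearMap.mem_ker, LinearMap.sub_apply, LinearMap.comp_apply, LinearMap.comp_apply]
      by_cases h : j = i
      · subst h
        rw [h₁ _ _ (E.d_mem hy), h₁ _ _ hy, sub_self]
      · rw [h₂ _ _ _ (E.d_mem hy) (by omega), h₂ _ _ _ hy h, map_zero, sub_self]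
    exact sub_eq_zero.1 (this (Submodule.mem_top (x := x)))
  · have : (⊤ : Submodule ℂ E.carrier) ≤ LinearMap.ker (p 0 ∘ₗ E.d) := by
      rw [← E.internal.submodule_iSup_eq_top]
      refine iSup_le fun j y hy => ?_
      exact h₂ _ _ _ (E.d_mem hy) (by omega)
    exact this (Submodule.mem_top (x := x))

/-- The cocycles `ker d`. -/
def cocycles : Submodule ℂ E.carrier := LinearMap.ker E.d

/-- The coboundaries `im d`, as a subspace of the cocycles. -/
def coboundaries : Submodule ℂ E.cocycles := (LinearMap.range E.d).comap E.cocycles.subtype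

lemma cocycles_le : E.cocycles ≤ ⨆ i, E.cocycles ⊓ E.gr i := by
  obtain ⟨p, h₀, h₁, h₂, h₃, h₄, h₅⟩ := E.exists_proj
  refine le_iSup_inf_of_proj E.gr p h₀ h₃ _ fun i x hx => ?_
  change E.d (p i x) = 0
  rw [← h₄, show E.d x = 0 from hx, map_zero]

/-- The total cohomology `H(E) = ker d / im d`. -/
abbrev Coh : Type u := E.cocycles ⧸ E.coboundaries

/-- The degree `i` part `Hⁱ(E)` of the cohomology. -/
def cohGr (i : ℕ) : Submodule ℂ E.Coh :=
  ((E.gr i).comap E.cocycles.subtype).map E.coboundaries.mkQ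

/-- The cohomology of a complex, regarded as a complex with zero differential. -/
abbrev cohomology : GrComplex.{u} where
  carrier := E.Coh
  gr := E.cohGr
  internal := by
    obtain ⟨p, h₀, h₁, h₂, h₃, h₄, h₅⟩ := E.exists_proj
    have hZ : ∀ i x, x ∈ E.cocycles → p i x ∈ E.cocycles := fun i x hx => by
      change E.d (p i x) = 0
      rw [← h₄, show E.d x = 0 from hx, map_zero]
    refine isInternal_map_mkQ _ (fun i => (p i).restrict (hZ i)) ?_ ?_ ?_ ?_ _ ?_
    · exact fun i x => h₀ i x
    · exact fun i x hx => Subtype.ext (h₁ i x hx)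
    · exact fun i j x hx hj => Subtype.ext (h₂ i j x hx hj)
    · intro x
      obtain ⟨s, hs⟩ := h₃ x
      exact ⟨s, Subtype.ext (by simpa using hs)⟩
    · rintro i ⟨x, hx⟩ ⟨y, hy⟩
      change E.d y = x at hy
      subst hy
      cases i with
      | zero => exact ⟨0, by simp [h₅]⟩
      | succ i => exact ⟨p i y, by simp [h₄]⟩
  d := 0
  d_mem _ := Submodule.zero_mem _
  d_d _ := rfl

/-- A morphism of complexes: a linear map preserving the grading and the differential. -/
structure Hom (E : GrComplex.{u}) (F : GrComplex.{v}) where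
  toFun : E.carrier →ₗ[ℂ] F.carrier
  map_mem : ∀ {i : ℕ} {x : E.carrier}, x ∈ E.gr i → toFun x ∈ F.gr i
  map_d : ∀ x : E.carrier, toFun (E.d x) = F.d (toFun x)

/-- The map induced on cohomology. -/
def Hom.cohMap {E : GrComplex.{u}} {F : GrComplex.{v}} (f : E.Hom F) : E.Coh →ₗ[ℂ] F.Coh :=
  Submodule.mapQ _ _
    (f.toFun.restrict (p := E.cocycles) (q := F.cocycles) fun x hx => by
      change F.d (f.toFun x) = 0
      rw [← f.map_d, show E.d x = 0 from hx, map_zero])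
    (by
      rintro ⟨x, hx⟩ ⟨y, hy⟩
      exact ⟨f.toFun y, by rw [← f.map_d, hy]; rfl⟩)

/-- A morphism is a `q`-equivalence if it induces an isomorphism on `Hʲ` for `j ≤ q` and a
monomorphism on `H^(q+1)`. -/
def Hom.IsEquivalence {E : GrComplex.{u}} {F : GrComplex.{v}} (f : E.Hom F) (q : ℕ∞) : Prop :=
  (∀ j : ℕ, (j : ℕ∞) ≤ q → Set.BijOn f.cohMap (E.cohGr j) (F.cohGr j)) ∧
  ∀ j : ℕ, (j : ℕ∞) = q + 1 → Set.InjOn f.cohMap (E.cohGr j)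

section Bilinear

variable {E : GrComplex.{u}} {F : GrComplex.{v}} {G : GrComplex.{w}}
  (β : E.carrier →ₗ[ℂ] F.carrier →ₗ[ℂ] G.carrier)

lemma cocycles_bilin
    (hβ : ∀ (i : ℕ) (x : E.carrier), x ∈ E.gr i → ∀ y : F.carrier,
      G.d (β x y) = β (E.d x) y + (-1 : ℂ) ^ i • β x (F.d y))
    {x : E.carrier} (hx : x ∈ E.cocycles) {y : F.carrier} (hy : y ∈ F.cocycles) :
    β x y ∈ G.cocycles := by
  refine Submodule.iSup_induction (motive := fun x => β x y ∈ G.cocycles) _ (E.cocycles_le hx)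
    ?_ ?_ ?_
  · rintro i x ⟨hx, hi⟩
    change G.d (β x y) = 0
    rw [hβ i x hi, show E.d x = 0 from hx, show F.d y = 0 from hy]
    simp
  · simp
  · intro a b ha hb
    rw [map_add, LinearMap.add_apply]
    exact add_mem ha hb

lemma bilin_d_right
    (hβ : ∀ (i : ℕ) (x : E.carrier), x ∈ E.gr i → ∀ y : F.carrier,
      G.d (β x y) = β (E.d x) y + (-1 : ℂ) ^ i • β x (F.d y))
    {x : E.carrier} (hx : x ∈ E.cocycles) (y : F.carrier) :
    β x (F.d y) ∈ LinearMap.range G.d := by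
  refine Submodule.iSup_induction (motive := fun x => β x (F.d y) ∈ LinearMap.range G.d) _
    (E.cocycles_le hx) ?_ ?_ ?_
  · rintro i x ⟨hx, hi⟩
    refine ⟨(-1 : ℂ) ^ i • β x y, ?_⟩
    rw [map_smul, hβ i x hi, show E.d x = 0 from hx, map_zero, LinearMap.zero_apply, zero_add,
      smul_smul, ← mul_pow]
    simp
  · simp
  · intro a b ha hb
    rw [map_add, LinearMap.add_apply]
    exact add_mem ha hb

lemma bilin_d_left
    (hβ : ∀ (i : ℕ) (x : E.carrier), x ∈ E.gr i → ∀ y : F.carrier,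
      G.d (β x y) = β (E.d x) y + (-1 : ℂ) ^ i • β x (F.d y))
    (x : E.carrier) {y : F.carrier} (hy : y ∈ F.cocycles) :
    β (E.d x) y ∈ LinearMap.range G.d := by
  have hx : x ∈ ⨆ i, E.gr i := by
    rw [E.internal.submodule_iSup_eq_top]
    exact Submodule.mem_top
  refine Submodule.iSup_induction (motive := fun x => β (E.d x) y ∈ LinearMap.range G.d) _
    hx ?_ ?_ ?_
  · rintro i x hi
    refine ⟨β x y, ?_⟩
    rw [hβ i x hi, show F.d y = 0 from hy]
    simp
  · simp
  · intro a b ha hb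
    rw [map_add, map_add, LinearMap.add_apply]
    exact add_mem ha hb

/-- The bilinear map on cohomology induced by a bilinear map satisfying the Leibniz rule. -/
def cohBilin
    (hβ : ∀ (i : ℕ) (x : E.carrier), x ∈ E.gr i → ∀ y : F.carrier,
      G.d (β x y) = β (E.d x) y + (-1 : ℂ) ^ i • β x (F.d y)) :
    E.Coh →ₗ[ℂ] F.Coh →ₗ[ℂ] G.Coh :=
  (F.coboundaries.liftQ
    (E.coboundaries.liftQ
      (LinearMap.mk₂ ℂ
        (fun (x : E.cocycles) (y : F.cocycles) =>
          G.coboundaries.mkQ ⟨β x y, cocycles_bilin β hβ x.2 y.2⟩)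
        (fun x x' y => by
          rw [← map_add]
          exact congrArg _ (Subtype.ext (by simp)))
        (fun c x y => by
          rw [← map_smul]
          exact congrArg _ (Subtype.ext (by simp)))
        (fun x y y' => by
          rw [← map_add]
          exact congrArg _ (Subtype.ext (by simp)))
        (fun c x y => by
          rw [← map_smul]
          exact congrArg _ (Subtype.ext (by simp))))
      (by
        rintro ⟨_, hx⟩ ⟨x, rfl⟩
        refine LinearMap.ext fun y => ?_
        exact (Submodule.Quotient.mk_eq_zero _).2 (bilin_d_left β hβ x y.2))).flip
    (by
      rintro ⟨_, hy⟩ ⟨y, rfl⟩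
      refine LinearMap.ext fun x => ?_
      obtain ⟨x, rfl⟩ := E.coboundaries.mkQ_surjective x
      exact (Submodule.Quotient.mk_eq_zero _).2 (bilin_d_right β hβ x.2 y))).flip

lemma cohBilin_mk
    (hβ : ∀ (i : ℕ) (x : E.carrier), x ∈ E.gr i → ∀ y : F.carrier,
      G.d (β x y) = β (E.d x) y + (-1 : ℂ) ^ i • β x (F.d y))
    (x : E.cocycles) (y : F.cocycles) :
    cohBilin β hβ (E.coboundaries.mkQ x) (F.coboundaries.mkQ y) =
      G.coboundaries.mkQ ⟨β x y, cocycles_bilin β hβ x.2 y.2⟩ := rfl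

lemma cohBilin_zero
    (hβ : ∀ (i : ℕ) (x : E.carrier), x ∈ E.gr i → ∀ y : F.carrier,
      G.d (β x y) = β (E.d x) y + (-1 : ℂ) ^ i • β x (F.d y))
    (x : E.Coh) (y : F.Coh) (c : ℂ) :
    (0 : G.Coh) = cohBilin β hβ 0 y + c • cohBilin β hβ x 0 := by
  rw [map_zero, map_zero, LinearMap.zero_apply, smul_zero, add_zero]

end Bilinear

end GrComplex

/-- A differential graded Lie algebra over `ℂ`, graded by `ℕ`. -/
structure DGLA extends GrComplex.{u} where
  bracket : carrier →ₗ[ℂ] carrier →ₗ[ℂ] carrier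
  bracket_mem : ∀ {i j : ℕ} {x y : carrier}, x ∈ gr i → y ∈ gr j → bracket x y ∈ gr (i + j)
  bracket_skew : ∀ {i j : ℕ} {x y : carrier}, x ∈ gr i → y ∈ gr j →
    bracket x y + (-1 : ℂ) ^ (i * j) • bracket y x = 0
  jacobi : ∀ {i j k : ℕ} {x y z : carrier}, x ∈ gr i → y ∈ gr j → z ∈ gr k →
    (-1 : ℂ) ^ (k * i) • bracket x (bracket y z) + (-1 : ℂ) ^ (i * j) • bracket y (bracket z x) +
      (-1 : ℂ) ^ (j * k) • bracket z (bracket x y) = 0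
  leibniz : ∀ (i : ℕ) (x : carrier), x ∈ gr i → ∀ y : carrier,
    d (bracket x y) = bracket (d x) y + (-1 : ℂ) ^ i • bracket x (d y)

/-- A differential graded module over a DGLA. -/
structure DGModule (C : DGLA.{u}) extends GrComplex.{v} where
  act : C.carrier →ₗ[ℂ] carrier →ₗ[ℂ] carrier
  act_mem : ∀ {i j : ℕ} {a : C.carrier} {x : carrier}, a ∈ C.gr i → x ∈ gr j →
    act a x ∈ gr (i + j)
  act_bracket : ∀ {i j : ℕ} {a b : C.carrier}, a ∈ C.gr i → b ∈ C.gr j → ∀ x : carrier,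
    act (C.bracket a b) x = act a (act b x) - (-1 : ℂ) ^ (i * j) • act b (act a x)
  leibniz : ∀ (i : ℕ) (a : C.carrier), a ∈ C.gr i → ∀ x : carrier,
    d (act a x) = act (C.d a) x + (-1 : ℂ) ^ i • act a (d x)

namespace DGLA

/-- A homomorphism of DGLAs. -/
structure Hom (C : DGLA.{u}) (D : DGLA.{v}) extends C.toGrComplex.Hom D.toGrComplex where
  map_bracket : ∀ x y : C.carrier, toFun (C.bracket x y) = D.bracket (toFun x) (toFun y)

/-- The cohomology of a DGLA, a DGLA with zero differential. -/
abbrev cohomology (C : DGLA.{u}) : DGLA.{u} where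
  toGrComplex := C.toGrComplex.cohomology
  bracket := GrComplex.cohBilin C.bracket C.leibniz
  bracket_mem := by
    rintro i j _ _ ⟨x, hx, rfl⟩ ⟨y, hy, rfl⟩
    exact ⟨_, C.bracket_mem hx hy, rfl⟩
  bracket_skew := by
    rintro i j _ _ ⟨x, hx, rfl⟩ ⟨y, hy, rfl⟩
    exact congrArg C.coboundaries.mkQ
      (Subtype.ext (C.bracket_skew hx hy) : (⟨C.bracket x y, _⟩ : C.cocycles) +
        (-1 : ℂ) ^ (i * j) • ⟨C.bracket y x, _⟩ = 0)
  jacobi := by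
    rintro i j k _ _ _ ⟨x, hx, rfl⟩ ⟨y, hy, rfl⟩ ⟨z, hz, rfl⟩
    have cc : ∀ {a b : C.carrier}, a ∈ C.cocycles → b ∈ C.cocycles →
        C.bracket a b ∈ C.cocycles :=
      fun h h' => GrComplex.cocycles_bilin C.bracket C.leibniz h h'
    exact congrArg C.coboundaries.mkQ
      (Subtype.ext (C.jacobi hx hy hz) :
        (-1 : ℂ) ^ (k * i) • (⟨C.bracket x (C.bracket y z), cc x.2 (cc y.2 z.2)⟩ : C.cocycles) +
        (-1 : ℂ) ^ (i * j) • ⟨C.bracket y (C.bracket z x), cc y.2 (cc z.2 x.2)⟩ +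
        (-1 : ℂ) ^ (j * k) • ⟨C.bracket z (C.bracket x y), cc z.2 (cc x.2 y.2)⟩ = 0)
  leibniz i x _ y := GrComplex.cohBilin_zero C.bracket C.leibniz x y _

/-- A Lie algebra, regarded as a DGLA concentrated in degree zero. -/
abbrev ofLie (g : Type u) [LieRing g] [LieAlgebra ℂ g] : DGLA.{u} where
  carrier := g
  gr i := if i = 0 then ⊤ else ⊥
  internal := by
    refine isInternal_of_proj _ (fun i => if i = 0 then LinearMap.id else 0) ?_ ?_ ?_
    · intro i x hx
      by_cases h : i = 0
      · simp [h]
      · simp_all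
    · intro i j x hx hj
      by_cases h : i = 0
      · have : j ≠ 0 := fun h' => hj (h'.trans h.symm)
        simp_all
      · simp [h]
    · intro x
      exact (le_iSup (fun i : ℕ => if i = 0 then (⊤ : Submodule ℂ g) else ⊥) 0) (by simp)
  d := 0
  d_mem _ := Submodule.zero_mem _
  d_d _ := rfl
  bracket := (LieModule.toEnd ℂ g g : g →ₗ[ℂ] Module.End ℂ g)
  bracket_mem {i j x y} hx hy := by
    by_cases hi : i = 0
    · by_cases hj : j = 0
      · simp [hi, hj]
      · simp_all
    · simp_all
  bracket_skew {i j x y} hx hy := by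
    by_cases hi : i = 0
    · simp only [hi, zero_mul, pow_zero, one_smul]
      change ⁅x, y⁆ + ⁅y, x⁆ = 0
      rw [← lie_skew, neg_add_cancel]
    · simp_all
  jacobi {i j k x y z} hx hy hz := by
    by_cases hi : i = 0
    · by_cases hj : j = 0
      · by_cases hk : k = 0
        · simp [hi, hj, hk, lie_jacobi]
        · simp_all
      · simp_all
    · simp_all
  leibniz i x _ y := by simp

/-- The kernel of a homomorphism of DGLAs. -/
def Hom.ker {C : DGLA.{u}} {D : DGLA.{v}} (f : C.Hom D) : DGLA.{u} where
  carrier := LinearMap.ker f.toFun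
  gr i := (C.gr i).comap (LinearMap.ker f.toFun).subtype
  internal := by
    obtain ⟨p, h₀, h₁, h₂, h₃, -, -⟩ := C.exists_proj
    obtain ⟨r, -, k₁, k₂, -, -, -⟩ := D.exists_proj
    refine isInternal_comap_subtype _ p h₀ h₁ h₂ h₃ _ fun i x hx => ?_
    have key : (⊤ : Submodule ℂ C.carrier) ≤
        LinearMap.ker (f.toFun ∘ₗ p i - r i ∘ₗ f.toFun) := by
      rw [← C.internal.submodule_iSup_eq_top]
      refine iSup_le fun j y hy => ?_
      rw [LinearMap.mem_ker, LinearMap.sub_apply, LinearMap.comp_apply, LinearMap.comp_apply]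
      by_cases h : j = i
      · subst h
        rw [h₁ _ _ hy, k₁ _ _ (f.map_mem hy), sub_self]
      · rw [h₂ _ _ _ hy h, k₂ _ _ _ (f.map_mem hy) h, map_zero, sub_self]
    have := sub_eq_zero.1 (key (Submodule.mem_top (x := x)))
    rw [LinearMap.comp_apply, LinearMap.comp_apply, show f.toFun x = 0 from hx, map_zero] at this
    exact this
  d := C.d.restrict fun x hx => by
    change f.toFun (C.d x) = 0
    rw [f.map_d, show f.toFun x = 0 from hx, map_zero]
  d_mem hx := C.d_mem hx
  d_d x := Subtype.ext (C.d_d x)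
  bracket := LinearMap.mk₂ ℂ
    (fun x y => ⟨C.bracket x y, by
      rw [LinearMap.mem_ker, f.map_bracket, LinearMap.mem_ker.1 x.2, map_zero,
        LinearMap.zero_apply]⟩)
    (fun _ _ _ => Subtype.ext (by simp)) (fun _ _ _ => Subtype.ext (by simp))
    (fun _ _ _ => Subtype.ext (by simp)) (fun _ _ _ => Subtype.ext (by simp))
  bracket_mem hx hy := C.bracket_mem hx hy
  bracket_skew hx hy := Subtype.ext (C.bracket_skew hx hy)
  jacobi hx hy hz := Subtype.ext (C.jacobi hx hy hz)
  leibniz i x hx y := Subtype.ext (C.leibniz i x hx y)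

/-- The inclusion of the kernel of a homomorphism of DGLAs. -/
def Hom.kerInclusion {C : DGLA.{u}} {D : DGLA.{v}} (f : C.Hom D) : f.ker.Hom C where
  toFun := (LinearMap.ker f.toFun).subtype
  map_mem hx := hx
  map_d _ := rfl
  map_bracket _ _ := rfl

end DGLA

namespace DGModule

/-- The cohomology of a module over a DGLA, a module over the cohomology DGLA. -/
def cohomology {C : DGLA.{u}} (M : DGModule.{u, v} C) : DGModule.{u, v} C.cohomology where
  toGrComplex := M.toGrComplex.cohomology
  act := GrComplex.cohBilin M.act M.leibniz
  act_mem := by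
    rintro i j _ _ ⟨x, hx, rfl⟩ ⟨y, hy, rfl⟩
    exact ⟨_, M.act_mem hx hy, rfl⟩
  act_bracket := by
    rintro i j _ _ ⟨a, ha, rfl⟩ ⟨b, hb, rfl⟩ x
    obtain ⟨x, rfl⟩ := M.coboundaries.mkQ_surjective x
    have cm : ∀ {a : C.carrier} {x : M.carrier}, a ∈ C.cocycles → x ∈ M.cocycles →
        M.act a x ∈ M.cocycles :=
      fun h h' => GrComplex.cocycles_bilin M.act M.leibniz h h'
    have cc : ∀ {a b : C.carrier}, a ∈ C.cocycles → b ∈ C.cocycles →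
        C.bracket a b ∈ C.cocycles :=
      fun h h' => GrComplex.cocycles_bilin C.bracket C.leibniz h h'
    exact congrArg M.coboundaries.mkQ
      (Subtype.ext (M.act_bracket ha hb x) :
        (⟨M.act (C.bracket a b) x, cm (cc a.2 b.2) x.2⟩ : M.cocycles) =
          ⟨M.act a (M.act b x), cm a.2 (cm b.2 x.2)⟩ -
          (-1 : ℂ) ^ (i * j) • ⟨M.act b (M.act a x), cm b.2 (cm a.2 x.2)⟩)
  leibniz i a _ x := GrComplex.cohBilin_zero M.act M.leibniz a x _

/-- Restriction of a module along a homomorphism of DGLAs. -/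
def restrict {C : DGLA.{u}} {D : DGLA.{w}} (f : C.Hom D) (M : DGModule.{w, v} D) :
    DGModule.{u, v} C where
  toGrComplex := M.toGrComplex
  act := M.act ∘ₗ f.toFun
  act_mem ha hx := M.act_mem (f.map_mem ha) hx
  act_bracket ha hb x := by
    simpa [f.map_bracket] using M.act_bracket (f.map_mem ha) (f.map_mem hb) x
  leibniz i a ha x := by
    simpa [f.map_d] using M.leibniz i _ (f.map_mem ha) x

end DGModule

/-- A DGLA pair: a DGLA together with a module over it. -/
structure DGLAPair where
  C : DGLA.{u}
  M : DGModule.{u, v} C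

namespace DGLAPair

/-- A homomorphism of DGLA pairs. -/
structure Hom (P Q : DGLAPair.{u, v}) where
  toDGLA : P.C.Hom Q.C
  toModule : P.M.toGrComplex.Hom Q.M.toGrComplex
  map_act : ∀ (a : P.C.carrier) (x : P.M.carrier),
    toModule.toFun (P.M.act a x) = Q.M.act (toDGLA.toFun a) (toModule.toFun x)

/-- A homomorphism of DGLA pairs is a `q`-equivalence if it is `1`-equivalent on the DGLAs and
`q`-equivalent on the modules. -/
def Hom.IsEquivalence {P Q : DGLAPair.{u, v}} (g : P.Hom Q) (q : ℕ∞) : Prop :=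
  g.toDGLA.toHom.IsEquivalence 1 ∧ g.toModule.IsEquivalence q

/-- The cohomology DGLA pair `(H(C), H(M))`. -/
def cohomology (P : DGLAPair.{u, v}) : DGLAPair.{u, v} where
  C := P.C.cohomology
  M := P.M.cohomology

/-- The standing assumption on DGLA pairs: `M` is bounded above and every `Hʲ(M)` is
finite-dimensional. -/
structure IsAdmissible (P : DGLAPair.{u, v}) : Prop where
  bounded : ∃ n : ℕ, ∀ i : ℕ, n < i → P.M.gr i = ⊥
  finite : ∀ j : ℕ, FiniteDimensional ℂ (P.M.toGrComplex.cohGr j)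

/-- Two pairs have the same `q`-homotopy type if they are connected by a zig-zag of
`q`-equivalences (between pairs satisfying the standing assumption). -/
def SameHomotopyType (q : ℕ∞) : DGLAPair.{u, v} → DGLAPair.{u, v} → Prop :=
  Relation.EqvGen fun P Q =>
    P.IsAdmissible ∧ Q.IsAdmissible ∧ ∃ g : P.Hom Q, g.IsEquivalence q

/-- A pair is `q`-formal if it has the `q`-homotopy type of its cohomology pair. -/
def IsFormal (P : DGLAPair.{u, v}) (q : ℕ∞) : Prop := SameHomotopyType q P P.cohomology

end DGLAPair

/-! ### Extension of scalars and Aomoto complexes -/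

section BaseChange

variable {V : Type u} {W : Type v} {U : Type w} [AddCommGroup V] [Module ℂ V] [AddCommGroup W]
  [Module ℂ W] [AddCommGroup U] [Module ℂ U] (A : Type t) [CommRing A] [Algebra ℂ A]

/-- The `A`-bilinear extension `(a ⊗ x, b ⊗ y) ↦ ab ⊗ β(x, y)` of a bilinear map `β`. -/
def extendBilin (β : V →ₗ[ℂ] W →ₗ[ℂ] U) :
    A ⊗[ℂ] V →ₗ[A] A ⊗[ℂ] W →ₗ[A] A ⊗[ℂ] U :=
  LinearMap.liftBaseChange A (LinearMap.baseChangeHom ℂ A W U ∘ₗ β)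

lemma extendBilin_tmul (β : V →ₗ[ℂ] W →ₗ[ℂ] U) (a b : A) (x : V) (y : W) :
    extendBilin A β (a ⊗ₜ x) (b ⊗ₜ y) = (a * b) ⊗ₜ β x y := by
  simp [extendBilin, TensorProduct.smul_tmul']

lemma baseChange_le_iff (S : Submodule ℂ V) (T : Submodule A (A ⊗[ℂ] V)) :
    S.baseChange A ≤ T ↔ ∀ x ∈ S, (1 : A) ⊗ₜ[ℂ] x ∈ T := by
  constructor
  · exact fun h x hx => h (Submodule.tmul_mem_baseChange_of_mem 1 hx)
  · intro h
    rw [Submodule.baseChange_eq_span, Submodule.span_le]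
    rintro _ ⟨x, hx, rfl⟩
    exact h x hx

lemma extendBilin_mem (β : V →ₗ[ℂ] W →ₗ[ℂ] U) (S : Submodule ℂ V) (T : Submodule ℂ W)
    (R : Submodule ℂ U) (h : ∀ x ∈ S, ∀ y ∈ T, β x y ∈ R) {x : A ⊗[ℂ] V} {y : A ⊗[ℂ] W}
    (hx : x ∈ S.baseChange A) (hy : y ∈ T.baseChange A) :
    extendBilin A β x y ∈ R.baseChange A := by
  have h₁ : ∀ s ∈ S, T.baseChange A ≤
      (R.baseChange A).comap (extendBilin A β ((1 : A) ⊗ₜ s)) := by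
    intro s hs
    rw [baseChange_le_iff]
    intro t ht
    rw [Submodule.mem_comap, extendBilin_tmul]
    exact Submodule.tmul_mem_baseChange_of_mem _ (h s hs t ht)
  have h₂ : S.baseChange A ≤ (R.baseChange A).comap ((extendBilin A β).flip y) := by
    rw [baseChange_le_iff]
    exact fun s hs => h₁ s hs hy
  exact h₂ hx

/-- The map `V ⊗ A → V ⊗ B` induced by a homomorphism `A → B`. -/
def pushTensor {A : Type t} [CommRing A] [Algebra ℂ A] {B : Type s} [CommRing B] [Algebra ℂ B]
    (p : A →ₐ[ℂ] B) (V : Type u) [AddCommGroup V] [Module ℂ V] : A ⊗[ℂ] V →ₗ[ℂ] B ⊗[ℂ] V :=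
  LinearMap.rTensor V p.toLinearMap

section Push

variable {A} {B : Type s} [CommRing B] [Algebra ℂ B] (p : A →ₐ[ℂ] B)

lemma pushTensor_tmul (a : A) (x : V) : pushTensor p V (a ⊗ₜ x) = p a ⊗ₜ x := rfl

lemma pushTensor_smul (a : A) (x : A ⊗[ℂ] V) : pushTensor p V (a • x) = p a • pushTensor p V x := by
  induction x using TensorProduct.induction_on with
  | zero => simp
  | tmul b x => simp [pushTensor_tmul, TensorProduct.smul_tmul']
  | add x y hx hy => rw [smul_add, map_add, hx, hy, map_add, smul_add]

lemma pushTensor_extendBilin (β : V →ₗ[ℂ] W →ₗ[ℂ] U) (x : A ⊗[ℂ] V) (y : A ⊗[ℂ] W) :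
    pushTensor p U (extendBilin A β x y) =
      extendBilin B β (pushTensor p V x) (pushTensor p W y) := by
  induction x using TensorProduct.induction_on with
  | zero => simp
  | add x x' hx hx' => simp only [map_add, LinearMap.add_apply, hx, hx']
  | tmul a x =>
    induction y using TensorProduct.induction_on with
    | zero => simp
    | add y y' hy hy' => simp only [map_add, hy, hy']
    | tmul b y => simp only [extendBilin_tmul, pushTensor_tmul, map_mul]

lemma pushTensor_baseChange (f : V →ₗ[ℂ] W) (x : A ⊗[ℂ] V) :
    pushTensor p W (f.baseChange A x) = f.baseChange B (pushTensor p V x) := by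
  induction x using TensorProduct.induction_on with
  | zero => simp
  | add x x' hx hx' => simp only [map_add, hx, hx']
  | tmul a x => simp [pushTensor_tmul]

lemma pushTensor_mem (S : Submodule ℂ V) {x : A ⊗[ℂ] V} (hx : x ∈ S.baseChange A) :
    pushTensor p V x ∈ S.baseChange B := by
  rw [Submodule.baseChange_eq_span] at hx
  induction hx using Submodule.span_induction with
  | mem x hx =>
    obtain ⟨x, hx, rfl⟩ := hx
    exact Submodule.tmul_mem_baseChange_of_mem (p 1) hx
  | zero => simp
  | add x y _ _ hx hy => rw [map_add]; exact add_mem hx hy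
  | smul a x _ hx => rw [pushTensor_smul]; exact Submodule.smul_mem _ _ hx

lemma rid_lTensor_pushTensor (l : Module.Dual ℂ V) (x : A ⊗[ℂ] V) :
    TensorProduct.rid ℂ B (LinearMap.lTensor B l (pushTensor p V x)) =
      p (TensorProduct.rid ℂ A (LinearMap.lTensor A l x)) := by
  induction x using TensorProduct.induction_on with
  | zero => simp only [map_zero]
  | tmul a x =>
    rw [pushTensor_tmul, LinearMap.lTensor_tmul, LinearMap.lTensor_tmul,
      TensorProduct.rid_tmul, TensorProduct.rid_tmul, map_smul]
  | add x y hx hy => simp only [map_add, hx, hy]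

end Push

lemma eq_zero_of_forall_dual (x : A ⊗[ℂ] V)
    (h : ∀ l : Module.Dual ℂ V, TensorProduct.rid ℂ A (LinearMap.lTensor A l x) = 0) : x = 0 := by
  let b := Module.Free.chooseBasis ℂ V
  apply (TensorProduct.equivFinsuppOfBasisRight (M := A) b).injective
  ext i
  rw [TensorProduct.equivFinsuppOfBasisRight_apply, map_zero, Finsupp.zero_apply]
  exact h (b.coord i)

end BaseChange

namespace DGLA

variable (C : DGLA.{u}) (A : Type t) [CommRing A] [Algebra ℂ A]

/-- The differential of `C ⊗ A`. -/
def dTensor : A ⊗[ℂ] C.carrier →ₗ[A] A ⊗[ℂ] C.carrier := C.d.baseChange A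

/-- The bracket of `C ⊗ A`. -/
def bracketTensor : A ⊗[ℂ] C.carrier →ₗ[A] A ⊗[ℂ] C.carrier →ₗ[A] A ⊗[ℂ] C.carrier :=
  extendBilin A C.bracket

/-- The curvature `dω + ½[ω, ω]`. -/
noncomputable def curvature (ω : A ⊗[ℂ] C.carrier) : A ⊗[ℂ] C.carrier :=
  C.dTensor A ω + (1 / 2 : ℂ) • C.bracketTensor A ω ω

/-- `ω ∈ C¹ ⊗ A` is flat if it satisfies the Maurer–Cartan equation. -/
structure IsFlat (ω : A ⊗[ℂ] C.carrier) : Prop where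
  mem : ω ∈ (C.gr 1).baseChange A
  curvature_eq : C.curvature A ω = 0

end DGLA

namespace DGModule

variable {C : DGLA.{u}} (M : DGModule.{u, v} C) (A : Type t) [CommRing A] [Algebra ℂ A]

/-- The differential `d_ω = d ⊗ id + ω` on `M ⊗ A`. -/
def dAomoto (ω : A ⊗[ℂ] C.carrier) : A ⊗[ℂ] M.carrier →ₗ[A] A ⊗[ℂ] M.carrier :=
  M.d.baseChange A + extendBilin A M.act ω

/-- The degree `n` part of `M ⊗ A`, for `n ∈ ℤ`. -/
def grTensor (n : ℤ) : Submodule A (A ⊗[ℂ] M.carrier) :=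
  if 0 ≤ n then (M.gr n.toNat).baseChange A else ⊥

variable {A}

lemma dAomoto_mem {ω : A ⊗[ℂ] C.carrier} (hω : ω ∈ (C.gr 1).baseChange A) {n : ℤ}
    {x : A ⊗[ℂ] M.carrier} (hx : x ∈ M.grTensor A n) : M.dAomoto A ω x ∈ M.grTensor A (n + 1) := by
  unfold grTensor at hx ⊢
  by_cases hn : 0 ≤ n
  · rw [if_pos hn] at hx
    rw [if_pos (by omega)]
    obtain ⟨m, rfl⟩ := Int.eq_ofNat_of_zero_le hn
    have e : ((m : ℤ) + 1).toNat = m + 1 := by omega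
    rw [e]
    rw [Int.toNat_natCast] at hx
    refine add_mem ?_ ?_
    · have : (M.gr m).baseChange A ≤ ((M.gr (m + 1)).baseChange A).comap (M.d.baseChange A) := by
        rw [baseChange_le_iff]
        intro y hy
        rw [Submodule.mem_comap, LinearMap.baseChange_tmul]
        exact Submodule.tmul_mem_baseChange_of_mem _ (M.d_mem hy)
      exact this hx
    · refine extendBilin_mem A M.act _ _ _ (fun a ha y hy => ?_) hω hx
      rw [add_comm]
      exact M.act_mem ha hy
  · rw [if_neg hn, Submodule.mem_bot] at hx
    rw [hx, map_zero]
    exact Submodule.zero_mem _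

lemma leibnizTensor {ω : A ⊗[ℂ] C.carrier} (hω : ω ∈ (C.gr 1).baseChange A)
    (x : A ⊗[ℂ] M.carrier) :
    M.d.baseChange A (extendBilin A M.act ω x) =
      extendBilin A M.act (C.dTensor A ω) x - extendBilin A M.act ω (M.d.baseChange A x) := by
  have key : (C.gr 1).baseChange A ≤ LinearMap.ker
      ((extendBilin A M.act).flip x ∘ₗ C.dTensor A -
        (extendBilin A M.act).flip (M.d.baseChange A x) -
        M.d.baseChange A ∘ₗ (extendBilin A M.act).flip x) := by
    rw [baseChange_le_iff]
    intro a ha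
    simp only [LinearMap.mem_ker, LinearMap.sub_apply, LinearMap.comp_apply, LinearMap.flip_apply]
    induction x using TensorProduct.induction_on with
    | zero => simp
    | add x y hx hy =>
      simp only [map_add] at hx hy ⊢
      rw [← add_zero (0 : A ⊗[ℂ] M.carrier)]
      nth_rewrite 1 [← hx]
      rw [← hy]
      abel
    | tmul b x =>
      simp only [DGLA.dTensor, LinearMap.baseChange_tmul, extendBilin_tmul, M.leibniz 1 a ha,
        TensorProduct.tmul_add, pow_one, neg_smul, one_smul,
        TensorProduct.tmul_neg]
      abel
  have := key hω
  simp only [LinearMap.mem_ker, LinearMap.sub_apply, LinearMap.comp_apply,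
    LinearMap.flip_apply] at this
  exact (sub_eq_zero.1 this).symm

lemma act_bracketTensor {ω η : A ⊗[ℂ] C.carrier} (hω : ω ∈ (C.gr 1).baseChange A)
    (hη : η ∈ (C.gr 1).baseChange A) (x : A ⊗[ℂ] M.carrier) :
    extendBilin A M.act (C.bracketTensor A ω η) x =
      extendBilin A M.act ω (extendBilin A M.act η x) +
        extendBilin A M.act η (extendBilin A M.act ω x) := by
  have key₁ : ∀ a ∈ C.gr 1, (C.gr 1).baseChange A ≤ LinearMap.ker
      ((extendBilin A M.act).flip x ∘ₗ C.bracketTensor A ((1 : A) ⊗ₜ a) -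
        extendBilin A M.act ((1 : A) ⊗ₜ a) ∘ₗ (extendBilin A M.act).flip x -
        (extendBilin A M.act).flip (extendBilin A M.act ((1 : A) ⊗ₜ a) x)) := by
    intro a ha
    rw [baseChange_le_iff]
    intro b hb
    simp only [LinearMap.mem_ker, LinearMap.sub_apply, LinearMap.comp_apply, LinearMap.flip_apply]
    induction x using TensorProduct.induction_on with
    | zero => simp
    | add x y hx hy =>
      simp only [map_add] at hx hy ⊢
      rw [← add_zero (0 : A ⊗[ℂ] M.carrier)]
      nth_rewrite 1 [← hx]
      rw [← hy]
      abel
    | tmul c x =>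
      simp only [DGLA.bracketTensor, extendBilin_tmul, M.act_bracket ha hb,
        TensorProduct.tmul_sub, pow_one, neg_smul, one_smul, mul_one,
        TensorProduct.tmul_neg, one_mul]
      abel
  have key₂ : (C.gr 1).baseChange A ≤ LinearMap.ker
      ((extendBilin A M.act).flip x ∘ₗ (C.bracketTensor A).flip η -
        (extendBilin A M.act).flip (extendBilin A M.act η x) -
        extendBilin A M.act η ∘ₗ (extendBilin A M.act).flip x) := by
    rw [baseChange_le_iff]
    intro a ha
    exact key₁ a ha hη
  have := key₂ hω
  simp only [LinearMap.mem_ker, LinearMap.sub_apply, LinearMap.comp_apply,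
    LinearMap.flip_apply] at this
  rw [sub_sub] at this
  exact sub_eq_zero.1 this

lemma dAomoto_dAomoto {ω : A ⊗[ℂ] C.carrier} (hω : C.IsFlat A ω) (x : A ⊗[ℂ] M.carrier) :
    M.dAomoto A ω (M.dAomoto A ω x) = 0 := by
  have hd : M.d.baseChange A (M.d.baseChange A x) = 0 := by
    rw [← LinearMap.comp_apply, ← LinearMap.baseChange_comp,
      show M.d ∘ₗ M.d = 0 from LinearMap.ext M.d_d, LinearMap.baseChange_zero,
      LinearMap.zero_apply]
  have hb := M.act_bracketTensor hω.mem hω.mem x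
  have hc : extendBilin A M.act (C.curvature A ω) x = 0 := by
    rw [hω.curvature_eq, map_zero, LinearMap.zero_apply]
  have hs : extendBilin A M.act ((1 / 2 : ℂ) • C.bracketTensor A ω ω) x =
      (1 / 2 : ℂ) • extendBilin A M.act (C.bracketTensor A ω ω) x := by
    rw [← algebraMap_smul A, map_smul, LinearMap.smul_apply, algebraMap_smul]
  rw [DGLA.curvature, map_add, LinearMap.add_apply, hs, hb, ← two_smul ℂ, smul_smul] at hc
  norm_num at hc
  simp only [dAomoto, LinearMap.add_apply, map_add, hd, M.leibnizTensor hω.mem]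
  refine Eq.trans ?_ hc
  abel

end DGModule

section Complexes

/-- The complex with terms `Vⁿ ⊆ V` and differential the restrictions of `D`. -/
def complexOfGraded {A : Type t} [CommRing A] {V : Type v} [AddCommGroup V] [Module A V]
    (gr : ℤ → Submodule A V) (D : V →ₗ[A] V)
    (hD : ∀ (n : ℤ) (x : V), x ∈ gr n → D x ∈ gr (n + 1)) (hDD : ∀ x, D (D x) = 0) :
    CochainComplex (ModuleCat.{v} A) ℤ where
  X n := ModuleCat.of A (gr n)
  d m n := if h : m + 1 = n then
      ModuleCat.ofHom (D.restrict (p := gr m) (q := gr n) fun x hx => h ▸ hD m x hx) else 0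
  shape m n h := dif_neg h
  d_comp_d' l m n h h' := by
    have h₁ : l + 1 = m := h
    have h₂ : m + 1 = n := h'
    rw [dif_pos h₁, dif_pos h₂]
    refine ModuleCat.hom_ext (LinearMap.ext fun x => ?_)
    exact Subtype.ext (hDD x)

/-- The Aomoto complex `(M ⊗ A, d_ω)` of a flat `ω ∈ C¹ ⊗ A`. -/
def DGModule.aomoto {C : DGLA.{u}} (M : DGModule.{u, v} C) {A : Type t} [CommRing A] [Algebra ℂ A]
    {ω : A ⊗[ℂ] C.carrier} (hω : C.IsFlat A ω) : CochainComplex (ModuleCat.{max t v} A) ℤ :=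
  complexOfGraded (M.grTensor A) (M.dAomoto A ω) (fun _ _ hx => M.dAomoto_mem hω.mem hx)
    (M.dAomoto_dAomoto hω)

end Complexes

/-! ### Cohomology jump ideals -/

section JumpIdeals

/-- The determinantal ideal `I_r`, generated by the minors of size `r` of a matrix. -/
def minorIdeal {R : Type t} [CommRing R] {m : Type u} {n : Type v} (N : Matrix m n R) (r : ℕ) :
    Ideal R :=
  Ideal.span (Set.range fun e : (Fin r → m) × (Fin r → n) => (N.submatrix e.1 e.2).det)

/-- A quasi-isomorphism `φ : F → E` from a bounded above complex of finitely generated free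
modules. -/
structure FreeResolution {R : Type t} [CommRing R] (E : CochainComplex (ModuleCat.{v} R) ℤ) where
  F : CochainComplex (ModuleCat.{v} R) ℤ
  free : ∀ n : ℤ, Module.Free R (F.X n)
  finite : ∀ n : ℤ, Module.Finite R (F.X n)
  bounded : ∃ N : ℤ, ∀ n : ℤ, N < n → Subsingleton (F.X n)
  φ : F ⟶ E
  quasiIso : QuasiIso φ

attribute [instance] FreeResolution.free FreeResolution.finite

open Classical in
/-- The matrix of `dⁿ : Fⁿ → Fⁿ⁺¹`. -/
noncomputable def FreeResolution.matrix {R : Type t} [CommRing R] {E : CochainComplex (ModuleCat.{v} R) ℤ}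
    (ρ : FreeResolution E) (m n : ℤ) :
    Matrix (Module.Free.ChooseBasisIndex R (ρ.F.X n))
      (Module.Free.ChooseBasisIndex R (ρ.F.X m)) R :=
  LinearMap.toMatrix (Module.Free.chooseBasis R (ρ.F.X m)) (Module.Free.chooseBasis R (ρ.F.X n))
    (ρ.F.d m n).hom

/-- The ideal `I_{rank(Fⁱ) - k + 1}(dⁱ⁻¹ ⊕ dⁱ)`. Minors of size `≤ 0`
generate the unit ideal, so that the size may be truncated at `0`. -/
noncomputable def FreeResolution.jumpIdeal {R : Type t} [CommRing R] {E : CochainComplex (ModuleCat.{v} R) ℤ}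
    (ρ : FreeResolution E) (i : ℤ) (k : ℕ) : Ideal R :=
  minorIdeal (Matrix.fromBlocks (ρ.matrix (i - 1) i) 0 0 (ρ.matrix i (i + 1)))
    (Module.finrank R (ρ.F.X i) + 1 - k)

/-- The cohomology jump ideal `J^i_k(E) = I_{rank(Fⁱ) - k + 1}(dⁱ⁻¹ ⊕ dⁱ)`. All resolutions
`F → E` give the same ideal, so that the supremum over them is their common value. -/
noncomputable def jumpIdeal {R : Type t} [CommRing R] (E : CochainComplex (ModuleCat.{v} R) ℤ) (i : ℤ) (k : ℕ) :
    Ideal R :=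
  ⨆ ρ : FreeResolution E, ρ.jumpIdeal i k

end JumpIdeals

/-! ### Artinian local algebras and deformation functors -/

/-- An Artinian local algebra of finite type over `ℂ`. -/
structure ArtAlg : Type 1 where
  carrier : Type
  [commRing : CommRing carrier]
  [algebra : Algebra ℂ carrier]
  [isLocalRing : IsLocalRing carrier]
  [isArtinianRing : IsArtinianRing carrier]
  [finiteType : Algebra.FiniteType ℂ carrier]

namespace ArtAlg

attribute [instance] commRing algebra isLocalRing isArtinianRing finiteType

/-- The maximal ideal. -/
abbrev m (A : ArtAlg) : Ideal A.carrier := IsLocalRing.maximalIdeal A.carrier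

/-- The category of Artinian local algebras with local homomorphisms. -/
instance : Category ArtAlg where
  Hom A B := {p : A.carrier →ₐ[ℂ] B.carrier // IsLocalHom p}
  id A := ⟨AlgHom.id ℂ A.carrier, ⟨fun _ h => h⟩⟩
  comp p q := ⟨q.1.comp p.1, ⟨fun a h => p.2.map_nonunit a (q.2.map_nonunit _ h)⟩⟩

lemma map_mem_m {A B : ArtAlg} (p : A ⟶ B) {a : A.carrier} (ha : a ∈ A.m) : p.1 a ∈ B.m :=
  fun h => ha (p.2.map_nonunit a h)

/-- The functor `Hom(R, -)` on Artinian local algebras. (If `R` is a local `ℂ`-algebra with residue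
field `ℂ`, then every homomorphism from `R` to an Artinian local algebra is local.) -/
def homFunctor (R : Type u) [CommRing R] [Algebra ℂ R] : ArtAlg ⥤ Type u where
  obj A := R →ₐ[ℂ] A.carrier
  map p := ↾fun f => p.1.comp f

/-- The natural transformation `Hom(S, -) → Hom(R, -)` induced by `R → S`. -/
def homFunctorMap {R S : Type u} [CommRing R] [Algebra ℂ R] [CommRing S] [Algebra ℂ S]
    (f : R →ₐ[ℂ] S) : homFunctor S ⟶ homFunctor R where
  app A := ↾fun h : S →ₐ[ℂ] A.carrier => h.comp f

end ArtAlg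

section NilTensor

variable {V : Type u} [AddCommGroup V] [Module ℂ V]

/-- The subspace `S ⊗ m` of `V ⊗ A`, where `m` is the maximal ideal of `A`. -/
def nilTensor (A : ArtAlg) (S : Submodule ℂ V) : Submodule A.carrier (A.carrier ⊗[ℂ] V) :=
  A.m • S.baseChange A.carrier

lemma nilTensor_le (A : ArtAlg) (S : Submodule ℂ V) : nilTensor A S ≤ S.baseChange A.carrier :=
  Submodule.smul_le_right

lemma pushTensor_nilTensor {A B : ArtAlg} (p : A ⟶ B) (S : Submodule ℂ V)
    {x : A.carrier ⊗[ℂ] V} (hx : x ∈ nilTensor A S) : pushTensor p.1 V x ∈ nilTensor B S := by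
  induction hx using Submodule.smul_induction_on' with
  | smul a ha x hx =>
    rw [pushTensor_smul]
    exact Submodule.smul_mem_smul (ArtAlg.map_mem_m p ha) (pushTensor_mem p.1 S hx)
  | add x _ y _ hx hy => rw [map_add]; exact add_mem hx hy

end NilTensor

namespace DGLA

variable (C : DGLA.{u})

lemma curvature_push {A : Type t} [CommRing A] [Algebra ℂ A] {B : Type s} [CommRing B]
    [Algebra ℂ B] (p : A →ₐ[ℂ] B) (ω : A ⊗[ℂ] C.carrier) :
    C.curvature B (pushTensor p C.carrier ω) = pushTensor p C.carrier (C.curvature A ω) := by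
  rw [curvature, curvature, map_add, map_smul, bracketTensor, bracketTensor,
    pushTensor_extendBilin, dTensor, dTensor, pushTensor_baseChange]

/-- The objects of the Deligne groupoid `𝒞(C; A)`: the solutions `ω ∈ C¹ ⊗ m` of the
Maurer–Cartan equation. -/
def MC (A : ArtAlg) : Type u :=
  {ω : A.carrier ⊗[ℂ] C.carrier // ω ∈ nilTensor A (C.gr 1) ∧ C.curvature A.carrier ω = 0}

lemma MC.isFlat {C : DGLA.{u}} {A : ArtAlg} (ω : C.MC A) : C.IsFlat A.carrier ω.1 :=
  ⟨nilTensor_le A _ ω.2.1, ω.2.2⟩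

/-- The map `𝒞(C; A) → 𝒞(C; B)` on objects. -/
def MC.push {C : DGLA.{u}} {A B : ArtAlg} (p : A ⟶ B) (ω : C.MC A) : C.MC B :=
  ⟨pushTensor p.1 C.carrier ω.1, pushTensor_nilTensor p _ ω.2.1, by
    rw [curvature_push, ω.2.2, map_zero]⟩

/-- The gauge action `ω ↦ exp(ad λ) ω + ((1 - exp(ad λ)) / ad λ)(dλ)` of `l = λ ∈ C⁰ ⊗ m`, in terms
of power series (the sums are finite, as `ad λ` is nilpotent). -/
noncomputable def gauge (A : ArtAlg) (l ω : A.carrier ⊗[ℂ] C.carrier) : A.carrier ⊗[ℂ] C.carrier :=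
  (∑ᶠ n : ℕ, ((n.factorial : ℂ)⁻¹) • ((C.bracketTensor A.carrier l) ^ n) ω) -
    ∑ᶠ n : ℕ, (((n + 1).factorial : ℂ)⁻¹) •
      ((C.bracketTensor A.carrier l) ^ n) (C.dTensor A.carrier l)

/-- Two Maurer–Cartan elements are isomorphic in `𝒞(C; A)` if some `λ ∈ C⁰ ⊗ m` carries the first
to the second. -/
def MC.Iso {C : DGLA.{u}} {A : ArtAlg} (ω η : C.MC A) : Prop :=
  ∃ l ∈ nilTensor A (C.gr 0), C.gauge A l ω.1 = η.1

lemma ad_pow_mem (A : ArtAlg) {l : A.carrier ⊗[ℂ] C.carrier} (hl : l ∈ nilTensor A (C.gr 0))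
    (n : ℕ) (x : A.carrier ⊗[ℂ] C.carrier) :
    ((C.bracketTensor A.carrier l) ^ n) x ∈
      A.m ^ n • (⊤ : Submodule A.carrier (A.carrier ⊗[ℂ] C.carrier)) := by
  have h₁ : ∀ y, C.bracketTensor A.carrier l y ∈
      A.m • (⊤ : Submodule A.carrier (A.carrier ⊗[ℂ] C.carrier)) := by
    intro y
    have : nilTensor A (C.gr 0) ≤
        (A.m • (⊤ : Submodule A.carrier (A.carrier ⊗[ℂ] C.carrier))).comap
          ((C.bracketTensor A.carrier).flip y) := by
      refine Submodule.smul_le.2 fun a ha z _ => ?_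
      rw [Submodule.mem_comap, map_smul]
      exact Submodule.smul_mem_smul ha Submodule.mem_top
    exact this hl
  induction n with
  | zero => simp
  | succ n ih =>
    have e : (C.bracketTensor A.carrier l) ^ (n + 1) =
      C.bracketTensor A.carrier l * (C.bracketTensor A.carrier l) ^ n := pow_succ' _ _
    rw [e, Module.End.mul_apply]
    have : A.m ^ n • (⊤ : Submodule A.carrier (A.carrier ⊗[ℂ] C.carrier)) ≤
        (A.m ^ (n + 1) • (⊤ : Submodule A.carrier (A.carrier ⊗[ℂ] C.carrier))).comap
          (C.bracketTensor A.carrier l) := by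
      refine Submodule.smul_le.2 fun a ha z _ => ?_
      rw [Submodule.mem_comap, map_smul, pow_succ, Submodule.mul_smul]
      exact Submodule.smul_mem_smul ha (h₁ z)
    exact this ih

lemma exists_ad_pow_eq_zero (A : ArtAlg) :
    ∃ N : ℕ, ∀ l ∈ nilTensor A (C.gr 0), ∀ n, N ≤ n → ∀ x,
      ((C.bracketTensor A.carrier l) ^ n) x = 0 := by
  obtain ⟨N, hN⟩ := IsArtinianRing.isNilpotent_jacobson_bot (R := A.carrier)
  rw [IsLocalRing.jacobson_eq_maximalIdeal _ bot_ne_top] at hN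
  refine ⟨N, fun l hl n hn x => ?_⟩
  have h := C.ad_pow_mem A hl n x
  have h0 : A.m ^ n = ⊥ := le_bot_iff.1 ((Ideal.pow_le_pow_right hn).trans hN.le)
  rw [h0, Submodule.bot_smul, Submodule.mem_bot] at h
  exact h

lemma push_ad_pow {A B : ArtAlg} (p : A ⟶ B) (l x : A.carrier ⊗[ℂ] C.carrier) (n : ℕ) :
    pushTensor p.1 C.carrier (((C.bracketTensor A.carrier l) ^ n) x) =
      ((C.bracketTensor B.carrier (pushTensor p.1 C.carrier l)) ^ n)
        (pushTensor p.1 C.carrier x) := by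
  induction n with
  | zero => simp
  | succ n ih =>
    rw [pow_succ', Module.End.mul_apply, pow_succ', Module.End.mul_apply, ← ih]
    exact pushTensor_extendBilin p.1 C.bracket _ _

lemma push_gauge {A B : ArtAlg} (p : A ⟶ B) {l : A.carrier ⊗[ℂ] C.carrier}
    (hl : l ∈ nilTensor A (C.gr 0)) (ω : A.carrier ⊗[ℂ] C.carrier) :
    pushTensor p.1 C.carrier (C.gauge A l ω) =
      C.gauge B (pushTensor p.1 C.carrier l) (pushTensor p.1 C.carrier ω) := by
  obtain ⟨N, hN⟩ := C.exists_ad_pow_eq_zero A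
  have key : ∀ (c : ℕ → ℂ) (x : A.carrier ⊗[ℂ] C.carrier),
      pushTensor p.1 C.carrier (∑ᶠ n : ℕ, c n • ((C.bracketTensor A.carrier l) ^ n) x) =
        ∑ᶠ n : ℕ, c n • ((C.bracketTensor B.carrier (pushTensor p.1 C.carrier l)) ^ n)
          (pushTensor p.1 C.carrier x) := by
    intro c x
    have hfin : (Function.support
        fun n : ℕ => c n • ((C.bracketTensor A.carrier l) ^ n) x).Finite := by
      refine (Set.finite_lt_nat N).subset fun n hn => ?_
      by_contra h
      refine hn ?_
      change c n • ((C.bracketTensor A.carrier l) ^ n) x = 0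
      rw [hN l hl n (not_lt.1 h), smul_zero]
    rw [← LinearMap.toAddMonoidHom_coe, AddMonoidHom.map_finsum _ hfin]
    refine finsum_congr fun n => ?_
    rw [LinearMap.toAddMonoidHom_coe, map_smul, push_ad_pow]
  rw [gauge, gauge, map_sub, key, key, dTensor, dTensor, pushTensor_baseChange]

lemma MC.Iso.push {C : DGLA.{u}} {A B : ArtAlg} (p : A ⟶ B) {ω η : C.MC A} (h : ω.Iso η) :
    (ω.push p).Iso (η.push p) := by
  obtain ⟨l, hl, e⟩ := h
  refine ⟨pushTensor p.1 C.carrier l, pushTensor_nilTensor p _ hl, ?_⟩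
  change C.gauge B _ (pushTensor p.1 C.carrier ω.1) = pushTensor p.1 C.carrier η.1
  rw [← push_gauge C p hl, e]

lemma pushTensor_id (A : ArtAlg) (x : A.carrier ⊗[ℂ] C.carrier) :
    pushTensor (AlgHom.id ℂ A.carrier) C.carrier x = x := by
  change LinearMap.rTensor C.carrier (LinearMap.id) x = x
  rw [LinearMap.rTensor_id, LinearMap.id_apply]

/-- The deformation functor `Def(C)`, with `Def(C)(A)` the set of isomorphism classes of
`𝒞(C; A)`. -/
def Def : ArtAlg ⥤ Type u where
  obj A := Quot (MC.Iso (C := C) (A := A))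
  map p := ↾Quot.map (MC.push p) fun _ _ h => h.push p
  map_id A := by
    ext x
    induction x using Quot.ind with
    | mk ω => exact congrArg (Quot.mk _) (Subtype.ext (C.pushTensor_id A ω.1))
  map_comp {X Y Z} p q := by
    ext x
    induction x using Quot.ind with
    | mk ω =>
      refine congrArg (Quot.mk _) (Subtype.ext ?_)
      change LinearMap.rTensor C.carrier (q.1.toLinearMap ∘ₗ p.1.toLinearMap) ω.1 = _
      rw [LinearMap.rTensor_comp]
      rfl

end DGLA

namespace DGLAPair

/-- The objects of `𝒞^i_k(C, M; A)`: the Maurer–Cartan elements `ω` with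
`J^i_k(M ⊗ A, d_ω) = 0`. -/
def IsJump (P : DGLAPair.{u, v}) (i : ℤ) (k : ℕ) {A : ArtAlg} (ω : P.C.MC A) : Prop :=
  jumpIdeal (P.M.aomoto ω.isFlat) i k = ⊥

/-- The subset `Def^i_k(C, M)(A)` of `Def(C)(A)`: the isomorphism classes of the full subcategory
`𝒞^i_k(C, M; A)` of `𝒞(C; A)`. -/
def jumpSet (P : DGLAPair.{u, v}) (i : ℤ) (k : ℕ) (A : ArtAlg) : Set (P.C.Def.obj A) :=
  {x | ∃ ω : P.C.MC A, P.IsJump i k ω ∧ Quot.mk _ ω = x}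

/-- The sets `Def^i_k(C, M)(A)` form a subfunctor of `Def(C)`. -/
def JumpStable (P : DGLAPair.{u, v}) (i : ℤ) (k : ℕ) : Prop :=
  ∀ {A B : ArtAlg} (p : A ⟶ B), P.jumpSet i k A ⊆ P.C.Def.map p ⁻¹' P.jumpSet i k B

/-- The cohomology jump functor `Def^i_k(C, M)`, as a subfunctor of `Def(C)`. -/
def jumpFunctor (P : DGLAPair.{u, v}) (i : ℤ) (k : ℕ) (h : P.JumpStable i k) :
    Subfunctor P.C.Def where
  obj := P.jumpSet i k
  map := h

end DGLAPair

/-! ### Flat connections, resonance varieties and their germs -/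

namespace DGLA

variable (C : DGLA.{u}) [FiniteDimensional ℂ (C.gr 1)]

/-- The ring of polynomial functions on `C¹`. -/
abbrev PolyRing (C : DGLA.{u}) : Type u := SymmetricAlgebra ℂ (Module.Dual ℂ (C.gr 1))

/-- The tautological element `∑ eᵢ ⊗ eᵢ*` of `C¹ ⊗ Sym((C¹)*)`. -/
noncomputable def tautPoly : C.PolyRing ⊗[ℂ] C.carrier :=
  TensorProduct.map (SymmetricAlgebra.ι ℂ (Module.Dual ℂ (C.gr 1))) (C.gr 1).subtype
    (TensorProduct.comm ℂ _ _ (coevaluation ℂ (C.gr 1) 1))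

/-- The ideal of the equations `dω + ½[ω, ω] = 0` on `C¹`, generated by the coordinates of the
curvature of the tautological element. -/
noncomputable def flatIdeal : Ideal C.PolyRing :=
  Ideal.span (Set.range fun l : Module.Dual ℂ C.carrier =>
    TensorProduct.rid ℂ C.PolyRing (LinearMap.lTensor C.PolyRing l
      (C.curvature C.PolyRing C.tautPoly)))

/-- The coordinate ring of the space of flat connections `ℱ(C)`. -/
abbrev FlatRing : Type u := C.PolyRing ⧸ C.flatIdeal

/-- The coordinate functions on `ℱ(C)`. -/
noncomputable def flatCoord : Module.Dual ℂ (C.gr 1) →ₗ[ℂ] C.FlatRing :=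
  (Ideal.Quotient.mkₐ ℂ C.flatIdeal).toLinearMap ∘ₗ SymmetricAlgebra.ι ℂ (Module.Dual ℂ (C.gr 1))

/-- The tautological section `ζ` of `C¹ ⊗ 𝒪` over `ℱ(C)`. -/
noncomputable def taut : C.FlatRing ⊗[ℂ] C.carrier :=
  pushTensor (Ideal.Quotient.mkₐ ℂ C.flatIdeal) C.carrier C.tautPoly

lemma tautPoly_mem : C.tautPoly ∈ (C.gr 1).baseChange C.PolyRing := by
  unfold tautPoly
  generalize TensorProduct.comm ℂ (C.gr 1) (Module.Dual ℂ (C.gr 1)) (coevaluation ℂ (C.gr 1) 1) = x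
  induction x using TensorProduct.induction_on with
  | zero => rw [map_zero]; exact Submodule.zero_mem _
  | tmul a x =>
    rw [TensorProduct.map_tmul]
    exact Submodule.tmul_mem_baseChange_of_mem _ x.2
  | add x y hx hy => rw [map_add]; exact add_mem hx hy

lemma taut_isFlat : C.IsFlat C.FlatRing C.taut where
  mem := pushTensor_mem _ _ C.tautPoly_mem
  curvature_eq := by
    rw [taut, curvature_push]
    apply eq_zero_of_forall_dual
    intro l
    rw [rid_lTensor_pushTensor]
    exact Ideal.Quotient.eq_zero_iff_mem.2 (Ideal.subset_span ⟨l, rfl⟩)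

end DGLA

namespace DGLAPair

variable (P : DGLAPair.{u, v})

/-- The ideal in the coordinate ring of `ℱ(C)` of the resonance variety `ℛ^i_k(C, M)`: the jump
ideal of the universal complex `(M ⊗ 𝒪, d_ζ)`. -/
noncomputable def resonanceIdeal [FiniteDimensional ℂ (P.C.gr 1)] (i : ℤ) (k : ℕ) :
    Ideal P.C.FlatRing :=
  jumpIdeal (P.M.aomoto P.C.taut_isFlat) i k

end DGLAPair

section Germs

/-- The ring of polynomial functions on `X × W`, for an affine scheme `X` with coordinate ring `B`
and a finite-dimensional vector space `W`. -/
abbrev ProdRing (B : Type u) [CommRing B] [Algebra ℂ B] (W : Type v) [AddCommGroup W]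
    [Module ℂ W] : Type (max u v) :=
  B ⊗[ℂ] SymmetricAlgebra ℂ (Module.Dual ℂ W)

variable {V : Type u} [AddCommGroup V] [Module ℂ V]

/-- The ideal of the origin of `X × W`, where `X ⊆ V` is closed and `c` gives the linear
coordinates on `X`. -/
def originIdeal {B : Type v} [CommRing B] [Algebra ℂ B] (c : Module.Dual ℂ V →ₗ[ℂ] B)
    (W : Type w) [AddCommGroup W] [Module ℂ W] : Ideal (ProdRing B W) :=
  Ideal.span ((Set.range fun l => c l ⊗ₜ[ℂ] (1 : SymmetricAlgebra ℂ (Module.Dual ℂ W))) ∪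
    Set.range fun l => (1 : B) ⊗ₜ[ℂ] SymmetricAlgebra.ι ℂ (Module.Dual ℂ W) l)

/-- The ring of functions on the formal germ at the origin of `X × W`: the completion of the
coordinate ring of `X × W` at the ideal of the origin. -/
abbrev GermRing {B : Type v} [CommRing B] [Algebra ℂ B] (c : Module.Dual ℂ V →ₗ[ℂ] B)
    (W : Type w) [AddCommGroup W] [Module ℂ W] : Type (max v w) :=
  AdicCompletion (originIdeal c W) (ProdRing B W)

/-- The ring of functions on the formal germ at the origin of `X' × W`, where `X'` is the closed
subscheme of `X` defined by the ideal `J`, with coordinate ring `B ⧸ J`. -/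
abbrev SubGermRing {B : Type v} [CommRing B] [Algebra ℂ B] (c : Module.Dual ℂ V →ₗ[ℂ] B)
    (J : Ideal B) (W : Type w) [AddCommGroup W] [Module ℂ W] : Type (max v w) :=
  GermRing ((Ideal.Quotient.mkₐ ℂ J).toLinearMap ∘ₗ c) W

/-- The map of coordinate rings given by the inclusion `X' × W ⊆ X × W`, where `X'` is the closed
subscheme of `X` defined by the ideal `J`. -/
noncomputable def prodQuot {B : Type v} [CommRing B] [Algebra ℂ B] (J : Ideal B)
    (W : Type w) [AddCommGroup W] [Module ℂ W] : ProdRing B W →ₐ[ℂ] ProdRing (B ⧸ J) W :=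
  Algebra.TensorProduct.map (Ideal.Quotient.mkₐ ℂ J) (AlgHom.id ℂ _)

lemma originIdeal_le {B : Type v} [CommRing B] [Algebra ℂ B] (c : Module.Dual ℂ V →ₗ[ℂ] B)
    (J : Ideal B) (W : Type w) [AddCommGroup W] [Module ℂ W] :
    originIdeal c W ≤
      (originIdeal ((Ideal.Quotient.mkₐ ℂ J).toLinearMap ∘ₗ c) W).comap (prodQuot J W) := by
  refine Ideal.span_le.2 ?_
  rintro _ (⟨l, rfl⟩ | ⟨l, rfl⟩)
  · refine Ideal.subset_span (Or.inl ⟨l, ?_⟩)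
    simp [prodQuot]
  · refine Ideal.subset_span (Or.inr ⟨l, ?_⟩)
    simp [prodQuot]

/-- The map of completions induced by a homomorphism `f : R → S` with `f(I) ⊆ J`. -/
noncomputable def completionMap {R : Type u} {S : Type v} [CommRing R] [Algebra ℂ R] [CommRing S]
    [Algebra ℂ S] (f : R →ₐ[ℂ] S) (I : Ideal R) (J : Ideal S) (h : I ≤ J.comap f) :
    AdicCompletion I R →ₐ[ℂ] AdicCompletion J S :=
  AdicCompletion.liftAlgHom J
    (fun n => (Ideal.quotientMapₐ (J ^ n) f
        ((Ideal.pow_right_mono h n).trans (Ideal.le_comap_pow f n))).comp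
      ((AdicCompletion.evalₐ I n).restrictScalars ℂ))
    (by
      intro m n hle
      ext x
      obtain ⟨r, rfl⟩ := AdicCompletion.mk_surjective I R x
      have e := AdicCompletion.Ideal.mk_eq_mk I hle r
      simp only [AlgHom.comp_apply, AlgHom.restrictScalars_apply, AdicCompletion.evalₐ_mk]
      rw [← e]
      rfl)

/-- The restriction of functions from the germ of `X × W` to the germ of `X' × W`. -/
noncomputable def germRestrict {B : Type v} [CommRing B] [Algebra ℂ B]
    (c : Module.Dual ℂ V →ₗ[ℂ] B) (J : Ideal B) (W : Type w) [AddCommGroup W] [Module ℂ W] :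
    GermRing c W →ₐ[ℂ] SubGermRing c J W :=
  completionMap (prodQuot J W) _ _ (originIdeal_le c J W)

end Germs

namespace DGLAPair

variable (P : DGLAPair.{u, v}) {g : Type u} [LieRing g] [LieAlgebra ℂ g]

/-- The augmented pair `(C₀, M)`, where `C₀ = ker ε` is the augmentation ideal. -/
def augmented (ε : P.C.Hom (DGLA.ofLie g)) : DGLAPair.{u, v} where
  C := ε.ker
  M := P.M.restrict ε.kerInclusion

/-- The subspace `ε(H⁰(C)) ⊆ g`, where `H⁰(C) = ker d ∩ C⁰`. -/
def augH0 (ε : P.C.Hom (DGLA.ofLie g)) : Submodule ℂ g :=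
  (P.C.cocycles ⊓ P.C.gr 0).map ε.toFun

variable [FiniteDimensional ℂ (P.cohomology.C.gr 1)]

/-- The functor on Artinian local algebras prorepresented by the formal germ at the origin of
`𝒬(C) × W`. -/
noncomputable def quadGerm (W : Type u) [AddCommGroup W] [Module ℂ W] : ArtAlg ⥤ Type u :=
  ArtAlg.homFunctor (GermRing P.cohomology.C.flatCoord W)

/-- The functor on Artinian local algebras prorepresented by the formal germ at the origin of
`ʰℛ^i_k(C, M) × W`. -/
noncomputable def resGerm (i : ℤ) (k : ℕ) (W : Type u) [AddCommGroup W] [Module ℂ W] :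
    ArtAlg ⥤ Type u :=
  ArtAlg.homFunctor
    (SubGermRing P.cohomology.C.flatCoord (P.cohomology.resonanceIdeal i k) W)

/-- The natural transformation induced by the closed embedding
`ʰℛ^i_k(C, M) × W ⊆ 𝒬(C) × W`. -/
noncomputable def resGermInclusion (i : ℤ) (k : ℕ) (W : Type u) [AddCommGroup W] [Module ℂ W] :
    P.resGerm i k W ⟶ P.quadGerm W :=
  ArtAlg.homFunctorMap (germRestrict P.cohomology.C.flatCoord (P.cohomology.resonanceIdeal i k) W)

end DGLAPair

/-! ### Determinantal ideals -/

section Minors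

open Matrix

variable {R : Type t} [CommRing R]

/-! The DGLA `H = H(C)` has zero differential, so its Maurer–Cartan elements over `A` are exactly
the `A`-points of the germ of `𝒬(C)` at the origin. Its deformation functor still divides by the
action of `H⁰`, and the augmentation undoes this. As `g` sits in degree 0, `C₀ = ker ε` has the same
Maurer–Cartan elements as `C`; only the gauge group shrinks, from `C⁰` to `ker ε⁰`. The hypotheses
on `ε` split `C⁰` as `C₀⁰ ⊕ W ⊕ H⁰(C)`. The directions of `W` are no longer divided out and give a
free factor, and `H⁰(C)` no longer identifies points of `𝒬(C)`.

Formality enters through `DGLAPair.IsFormal.defEquiv`: an isomorphism `Ψ : Def(C) ≅ Def(H)` such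
that corresponding elements have Aomoto complexes that are homotopy equivalent near every degree `i
≤ q`. For the deformation functors this is the Goldman–Millson argument: solutions and gauge
equivalences are lifted one power of `m` at a time (`DGLA.Hom.surj_step`, `DGLA.Hom.inj_step`),
using the isomorphisms on `H⁰` and `H¹` and injectivity on `H²`. That gauge transformations form a
group is the Baker–Campbell–Hausdorff theorem. For the modules, the perturbation lemma replaces `(M
⊗ A, d_ω)` by a minimal model on (harmonic elements) `⊗ A`. The map of minimal models is the map on
cohomology modulo the nilpotent ideal `m`, so a `q`-equivalence makes it split surjective in degree
`i - 1`, bijective in degree `i` and split injective in degree `i + 1` (`DGLAPair.Hom.heq_aomoto`).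
This local form of homotopy equivalence already determines the ideals of minors
(`ThreeTerm.HEq.minors_eq`).

To pass from `Def(C)` to `Def(C₀)`, the universal Maurer–Cartan elements of `H` over the
infinitesimal neighbourhoods of the origin are lifted compatibly through `Ψ`. This gives a
functorial map `σ : MC(H) → MC(C)` inducing the inverse of `Ψ` on classes
(`DGLA.nonempty_natSection`), whose linear part is an isomorphism on `H¹`. Then `(η, w) ↦ exp(s(w))
· σ(η)` is bijective from the points of `𝒬(C) × W` to the classes modulo `C₀⁰`
(`DGLA.Splitting.theta_injective`, `DGLA.Splitting.theta_surjective`). To first order it moves by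
`θ(δη) - d s(δw)`, and a gauge parameter `l` moves by `-dl`; the splitting of `C⁰` makes these
independent and exhaustive.

Finally, `H(M)` is finite-dimensional in each degree, so the resonance ideal is generated by minors
of matrices over the coordinate ring, and minors commute with base change. The jump ideal of the
deformation at a point `φ` is therefore the extension of the resonance ideal along `φ`
(`DGLAPair.jumpIdeal_eq_map_resonanceIdeal`). It vanishes exactly when `φ` factors through the
closed subscheme `ʰℛ`, which gives both the subfunctor property and the commutative square. -/

lemma det_submatrix_mem_minorIdeal {m : Type u} {n : Type v} (N : Matrix m n R) {r : ℕ}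
    (e : Fin r → m) (e' : Fin r → n) : (N.submatrix e e').det ∈ minorIdeal N r :=
  Ideal.subset_span ⟨(e, e'), rfl⟩

lemma minorIdeal_le_iff {m : Type u} {n : Type v} {N : Matrix m n R} {r : ℕ} {I : Ideal R} :
    minorIdeal N r ≤ I ↔
      ∀ (e : Fin r → m) (e' : Fin r → n), (N.submatrix e e').det ∈ I := by
  rw [minorIdeal, Ideal.span_le]
  constructor
  · exact fun h e e' => h ⟨(e, e'), rfl⟩
  · rintro h _ ⟨e, rfl⟩
    exact h _ _

lemma minorIdeal_transpose {m : Type u} {n : Type v} (N : Matrix m n R) (r : ℕ) :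
    minorIdeal Nᵀ r = minorIdeal N r := by
  apply le_antisymm <;> rw [minorIdeal_le_iff] <;> intro e e' <;> rw [← det_transpose]
  · exact det_submatrix_mem_minorIdeal N e' e
  · exact det_submatrix_mem_minorIdeal Nᵀ e' e

/-- The rows of `M * N` are combinations of rows of `N`, so multilinearity writes a minor of the
product as a combination of determinants of `N` with rows chosen by arbitrary functions `f`.
Non-injective `f` do no harm, so the full Cauchy–Binet formula is not needed. -/
lemma minorIdeal_mul_le_right {l : Type s} {m : Type u} {n : Type v} [Fintype l]
    (M : Matrix m l R) (N : Matrix l n R) (r : ℕ) :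
    minorIdeal (M * N) r ≤ minorIdeal N r := by
  classical
  rw [minorIdeal_le_iff]
  intro e e'
  have h : ((M * N).submatrix e e') =
      fun i => ∑ k : l, M (e i) k • (fun j => N k (e' j)) := by
    funext i j
    simp [Matrix.mul_apply, Finset.sum_apply]
  have h₂ : ((M * N).submatrix e e').det =
      ∑ f : Fin r → l, (∏ i, M (e i) (f i)) • (N.submatrix f e').det := by
    rw [h]
    change (detRowAlternating (R := R) (n := Fin r)).toMultilinearMap _ = _
    rw [MultilinearMap.map_sum]
    refine Finset.sum_congr rfl fun f _ => ?_
    rw [MultilinearMap.map_smul_univ]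
    rfl
  rw [h₂]
  exact Submodule.sum_mem _ fun f _ => Submodule.smul_mem _ _ (det_submatrix_mem_minorIdeal N f e')

lemma minorIdeal_mul_le_left {l : Type s} {m : Type u} {n : Type v} [Fintype l]
    (M : Matrix m l R) (N : Matrix l n R) (r : ℕ) :
    minorIdeal (M * N) r ≤ minorIdeal M r := by
  rw [← minorIdeal_transpose (M * N), ← minorIdeal_transpose M, transpose_mul]
  exact minorIdeal_mul_le_right _ _ _

/-- Laplace expansion along a column. -/
lemma minorIdeal_succ_le {m : Type u} {n : Type v} (N : Matrix m n R) (r : ℕ) :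
    minorIdeal N (r + 1) ≤ minorIdeal N r := by
  rw [minorIdeal_le_iff]
  intro e e'
  rw [det_succ_column _ 0]
  refine Submodule.sum_mem _ fun i _ => Ideal.mul_mem_left _ _ ?_
  exact det_submatrix_mem_minorIdeal N _ _

lemma minorIdeal_antitone {m : Type u} {n : Type v} (N : Matrix m n R) :
    Antitone (minorIdeal N) :=
  antitone_nat_of_succ_le (minorIdeal_succ_le N)

lemma minorIdeal_zero {m : Type u} {n : Type v} (N : Matrix m n R) : minorIdeal N 0 = ⊤ := by
  rw [Ideal.eq_top_iff_one]
  convert det_submatrix_mem_minorIdeal N (r := 0) Fin.elim0 Fin.elim0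
  simp

/-- Bordering a square submatrix by the whole identity block does not change its determinant. -/
lemma minorIdeal_le_fromBlocks_one {m : Type u} {n : Type v} {k : Type w} [Fintype k]
    [DecidableEq k] (N : Matrix m n R) (r : ℕ) :
    minorIdeal N r ≤ minorIdeal (fromBlocks N 0 0 (1 : Matrix k k R)) (r + Fintype.card k) := by
  rw [minorIdeal_le_iff]
  intro e e'
  let c := Fintype.equivFin k
  let σ : Fin (r + Fintype.card k) ≃ Fin r ⊕ k :=
    finSumFinEquiv.symm.trans (Equiv.sumCongr (Equiv.refl _) c.symm)
  have h : ((fromBlocks N 0 0 (1 : Matrix k k R)).submatrix (Sum.map e id ∘ σ)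
      (Sum.map e' id ∘ σ)).det = (N.submatrix e e').det := by
    rw [← submatrix_submatrix, det_submatrix_equiv_self]
    have : (fromBlocks N 0 0 (1 : Matrix k k R)).submatrix (Sum.map e id) (Sum.map e' id) =
        fromBlocks (N.submatrix e e') 0 0 1 := by
      ext (i | i) (j | j) <;> rfl
    rw [this, det_fromBlocks_zero₂₁, det_one, mul_one]
  rw [← h]
  exact det_submatrix_mem_minorIdeal _ _ _

/-- The extra column is chosen at least twice (equal columns), once (expand along it), or never.
Without that column a chosen extra row is zero (`key`), and otherwise an honest minor of `N`
remains. -/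
lemma minorIdeal_fromBlocks_one_unit_le {m : Type u} {n : Type v} (N : Matrix m n R) (r : ℕ) :
    minorIdeal (fromBlocks N 0 0 (1 : Matrix Unit Unit R)) (r + 1) ≤ minorIdeal N r := by
  classical
  have key : ∀ (s : ℕ) (e : Fin s → m ⊕ Unit) (e' : Fin s → n),
      ((fromBlocks N 0 0 (1 : Matrix Unit Unit R)).submatrix e (Sum.inl ∘ e')).det ∈
        minorIdeal N s := by
    intro s e e'
    by_cases h : ∃ i, e i = Sum.inr ()
    · obtain ⟨i, hi⟩ := h
      rw [det_eq_zero_of_row_eq_zero i fun j => by simp [hi]]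
      exact zero_mem _
    · have : ∀ i, ∃ a, e i = Sum.inl a := by
        intro i
        rcases hi : e i with a | a
        · exact ⟨a, rfl⟩
        · exact absurd ⟨i, hi⟩ h
      choose a ha using this
      have : (fromBlocks N 0 0 (1 : Matrix Unit Unit R)).submatrix e (Sum.inl ∘ e') =
          N.submatrix a e' := by
        ext i j
        simp [ha]
      rw [this]
      exact det_submatrix_mem_minorIdeal _ _ _
  have inl_of : ∀ (s : ℕ) (e' : Fin s → n ⊕ Unit), (¬ ∃ j, e' j = Sum.inr ()) →
      ∃ a : Fin s → n, e' = Sum.inl ∘ a := by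
    intro s e' h
    have : ∀ i, ∃ a, e' i = Sum.inl a := by
      intro i
      rcases hi : e' i with a | a
      · exact ⟨a, rfl⟩
      · exact absurd ⟨i, hi⟩ h
    choose a ha using this
    exact ⟨a, funext ha⟩
  rw [minorIdeal_le_iff]
  intro e e'
  by_cases h : ∃ j, e' j = Sum.inr ()
  · obtain ⟨j, hj⟩ := h
    by_cases h' : ∃ j', e' (j.succAbove j') = Sum.inr ()
    · obtain ⟨j', hj'⟩ := h'
      rw [det_zero_of_column_eq (Fin.succAbove_ne j j') fun i => by
        simp only [submatrix_apply, hj, hj']]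
      exact zero_mem _
    · obtain ⟨a, ha⟩ := inl_of _ (fun j' => e' (j.succAbove j')) h'
      rw [det_succ_column _ j]
      refine Submodule.sum_mem _ fun i _ => Ideal.mul_mem_left _ _ ?_
      rw [submatrix_submatrix, show e' ∘ j.succAbove = Sum.inl ∘ a from ha]
      exact key _ _ _
  · obtain ⟨a, rfl⟩ := inl_of _ e' h
    exact minorIdeal_succ_le N r (key _ _ _)

lemma minorIdeal_submatrix_equiv {m m' : Type*} {n n' : Type*} (N : Matrix m n R) (σ : m' ≃ m)
    (τ : n' ≃ n) (r : ℕ) : minorIdeal (N.submatrix σ τ) r = minorIdeal N r := by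
  apply le_antisymm <;> rw [minorIdeal_le_iff] <;> intro e e'
  · rw [submatrix_submatrix]
    exact det_submatrix_mem_minorIdeal N _ _
  · have := det_submatrix_mem_minorIdeal (N.submatrix σ τ) (σ.symm ∘ e) (τ.symm ∘ e')
    rw [submatrix_submatrix] at this
    convert this <;> (ext; simp)

/-- The identity block is peeled off one row and column at a time. When `r` is at most the size of
the block, the truncated size is `0` and the bound is the unit ideal. -/
lemma minorIdeal_fromBlocks_one_le {m : Type u} {n : Type v} {k : Type w} [Fintype k]
    [DecidableEq k] (N : Matrix m n R) (r : ℕ) :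
    minorIdeal (fromBlocks N 0 0 (1 : Matrix k k R)) r ≤ minorIdeal N (r - Fintype.card k) := by
  have fin : ∀ (c r : ℕ), minorIdeal (fromBlocks N 0 0 (1 : Matrix (Fin c) (Fin c) R)) r ≤
      minorIdeal N (r - c) := by
    intro c
    induction c with
    | zero =>
      intro r
      have : fromBlocks N 0 0 (1 : Matrix (Fin 0) (Fin 0) R) =
          N.submatrix (Equiv.sumEmpty m (Fin 0)) (Equiv.sumEmpty n (Fin 0)) := by
        ext (i | i) (j | j)
        · rfl
        · exact j.elim0
        · exact i.elim0
        · exact i.elim0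
      rw [this, minorIdeal_submatrix_equiv]
      exact le_rfl
    | succ c ih =>
      intro r
      cases r with
      | zero => rw [Nat.zero_sub, minorIdeal_zero N]; exact le_top
      | succ r =>
        rw [Nat.add_sub_add_right]
        refine le_trans ?_ (ih r)
        refine le_trans (le_of_eq ?_) (minorIdeal_fromBlocks_one_unit_le _ r)
        let σ : ∀ m : Type _, (m ⊕ Fin c) ⊕ Unit ≃ m ⊕ Fin (c + 1) := fun m =>
          (Equiv.sumAssoc m (Fin c) Unit).trans (Equiv.sumCongr (Equiv.refl m)
            ((Equiv.sumCongr (Equiv.refl _) (Equiv.equivPUnit (Fin 1)).symm).trans finSumFinEquiv))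
        let σ' : ∀ n : Type _, (n ⊕ Fin c) ⊕ Unit ≃ n ⊕ Fin (c + 1) := fun m =>
          (Equiv.sumAssoc m (Fin c) Unit).trans (Equiv.sumCongr (Equiv.refl m)
            ((Equiv.sumCongr (Equiv.refl _) (Equiv.equivPUnit (Fin 1)).symm).trans finSumFinEquiv))
        rw [← minorIdeal_submatrix_equiv _ (σ m) (σ' n)]
        congr 1
        ext ((i | i) | i) ((j | j) | j) <;>
          simp [σ, σ', Matrix.one_apply, Fin.ext_iff] <;> omega
  have : fromBlocks N 0 0 (1 : Matrix k k R) =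
      (fromBlocks N 0 0 (1 : Matrix (Fin (Fintype.card k)) (Fin (Fintype.card k)) R)).submatrix
        (Equiv.sumCongr (Equiv.refl m) (Fintype.equivFin k))
        (Equiv.sumCongr (Equiv.refl n) (Fintype.equivFin k)) := by
    ext (i | i) (j | j) <;> simp [Matrix.one_apply]
  rw [this, minorIdeal_submatrix_equiv]
  exact fin _ _

lemma minorIdeal_map {S : Type s} [CommRing S] (f : R →+* S) {m : Type u} {n : Type v}
    (N : Matrix m n R) (r : ℕ) : minorIdeal (N.map f) r = (minorIdeal N r).map f := by
  rw [minorIdeal, minorIdeal, Ideal.map_span, ← Set.range_comp]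
  congr 2
  funext e
  simp only [Function.comp_apply, RingHom.map_det, RingHom.mapMatrix_apply]
  rfl

lemma minorIdeal_toMatrix_comp_le {m : Type u} {n : Type v} {m' n' : Type*} [Fintype m] [Fintype n]
    [Fintype m'] [Fintype n'] [DecidableEq m] [DecidableEq n] [DecidableEq m'] [DecidableEq n']
    {V W V' W' : Type*} [AddCommGroup V] [Module R V] [AddCommGroup W] [Module R W]
    [AddCommGroup V'] [Module R V'] [AddCommGroup W'] [Module R W'] (b : Module.Basis n R V) (c : Module.Basis m R W)
    (b' : Module.Basis n' R V') (c' : Module.Basis m' R W') (P : W' →ₗ[R] W) (φ : V' →ₗ[R] W')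
    (Q : V →ₗ[R] V') (r : ℕ) :
    minorIdeal (LinearMap.toMatrix b c (P ∘ₗ φ ∘ₗ Q)) r ≤
      minorIdeal (LinearMap.toMatrix b' c' φ) r := by
  rw [LinearMap.toMatrix_comp b c' c, LinearMap.toMatrix_comp b b' c']
  exact (minorIdeal_mul_le_right _ _ _).trans (minorIdeal_mul_le_left _ _ _)

lemma toMatrix_prodMap {m n m' n' : Type*} [Fintype m] [Fintype n] [Fintype m'] [Fintype n']
    [DecidableEq n] [DecidableEq n'] [DecidableEq (n ⊕ n')] {V W V' W' : Type*} [AddCommGroup V]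
    [Module R V] [AddCommGroup W] [Module R W] [AddCommGroup V'] [Module R V'] [AddCommGroup W']
    [Module R W'] (b : Module.Basis n R V) (c : Module.Basis m R W) (b' : Module.Basis n' R V')
    (c' : Module.Basis m' R W') (φ : V →ₗ[R] W) (ψ : V' →ₗ[R] W') :
    LinearMap.toMatrix (b.prod b') (c.prod c') (φ.prodMap ψ) =
      fromBlocks (LinearMap.toMatrix b c φ) 0 0 (LinearMap.toMatrix b' c' ψ) := by
  ext (i | i) (j | j) <;> simp [LinearMap.toMatrix_apply]

end Minors

/-! ### Homotopy invariance -/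

section ThreeTerm

variable {R : Type t} [CommRing R]

/-- Two consecutive composable maps of `R`-modules with zero composition. -/
structure ThreeTerm (R : Type t) [CommRing R] where
  X₀ : Type u
  X₁ : Type u
  X₂ : Type u
  [g₀ : AddCommGroup X₀]
  [g₁ : AddCommGroup X₁]
  [g₂ : AddCommGroup X₂]
  [m₀ : Module R X₀]
  [m₁ : Module R X₁]
  [m₂ : Module R X₂]
  d₀ : X₀ →ₗ[R] X₁
  d₁ : X₁ →ₗ[R] X₂
  d_d : ∀ x, d₁ (d₀ x) = 0

attribute [instance] ThreeTerm.g₀ ThreeTerm.g₁ ThreeTerm.g₂ ThreeTerm.m₀ ThreeTerm.m₁ ThreeTerm.m₂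

/-- The data of a homotopy equivalence near the middle term. -/
structure ThreeTerm.HEqData (X : ThreeTerm.{t, u} R) (Y : ThreeTerm.{t, v} R) where
  f₀ : X.X₀ →ₗ[R] Y.X₀
  f₁ : X.X₁ →ₗ[R] Y.X₁
  f₂ : X.X₂ →ₗ[R] Y.X₂
  g₀ : Y.X₀ →ₗ[R] X.X₀
  g₁ : Y.X₁ →ₗ[R] X.X₁
  g₂ : Y.X₂ →ₗ[R] X.X₂
  h₁ : X.X₁ →ₗ[R] X.X₀
  h₂ : X.X₂ →ₗ[R] X.X₁
  k₁ : Y.X₁ →ₗ[R] Y.X₀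
  k₂ : Y.X₂ →ₗ[R] Y.X₁
  f_d₀ : ∀ x, f₁ (X.d₀ x) = Y.d₀ (f₀ x)
  f_d₁ : ∀ x, f₂ (X.d₁ x) = Y.d₁ (f₁ x)
  g_d₀ : ∀ y, g₁ (Y.d₀ y) = X.d₀ (g₀ y)
  g_d₁ : ∀ y, g₂ (Y.d₁ y) = X.d₁ (g₁ y)
  hX : ∀ x, x = g₁ (f₁ x) + X.d₀ (h₁ x) + h₂ (X.d₁ x)
  hY : ∀ y, y = f₁ (g₁ y) + Y.d₀ (k₁ y) + k₂ (Y.d₁ y)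

/-- Homotopy equivalence near the middle term. -/
def ThreeTerm.HEq (X : ThreeTerm.{t, u} R) (Y : ThreeTerm.{t, v} R) : Prop :=
  Nonempty (X.HEqData Y)

namespace ThreeTerm

lemma HEq.symm {X : ThreeTerm.{t, u} R} {Y : ThreeTerm.{t, v} R} (h : X.HEq Y) : Y.HEq X := by
  obtain ⟨D⟩ := h
  exact ⟨⟨D.g₀, D.g₁, D.g₂, D.f₀, D.f₁, D.f₂, D.k₁, D.k₂, D.h₁, D.h₂, D.g_d₀, D.g_d₁, D.f_d₀,
    D.f_d₁, D.hY, D.hX⟩⟩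

lemma HEq.refl (X : ThreeTerm.{t, u} R) : X.HEq X :=
  ⟨⟨.id, .id, .id, .id, .id, .id, 0, 0, 0, 0, fun _ => rfl, fun _ => rfl, fun _ => rfl,
    fun _ => rfl, fun _ => by simp, fun _ => by simp⟩⟩

lemma HEq.trans {X : ThreeTerm.{t, u} R} {Y : ThreeTerm.{t, v} R} {Z : ThreeTerm.{t, w} R}
    (h : X.HEq Y) (h' : Y.HEq Z) : X.HEq Z := by
  obtain ⟨D⟩ := h
  obtain ⟨D'⟩ := h'
  refine ⟨⟨D'.f₀ ∘ₗ D.f₀, D'.f₁ ∘ₗ D.f₁, D'.f₂ ∘ₗ D.f₂, D.g₀ ∘ₗ D'.g₀, D.g₁ ∘ₗ D'.g₁,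
    D.g₂ ∘ₗ D'.g₂, D.h₁ + D.g₀ ∘ₗ D'.h₁ ∘ₗ D.f₁, D.h₂ + D.g₁ ∘ₗ D'.h₂ ∘ₗ D.f₂,
    D'.k₁ + D'.f₀ ∘ₗ D.k₁ ∘ₗ D'.g₁, D'.k₂ + D'.f₁ ∘ₗ D.k₂ ∘ₗ D'.g₂, ?_, ?_, ?_, ?_, ?_, ?_⟩⟩
  · intro x
    simp [D.f_d₀, D'.f_d₀]
  · intro x
    simp [D.f_d₁, D'.f_d₁]
  · intro x
    simp [D.g_d₀, D'.g_d₀]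
  · intro x
    simp [D.g_d₁, D'.g_d₁]
  · intro x
    simp only [LinearMap.comp_apply, LinearMap.add_apply, map_add, D.f_d₁, ← D.g_d₀]
    conv_lhs => rw [D.hX x, D'.hX (D.f₁ x)]
    simp only [map_add]
    abel
  · intro x
    simp only [LinearMap.comp_apply, LinearMap.add_apply, map_add, D'.g_d₁, ← D'.f_d₀]
    conv_lhs => rw [D'.hY x, D.hY (D'.g₁ x)]
    simp only [map_add]
    abel

/-- An isomorphism of the terms commuting with the maps is a homotopy equivalence. -/
lemma HEq.of_iso {X : ThreeTerm.{t, u} R} {Y : ThreeTerm.{t, v} R}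
    (f₀ : X.X₀ →ₗ[R] Y.X₀) (f₁ : X.X₁ →ₗ[R] Y.X₁) (f₂ : X.X₂ →ₗ[R] Y.X₂)
    (g₀ : Y.X₀ →ₗ[R] X.X₀) (g₁ : Y.X₁ →ₗ[R] X.X₁) (g₂ : Y.X₂ →ₗ[R] X.X₂)
    (f_d₀ : ∀ x, f₁ (X.d₀ x) = Y.d₀ (f₀ x)) (f_d₁ : ∀ x, f₂ (X.d₁ x) = Y.d₁ (f₁ x))
    (fg₀ : ∀ y, f₀ (g₀ y) = y) (gf₁ : ∀ x, g₁ (f₁ x) = x) (fg₁ : ∀ y, f₁ (g₁ y) = y)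
    (gf₂ : ∀ x, g₂ (f₂ x) = x) : X.HEq Y := by
  refine ⟨⟨f₀, f₁, f₂, g₀, g₁, g₂, 0, 0, 0, 0, f_d₀, f_d₁, fun y => ?_, fun y => ?_,
    fun x => by simp [gf₁], fun y => by simp [fg₁]⟩⟩
  · rw [← gf₁ (X.d₀ _), f_d₀, fg₀]
  · conv_lhs => rw [← fg₁ y, ← f_d₁, gf₂]

/-- The ideal of minors of size `rank X₁ - k + 1` of `d₀ ⊕ d₁`, in terms of bases. -/
noncomputable def minors (X : ThreeTerm.{t, u} R) {ι₀ ι₁ ι₂ : Type*} [Fintype ι₀] [Fintype ι₁]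
    [DecidableEq ι₀] [DecidableEq ι₁] [Fintype ι₂]
    (b₀ : Module.Basis ι₀ R X.X₀) (b₁ : Module.Basis ι₁ R X.X₁) (b₂ : Module.Basis ι₂ R X.X₂)
    (k : ℕ) : Ideal R :=
  minorIdeal (Matrix.fromBlocks (LinearMap.toMatrix b₀ b₁ X.d₀) 0 0
    (LinearMap.toMatrix b₁ b₂ X.d₁)) (Fintype.card ι₁ + 1 - k)

/-- This takes the place of cancelling contractible summands: each of the two maps becomes a factor
of the other once it is enlarged by the identity of the other's middle term. Only the homotopy
identities at the middle terms enter. -/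
lemma HEq.exists_factor {X : ThreeTerm.{t, u} R} {Y : ThreeTerm.{t, v} R} (h : X.HEq Y) :
    ∃ (Q : (X.X₀ × X.X₁) × Y.X₁ →ₗ[R] (Y.X₀ × Y.X₁) × X.X₁)
      (P : (Y.X₁ × Y.X₂) × X.X₁ →ₗ[R] (X.X₁ × X.X₂) × Y.X₁),
      (X.d₀.prodMap X.d₁).prodMap (LinearMap.id : Y.X₁ →ₗ[R] Y.X₁) =
        P ∘ₗ ((Y.d₀.prodMap Y.d₁).prodMap LinearMap.id) ∘ₗ Q := by
  obtain ⟨D⟩ := h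
  let x : (X.X₀ × X.X₁) × Y.X₁ →ₗ[R] X.X₀ := LinearMap.fst R _ _ ∘ₗ LinearMap.fst R _ _
  let y : (X.X₀ × X.X₁) × Y.X₁ →ₗ[R] X.X₁ := LinearMap.snd R _ _ ∘ₗ LinearMap.fst R _ _
  let z : (X.X₀ × X.X₁) × Y.X₁ →ₗ[R] Y.X₁ := LinearMap.snd R _ _
  let x' : (Y.X₁ × Y.X₂) × X.X₁ →ₗ[R] Y.X₁ := LinearMap.fst R _ _ ∘ₗ LinearMap.fst R _ _
  let y' : (Y.X₁ × Y.X₂) × X.X₁ →ₗ[R] Y.X₂ := LinearMap.snd R _ _ ∘ₗ LinearMap.fst R _ _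
  let z' : (Y.X₁ × Y.X₂) × X.X₁ →ₗ[R] X.X₁ := LinearMap.snd R _ _
  -- If the homotopies satisfied `h₁ h₂ = 0`, `h₁ g₁ = g₀ k₁` and `f₁ h₂ = k₂ f₂`, then `N` would be
  -- `x` and plain block elimination would do. The remaining terms of `N` and of `P` compensate for
  -- the failure of these relations.
  let N : (X.X₀ × X.X₁) × Y.X₁ →ₗ[R] X.X₀ := x - D.h₁ ∘ₗ D.h₂ ∘ₗ X.d₁ ∘ₗ y -
    (D.h₁ ∘ₗ D.g₁ - D.g₀ ∘ₗ D.k₁) ∘ₗ z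
  let S : (X.X₀ × X.X₁) × Y.X₁ →ₗ[R] (Y.X₀ × Y.X₁) × X.X₁ :=
    ((D.f₀ ∘ₗ N - D.k₁ ∘ₗ z).prod (D.f₁ ∘ₗ y - z)).prod (X.d₀ ∘ₗ N + D.h₂ ∘ₗ X.d₁ ∘ₗ y + D.g₁ ∘ₗ z)
  let r₂ : (Y.X₁ × Y.X₂) × X.X₁ →ₗ[R] X.X₂ := D.g₂ ∘ₗ y' + X.d₁ ∘ₗ z'
  let P : (Y.X₁ × Y.X₂) × X.X₁ →ₗ[R] (X.X₁ × X.X₂) × Y.X₁ :=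
    ((D.g₁ ∘ₗ x' + X.d₀ ∘ₗ D.h₁ ∘ₗ z').prod r₂).prod
      (-x' - D.k₂ ∘ₗ y' + D.f₁ ∘ₗ z' - (D.f₁ ∘ₗ D.h₂ - D.k₂ ∘ₗ D.f₂) ∘ₗ r₂)
  refine ⟨S, P, LinearMap.ext ?_⟩
  rintro ⟨⟨a, b⟩, c⟩
  -- The homotopy identities and their consequences, oriented as rewriting rules that eliminate
  -- differentials of homotopies.
  have e₁ : ∀ a, X.d₀ (D.h₁ a) = a - D.g₁ (D.f₁ a) - D.h₂ (X.d₁ a) := fun a => by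
    nth_rewrite 2 [D.hX a]; abel
  have e₂ : ∀ a, Y.d₀ (D.k₁ a) = a - D.f₁ (D.g₁ a) - D.k₂ (Y.d₁ a) := fun a => by
    nth_rewrite 2 [D.hY a]; abel
  have e₃ : ∀ a, X.d₁ (D.h₂ (X.d₁ a)) = X.d₁ a - X.d₁ (D.g₁ (D.f₁ a)) := fun a => by
    nth_rewrite 2 [D.hX a]; simp [X.d_d]
  have e₄ : ∀ a, X.d₁ (D.g₁ (D.f₁ (D.h₂ (X.d₁ a)))) =
      X.d₁ (D.g₁ (D.f₁ a)) - X.d₁ (D.g₁ (D.f₁ (D.g₁ (D.f₁ a)))) := fun a => by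
    nth_rewrite 2 [D.hX a]; simp [X.d_d, D.f_d₀, D.g_d₀]
  have e₅ : ∀ a, X.d₁ (D.g₁ (D.k₂ (Y.d₁ a))) =
      X.d₁ (D.g₁ a) - X.d₁ (D.g₁ (D.f₁ (D.g₁ a))) := fun a => by
    nth_rewrite 2 [D.hY a]; simp [X.d_d, D.g_d₀]
  refine Prod.ext (Prod.ext ?_ ?_) ?_
  · simp [P, S, N, r₂, x, y, z, x', y', z', X.d_d, D.f_d₁, D.g_d₁, ← D.f_d₀, ← D.g_d₀, e₁, e₂,
      e₃, e₄, e₅]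
    abel
  · simp [P, S, N, r₂, x, y, z, x', y', z', X.d_d, D.f_d₁, D.g_d₁, ← D.f_d₀, ← D.g_d₀, e₁, e₂,
      e₃, e₄, e₅]
  · simp [P, S, N, r₂, x, y, z, x', y', z', X.d_d, D.f_d₁, D.g_d₁, ← D.f_d₀, ← D.g_d₀, e₁, e₂,
      e₃, e₄, e₅]
    abel

/-- An identity block of rank `r` shifts the size of minors by `r`, and each side is enlarged by the
middle rank of the other, so the two shifts lead to the same size. -/
lemma HEq.minors_le {X : ThreeTerm.{t, u} R} {Y : ThreeTerm.{t, v} R} (h : X.HEq Y)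
    {ι₀ ι₁ ι₂ κ₀ κ₁ κ₂ : Type*} [Fintype ι₀] [Fintype ι₁] [Fintype ι₂] [Fintype κ₀] [Fintype κ₁]
    [Fintype κ₂] [DecidableEq ι₀] [DecidableEq ι₁] [DecidableEq κ₀] [DecidableEq κ₁]
    (b₀ : Module.Basis ι₀ R X.X₀) (b₁ : Module.Basis ι₁ R X.X₁) (b₂ : Module.Basis ι₂ R X.X₂)
    (c₀ : Module.Basis κ₀ R Y.X₀) (c₁ : Module.Basis κ₁ R Y.X₁) (c₂ : Module.Basis κ₂ R Y.X₂)
    (k : ℕ) : X.minors b₀ b₁ b₂ k ≤ Y.minors c₀ c₁ c₂ k := by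
  classical
  obtain ⟨Q, P, e⟩ := h.exists_factor
  have e' := minorIdeal_toMatrix_comp_le ((b₀.prod b₁).prod c₁) ((b₁.prod b₂).prod c₁)
    ((c₀.prod c₁).prod b₁) ((c₁.prod c₂).prod b₁) P
    ((Y.d₀.prodMap Y.d₁).prodMap LinearMap.id) Q (Fintype.card ι₁ + 1 - k + Fintype.card κ₁)
  rw [← e, toMatrix_prodMap, toMatrix_prodMap, toMatrix_prodMap, toMatrix_prodMap, LinearMap.toMatrix_id, LinearMap.toMatrix_id] at e'
  refine (minorIdeal_le_fromBlocks_one (k := κ₁) _ _).trans (e'.trans ?_)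
  refine (minorIdeal_fromBlocks_one_le _ _).trans (minorIdeal_antitone _ ?_)
  -- If `k` exceeds `rank X₁ + 1`, the subtraction truncates and only an inequality between the
  -- sizes survives; it points in the right direction.
  omega

lemma HEq.minors_eq {X : ThreeTerm.{t, u} R} {Y : ThreeTerm.{t, v} R} (h : X.HEq Y)
    {ι₀ ι₁ ι₂ κ₀ κ₁ κ₂ : Type*} [Fintype ι₀] [Fintype ι₁] [Fintype ι₂] [Fintype κ₀] [Fintype κ₁]
    [Fintype κ₂] [DecidableEq ι₀] [DecidableEq ι₁] [DecidableEq κ₀] [DecidableEq κ₁]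
    (b₀ : Module.Basis ι₀ R X.X₀) (b₁ : Module.Basis ι₁ R X.X₁) (b₂ : Module.Basis ι₂ R X.X₂)
    (c₀ : Module.Basis κ₀ R Y.X₀) (c₁ : Module.Basis κ₁ R Y.X₁) (c₂ : Module.Basis κ₂ R Y.X₂)
    (k : ℕ) : X.minors b₀ b₁ b₂ k = Y.minors c₀ c₁ c₂ k :=
  le_antisymm (h.minors_le _ _ _ _ _ _ k) (h.symm.minors_le _ _ _ _ _ _ k)

end ThreeTerm

end ThreeTerm

/-! ### Independence of the jump ideals from the resolution -/

section Resolutions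

variable {R : Type t} [CommRing R]

/-- The part of a cochain complex around the degree `i`. -/
def ThreeTerm.ofComplex (E : CochainComplex (ModuleCat.{v} R) ℤ) (i : ℤ) : ThreeTerm.{t, v} R where
  X₀ := E.X (i - 1)
  X₁ := E.X i
  X₂ := E.X (i + 1)
  d₀ := (E.d (i - 1) i).hom
  d₁ := (E.d i (i + 1)).hom
  d_d x := by
    rw [← LinearMap.comp_apply, ← ModuleCat.hom_comp, E.d_comp_d]
    rfl

lemma ThreeTerm.HEq.of_homotopyEquiv {E F : CochainComplex (ModuleCat.{v} R) ℤ}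
    (e : HomotopyEquiv E F) (i : ℤ) : (ofComplex E i).HEq (ofComplex F i) := by
  have comm : ∀ {E F : CochainComplex (ModuleCat.{v} R) ℤ} (f : E ⟶ F) (m n : ℤ) (x : E.X m),
      (f.f n).hom ((E.d m n).hom x) = (F.d m n).hom ((f.f m).hom x) := by
    intro E F f m n x
    rw [← LinearMap.comp_apply, ← LinearMap.comp_apply, ← ModuleCat.hom_comp, ← ModuleCat.hom_comp,
      f.comm]
  -- The relation `g f = d h + h d + 1` is solved for the identity, which is the origin of the minus
  -- signs.
  have htpy : ∀ {E F : CochainComplex (ModuleCat.{v} R) ℤ} (f : E ⟶ F) (g : F ⟶ E)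
      (h : Homotopy (f ≫ g) (𝟙 E)) (x : E.X i), x = (g.f i).hom ((f.f i).hom x) +
        (E.d (i - 1) i).hom ((-(h.hom i (i - 1)).hom) x) +
          (-(h.hom (i + 1) i).hom) ((E.d i (i + 1)).hom x) := by
    intro E F f g h x
    have h₁ := h.comm i
    rw [dNext_eq h.hom (show (ComplexShape.up ℤ).Rel i (i + 1) by simp),
      prevD_eq h.hom (show (ComplexShape.up ℤ).Rel (i - 1) i by simp)] at h₁
    have h₂ := congrArg (fun φ => φ.hom x) h₁
    simp only [HomologicalComplex.comp_f, ModuleCat.hom_comp, LinearMap.comp_apply,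
      ModuleCat.hom_add, LinearMap.add_apply, HomologicalComplex.id_f, ModuleCat.hom_id,
      LinearMap.id_apply] at h₂
    rw [h₂]
    simp
    abel
  exact ⟨⟨(e.hom.f _).hom, (e.hom.f _).hom, (e.hom.f _).hom, (e.inv.f _).hom, (e.inv.f _).hom,
    (e.inv.f _).hom, -(e.homotopyHomInvId.hom i (i - 1)).hom,
    -(e.homotopyHomInvId.hom (i + 1) i).hom, -(e.homotopyInvHomId.hom i (i - 1)).hom,
    -(e.homotopyInvHomId.hom (i + 1) i).hom, comm _ _ _, comm _ _ _, comm _ _ _, comm _ _ _,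
    htpy _ _ _, htpy _ _ _⟩⟩

lemma CochainComplex.isKProjective_of_bounded [Small.{v} R] (E : CochainComplex (ModuleCat.{v} R) ℤ)
    (hb : ∃ N : ℤ, ∀ n : ℤ, N < n → Subsingleton (E.X n))
    (hp : ∀ n : ℤ, Module.Projective R (E.X n)) : E.IsKProjective := by
  obtain ⟨N, hN⟩ := hb
  have : E.IsStrictlyLE N := by
    rw [CochainComplex.isStrictlyLE_iff]
    intro i hi
    have := hN i hi
    exact ModuleCat.isZero_of_subsingleton _
  have (n : ℤ) : Projective (E.X n) := (IsProjective.iff_projective _).1 (hp n)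
  exact CochainComplex.isKProjective_of_projective E N

/-- Both complexes are bounded above with projective terms, hence K-projective, and a
quasi-isomorphism of such complexes is a homotopy equivalence. The terms of `E` may be infinitely
generated, as those of `M ⊗ A` are in general. -/
lemma FreeResolution.heq [Small.{v} R] {E : CochainComplex (ModuleCat.{v} R) ℤ} (ρ : FreeResolution E)
    (hb : ∃ N : ℤ, ∀ n : ℤ, N < n → Subsingleton (E.X n))
    (hp : ∀ n : ℤ, Module.Projective R (E.X n)) (i : ℤ) :
    (ThreeTerm.ofComplex ρ.F i).HEq (ThreeTerm.ofComplex E i) := by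
  have := CochainComplex.isKProjective_of_bounded E hb hp
  have := CochainComplex.isKProjective_of_bounded ρ.F ρ.bounded fun n => inferInstance
  obtain ⟨e, -⟩ := (CochainComplex.IsKProjective.quasiIso_iff ρ.φ).1 ρ.quasiIso
  exact .of_homotopyEquiv e i

open Classical in
lemma FreeResolution.jumpIdeal_eq_minors [Nontrivial R] {E : CochainComplex (ModuleCat.{v} R) ℤ}
    (ρ : FreeResolution E) (i : ℤ) (k : ℕ) : ρ.jumpIdeal i k =
      (ThreeTerm.ofComplex ρ.F i).minors (Module.Free.chooseBasis R (ρ.F.X (i - 1)))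
        (Module.Free.chooseBasis R (ρ.F.X i)) (Module.Free.chooseBasis R (ρ.F.X (i + 1))) k := by
  rw [FreeResolution.jumpIdeal, Module.finrank_eq_card_chooseBasisIndex]
  rfl

/-- The cohomology jump ideal of a bounded above complex of projective modules is computed by
any complex of finitely generated free modules that is homotopy equivalent near degree `i`. -/
lemma jumpIdeal_eq_minors [Small.{v} R] {E : CochainComplex (ModuleCat.{v} R) ℤ} (hρ : Nonempty (FreeResolution E))
    (hb : ∃ N : ℤ, ∀ n : ℤ, N < n → Subsingleton (E.X n))
    (hp : ∀ n : ℤ, Module.Projective R (E.X n)) (i : ℤ) {Y : ThreeTerm.{t, w} R}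
    (h : (ThreeTerm.ofComplex E i).HEq Y) {ι₀ ι₁ ι₂ : Type*} [Fintype ι₀] [Fintype ι₁] [Fintype ι₂]
    [DecidableEq ι₀] [DecidableEq ι₁] (b₀ : Module.Basis ι₀ R Y.X₀) (b₁ : Module.Basis ι₁ R Y.X₁)
    (b₂ : Module.Basis ι₂ R Y.X₂) (k : ℕ) : jumpIdeal E i k = Y.minors b₀ b₁ b₂ k := by
  classical
  -- Ranks count basis elements over a nontrivial ring; over the zero ring all ideals agree anyway.
  rcases subsingleton_or_nontrivial R with _ | _
  · exact Subsingleton.elim _ _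
  have : ∀ ρ : FreeResolution E, ρ.jumpIdeal i k = Y.minors b₀ b₁ b₂ k := by
    intro ρ
    rw [ρ.jumpIdeal_eq_minors]
    exact ((ρ.heq hb hp i).trans h).minors_eq _ _ _ b₀ b₁ b₂ k
  rw [jumpIdeal, iSup_congr this, ciSup_const]

end Resolutions

/-! ### Contractions of complexes of vector spaces -/

section Grading

variable {V : Type u} [AddCommGroup V] [Module ℂ V]

lemma exists_linearMap_of_graded {W : Type v} [AddCommGroup W] [Module ℂ W]
    (gr : ℕ → Submodule ℂ V) (h : DirectSum.IsInternal gr) (G : ℕ → V →ₗ[ℂ] W) :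
    ∃ F : V →ₗ[ℂ] W, ∀ i, ∀ x ∈ gr i, F x = G i x := by
  classical
  let e := LinearEquiv.ofBijective (DirectSum.coeLinearMap gr) h
  refine ⟨DirectSum.toModule ℂ ℕ W (fun i => G i ∘ₗ (gr i).subtype) ∘ₗ e.symm.toLinearMap,
    fun i x hx => ?_⟩
  have : e.symm x = DirectSum.lof ℂ ℕ (fun i => gr i) i ⟨x, hx⟩ := by
    rw [LinearEquiv.symm_apply_eq]
    exact (DirectSum.coeLinearMap_lof gr i ⟨x, hx⟩).symm
  rw [LinearMap.comp_apply, LinearEquiv.coe_coe, this, DirectSum.toModule_lof]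
  rfl

lemma linearMap_ext_of_graded {W : Type v} [AddCommGroup W] [Module ℂ W]
    (gr : ℕ → Submodule ℂ V) (h : DirectSum.IsInternal gr) {F G : V →ₗ[ℂ] W}
    (e : ∀ i, ∀ x ∈ gr i, F x = G x) : F = G := by
  have : (⊤ : Submodule ℂ V) ≤ LinearMap.eqLocus F G := by
    rw [← h.submodule_iSup_eq_top]
    exact iSup_le fun i x hx => e i x hx
  exact LinearMap.ext fun x => this Submodule.mem_top

/-- A linear section of `d` over its image, extended to the whole space. -/
lemma exists_comp_comp_eq_self (d : V →ₗ[ℂ] V) : ∃ g : V →ₗ[ℂ] V, ∀ x, d (g (d x)) = d x := by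
  obtain ⟨r, hr⟩ := d.rangeRestrict.exists_rightInverse_of_surjective d.range_rangeRestrict
  obtain ⟨g, hg⟩ := LinearMap.exists_extend r
  refine ⟨g, fun x => ?_⟩
  have h₁ : g (d x) = r (d.rangeRestrict x) := LinearMap.congr_fun hg (d.rangeRestrict x)
  rw [h₁]
  exact congrArg Subtype.val (LinearMap.congr_fun hr (d.rangeRestrict x))

end Grading

namespace GrComplex

/-- A contraction of a complex onto its cohomology. -/
structure Contraction (E : GrComplex.{u}) where
  h : E.carrier →ₗ[ℂ] E.carrier
  h_mem : ∀ {i : ℕ} {x : E.carrier}, x ∈ E.gr (i + 1) → h x ∈ E.gr i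
  h_zero : ∀ {x : E.carrier}, x ∈ E.gr 0 → h x = 0
  h_h : ∀ x, h (h x) = 0
  h_d_h : ∀ x, h (E.d (h x)) = h x
  d_h_d : ∀ x, E.d (h (E.d x)) = E.d x

/-- A generalized inverse of `d` is made homogeneous of degree `-1` and then corrected twice to meet
the side conditions. -/
lemma exists_contraction (E : GrComplex.{u}) : Nonempty E.Contraction := by
  obtain ⟨p, p₀, p₁, p₂, -, p₄, -⟩ := E.exists_proj
  obtain ⟨g₀, hg₀⟩ := exists_comp_comp_eq_self E.d
  obtain ⟨g, hg⟩ := exists_linearMap_of_graded E.gr E.internal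
    (fun i => match i with | 0 => (0 : E.carrier →ₗ[ℂ] E.carrier) | j + 1 => p j ∘ₗ g₀)
  have g_zero : ∀ x ∈ E.gr 0, g x = 0 := fun x hx => hg 0 x hx
  have g_succ : ∀ j, ∀ x ∈ E.gr (j + 1), g x = p j (g₀ x) := fun j x hx => hg (j + 1) x hx
  have g_mem : ∀ j, ∀ x ∈ E.gr (j + 1), g x ∈ E.gr j := fun j x hx => by
    rw [g_succ j x hx]
    exact p₀ _ _
  have dgd : E.d ∘ₗ g ∘ₗ E.d = E.d := by
    refine linearMap_ext_of_graded E.gr E.internal fun i x hx => ?_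
    rw [LinearMap.comp_apply, LinearMap.comp_apply, g_succ i _ (E.d_mem hx), ← p₄, hg₀,
      p₁ _ _ (E.d_mem hx)]
  replace dgd : ∀ x, E.d (g (E.d x)) = E.d x := LinearMap.congr_fun dgd
  -- `g d g` is again a generalized inverse and moreover satisfies `k d k = k`.
  let k : E.carrier →ₗ[ℂ] E.carrier := g ∘ₗ E.d ∘ₗ g
  have kdk : ∀ x, k (E.d (k x)) = k x := fun x => by simp [k, dgd]
  have dkd : ∀ x, E.d (k (E.d x)) = E.d x := fun x => by simp [k, dgd]
  have k_mem : ∀ j, ∀ x ∈ E.gr (j + 1), k x ∈ E.gr j := fun j x hx =>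
    g_mem j _ (E.d_mem (g_mem j x hx))
  have k_zero : ∀ x ∈ E.gr 0, k x = 0 := fun x hx => by simp [k, g_zero x hx]
  -- Subtracting `d k k` makes the square zero, because `k d k = k`, and preserves the relations `h
  -- d h = h` and `d h d = d`.
  refine ⟨⟨k - E.d ∘ₗ k ∘ₗ k, ?_, ?_, ?_, ?_, ?_⟩⟩
  · intro i x hx
    refine sub_mem (k_mem _ _ hx) ?_
    cases i with
    | zero =>
      rw [LinearMap.comp_apply, LinearMap.comp_apply, k_zero _ (k_mem _ _ hx), map_zero]
      exact zero_mem _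
    | succ i => exact E.d_mem (k_mem _ _ (k_mem _ _ hx))
  · intro x hx
    simp [k_zero x hx]
  · intro x
    simp [kdk]
  · intro x
    simp [kdk, E.d_d]
  · intro x
    simp [dkd, E.d_d]

namespace Contraction

variable {E : GrComplex.{u}} (c : E.Contraction)

/-- The projection onto the harmonic subspace. -/
def proj : E.carrier →ₗ[ℂ] E.carrier := LinearMap.id - E.d ∘ₗ c.h - c.h ∘ₗ E.d

lemma proj_apply (x : E.carrier) : c.proj x = x - E.d (c.h x) - c.h (E.d x) := rfl

lemma proj_d (x : E.carrier) : c.proj (E.d x) = 0 := by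
  simp [proj_apply, c.d_h_d, E.d_d]

lemma d_proj (x : E.carrier) : E.d (c.proj x) = 0 := by
  simp [proj_apply, c.d_h_d, E.d_d]

lemma h_proj (x : E.carrier) : c.h (c.proj x) = 0 := by
  simp [proj_apply, c.h_d_h, c.h_h]

/-- The harmonic elements of degree `i`. -/
def harm (i : ℕ) : Submodule ℂ E.carrier := E.gr i ⊓ (LinearMap.ker E.d ⊓ LinearMap.ker c.h)

lemma proj_of_mem_harm {i : ℕ} {x : E.carrier} (hx : x ∈ c.harm i) : c.proj x = x := by
  rw [proj_apply, show E.d x = 0 from hx.2.1, show c.h x = 0 from hx.2.2]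
  simp

lemma d_h_mem {i : ℕ} {x : E.carrier} (hx : x ∈ E.gr i) : E.d (c.h x) ∈ E.gr i := by
  cases i with
  | zero => rw [c.h_zero hx, map_zero]; exact zero_mem _
  | succ i => exact E.d_mem (c.h_mem hx)

lemma proj_mem_harm {i : ℕ} {x : E.carrier} (hx : x ∈ E.gr i) : c.proj x ∈ c.harm i :=
  ⟨sub_mem (sub_mem hx (c.d_h_mem hx)) (c.h_mem (E.d_mem hx)), c.d_proj x, c.h_proj x⟩

/-- The projection fixes harmonic elements and kills coboundaries, so harmonic elements inject into
cohomology. -/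
lemma finite_harm (i : ℕ) [FiniteDimensional ℂ (E.cohGr i)] : FiniteDimensional ℂ (c.harm i) := by
  let f : c.harm i →ₗ[ℂ] E.cohGr i :=
    (E.coboundaries.mkQ ∘ₗ Submodule.inclusion (p := c.harm i) (p' := E.cocycles) fun x hx => hx.2.1).codRestrict _
      fun x => ⟨⟨x, x.2.2.1⟩, x.2.1, rfl⟩
  refine FiniteDimensional.of_injective f ?_
  rw [← LinearMap.ker_eq_bot, LinearMap.ker_eq_bot']
  intro x hx
  have h₁ := (Submodule.Quotient.mk_eq_zero _).1 (congrArg Subtype.val hx)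
  obtain ⟨y, hy⟩ := h₁
  have hy' : E.d y = x := hy
  apply Subtype.ext
  rw [← c.proj_of_mem_harm x.2, ← hy', c.proj_d]
  rfl

section Equivalence

variable {F : GrComplex.{v}} (c' : F.Contraction) (f : E.Hom F) (j : ℕ)

/-- In terms of harmonic representatives the map on cohomology is `x ↦ proj (f x)`. The lemmas from
here to the end of the section transport injectivity and surjectivity on `Hʲ` to this map. -/
lemma injOn_proj_comp (hf : Set.InjOn f.cohMap (E.cohGr j)) {x : E.carrier} (hx : x ∈ c.harm j)
    (h : c'.proj (f.toFun x) = 0) : x = 0 := by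
  have h₁ : f.toFun x = F.d (c'.h (f.toFun x)) := by
    rw [proj_apply, ← f.map_d, show E.d x = 0 from hx.2.1, map_zero, map_zero, sub_zero] at h
    exact sub_eq_zero.1 h
  have h₂ : E.coboundaries.mkQ ⟨x, hx.2.1⟩ = 0 := by
    refine hf ⟨⟨x, hx.2.1⟩, hx.1, rfl⟩ (zero_mem _) ?_
    rw [map_zero]
    exact (Submodule.Quotient.mk_eq_zero _).2 ⟨_, h₁.symm⟩
  obtain ⟨y, hy⟩ := (Submodule.Quotient.mk_eq_zero _).1 h₂
  have hy' : E.d y = x := hy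
  rw [← c.proj_of_mem_harm hx, ← hy', c.proj_d]

lemma exists_proj_comp (hf : Set.SurjOn f.cohMap (E.cohGr j) (F.cohGr j)) {y : F.carrier}
    (hy : y ∈ c'.harm j) : ∃ x ∈ c.harm j, c'.proj (f.toFun x) = y := by
  obtain ⟨_, ⟨x, hx, rfl⟩, h⟩ := hf (a := F.coboundaries.mkQ ⟨y, hy.2.1⟩) ⟨⟨y, hy.2.1⟩, hy.1, rfl⟩
  obtain ⟨z, hz⟩ := (Submodule.Quotient.eq _).1 h
  have hz' : F.d z = f.toFun x - y := hz
  refine ⟨_, c.proj_mem_harm hx, ?_⟩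
  have hx₀ : E.d (E.cocycles.subtype x) = 0 := x.2
  have h₂ := c'.proj_d z
  rw [hz', map_sub, c'.proj_of_mem_harm hy] at h₂
  rw [c.proj_apply, hx₀, map_zero, sub_zero, map_sub, f.map_d, map_sub, c'.proj_d, sub_zero]
  exact sub_eq_zero.1 h₂

/-- The inverse is defined on the whole space, so that it can be tensored with `A` directly. -/
lemma exists_leftInverse (hf : Set.InjOn f.cohMap (E.cohGr j)) :
    ∃ r : F.carrier →ₗ[ℂ] E.carrier, (∀ y, r y ∈ c.harm j) ∧
      ∀ x ∈ c.harm j, r (c'.proj (f.toFun x)) = x := by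
  let g : c.harm j →ₗ[ℂ] F.carrier := c'.proj ∘ₗ f.toFun ∘ₗ (c.harm j).subtype
  have hg : LinearMap.ker g = ⊥ := by
    rw [LinearMap.ker_eq_bot']
    exact fun x hx => Subtype.ext (c.injOn_proj_comp c' f j hf x.2 hx)
  obtain ⟨r, hr⟩ := g.exists_leftInverse_of_injective hg
  exact ⟨(c.harm j).subtype ∘ₗ r, fun y => (r y).2,
    fun x hx => congrArg Subtype.val (LinearMap.congr_fun hr ⟨x, hx⟩)⟩

lemma exists_rightInverse (hf : Set.SurjOn f.cohMap (E.cohGr j) (F.cohGr j)) :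
    ∃ r : F.carrier →ₗ[ℂ] E.carrier, (∀ y, r y ∈ c.harm j) ∧
      ∀ y ∈ c'.harm j, c'.proj (f.toFun (r y)) = y := by
  let g : c.harm j →ₗ[ℂ] c'.harm j :=
    (c'.proj ∘ₗ f.toFun ∘ₗ (c.harm j).subtype).codRestrict _ fun x =>
      c'.proj_mem_harm (f.map_mem x.2.1)
  have hg : LinearMap.range g = ⊤ := by
    rw [LinearMap.range_eq_top]
    rintro ⟨y, hy⟩
    obtain ⟨x, hx, e⟩ := c.exists_proj_comp c' f j hf hy
    exact ⟨⟨x, hx⟩, Subtype.ext e⟩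
  obtain ⟨r, hr⟩ := g.exists_rightInverse_of_surjective hg
  obtain ⟨r', hr'⟩ := LinearMap.exists_extend r
  refine ⟨(c.harm j).subtype ∘ₗ r', fun y => (r' y).2, fun y hy => ?_⟩
  have h₁ : r' y = r ⟨y, hy⟩ := LinearMap.congr_fun hr' ⟨y, hy⟩
  rw [LinearMap.comp_apply, h₁]
  exact congrArg Subtype.val (LinearMap.congr_fun hr ⟨y, hy⟩)

end Equivalence

end Contraction

end GrComplex

/-! ### The perturbation lemma -/

section Perturbation

variable {S : Type u} [Ring S] {d h a u v : S}

lemma perturbation_aux (hd : d * d = 0) (hD : (d + a) * (d + a) = 0) :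
    a * a = -(d * a) - a * d := by
  have : d * a + a * d + a * a = 0 := by
    calc d * a + a * d + a * a = (d + a) * (d + a) - d * d := by noncomm_ring
      _ = 0 := by rw [hD, hd, sub_zero]
  rw [← sub_eq_zero, ← this]
  noncomm_ring

/-- With `p = 1 - dh - hd`, the perturbed inclusion is `u p` and the transferred differential is `p
a u p`. After multiplication by the invertible `1 + h a`, the claim follows from `a a = -d a - a d`
and `d p = 0`. -/
lemma perturbation_incl
    (hd : d * d = 0) (hD : (d + a) * (d + a) = 0) (dhd : d * h * d = d) (hu : u * (1 + h * a) = 1)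
    (hu' : (1 + h * a) * u = 1) :
    (d + a) * (u * (1 - d * h - h * d)) =
    u * ((1 - d * h - h * d) * a * u * (1 - d * h - h * d)) := by
  have e₁ := perturbation_aux hd hD
  set p := 1 - d * h - h * d with hp
  have dp : d * p = 0 := by
    rw [hp, mul_sub, mul_sub, ← mul_assoc, hd, ← mul_assoc, dhd]; simp
  have up : u * p = p - h * a * u * p := by
    calc u * p = (1 + h * a) * u * p - h * a * u * p := by noncomm_ring
      _ = _ := by rw [hu', one_mul]
  have e₂ : (1 + h * a) * ((d + a) * (u * p)) = p * a * u * p := by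
    calc (1 + h * a) * ((d + a) * (u * p))
        = d * (u * p) + a * u * p + h * a * d * u * p + h * (a * a) * u * p := by noncomm_ring
      _ = d * (p - h * a * u * p) + a * u * p + h * a * d * u * p +
            h * (-(d * a) - a * d) * u * p := by rw [e₁, up]
      _ = d * p + p * a * u * p := by rw [hp]; noncomm_ring
      _ = p * a * u * p := by rw [dp, zero_add]
  rw [← e₂, ← mul_assoc u, hu, one_mul]

/-- The mirror image of the previous identity, with perturbed projection `p v`; the relation `v a =
a u` makes the two transferred differentials agree. -/
lemma perturbation_proj
    (hd : d * d = 0) (hD : (d + a) * (d + a) = 0) (dhd : d * h * d = d)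
    (hu' : (1 + h * a) * u = 1) (hv : v * (1 + a * h) = 1) (hv' : (1 + a * h) * v = 1) :
    (1 - d * h - h * d) * v * (d + a) =
    (1 - d * h - h * d) * a * u * (1 - d * h - h * d) * v := by
  have e₁ := perturbation_aux hd hD
  have va : v * a = a * u := by
    calc v * a = v * a * ((1 + h * a) * u) := by rw [hu', mul_one]
      _ = v * (1 + a * h) * a * u := by noncomm_ring
      _ = a * u := by rw [hv, one_mul]
  set p := 1 - d * h - h * d with hp
  have pd : p * d = 0 := by
    rw [hp, sub_mul, sub_mul, mul_assoc h, hd, dhd]; simp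
  have pv : p * v = p - p * v * a * h := by
    calc p * v = p * (v * (1 + a * h)) - p * v * a * h := by noncomm_ring
      _ = _ := by rw [hv, mul_one]
  have e₂ : p * v * (d + a) * (1 + a * h) = p * a * u * p := by
    calc p * v * (d + a) * (1 + a * h)
        = (p * v) * d + p * v * a + p * v * d * a * h + p * v * (a * a) * h := by noncomm_ring
      _ = (p - p * v * a * h) * d + p * v * a + p * v * d * a * h +
            p * v * (-(d * a) - a * d) * h := by rw [e₁, ← pv]
      _ = p * d + p * (v * a) * p := by rw [hp]; noncomm_ring
      _ = p * a * u * p := by rw [pd, zero_add, va]; noncomm_ring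
  rw [← e₂, mul_assoc (p * v * (d + a)), hv', mul_one]

/-- The side conditions give `h p = 0 = p h` and `h h = 0`, so every correction term in `p v u p`
disappears. -/
lemma perturbation_proj_incl
    (hd : d * d = 0) (hh : h * h = 0) (hdh : h * d * h = h) (dhd : d * h * d = d)
    (hu' : (1 + h * a) * u = 1) (hv : v * (1 + a * h) = 1) :
    (1 - d * h - h * d) * v * (u * (1 - d * h - h * d)) =
    1 - d * h - h * d := by
  set p := 1 - d * h - h * d with hp
  have hp₀ : h * p = 0 := by
    rw [hp, mul_sub, mul_sub, ← mul_assoc, ← mul_assoc, hdh, hh]; simp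
  have ph₀ : p * h = 0 := by
    rw [hp, sub_mul, sub_mul, mul_assoc d, hdh, hh]; simp
  have dp : d * p = 0 := by
    rw [hp, mul_sub, mul_sub, ← mul_assoc, hd, ← mul_assoc, dhd]; simp
  have pp : p * p = p := by
    nth_rewrite 1 [hp]
    rw [sub_mul, sub_mul, mul_assoc, hp₀, mul_assoc, dp]
    simp
  have up : u * p = p - h * a * u * p := by
    calc u * p = (1 + h * a) * u * p - h * a * u * p := by noncomm_ring
      _ = _ := by rw [hu', one_mul]
  have pv : p * v = p - p * v * a * h := by
    calc p * v = p * (v * (1 + a * h)) - p * v * a * h := by noncomm_ring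
      _ = _ := by rw [hv, mul_one]
  calc p * v * (u * p) = (p - p * v * a * h) * (p - h * a * u * p) := by rw [← pv, ← up]
    _ = p * p - (p * h) * a * u * p - p * v * a * (h * p) + p * v * a * (h * h) * a * u * p := by
      noncomm_ring
    _ = p := by rw [pp, ph₀, hp₀, hh]; simp

/-- The perturbed homotopy is `u h = h v`. Multiplication by `1 + h a` on the left and `1 + a h` on
the right clears the inverses; what is left over is `h (a d + d a + a a) h = 0`. -/
lemma perturbation_homotopy
    (hd : d * d = 0) (hD : (d + a) * (d + a) = 0) (hu : u * (1 + h * a) = 1)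
    (hu' : (1 + h * a) * u = 1) (hv : v * (1 + a * h) = 1) (hv' : (1 + a * h) * v = 1) :
    1 = u * (1 - d * h - h * d) * v + (d + a) * (u * h) +
    u * h * (d + a) := by
  have e₁ := perturbation_aux hd hD
  have hv₁ : u * h = h * v := by
    calc u * h = u * h * ((1 + a * h) * v) := by rw [hv', mul_one]
      _ = u * (1 + h * a) * h * v := by noncomm_ring
      _ = h * v := by rw [hu, one_mul]
  have e₂ : h * a * d * h + h * d * a * h + h * (a * a) * h = 0 := by rw [e₁]; noncomm_ring
  have key : (1 + h * a) * (u * (1 - d * h - h * d) * v + (d + a) * (u * h) +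
      u * h * (d + a)) * (1 + a * h) = (1 + h * a) * (1 + a * h) := by
    calc (1 + h * a) * (u * (1 - d * h - h * d) * v + (d + a) * (u * h) +
          u * h * (d + a)) * (1 + a * h)
        = ((1 + h * a) * u) * (1 - d * h - h * d) * (v * (1 + a * h)) +
          (1 + h * a) * (d + a) * (u * h) * (1 + a * h) +
          ((1 + h * a) * u) * h * (d + a) * (1 + a * h) := by noncomm_ring
      _ = (1 - d * h - h * d) * (v * (1 + a * h)) + (1 + h * a) * (d + a) * h * (v * (1 + a * h)) +
          h * (d + a) * (1 + a * h) := by rw [hu', hv₁]; noncomm_ring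
      _ = (1 + h * a) * (1 + a * h) + (h * a * d * h + h * d * a * h + h * (a * a) * h) := by
          rw [hv]; noncomm_ring
      _ = (1 + h * a) * (1 + a * h) := by rw [e₂, add_zero]
  calc (1 : S) = u * ((1 + h * a) * (1 + a * h)) * v := by
        rw [← mul_assoc, hu, one_mul, hv']
    _ = (u * (1 + h * a)) * (u * (1 - d * h - h * d) * v + (d + a) * (u * h) +
      u * h * (d + a)) * ((1 + a * h) * v) := by rw [← key]; noncomm_ring
    _ = _ := by rw [hu, hv', one_mul, mul_one]

end Perturbation

/-! ### Complexes and homotopies given by maps of total modules -/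

section GradedComplexes

variable {A : Type t} [CommRing A] {V : Type v} [AddCommGroup V] [Module A V]
  {V' : Type v} [AddCommGroup V'] [Module A V']
  {gr : ℤ → Submodule A V} {D : V →ₗ[A] V} {gr' : ℤ → Submodule A V'} {D' : V' →ₗ[A] V'}
  {hD : ∀ (n : ℤ) (x : V), x ∈ gr n → D x ∈ gr (n + 1)} {hDD : ∀ x, D (D x) = 0}
  {hD' : ∀ (n : ℤ) (x : V'), x ∈ gr' n → D' x ∈ gr' (n + 1)} {hDD' : ∀ x, D' (D' x) = 0}

lemma complexOfGraded_d_apply (m n : ℤ) (h : m + 1 = n) (x : gr m) :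
    (((complexOfGraded gr D hD hDD).d m n).hom x : gr n).1 = D x := by
  subst h
  simp only [complexOfGraded, dite_true]
  rfl

/-- The morphism of complexes given by a linear map preserving the graded pieces. -/
def complexOfGradedMap (f : V →ₗ[A] V') (hf : ∀ n, ∀ x ∈ gr n, f x ∈ gr' n)
    (hfD : ∀ n, ∀ x ∈ gr n, f (D x) = D' (f x)) :
    complexOfGraded gr D hD hDD ⟶ complexOfGraded gr' D' hD' hDD' where
  f n := ModuleCat.ofHom (f.restrict (hf n))
  comm' m n h := by
    refine ModuleCat.hom_ext (LinearMap.ext fun (x : gr m) => Subtype.ext ?_)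
    have h' : m + 1 = n := h
    refine (complexOfGraded_d_apply (hD := hD') (hDD := hDD') m n h' ⟨f x, hf m x x.2⟩).trans ?_
    refine (hfD m x x.2).symm.trans ?_
    exact (congrArg f (complexOfGraded_d_apply (hD := hD) (hDD := hDD) m n h' x)).symm

/-- The components of the homotopy given by a linear map of degree `-1`. -/
def complexOfGradedShift (h : V →ₗ[A] V') (hh : ∀ n, ∀ x ∈ gr (n + 1), h x ∈ gr' n) (m n : ℤ) :
    (complexOfGraded gr D hD hDD).X m ⟶ (complexOfGraded gr' D' hD' hDD').X n :=
  if k : n + 1 = m then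
    ModuleCat.ofHom (h.restrict (p := gr m) (q := gr' n) fun x hx => hh n x (k ▸ hx)) else 0

lemma complexOfGradedShift_apply (h : V →ₗ[A] V') (hh : ∀ n, ∀ x ∈ gr (n + 1), h x ∈ gr' n)
    (m n : ℤ) (k : n + 1 = m) (x : gr m) :
    (((complexOfGradedShift (gr := gr) (gr' := gr') (hD := hD) (hDD := hDD) (hD' := hD') (hDD' := hDD') h hh m n).hom x :
      gr' n).1 : V') = h x := by
  subst k
  exact congrArg (fun φ : (complexOfGraded gr D hD hDD).X (n + 1) ⟶
    (complexOfGraded gr' D' hD' hDD').X n => (φ.hom x : gr' n).1) (dif_pos rfl)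

/-- The homotopy given by a linear map of degree `-1`. -/
def complexOfGradedHomotopy (f g : complexOfGraded gr D hD hDD ⟶ complexOfGraded gr' D' hD' hDD')
    (h : V →ₗ[A] V') (hh : ∀ n, ∀ x ∈ gr (n + 1), h x ∈ gr' n)
    (e : ∀ (n : ℤ) (x : gr n), ((f.f n).hom x : gr' n).1 =
      h (D x) + D' (h x) + ((g.f n).hom x : gr' n).1) : Homotopy f g where
  hom m n := complexOfGradedShift h hh m n
  zero m n k := dif_neg k
  comm n := by
    rw [dNext_eq _ (show (ComplexShape.up ℤ).Rel n (n + 1) by simp),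
      prevD_eq _ (show (ComplexShape.up ℤ).Rel (n - 1) n by simp)]
    refine ModuleCat.hom_ext (LinearMap.ext fun (x : gr n) => Subtype.ext ?_)
    refine (e n x).trans (congrArg₂ _ (congrArg₂ _ ?_ ?_) rfl)
    · refine Eq.trans ?_ (complexOfGradedShift_apply h hh (n + 1) n rfl _).symm
      exact (congrArg h (complexOfGraded_d_apply (hD := hD) (hDD := hDD) n (n + 1) rfl x)).symm
    · refine Eq.trans ?_ (complexOfGraded_d_apply (hD := hD') (hDD := hDD') (n - 1) n
        (by omega) _).symm
      exact (congrArg D' (complexOfGradedShift_apply h hh n (n - 1) (by omega) x)).symm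

/-- A homotopy equivalence of complexes in terms of linear maps of the total modules. -/
def complexOfGradedHomotopyEquiv (f : V →ₗ[A] V') (hf : ∀ n, ∀ x ∈ gr n, f x ∈ gr' n)
    (hfD : ∀ n, ∀ x ∈ gr n, f (D x) = D' (f x))
    (g : V' →ₗ[A] V) (hg : ∀ n, ∀ x ∈ gr' n, g x ∈ gr n)
    (hgD : ∀ n, ∀ x ∈ gr' n, g (D' x) = D (g x))
    (h : V →ₗ[A] V) (hh : ∀ n, ∀ x ∈ gr (n + 1), h x ∈ gr n)
    (hgf : ∀ n, ∀ x ∈ gr n, x = g (f x) + D (h x) + h (D x))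
    (hfg : ∀ n, ∀ x ∈ gr' n, f (g x) = x) :
    HomotopyEquiv (complexOfGraded gr D hD hDD) (complexOfGraded gr' D' hD' hDD') where
  hom := complexOfGradedMap f hf hfD
  inv := complexOfGradedMap g hg hgD
  -- The sign changes because `g f`, not the identity, has to be isolated in `1 = g f + d h + h d`.
  homotopyHomInvId := complexOfGradedHomotopy _ _ (-h) (fun n x hx => neg_mem (hh n x hx))
    fun n x => by
      change g (f x) = -h (D x) + D (-h x) + x
      rw [map_neg]
      nth_rewrite 4 [hgf n x x.2]
      abel
  homotopyInvHomId := Homotopy.ofEq (by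
    ext n : 1
    refine ModuleCat.hom_ext (LinearMap.ext fun (x : gr' n) => Subtype.ext ?_)
    exact hfg n x x.2)

/-- A map of graded complexes that is invertible near degree `i` gives a homotopy equivalence
near degree `i`. -/
lemma ThreeTerm.HEq.of_graded (i : ℤ) (φ : V →ₗ[A] V') (hφ : ∀ n, ∀ x ∈ gr n, φ x ∈ gr' n)
    (hφD : ∀ n, ∀ x ∈ gr n, φ (D x) = D' (φ x)) (r₀ r₁ r₂ : V' →ₗ[A] V)
    (h₀ : ∀ y ∈ gr' (i - 1), r₀ y ∈ gr (i - 1)) (h₁ : ∀ y ∈ gr' i, r₁ y ∈ gr i)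
    (h₂ : ∀ y ∈ gr' (i + 1), r₂ y ∈ gr (i + 1)) (e₀ : ∀ y ∈ gr' (i - 1), φ (r₀ y) = y)
    (e₁ : ∀ y ∈ gr' i, φ (r₁ y) = y) (e₁' : ∀ x ∈ gr i, r₁ (φ x) = x)
    (e₂ : ∀ x ∈ gr (i + 1), r₂ (φ x) = x) :
    (ofComplex (complexOfGraded gr D hD hDD) i).HEq
      (ofComplex (complexOfGraded gr' D' hD' hDD') i) := by
  refine .of_iso (φ.restrict (hφ _)) (φ.restrict (hφ _)) (φ.restrict (hφ _)) (r₀.restrict h₀)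
    (r₁.restrict h₁) (r₂.restrict h₂) (fun x => Subtype.ext ?_) (fun x => Subtype.ext ?_)
    (fun x => Subtype.ext (e₀ x.1 x.2)) (fun x => Subtype.ext (e₁' x.1 x.2))
    (fun x => Subtype.ext (e₁ x.1 x.2)) (fun x => Subtype.ext (e₂ x.1 x.2))
  · refine (congrArg φ (complexOfGraded_d_apply (i - 1) i (by omega) x)).trans ?_
    refine (hφD _ x.1 x.2).trans ?_
    exact (complexOfGraded_d_apply (hD := hD') (hDD := hDD') (i - 1) i (by omega)
      ⟨φ x.1, hφ _ _ x.2⟩).symm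
  · refine (congrArg φ (complexOfGraded_d_apply i (i + 1) (by omega) x)).trans ?_
    refine (hφD _ x.1 x.2).trans ?_
    exact (complexOfGraded_d_apply (hD := hD') (hDD := hDD') i (i + 1) (by omega)
      ⟨φ x.1, hφ _ _ x.2⟩).symm

end GradedComplexes

/-! ### Endomorphisms with values in a nilpotent ideal -/

section NilpotentEndomorphisms

lemma geom_sum_mul_one_add {S : Type u} [Ring S] {x : S} {N : ℕ} (h : x ^ N = 0) :
    (∑ k ∈ Finset.range N, (-x) ^ k) * (1 + x) = 1 ∧
      (1 + x) * (∑ k ∈ Finset.range N, (-x) ^ k) = 1 := by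
  have h' : (-x) ^ N = 0 := by rw [neg_pow, h, mul_zero]
  have e : 1 + x = 1 - -x := by rw [sub_neg_eq_add]
  rw [e, geom_sum_mul_neg, mul_neg_geom_sum, h', sub_zero]
  exact ⟨rfl, rfl⟩

variable {A : Type t} [CommRing A] {V : Type v} [AddCommGroup V] [Module A V]

lemma pow_apply_mem_pow_smul {I : Ideal A} {T : Module.End A V}
    (h : ∀ x, T x ∈ I • (⊤ : Submodule A V)) (n : ℕ) (x : V) :
    (T ^ n) x ∈ I ^ n • (⊤ : Submodule A V) := by
  induction n with
  | zero => simp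
  | succ n ih =>
    have e : T ^ (n + 1) = T * T ^ n := pow_succ' _ _
    rw [e, Module.End.mul_apply]
    have : I ^ n • (⊤ : Submodule A V) ≤ (I ^ (n + 1) • (⊤ : Submodule A V)).comap T := by
      refine Submodule.smul_le.2 fun a ha z _ => ?_
      rw [Submodule.mem_comap, map_smul, pow_succ, Submodule.mul_smul]
      exact Submodule.smul_mem_smul ha (h z)
    exact this ih

/-- By linearity each application gains a factor of `I`, so the `N`-th power has image in `Iᴺ V =
0`. -/
lemma pow_eq_zero_of_forall_mem {I : Ideal A} {N : ℕ} (hI : I ^ N = ⊥) {T : Module.End A V}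
    (h : ∀ x, T x ∈ I • (⊤ : Submodule A V)) : T ^ N = 0 := by
  refine LinearMap.ext fun x => ?_
  have := pow_apply_mem_pow_smul h N x
  rw [hI, Submodule.bot_smul, Submodule.mem_bot] at this
  exact this

lemma sum_pow_apply_mem {T : Module.End A V} {S : Submodule A V} (h : ∀ x ∈ S, T x ∈ S) (N : ℕ)
    {x : V} (hx : x ∈ S) : (∑ k ∈ Finset.range N, (-T) ^ k) x ∈ S := by
  rw [LinearMap.sum_apply]
  refine Submodule.sum_mem _ fun k hk => ?_
  clear hk
  induction k with
  | zero => exact hx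
  | succ k ih =>
    rw [pow_succ', Module.End.mul_apply]
    exact neg_mem (h _ ih)

lemma ArtAlg.exists_m_pow_eq_bot (A : ArtAlg) : ∃ N : ℕ, A.m ^ N = ⊥ := by
  obtain ⟨N, hN⟩ := IsArtinianRing.isNilpotent_jacobson_bot (R := A.carrier)
  rw [IsLocalRing.jacobson_eq_maximalIdeal _ bot_ne_top] at hN
  exact ⟨N, hN⟩

lemma smul_top_map_le {V' : Type w} [AddCommGroup V'] [Module A V'] (I : Ideal A) (f : V →ₗ[A] V')
    {x : V} (hx : x ∈ I • (⊤ : Submodule A V)) : f x ∈ I • (⊤ : Submodule A V') := by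
  have : I • (⊤ : Submodule A V) ≤ (I • (⊤ : Submodule A V')).comap f := by
    refine Submodule.smul_le.2 fun a ha z _ => ?_
    rw [Submodule.mem_comap, map_smul]
    exact Submodule.smul_mem_smul ha Submodule.mem_top
  exact this hx

end NilpotentEndomorphisms

/-! ### Subspaces under extension of scalars -/

section BaseChange

variable {V : Type u} {W : Type v} {U : Type w} [AddCommGroup V] [Module ℂ V] [AddCommGroup W]
  [Module ℂ W] [AddCommGroup U] [Module ℂ U] (A : Type t) [CommRing A] [Algebra ℂ A]

lemma baseChange_apply_mem (f : V →ₗ[ℂ] W) (S : Submodule ℂ V) (T : Submodule ℂ W)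
    (h : ∀ x ∈ S, f x ∈ T) {x : A ⊗[ℂ] V} (hx : x ∈ S.baseChange A) :
    f.baseChange A x ∈ T.baseChange A := by
  have : S.baseChange A ≤ (T.baseChange A).comap (f.baseChange A) := by
    rw [baseChange_le_iff]
    intro y hy
    rw [Submodule.mem_comap, LinearMap.baseChange_tmul]
    exact Submodule.tmul_mem_baseChange_of_mem _ (h y hy)
  exact this hx

lemma baseChange_apply_eq {f g : V →ₗ[ℂ] W} {S : Submodule ℂ V} (h : ∀ x ∈ S, f x = g x)
    {x : A ⊗[ℂ] V} (hx : x ∈ S.baseChange A) : f.baseChange A x = g.baseChange A x := by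
  have : S.baseChange A ≤ LinearMap.eqLocus (f.baseChange A) (g.baseChange A) := by
    rw [baseChange_le_iff]
    intro y hy
    rw [LinearMap.mem_eqLocus, LinearMap.baseChange_tmul, LinearMap.baseChange_tmul, h y hy]
  exact this hx

lemma baseChange_mono {S T : Submodule ℂ V} (h : S ≤ T) : S.baseChange A ≤ T.baseChange A := by
  rw [baseChange_le_iff]
  exact fun x hx => Submodule.tmul_mem_baseChange_of_mem _ (h hx)

/-- The equivalence of `A ⊗ S` with the submodule of `A ⊗ V` that it generates. -/
noncomputable def baseChangeEquiv (S : Submodule ℂ V) : A ⊗[ℂ] S ≃ₗ[A] S.baseChange A :=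
  LinearEquiv.ofBijective (S.toBaseChange A) ⟨fun x y h => by
    refine Module.Flat.lTensor_preserves_injective_linearMap (M := A) S.subtype
      S.injective_subtype ?_
    exact congrArg Subtype.val h, S.toBaseChange_surjective A⟩

/-- The basis of `S.baseChange A` given by a basis of `S`. -/
noncomputable def baseChangeBasis {ι : Type*} (S : Submodule ℂ V) (b : Module.Basis ι ℂ S) :
    Module.Basis ι A (S.baseChange A) :=
  (b.baseChange A).map (baseChangeEquiv A S)

lemma baseChangeBasis_apply {ι : Type*} (S : Submodule ℂ V) (b : Module.Basis ι ℂ S) (i : ι) :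
    (baseChangeBasis A S b i : A ⊗[ℂ] V) = 1 ⊗ₜ[ℂ] (b i : V) := by
  rw [baseChangeBasis, Module.Basis.map_apply, Module.Basis.baseChange_apply]
  rfl

lemma extendBilin_mem_smul_top {A : Type t} [CommRing A] [Algebra ℂ A] (β : V →ₗ[ℂ] W →ₗ[ℂ] U)
    (I : Ideal A) {x : A ⊗[ℂ] V} (hx : x ∈ I • (⊤ : Submodule A (A ⊗[ℂ] V))) (y : A ⊗[ℂ] W) :
    extendBilin A β x y ∈ I • (⊤ : Submodule A (A ⊗[ℂ] U)) :=
  smul_top_map_le I ((extendBilin A β).flip y) hx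

lemma nilTensor_le_smul_top (A : ArtAlg) (S : Submodule ℂ V) :
    nilTensor A S ≤ A.m • (⊤ : Submodule A.carrier (A.carrier ⊗[ℂ] V)) :=
  Submodule.smul_mono le_rfl le_top

end BaseChange

/-! ### Gradings by the integers under extension of scalars -/

section IntegerGrading

variable {V : Type u} {W : Type v} [AddCommGroup V] [Module ℂ V] [AddCommGroup W] [Module ℂ W]
  (A : Type t) [CommRing A] [Algebra ℂ A]

/-- The degree `n` part of `A ⊗ V`, for `n ∈ ℤ`, where `V` is graded by `ℕ`. -/
def intGr (gr : ℕ → Submodule ℂ V) (n : ℤ) : Submodule A (A ⊗[ℂ] V) :=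
  if 0 ≤ n then (gr n.toNat).baseChange A else ⊥

variable {A} {gr : ℕ → Submodule ℂ V} {gr' : ℕ → Submodule ℂ W}

lemma intGr_natCast (i : ℕ) : intGr A gr i = (gr i).baseChange A := by
  rw [intGr, if_pos (by omega), Int.toNat_natCast]

lemma intGr_of_neg {n : ℤ} (hn : n < 0) : intGr A gr n = ⊥ := if_neg (by omega)

lemma intGr_map (f : V →ₗ[ℂ] W) (hf : ∀ i, ∀ x ∈ gr i, f x ∈ gr' i) (n : ℤ) {x : A ⊗[ℂ] V}
    (hx : x ∈ intGr A gr n) : f.baseChange A x ∈ intGr A gr' n := by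
  rcases lt_or_ge n 0 with hn | hn
  · rw [intGr_of_neg hn, Submodule.mem_bot] at hx
    rw [hx, map_zero]
    exact Submodule.zero_mem _
  · lift n to ℕ using hn
    rw [intGr_natCast] at hx ⊢
    exact baseChange_apply_mem A f _ _ (hf n) hx

lemma intGr_map_succ (f : V →ₗ[ℂ] W) (hf : ∀ i, ∀ x ∈ gr i, f x ∈ gr' (i + 1)) (n : ℤ)
    {x : A ⊗[ℂ] V} (hx : x ∈ intGr A gr n) : f.baseChange A x ∈ intGr A gr' (n + 1) := by
  rcases lt_or_ge n 0 with hn | hn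
  · rw [intGr_of_neg hn, Submodule.mem_bot] at hx
    rw [hx, map_zero]
    exact Submodule.zero_mem _
  · lift n to ℕ using hn
    rw [← Nat.cast_succ, intGr_natCast] at *
    exact baseChange_apply_mem A f _ _ (hf n) hx

/-- The vanishing `hf₀` on degree 0 is what puts the image in degree `-1`, which is zero. -/
lemma intGr_map_pred (f : V →ₗ[ℂ] W) (hf : ∀ i, ∀ x ∈ gr (i + 1), f x ∈ gr' i)
    (hf₀ : ∀ x ∈ gr 0, f x = 0) (n : ℤ)
    {x : A ⊗[ℂ] V} (hx : x ∈ intGr A gr (n + 1)) : f.baseChange A x ∈ intGr A gr' n := by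
  rcases lt_or_ge n 0 with hn | hn
  · rcases lt_or_ge (n + 1) 0 with hn' | hn'
    · rw [intGr_of_neg hn', Submodule.mem_bot] at hx
      rw [hx, map_zero]
      exact Submodule.zero_mem _
    · have e : n + 1 = ((0 : ℕ) : ℤ) := by omega
      rw [e, intGr_natCast] at hx
      rw [baseChange_apply_eq A (g := 0) hf₀ hx, LinearMap.baseChange_zero, LinearMap.zero_apply]
      exact Submodule.zero_mem _
  · lift n to ℕ using hn
    rw [← Nat.cast_succ, intGr_natCast] at hx
    rw [intGr_natCast]
    exact baseChange_apply_mem A f _ _ (hf n) hx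

lemma intGr_congr {f g : V →ₗ[ℂ] W} (h : ∀ i, ∀ x ∈ gr i, f x = g x) (n : ℤ) {x : A ⊗[ℂ] V}
    (hx : x ∈ intGr A gr n) : f.baseChange A x = g.baseChange A x := by
  rcases lt_or_ge n 0 with hn | hn
  · rw [intGr_of_neg hn, Submodule.mem_bot] at hx
    rw [hx, map_zero, map_zero]
  · lift n to ℕ using hn
    rw [intGr_natCast] at hx
    exact baseChange_apply_eq A (h n) hx

lemma free_intGr (n : ℤ) : Module.Free A (intGr A gr n) := by
  rcases lt_or_ge n 0 with hn | hn
  · rw [intGr_of_neg hn]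
    infer_instance
  · lift n to ℕ using hn
    rw [intGr_natCast]
    exact Module.Free.of_basis (baseChangeBasis A _ (Module.Free.chooseBasis ℂ (gr n)))

lemma finite_intGr (hgr : ∀ i, FiniteDimensional ℂ (gr i)) (n : ℤ) :
    Module.Finite A (intGr A gr n) := by
  rcases lt_or_ge n 0 with hn | hn
  · rw [intGr_of_neg hn]
    infer_instance
  · lift n to ℕ using hn
    rw [intGr_natCast]
    have := hgr n
    exact Module.Finite.of_basis (baseChangeBasis A _ (Module.Free.chooseBasis ℂ (gr n)))

lemma subsingleton_intGr {m : ℕ} (hgr : ∀ i, m < i → gr i = ⊥) (n : ℤ) (hn : m < n) :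
    Subsingleton (intGr A gr n) := by
  lift n to ℕ using by omega
  rw [intGr_natCast, hgr n (by omega), Submodule.baseChange_bot]
  infer_instance

end IntegerGrading

/-! ### Minimal models of Aomoto complexes -/

namespace DGModule

variable {C : DGLA.{u}} (M : DGModule.{u, v} C) {A : ArtAlg} (c : M.toGrComplex.Contraction)
  (ω : C.MC A)

/-- The action of `ω` on `A ⊗ M`. -/
noncomputable def actEnd : Module.End A.carrier (A.carrier ⊗[ℂ] M.carrier) :=
  extendBilin A.carrier M.act ω.1

/-- The homotopy of `A ⊗ M`. -/
noncomputable def hEnd (A : ArtAlg) : Module.End A.carrier (A.carrier ⊗[ℂ] M.carrier) :=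
  c.h.baseChange A.carrier

/-- The differential of `A ⊗ M`. -/
noncomputable def dEnd (A : ArtAlg) : Module.End A.carrier (A.carrier ⊗[ℂ] M.carrier) :=
  M.d.baseChange A.carrier

/-- The projection of `A ⊗ M` to the harmonic part. -/
noncomputable def projEnd (A : ArtAlg) : Module.End A.carrier (A.carrier ⊗[ℂ] M.carrier) :=
  c.proj.baseChange A.carrier

lemma actEnd_mem (x : A.carrier ⊗[ℂ] M.carrier) :
    M.actEnd ω x ∈ A.m • (⊤ : Submodule A.carrier (A.carrier ⊗[ℂ] M.carrier)) :=
  extendBilin_mem_smul_top _ _ (nilTensor_le_smul_top A _ ω.2.1) x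

/-- The inverse of `1 + hω`. -/
noncomputable def leftPert : Module.End A.carrier (A.carrier ⊗[ℂ] M.carrier) :=
  ∑ k ∈ Finset.range A.exists_m_pow_eq_bot.choose, (-(M.hEnd c A * M.actEnd ω)) ^ k

/-- The inverse of `1 + ωh`. -/
noncomputable def rightPert : Module.End A.carrier (A.carrier ⊗[ℂ] M.carrier) :=
  ∑ k ∈ Finset.range A.exists_m_pow_eq_bot.choose, (-(M.actEnd ω * M.hEnd c A)) ^ k

lemma leftPert_spec : M.leftPert c ω * (1 + M.hEnd c A * M.actEnd ω) = 1 ∧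
    (1 + M.hEnd c A * M.actEnd ω) * M.leftPert c ω = 1 :=
  geom_sum_mul_one_add (pow_eq_zero_of_forall_mem A.exists_m_pow_eq_bot.choose_spec fun x => by
    have := smul_top_map_le A.m (M.hEnd c A) (M.actEnd_mem ω x)
    exact this)

lemma rightPert_spec : M.rightPert c ω * (1 + M.actEnd ω * M.hEnd c A) = 1 ∧
    (1 + M.actEnd ω * M.hEnd c A) * M.rightPert c ω = 1 :=
  geom_sum_mul_one_add (pow_eq_zero_of_forall_mem A.exists_m_pow_eq_bot.choose_spec fun x =>
    M.actEnd_mem ω (M.hEnd c A x))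

lemma dEnd_mul_dEnd : M.dEnd A * M.dEnd A = 0 := by
  rw [dEnd, Module.End.mul_eq_comp, ← LinearMap.baseChange_comp,
    show M.d ∘ₗ M.d = 0 from LinearMap.ext M.d_d, LinearMap.baseChange_zero]

lemma hEnd_mul_hEnd : M.hEnd c A * M.hEnd c A = 0 := by
  rw [hEnd, Module.End.mul_eq_comp, ← LinearMap.baseChange_comp,
    show c.h ∘ₗ c.h = 0 from LinearMap.ext c.h_h, LinearMap.baseChange_zero]

lemma hEnd_mul_dEnd_mul_hEnd : M.hEnd c A * M.dEnd A * M.hEnd c A = M.hEnd c A := by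
  rw [hEnd, dEnd, Module.End.mul_eq_comp, Module.End.mul_eq_comp, ← LinearMap.baseChange_comp,
    ← LinearMap.baseChange_comp]
  exact congrArg _ (LinearMap.ext c.h_d_h)

lemma dEnd_mul_hEnd_mul_dEnd : M.dEnd A * M.hEnd c A * M.dEnd A = M.dEnd A := by
  rw [hEnd, dEnd, Module.End.mul_eq_comp, Module.End.mul_eq_comp, ← LinearMap.baseChange_comp,
    ← LinearMap.baseChange_comp]
  exact congrArg _ (LinearMap.ext c.d_h_d)

lemma projEnd_eq : M.projEnd c A = 1 - M.dEnd A * M.hEnd c A - M.hEnd c A * M.dEnd A := by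
  rw [projEnd, GrComplex.Contraction.proj, LinearMap.baseChange_sub, LinearMap.baseChange_sub,
    LinearMap.baseChange_comp, LinearMap.baseChange_comp, LinearMap.baseChange_id]
  rfl

lemma projEnd_mul_projEnd : M.projEnd c A * M.projEnd c A = M.projEnd c A := by
  rw [projEnd, Module.End.mul_eq_comp, ← LinearMap.baseChange_comp]
  refine congrArg _ (LinearMap.ext fun x => ?_)
  rw [LinearMap.comp_apply, c.proj_apply (c.proj x), c.h_proj, c.d_proj, map_zero, map_zero,
    sub_zero, sub_zero]

lemma dAomoto_eq : M.dAomoto A.carrier ω.1 = M.dEnd A + M.actEnd ω := rfl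

lemma dAomoto_mul_dAomoto :
    (M.dEnd A + M.actEnd ω) * (M.dEnd A + M.actEnd ω) = 0 :=
  LinearMap.ext fun x => M.dAomoto_dAomoto ω.isFlat x

/-- The differential on the harmonic part given by the perturbation lemma. -/
noncomputable def minD : Module.End A.carrier (A.carrier ⊗[ℂ] M.carrier) :=
  M.projEnd c A * M.actEnd ω * M.leftPert c ω * M.projEnd c A

lemma dAomoto_mul_leftPert : (M.dEnd A + M.actEnd ω) * (M.leftPert c ω * M.projEnd c A) =
    M.leftPert c ω * M.minD c ω := by
  rw [minD, projEnd_eq]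
  exact perturbation_incl (S := Module.End A.carrier (A.carrier ⊗[ℂ] M.carrier)) M.dEnd_mul_dEnd (M.dAomoto_mul_dAomoto ω) (M.dEnd_mul_hEnd_mul_dEnd c)
    (M.leftPert_spec c ω).1 (M.leftPert_spec c ω).2

lemma projEnd_mul_minD : M.projEnd c A * M.minD c ω = M.minD c ω := by
  rw [minD, ← mul_assoc, ← mul_assoc, ← mul_assoc, projEnd_mul_projEnd]

lemma minD_mul_projEnd : M.minD c ω * M.projEnd c A = M.minD c ω := by
  rw [minD, mul_assoc, projEnd_mul_projEnd]

lemma rightPert_mul_dAomoto : M.projEnd c A * M.rightPert c ω * (M.dEnd A + M.actEnd ω) =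
    M.minD c ω * (M.projEnd c A * M.rightPert c ω) := by
  rw [← mul_assoc, minD_mul_projEnd, minD, projEnd_eq]
  exact perturbation_proj (S := Module.End A.carrier (A.carrier ⊗[ℂ] M.carrier)) M.dEnd_mul_dEnd (M.dAomoto_mul_dAomoto ω) (M.dEnd_mul_hEnd_mul_dEnd c)
    (M.leftPert_spec c ω).2 (M.rightPert_spec c ω).1 (M.rightPert_spec c ω).2

lemma projEnd_mul_rightPert_mul :
    M.projEnd c A * M.rightPert c ω * (M.leftPert c ω * M.projEnd c A) = M.projEnd c A := by
  rw [projEnd_eq]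
  exact perturbation_proj_incl (S := Module.End A.carrier (A.carrier ⊗[ℂ] M.carrier)) M.dEnd_mul_dEnd (M.hEnd_mul_hEnd c) (M.hEnd_mul_dEnd_mul_hEnd c)
    (M.dEnd_mul_hEnd_mul_dEnd c) (M.leftPert_spec c ω).2 (M.rightPert_spec c ω).1

lemma one_eq_leftPert_mul :
    1 = M.leftPert c ω * M.projEnd c A * M.rightPert c ω +
      (M.dEnd A + M.actEnd ω) * (M.leftPert c ω * M.hEnd c A) +
      M.leftPert c ω * M.hEnd c A * (M.dEnd A + M.actEnd ω) := by
  rw [projEnd_eq]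
  exact perturbation_homotopy (S := Module.End A.carrier (A.carrier ⊗[ℂ] M.carrier)) M.dEnd_mul_dEnd (M.dAomoto_mul_dAomoto ω) (M.leftPert_spec c ω).1
    (M.leftPert_spec c ω).2 (M.rightPert_spec c ω).1 (M.rightPert_spec c ω).2

/-- `leftPert` is invertible and carries `minD` to the Aomoto differential on the harmonic part,
whose square is zero. -/
lemma minD_mul_minD : M.minD c ω * M.minD c ω = 0 := by
  have e : M.leftPert c ω * (M.minD c ω * M.minD c ω) = 0 := by
    rw [← mul_assoc, ← dAomoto_mul_leftPert, mul_assoc, mul_assoc (M.leftPert c ω),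
      projEnd_mul_minD, ← dAomoto_mul_leftPert, ← mul_assoc, dAomoto_mul_dAomoto, zero_mul]
  calc M.minD c ω * M.minD c ω = (1 + M.hEnd c A * M.actEnd ω) * M.leftPert c ω *
        (M.minD c ω * M.minD c ω) := by rw [(M.leftPert_spec c ω).2, one_mul]
    _ = 0 := by rw [mul_assoc, e, mul_zero]

lemma dEnd_mem (n : ℤ) {x : A.carrier ⊗[ℂ] M.carrier} (hx : x ∈ M.grTensor A.carrier n) :
    M.dEnd A x ∈ M.grTensor A.carrier (n + 1) :=
  intGr_map_succ (gr' := M.gr) M.d (fun _ _ h => M.d_mem h) n hx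

lemma actEnd_mem_grTensor (n : ℤ) {x : A.carrier ⊗[ℂ] M.carrier}
    (hx : x ∈ M.grTensor A.carrier n) : M.actEnd ω x ∈ M.grTensor A.carrier (n + 1) := by
  have h := sub_mem (M.dAomoto_mem ω.isFlat.mem hx) (M.dEnd_mem n hx)
  rwa [dAomoto_eq, LinearMap.add_apply, add_sub_cancel_left] at h

lemma hEnd_mem (n : ℤ) {x : A.carrier ⊗[ℂ] M.carrier} (hx : x ∈ M.grTensor A.carrier (n + 1)) :
    M.hEnd c A x ∈ M.grTensor A.carrier n :=
  intGr_map_pred (gr' := M.gr) c.h (fun _ _ h => c.h_mem h) (fun _ h => c.h_zero h) n hx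

lemma projEnd_mem (n : ℤ) {x : A.carrier ⊗[ℂ] M.carrier} (hx : x ∈ M.grTensor A.carrier n) :
    M.projEnd c A x ∈ intGr A.carrier c.harm n :=
  intGr_map c.proj (fun _ _ h => c.proj_mem_harm h) n hx

lemma intGr_harm_le (n : ℤ) {x : A.carrier ⊗[ℂ] M.carrier} (hx : x ∈ intGr A.carrier c.harm n) :
    x ∈ M.grTensor A.carrier n := by
  have := intGr_map (gr := c.harm) (gr' := M.gr) LinearMap.id (fun _ _ h => h.1) n hx
  rwa [LinearMap.baseChange_id] at this

lemma projEnd_apply (n : ℤ) {x : A.carrier ⊗[ℂ] M.carrier} (hx : x ∈ intGr A.carrier c.harm n) :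
    M.projEnd c A x = x := by
  have := intGr_congr (gr := c.harm) (f := c.proj) (g := LinearMap.id) (fun _ _ h => c.proj_of_mem_harm h) n hx
  rwa [LinearMap.baseChange_id] at this

lemma leftPert_mem (n : ℤ) {x : A.carrier ⊗[ℂ] M.carrier} (hx : x ∈ M.grTensor A.carrier n) :
    M.leftPert c ω x ∈ M.grTensor A.carrier n :=
  sum_pow_apply_mem (T := M.hEnd c A * M.actEnd ω)
    (fun _ h => M.hEnd_mem c n (M.actEnd_mem_grTensor ω n h)) _ hx

lemma rightPert_mem (n : ℤ) {x : A.carrier ⊗[ℂ] M.carrier} (hx : x ∈ M.grTensor A.carrier n) :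
    M.rightPert c ω x ∈ M.grTensor A.carrier n := by
  refine sum_pow_apply_mem (T := M.actEnd ω * M.hEnd c A) (fun y h => ?_) _ hx
  have h₁ : M.hEnd c A y ∈ M.grTensor A.carrier (n - 1) := M.hEnd_mem c _ (by rwa [sub_add_cancel])
  have h₂ := M.actEnd_mem_grTensor ω _ h₁
  rwa [sub_add_cancel] at h₂

lemma minD_mem (n : ℤ) {x : A.carrier ⊗[ℂ] M.carrier} (hx : x ∈ intGr A.carrier c.harm n) :
    M.minD c ω x ∈ intGr A.carrier c.harm (n + 1) :=
  M.projEnd_mem c _ (M.actEnd_mem_grTensor ω n (M.leftPert_mem c ω n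
    (M.intGr_harm_le c n (M.projEnd_mem c n (M.intGr_harm_le c n hx)))))

/-- The minimal model of the Aomoto complex. -/
noncomputable def minimalAomoto : CochainComplex (ModuleCat.{v} A.carrier) ℤ :=
  complexOfGraded (intGr A.carrier c.harm) (M.minD c ω) (fun n _ hx => M.minD_mem c ω n hx)
    (fun x => LinearMap.congr_fun (M.minD_mul_minD c ω) x)

/-- The Aomoto complex is homotopy equivalent to its minimal model. -/
noncomputable def aomotoEquivMinimal :
    HomotopyEquiv (M.aomoto ω.isFlat) (M.minimalAomoto c ω) :=
  complexOfGradedHomotopyEquiv (M.projEnd c A * M.rightPert c ω)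
    (fun n _ hx => M.projEnd_mem c n (M.rightPert_mem c ω n hx))
    (fun _ x _ => LinearMap.congr_fun (M.rightPert_mul_dAomoto c ω) x)
    (M.leftPert c ω) (fun n _ hx => M.leftPert_mem c ω n (M.intGr_harm_le c n hx))
    (fun n x hx => by
      have := LinearMap.congr_fun (M.dAomoto_mul_leftPert c ω) x
      simp only [Module.End.mul_apply, M.projEnd_apply c n hx] at this
      exact this.symm)
    (M.leftPert c ω * M.hEnd c A)
    (fun n _ hx => M.leftPert_mem c ω n (M.hEnd_mem c n hx))
    (fun _ x _ => LinearMap.congr_fun (M.one_eq_leftPert_mul c ω) x)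
    (fun n x hx => by
      have := LinearMap.congr_fun (M.projEnd_mul_rightPert_mul c ω) x
      simp only [Module.End.mul_apply, M.projEnd_apply c n hx] at this
      exact this)

/-- `M ⊗ A` may be infinitely generated, but the minimal model lives on the harmonic spaces, which
are as small as the cohomology. Existence matters: the supremum defining `jumpIdeal` must not run
over an empty family. -/
lemma nonempty_freeResolution_aomoto (hb : ∃ n : ℕ, ∀ i : ℕ, n < i → M.gr i = ⊥)
    (hf : ∀ j : ℕ, FiniteDimensional ℂ (M.toGrComplex.cohGr j)) :
    Nonempty (FreeResolution (M.aomoto ω.isFlat)) := by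
  obtain ⟨c⟩ := M.toGrComplex.exists_contraction
  obtain ⟨N, hN⟩ := hb
  refine ⟨⟨M.minimalAomoto c ω, fun n => free_intGr n,
    fun n => finite_intGr (fun i => c.finite_harm i) n, ⟨N, fun n hn =>
      subsingleton_intGr (gr := c.harm) (fun i hi => ?_) n hn⟩, (M.aomotoEquivMinimal c ω).inv, ?_⟩⟩
  · rw [GrComplex.Contraction.harm, hN i hi, bot_inf_eq]
  · exact (M.aomotoEquivMinimal c ω).symm.quasiIso_hom

lemma subsingleton_aomoto {B : Type t} [CommRing B] [Algebra ℂ B] {η : B ⊗[ℂ] C.carrier}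
    (hη : C.IsFlat B η) (hb : ∃ n : ℕ, ∀ i : ℕ, n < i → M.gr i = ⊥) :
    ∃ N : ℤ, ∀ n : ℤ, N < n → Subsingleton ((M.aomoto hη).X n) := by
  obtain ⟨N, hN⟩ := hb
  exact ⟨N, fun n hn => subsingleton_intGr hN n hn⟩

lemma projective_aomoto {B : Type t} [CommRing B] [Algebra ℂ B] {η : B ⊗[ℂ] C.carrier}
    (hη : C.IsFlat B η) (n : ℤ) : Module.Projective B ((M.aomoto hη).X n) := by
  have : Module.Free B (intGr B M.gr n) := free_intGr n
  exact Module.Projective.of_free (R := B) (P := intGr B M.gr n)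

end DGModule

/-! ### Homomorphisms of DGLAs after extension of scalars -/

section Functoriality

variable {V : Type*} {W : Type*} {U : Type*} {V' : Type*} {W' : Type*} {U' : Type*}
  [AddCommGroup V] [Module ℂ V] [AddCommGroup W] [Module ℂ W] [AddCommGroup U] [Module ℂ U]
  [AddCommGroup V'] [Module ℂ V'] [AddCommGroup W'] [Module ℂ W'] [AddCommGroup U'] [Module ℂ U']

lemma baseChange_extendBilin (A : Type t) [CommRing A] [Algebra ℂ A] {β : V →ₗ[ℂ] W →ₗ[ℂ] U}
    {β' : V' →ₗ[ℂ] W' →ₗ[ℂ] U'} {f : V →ₗ[ℂ] V'} {g : W →ₗ[ℂ] W'} {h : U →ₗ[ℂ] U'}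
    (H : ∀ x y, h (β x y) = β' (f x) (g y)) (x : A ⊗[ℂ] V) (y : A ⊗[ℂ] W) :
    h.baseChange A (extendBilin A β x y) =
      extendBilin A β' (f.baseChange A x) (g.baseChange A y) := by
  induction x using TensorProduct.induction_on with
  | zero => simp
  | add x x' hx hx' => simp only [map_add, LinearMap.add_apply, hx, hx']
  | tmul a x =>
    induction y using TensorProduct.induction_on with
    | zero => simp
    | add y y' hy hy' => simp only [map_add, hy, hy']
    | tmul b y => simp only [extendBilin_tmul, LinearMap.baseChange_tmul, H]

lemma baseChange_smul_mem (A : Type t) [CommRing A] [Algebra ℂ A] (f : V →ₗ[ℂ] W)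
    {S : Submodule ℂ V} {T : Submodule ℂ W} (h : ∀ x ∈ S, f x ∈ T) (I : Ideal A) {x : A ⊗[ℂ] V}
    (hx : x ∈ I • S.baseChange A) : f.baseChange A x ∈ I • T.baseChange A := by
  have : I • S.baseChange A ≤ (I • T.baseChange A).comap (f.baseChange A) := by
    refine Submodule.smul_le.2 fun a ha z hz => ?_
    rw [Submodule.mem_comap, map_smul]
    exact Submodule.smul_mem_smul ha (baseChange_apply_mem A f S T h hz)
  exact this hx

end Functoriality

namespace DGLA

variable {C : DGLA.{u}} {D : DGLA.{v}}

lemma Hom.map_curvature (f : C.Hom D) (A : Type t) [CommRing A] [Algebra ℂ A]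
    (ω : A ⊗[ℂ] C.carrier) :
    f.toFun.baseChange A (C.curvature A ω) = D.curvature A (f.toFun.baseChange A ω) := by
  have e : f.toFun.baseChange A (C.dTensor A ω) = D.dTensor A (f.toFun.baseChange A ω) := by
    rw [dTensor, dTensor, ← LinearMap.comp_apply, ← LinearMap.comp_apply,
      ← LinearMap.baseChange_comp, ← LinearMap.baseChange_comp]
    exact congrArg (fun φ : C.carrier →ₗ[ℂ] D.carrier => φ.baseChange A ω)
      (LinearMap.ext f.map_d)
  rw [curvature, curvature, map_add, LinearMap.map_smul_of_tower, e, bracketTensor,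
    baseChange_extendBilin A f.map_bracket]
  rfl

/-- The map of Maurer–Cartan elements given by a homomorphism of DGLAs. -/
noncomputable def Hom.mapMC (f : C.Hom D) {A : ArtAlg} (ω : C.MC A) : D.MC A :=
  ⟨f.toFun.baseChange A.carrier ω.1, baseChange_smul_mem _ f.toFun (fun _ h => f.map_mem h) _ ω.2.1,
    by rw [← f.map_curvature, ω.2.2, map_zero]⟩

end DGLA

namespace DGModule

variable {C : DGLA.{u}} (M : DGModule.{u, v} C) {A : ArtAlg} (c : M.toGrComplex.Contraction)
  (ω : C.MC A)

/-- `u = 1 - h ω u`, and `ω` has coefficients in `m`. -/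
lemma leftPert_sub_mem (x : A.carrier ⊗[ℂ] M.carrier) : M.leftPert c ω x - x ∈
    A.m • (⊤ : Submodule A.carrier (A.carrier ⊗[ℂ] M.carrier)) := by
  have e : M.leftPert c ω x + M.hEnd c A (M.actEnd ω (M.leftPert c ω x)) = x := by
    have := LinearMap.congr_fun (M.leftPert_spec c ω).2 x
    rw [add_mul, one_mul] at this
    exact this
  have h := smul_top_map_le A.m (M.hEnd c A) (M.actEnd_mem ω (M.leftPert c ω x))
  have e' : M.leftPert c ω x - x = -M.hEnd c A (M.actEnd ω (M.leftPert c ω x)) := by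
    nth_rewrite 2 [← e]
    abel
  rw [e']
  exact neg_mem h

lemma rightPert_sub_mem (x : A.carrier ⊗[ℂ] M.carrier) : M.rightPert c ω x - x ∈
    A.m • (⊤ : Submodule A.carrier (A.carrier ⊗[ℂ] M.carrier)) := by
  have e : M.rightPert c ω x + M.actEnd ω (M.hEnd c A (M.rightPert c ω x)) = x := by
    have := LinearMap.congr_fun (M.rightPert_spec c ω).2 x
    rw [add_mul, one_mul] at this
    exact this
  have h := M.actEnd_mem ω (M.hEnd c A (M.rightPert c ω x))
  have e' : M.rightPert c ω x - x = -M.actEnd ω (M.hEnd c A (M.rightPert c ω x)) := by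
    nth_rewrite 2 [← e]
    abel
  rw [e']
  exact neg_mem h

end DGModule

/-! ### Aomoto complexes under `q`-equivalences -/

namespace DGLAPair

variable {P Q : DGLAPair.{u, v}} (g : P.Hom Q) (c : P.M.toGrComplex.Contraction)
  (c' : Q.M.toGrComplex.Contraction) {A : ArtAlg} (ω : P.C.MC A)

namespace Hom

/-- The map of `A ⊗ M` given by a homomorphism of pairs. -/
noncomputable def modMap (A : ArtAlg) : A.carrier ⊗[ℂ] P.M.carrier →ₗ[A.carrier]
    A.carrier ⊗[ℂ] Q.M.carrier :=
  g.toModule.toFun.baseChange A.carrier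

lemma modMap_dAomoto (x : A.carrier ⊗[ℂ] P.M.carrier) :
    g.modMap A (P.M.dAomoto A.carrier ω.1 x) =
      Q.M.dAomoto A.carrier (g.toDGLA.mapMC ω).1 (g.modMap A x) := by
  have e : g.modMap A (P.M.d.baseChange A.carrier x) =
      Q.M.d.baseChange A.carrier (g.modMap A x) := by
    rw [modMap, ← LinearMap.comp_apply, ← LinearMap.comp_apply, ← LinearMap.baseChange_comp,
      ← LinearMap.baseChange_comp]
    exact congrArg (fun φ : P.M.carrier →ₗ[ℂ] Q.M.carrier => φ.baseChange A.carrier x)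
      (LinearMap.ext g.toModule.map_d)
  rw [DGModule.dAomoto, DGModule.dAomoto, LinearMap.add_apply, LinearMap.add_apply, map_add, e]
  refine congrArg _ ?_
  exact baseChange_extendBilin A.carrier g.map_act _ _

/-- The map of minimal models given by a homomorphism of pairs. -/
noncomputable def minMap : A.carrier ⊗[ℂ] P.M.carrier →ₗ[A.carrier]
    A.carrier ⊗[ℂ] Q.M.carrier :=
  (Q.M.projEnd c' A * Q.M.rightPert c' (g.toDGLA.mapMC ω)) ∘ₗ g.modMap A ∘ₗ P.M.leftPert c ω

lemma minMap_mem (n : ℤ) {x : A.carrier ⊗[ℂ] P.M.carrier} (hx : x ∈ intGr A.carrier c.harm n) :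
    g.minMap c c' ω x ∈ intGr A.carrier c'.harm n := by
  refine Q.M.projEnd_mem c' n (Q.M.rightPert_mem c' _ n ?_)
  exact intGr_map (gr' := Q.M.gr) g.toModule.toFun (fun _ _ h => g.toModule.map_mem h) n
    (P.M.leftPert_mem c ω n (P.M.intGr_harm_le c n hx))

lemma minMap_minD (n : ℤ) {x : A.carrier ⊗[ℂ] P.M.carrier}
    (hx : x ∈ intGr A.carrier c.harm n) : g.minMap c c' ω (P.M.minD c ω x) =
      Q.M.minD c' (g.toDGLA.mapMC ω) (g.minMap c c' ω x) := by
  have h := LinearMap.congr_fun (P.M.dAomoto_mul_leftPert c ω) x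
  simp only [Module.End.mul_apply, P.M.projEnd_apply c n hx] at h
  have h' := LinearMap.congr_fun (Q.M.rightPert_mul_dAomoto c' (g.toDGLA.mapMC ω))
    (g.modMap A (P.M.leftPert c ω x))
  have h'' := g.modMap_dAomoto ω (P.M.leftPert c ω x)
  rw [DGModule.dAomoto_eq, DGModule.dAomoto_eq, h] at h''
  refine Eq.trans ?_ h'
  exact congrArg (Q.M.projEnd c' A * Q.M.rightPert c' (g.toDGLA.mapMC ω)) h''

/-- Both perturbation factors are the identity modulo `m`, so the map of minimal models reduces to
the map on cohomology written in harmonic representatives. -/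
lemma minMap_sub_mem (x : A.carrier ⊗[ℂ] P.M.carrier) :
    g.minMap c c' ω x - (c'.proj ∘ₗ g.toModule.toFun).baseChange A.carrier x ∈
      A.m • (⊤ : Submodule A.carrier (A.carrier ⊗[ℂ] Q.M.carrier)) := by
  have e : g.minMap c c' ω x - (c'.proj ∘ₗ g.toModule.toFun).baseChange A.carrier x =
      Q.M.projEnd c' A (Q.M.rightPert c' (g.toDGLA.mapMC ω) (g.modMap A (P.M.leftPert c ω x)) -
        g.modMap A (P.M.leftPert c ω x)) +
      Q.M.projEnd c' A (g.modMap A (P.M.leftPert c ω x - x)) := by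
    rw [LinearMap.baseChange_comp, map_sub, map_sub, map_sub]
    change _ - Q.M.projEnd c' A (g.modMap A x) = _
    rw [sub_add_sub_cancel]
    rfl
  rw [e]
  exact add_mem (smul_top_map_le _ _ (Q.M.rightPert_sub_mem c' _ _))
    (smul_top_map_le _ _ (smul_top_map_le _ _ (P.M.leftPert_sub_mem c ω x)))

/-- A left inverse of the map on cohomology is a left inverse modulo `m`; the nilpotent error `T` is
inverted by a geometric series. -/
lemma exists_leftInverse_minMap (j : ℕ)
    (hf : Set.InjOn g.toModule.cohMap (P.M.toGrComplex.cohGr j)) :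
    ∃ L : A.carrier ⊗[ℂ] Q.M.carrier →ₗ[A.carrier] A.carrier ⊗[ℂ] P.M.carrier,
      (∀ y, L y ∈ intGr A.carrier c.harm j) ∧
      ∀ x ∈ intGr A.carrier c.harm j, L (g.minMap c c' ω x) = x := by
  obtain ⟨r, hr, hr'⟩ := GrComplex.Contraction.exists_leftInverse c c' g.toModule j hf
  rw [intGr_natCast]
  have hrA : ∀ y, r.baseChange A.carrier y ∈ (c.harm j).baseChange A.carrier := fun y =>
    baseChange_apply_mem A.carrier r ⊤ _ (fun x _ => hr x) (by
      rw [Submodule.baseChange_top]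
      exact Submodule.mem_top)
  let p := (c'.proj ∘ₗ g.toModule.toFun).baseChange A.carrier
  let T : Module.End A.carrier (A.carrier ⊗[ℂ] P.M.carrier) :=
    r.baseChange A.carrier ∘ₗ (g.minMap c c' ω - p)
  have hT := geom_sum_mul_one_add (x := T) (pow_eq_zero_of_forall_mem
    A.exists_m_pow_eq_bot.choose_spec fun x => smul_top_map_le A.m (r.baseChange A.carrier) (g.minMap_sub_mem c c' ω x))
  refine ⟨(∑ k ∈ Finset.range A.exists_m_pow_eq_bot.choose, (-T) ^ k) ∘ₗ r.baseChange A.carrier,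
    fun y => sum_pow_apply_mem (fun x _ => hrA _) _ (hrA y), fun x hx => ?_⟩
  have e : r.baseChange A.carrier (p x) = x := by
    have := baseChange_apply_eq A.carrier (f := r ∘ₗ c'.proj ∘ₗ g.toModule.toFun)
      (g := LinearMap.id) hr' hx
    rwa [LinearMap.baseChange_comp, LinearMap.baseChange_id] at this
  have e' : r.baseChange A.carrier (g.minMap c c' ω x) = x + T x := by
    change _ = x + r.baseChange A.carrier (g.minMap c c' ω x - p x)
    rw [map_sub, e]
    abel
  rw [LinearMap.comp_apply, e']
  exact LinearMap.congr_fun hT.1 x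

lemma exists_rightInverse_minMap (j : ℕ)
    (hf : Set.SurjOn g.toModule.cohMap (P.M.toGrComplex.cohGr j) (Q.M.toGrComplex.cohGr j)) :
    ∃ L : A.carrier ⊗[ℂ] Q.M.carrier →ₗ[A.carrier] A.carrier ⊗[ℂ] P.M.carrier,
      (∀ y, L y ∈ intGr A.carrier c.harm j) ∧
      ∀ y ∈ intGr A.carrier c'.harm j, g.minMap c c' ω (L y) = y := by
  obtain ⟨r, hr, hr'⟩ := GrComplex.Contraction.exists_rightInverse c c' g.toModule j hf
  have hrA : ∀ y, r.baseChange A.carrier y ∈ intGr A.carrier c.harm j := fun y => by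
    rw [intGr_natCast]
    exact baseChange_apply_mem A.carrier r ⊤ _ (fun x _ => hr x) (by
      rw [Submodule.baseChange_top]
      exact Submodule.mem_top)
  let p := (c'.proj ∘ₗ g.toModule.toFun).baseChange A.carrier
  let T : Module.End A.carrier (A.carrier ⊗[ℂ] Q.M.carrier) :=
    (g.minMap c c' ω - p) ∘ₗ r.baseChange A.carrier
  have hp : ∀ y ∈ intGr A.carrier c'.harm j, p (r.baseChange A.carrier y) = y := by
    intro y hy
    rw [intGr_natCast] at hy
    have := baseChange_apply_eq A.carrier (f := (c'.proj ∘ₗ g.toModule.toFun) ∘ₗ r)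
      (g := LinearMap.id) hr' hy
    rwa [LinearMap.baseChange_comp, LinearMap.baseChange_id] at this
  have hT := geom_sum_mul_one_add (x := T) (pow_eq_zero_of_forall_mem
    A.exists_m_pow_eq_bot.choose_spec fun x => g.minMap_sub_mem c c' ω _)
  -- The identity `p r = 1` is only available on the harmonic part, so the geometric series must not
  -- leave it.
  have hTm : ∀ y ∈ intGr A.carrier c'.harm j, T y ∈ intGr A.carrier c'.harm j := by
    intro y hy
    change g.minMap c c' ω (r.baseChange A.carrier y) - p (r.baseChange A.carrier y) ∈ _
    rw [hp y hy]
    exact sub_mem (g.minMap_mem c c' ω j (hrA y)) hy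
  refine ⟨r.baseChange A.carrier ∘ₗ
    (∑ k ∈ Finset.range A.exists_m_pow_eq_bot.choose, (-T) ^ k), fun y => hrA _, fun y hy => ?_⟩
  have hS := sum_pow_apply_mem hTm A.exists_m_pow_eq_bot.choose hy
  have h := LinearMap.congr_fun hT.2 y
  rw [LinearMap.comp_apply]
  generalize (∑ k ∈ Finset.range A.exists_m_pow_eq_bot.choose, (-T) ^ k) = S at h hS ⊢
  have e' : g.minMap c c' ω (r.baseChange A.carrier (S y)) = S y + T (S y) := by
    change _ = S y + (g.minMap c c' ω (r.baseChange A.carrier (S y)) -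
      p (r.baseChange A.carrier (S y)))
    rw [hp _ hS]
    abel
  rw [e']
  exact h

/-- A `q`-equivalence of pairs induces homotopy equivalences of Aomoto complexes near the degrees
up to `q`. -/
lemma heq_aomoto {q : ℕ∞} (hg : g.toModule.IsEquivalence q) {i : ℕ} (hi : (i : ℕ∞) ≤ q) :
    (ThreeTerm.ofComplex (P.M.aomoto ω.isFlat) i).HEq
      (ThreeTerm.ofComplex (Q.M.aomoto (g.toDGLA.mapMC ω).isFlat) i) := by
  obtain ⟨c⟩ := P.M.toGrComplex.exists_contraction
  obtain ⟨c'⟩ := Q.M.toGrComplex.exists_contraction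
  refine (ThreeTerm.HEq.of_homotopyEquiv (P.M.aomotoEquivMinimal c ω) i).trans (.trans ?_
    (ThreeTerm.HEq.of_homotopyEquiv (Q.M.aomotoEquivMinimal c' (g.toDGLA.mapMC ω)) i).symm)
  -- In degree `i - 1` only surjectivity is needed; for `i = 0` this degree is zero.
  have hR : ∃ L : A.carrier ⊗[ℂ] Q.M.carrier →ₗ[A.carrier] A.carrier ⊗[ℂ] P.M.carrier,
      (∀ y, L y ∈ intGr A.carrier c.harm (i - 1 : ℤ)) ∧
      ∀ y ∈ intGr A.carrier c'.harm (i - 1 : ℤ), g.minMap c c' ω (L y) = y := by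
    rcases Nat.eq_zero_or_pos i with h | h
    · refine ⟨0, fun y => Submodule.zero_mem _, fun y hy => ?_⟩
      rw [intGr_of_neg (by omega), Submodule.mem_bot] at hy
      rw [hy, map_zero, map_zero]
    · obtain ⟨j, rfl⟩ := Nat.exists_eq_succ_of_ne_zero h.ne'
      have e : ((j.succ : ℕ) : ℤ) - 1 = j := by push_cast; ring
      rw [e]
      exact g.exists_rightInverse_minMap c c' ω j
        (hg.1 j (le_trans (by exact_mod_cast Nat.le_succ j) hi)).surjOn
  -- In degree `i + 1` only injectivity is needed: if `i + 1 ≤ q` there is even an isomorphism, and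
  -- otherwise `i = q` and the condition on `H^(q+1)` applies.
  have hL : Set.InjOn g.toModule.cohMap (P.M.toGrComplex.cohGr (i + 1)) := by
    by_cases h : ((i + 1 : ℕ) : ℕ∞) ≤ q
    · exact (hg.1 _ h).injOn
    · refine hg.2 _ ?_
      rw [not_le] at h
      obtain ⟨n, rfl⟩ := ENat.ne_top_iff_exists.1 (ne_top_of_lt h)
      norm_cast at h hi ⊢
      omega
  obtain ⟨r₀, h₀, e₀⟩ := hR
  obtain ⟨r₁, h₁, e₁⟩ := g.exists_rightInverse_minMap c c' ω i (hg.1 i hi).surjOn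
  obtain ⟨l₁, -, e₁'⟩ := g.exists_leftInverse_minMap c c' ω i (hg.1 i hi).injOn
  obtain ⟨r₂, h₂, e₂⟩ := g.exists_leftInverse_minMap c c' ω (i + 1) hL
  refine ThreeTerm.HEq.of_graded i (g.minMap c c' ω) (fun n x hx => g.minMap_mem c c' ω n hx)
    (fun n x hx => g.minMap_minD c c' ω n hx) r₀ r₁ r₂ (fun y _ => h₀ y) (fun y _ => h₁ y)
    (fun y _ => h₂ y) e₀ e₁ (fun x hx => ?_) e₂
  -- In the presence of a left inverse the right inverse `r₁` is two-sided.
  rw [← e₁' _ (h₁ (g.minMap c c' ω x)), e₁ _ (g.minMap_mem c c' ω i hx), e₁' x hx]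

end Hom

end DGLAPair

/-! ### The Baker–Campbell–Hausdorff theorem -/

section Exponentials

open IsNilpotent

variable {R : Type u} [Ring R] [Algebra ℚ R]

/-- The commutator with `a`, as a linear map. -/
def commEnd (a : R) : Module.End ℚ R := LinearMap.mulLeft ℚ a - LinearMap.mulRight ℚ a

lemma commEnd_apply (a b : R) : commEnd a b = a * b - b * a := rfl

lemma commEnd_eq_add (a : R) :
    commEnd a = LinearMap.mulLeft ℚ a + LinearMap.mulRight ℚ (-a) := by
  refine LinearMap.ext fun x => ?_
  simp [commEnd, sub_eq_add_neg]

lemma mulLeft_pow_eq_zero {a : R} {N : ℕ} (h : a ^ N = 0) : (LinearMap.mulLeft ℚ a) ^ N = 0 := by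
  rw [LinearMap.pow_mulLeft, h, LinearMap.mulLeft_zero_eq_zero]

lemma mulRight_pow_eq_zero {a : R} {N : ℕ} (h : a ^ N = 0) : (LinearMap.mulRight ℚ a) ^ N = 0 := by
  rw [LinearMap.pow_mulRight, h, LinearMap.mulRight_zero_eq_zero]

lemma commEnd_pow_eq_zero {a : R} {N : ℕ} (h : a ^ N = 0) : (commEnd a) ^ (2 * N) = 0 := by
  have h' : (-a) ^ N = 0 := by rw [neg_pow, h, mul_zero]
  rw [commEnd_eq_add]
  exact Commute.add_pow_eq_zero_of_add_le_succ_of_pow_eq_zero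
    (LinearMap.commute_mulLeft_right a (-a)) (mulLeft_pow_eq_zero h) (mulRight_pow_eq_zero h')
    (by omega)

/-- `ad a` is the sum of left multiplication by `a` and right multiplication by `-a`; these commute,
so the exponential factors. -/
lemma exp_mul_mul_exp_neg {a : R} (h : IsNilpotent a) (b : R) :
    exp a * b * exp (-a) = exp (commEnd a) b := by
  obtain ⟨N, hN⟩ := h
  have hN' : (-a) ^ N = 0 := by rw [neg_pow, hN, mul_zero]
  have e₁ : exp (LinearMap.mulLeft ℚ a) = LinearMap.mulLeft ℚ (exp a) :=
    (map_exp ⟨N, hN⟩ (Algebra.lmul ℚ R)).symm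
  have e₂ : exp (LinearMap.mulRight ℚ (-a)) = LinearMap.mulRight ℚ (exp (-a)) := by
    rw [exp_eq_sum (mulRight_pow_eq_zero hN'), exp_eq_sum hN']
    refine LinearMap.ext fun x => ?_
    simp [LinearMap.pow_mulRight, Finset.mul_sum]
  rw [commEnd_eq_add, exp_add_of_commute (LinearMap.commute_mulLeft_right a (-a))
    ⟨N, mulLeft_pow_eq_zero hN⟩ ⟨N, mulRight_pow_eq_zero hN'⟩, e₁, e₂]
  simp [mul_assoc]

/-- The logarithmic derivative of the exponential, truncated at order `K`. -/
def logDer (D : Module.End ℚ R) (K : ℕ) (a : R) : R :=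
  ∑ n ∈ Finset.range K, ((n + 1).factorial : ℚ)⁻¹ • ((commEnd a) ^ n) (D a)

/-- Conjugate the operator `D` by `exp T`, where `T` is left multiplication by `a`. On the one hand
`exp(T) D exp(-T)` sends `exp a` to `exp(a) D(1) = 0`. On the other hand it equals `exp(ad T) D`,
which is `D` minus left multiplication by `logDer D a`, because `[T, D]` is left multiplication by
`-D a`. The bound `2 * N` is the nilpotency order of the commutator. -/
lemma derivation_exp {D : Module.End ℚ R} (hD : ∀ x y, D (x * y) = D x * y + x * D y) {a : R}
    {N : ℕ} (h : a ^ N = 0) : D (exp a) = logDer D (2 * N) a * exp a := by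
  set T : Module.End ℚ R := LinearMap.mulLeft ℚ a with hT
  have hTN : T ^ N = 0 := mulLeft_pow_eq_zero h
  have h₁ : D 1 = 0 := by simpa using hD 1 1
  have h₂ := LinearMap.congr_fun (exp_mul_mul_exp_neg ⟨N, hTN⟩ D) (exp a)
  have e₁ : exp (-T) = LinearMap.mulLeft ℚ (exp (-a)) := by
    have : -T = Algebra.lmul ℚ R (-a) := by rw [map_neg]; rfl
    rw [this]
    exact (map_exp (IsNilpotent.neg ⟨N, h⟩) (Algebra.lmul ℚ R)).symm
  rw [Module.End.mul_apply, Module.End.mul_apply, e₁, LinearMap.mulLeft_apply,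
    exp_neg_mul_exp_self ⟨N, h⟩, h₁, map_zero,
    exp_eq_sum (k := 2 * N + 1) (pow_eq_zero_of_le (by omega) (commEnd_pow_eq_zero hTN)),
    Finset.sum_range_succ'] at h₂
  have e₂ : ∀ n, ((commEnd T) ^ (n + 1)) D = -LinearMap.mulLeft ℚ (((commEnd a) ^ n) (D a)) := by
    intro n
    induction n with
    | zero =>
      refine LinearMap.ext fun x => ?_
      simp [commEnd_apply, hT, hD]
    | succ n ih =>
      have e : (commEnd T) ^ (n + 1 + 1) = commEnd T * (commEnd T) ^ (n + 1) := pow_succ' _ _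
      rw [e, Module.End.mul_apply, ih, pow_succ', Module.End.mul_apply]
      refine LinearMap.ext fun x => ?_
      simp only [commEnd_apply, hT, Module.End.mul_apply, LinearMap.sub_apply,
        LinearMap.neg_apply, LinearMap.mulLeft_apply, sub_mul, mul_assoc]
      simp
      abel
  simp only [e₂, pow_zero, Nat.factorial_zero, Nat.cast_one, inv_one, one_smul,
    Module.End.one_apply, LinearMap.add_apply, LinearMap.sum_apply, LinearMap.smul_apply,
    LinearMap.neg_apply, LinearMap.mulLeft_apply, smul_neg, Finset.sum_neg_distrib] at h₂
  rw [logDer, Finset.sum_mul]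
  simp only [smul_mul_assoc]
  rw [eq_comm, neg_add_eq_zero] at h₂
  exact h₂.symm

end Exponentials

section BCH

open Polynomial IsNilpotent

variable {E : Type u} [Ring E] [Algebra ℚ E]

/-- The polynomials with coefficients in a subspace. -/
def polyCoeffs (S : Submodule ℚ E) : Submodule ℚ E[X] where
  carrier := {p | ∀ n, p.coeff n ∈ S}
  add_mem' hp hq n := by rw [coeff_add]; exact add_mem (hp n) (hq n)
  zero_mem' n := by rw [coeff_zero]; exact S.zero_mem
  smul_mem' c p hp n := by rw [coeff_smul]; exact S.smul_mem c (hp n)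

lemma C_mem_polyCoeffs {S : Submodule ℚ E} {a : E} (ha : a ∈ S) : C a ∈ polyCoeffs S := by
  intro n
  rw [coeff_C]
  split_ifs
  · exact ha
  · exact S.zero_mem

lemma derivative_mem_polyCoeffs {S : Submodule ℚ E} {p : E[X]} (hp : p ∈ polyCoeffs S) :
    derivative p ∈ polyCoeffs S := by
  intro n
  have : (derivative p).coeff n = ((n + 1 : ℕ) : ℚ) • p.coeff (n + 1) := by
    rw [coeff_derivative, Nat.cast_smul_eq_nsmul, nsmul_eq_mul, Nat.cast_succ, ← Nat.cast_succ]
    exact ((Nat.cast_commute (n + 1) (p.coeff (n + 1))).eq).symm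
  rw [this]
  exact S.smul_mem _ (hp _)

lemma exists_derivative_eq {S : Submodule ℚ E} {p : E[X]} (hp : p ∈ polyCoeffs S) :
    ∃ q ∈ polyCoeffs S, derivative q = p ∧ q.coeff 0 = 0 := by
  refine ⟨∑ n ∈ Finset.range (p.natDegree + 1), monomial (n + 1) ((n + 1 : ℚ)⁻¹ • p.coeff n),
    Submodule.sum_mem _ fun n _ k => ?_, ?_, ?_⟩
  · rw [coeff_monomial]
    split_ifs
    · exact S.smul_mem _ (hp n)
    · exact S.zero_mem
  · rw [derivative_sum]
    conv_rhs => rw [p.as_sum_range]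
    refine Finset.sum_congr rfl fun n _ => ?_
    rw [derivative_monomial, Nat.add_sub_cancel]
    congr 1
    have h : (n + 1 : ℚ) ≠ 0 := by positivity
    have : ((n + 1 : ℕ) : E) = algebraMap ℚ E (n + 1) := by simp
    rw [this, ← Algebra.commutes, ← Algebra.smul_def, smul_smul, mul_inv_cancel₀ h, one_smul]
  · rw [finsetSum_coeff]
    exact Finset.sum_eq_zero fun n _ => by rw [coeff_monomial, if_neg (by omega)]

lemma commEnd_mem_polyCoeffs {S T U : Submodule ℚ E}
    (h : ∀ a ∈ S, ∀ b ∈ T, a * b - b * a ∈ U) {p q : E[X]} (hp : p ∈ polyCoeffs S)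
    (hq : q ∈ polyCoeffs T) : commEnd p q ∈ polyCoeffs U := by
  intro n
  rw [commEnd_apply, coeff_sub, coeff_mul, coeff_mul, ← Finset.Nat.sum_antidiagonal_swap,
    ← Finset.sum_sub_distrib]
  rw [← Finset.Nat.sum_antidiagonal_swap]
  exact Submodule.sum_mem _ fun x _ => h _ (hp _) _ (hq _)

lemma mul_mem_polyCoeffs {S T U : Submodule ℚ E}
    (h : ∀ a ∈ S, ∀ b ∈ T, a * b ∈ U) {p q : E[X]} (hp : p ∈ polyCoeffs S)
    (hq : q ∈ polyCoeffs T) : p * q ∈ polyCoeffs U := by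
  intro n
  rw [coeff_mul]
  exact Submodule.sum_mem _ fun x _ => h _ (hp _) _ (hq _)

/-- The derivative of polynomials, as a linear map over `ℚ`. -/
noncomputable def polyDer : Module.End ℚ E[X] := (derivative : E[X] →ₗ[E] E[X]).restrictScalars ℚ

lemma polyDer_mul (p q : E[X]) : polyDer (p * q) = polyDer p * q + p * polyDer q := derivative_mul

lemma commEnd_pow_mem_polyCoeffs {L : ℕ → Submodule ℚ E} (hLa : Antitone L)
    (hL : ∀ i j, ∀ a ∈ L i, ∀ b ∈ L j, a * b - b * a ∈ L (i + j)) {p q : E[X]}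
    (hp : p ∈ polyCoeffs (L 1)) (hq : q ∈ polyCoeffs (L 1)) (n : ℕ) :
    ((commEnd p) ^ n) q ∈ polyCoeffs (L 1) := by
  induction n with
  | zero => exact hq
  | succ n ih =>
    rw [pow_succ', Module.End.mul_apply]
    exact fun k => hLa (by omega) (commEnd_mem_polyCoeffs (hL 1 1) hp ih k)

/-- The first term of `logDer` is the derivative and every later term contains a bracket, so a
change `q` in `L k` is felt as `q'` modulo `L (k + 1)`. This linearization drives the successive
approximation in the proof of Baker–Campbell–Hausdorff. -/
lemma logDer_add_sub_mem {L : ℕ → Submodule ℚ E} (hLa : Antitone L)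
    (hL : ∀ i j, ∀ a ∈ L i, ∀ b ∈ L j, a * b - b * a ∈ L (i + j)) {p q : E[X]} {k : ℕ}
    (hk : 1 ≤ k) (hp : p ∈ polyCoeffs (L 1)) (hq : q ∈ polyCoeffs (L k)) (K : ℕ) :
    logDer polyDer (K + 1) (p + q) - logDer polyDer (K + 1) p - derivative q ∈
      polyCoeffs (L (k + 1)) := by
  have mono : ∀ {i j}, i ≤ j → polyCoeffs (L j) ≤ polyCoeffs (L i) := fun h p hp n => hLa h (hp n)
  have hq₁ := mono hk hq
  have hT := commEnd_pow_mem_polyCoeffs hLa hL (add_mem hp hq₁)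
    (derivative_mem_polyCoeffs (add_mem hp hq₁))
  have hdiff : ∀ n, ((commEnd (p + q)) ^ n) (derivative (p + q)) -
      ((commEnd p) ^ n) (derivative p) ∈ polyCoeffs (L k) ∧
      ((commEnd (p + q)) ^ (n + 1)) (derivative (p + q)) -
      ((commEnd p) ^ (n + 1)) (derivative p) ∈ polyCoeffs (L (k + 1)) := by
    have step : ∀ n, ((commEnd (p + q)) ^ n) (derivative (p + q)) -
      ((commEnd p) ^ n) (derivative p) ∈ polyCoeffs (L k) →
      ((commEnd (p + q)) ^ (n + 1)) (derivative (p + q)) -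
      ((commEnd p) ^ (n + 1)) (derivative p) ∈ polyCoeffs (L (k + 1)) := by
      intro n ih
      have e₁ : (commEnd (p + q)) ^ (n + 1) = commEnd (p + q) * (commEnd (p + q)) ^ n :=
        pow_succ' _ _
      have e₂ : (commEnd p) ^ (n + 1) = commEnd p * (commEnd p) ^ n := pow_succ' _ _
      rw [e₁, e₂, Module.End.mul_apply, Module.End.mul_apply]
      have h₁ := commEnd_mem_polyCoeffs (hL 1 k) hp ih
      have h₂ := commEnd_mem_polyCoeffs (hL k 1) hq (hT n)
      rw [add_comm 1 k] at h₁
      have := add_mem h₁ h₂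
      convert this using 1
      simp only [commEnd_apply]
      noncomm_ring
    intro n
    induction n with
    | zero =>
      have h : ((commEnd (p + q)) ^ 0) (derivative (p + q)) -
          ((commEnd p) ^ 0) (derivative p) ∈ polyCoeffs (L k) := by
        have : ((commEnd (p + q)) ^ 0) (derivative (p + q)) -
          ((commEnd p) ^ 0) (derivative p) = derivative q := by simp
        rw [this]
        exact derivative_mem_polyCoeffs hq
      exact ⟨h, step 0 h⟩
    | succ n ih => exact ⟨mono (by omega) ih.2, step _ (mono (by omega) ih.2)⟩
  have e : logDer polyDer (K + 1) (p + q) - logDer polyDer (K + 1) p - derivative q =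
      ∑ n ∈ Finset.range K, ((n + 1 + 1).factorial : ℚ)⁻¹ •
        (((commEnd (p + q)) ^ (n + 1)) (derivative (p + q)) -
          ((commEnd p) ^ (n + 1)) (derivative p)) := by
    simp only [logDer, Finset.sum_range_succ', smul_sub, Finset.sum_sub_distrib]
    simp [polyDer]
    abel
  rw [e]
  exact Submodule.sum_mem _ fun n _ => Submodule.smul_mem _ _ (hdiff n).2

/-- The exponentials of a nilpotent Lie algebra of elements of an algebra are closed under
multiplication. -/
theorem exists_exp_eq_exp_mul_exp {L F : ℕ → Submodule ℚ E} (hLF : ∀ k, L k ≤ F k)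
    (hLa : Antitone L) (hL : ∀ i j, ∀ a ∈ L i, ∀ b ∈ L j, a * b - b * a ∈ L (i + j))
    (hF : ∀ i j, ∀ a ∈ F i, ∀ b ∈ F j, a * b ∈ F (i + j)) {N : ℕ} (hN : F (N + 1) = ⊥) {x y : E}
    (hx : x ∈ L 1) (hy : y ∈ L 1) : ∃ z ∈ L 1, exp z = exp x * exp y := by
  have hpow : ∀ p ∈ polyCoeffs (L 1), p ^ (N + 1) = 0 := by
    intro p hp
    have : ∀ n, p ^ (n + 1) ∈ polyCoeffs (F (n + 1)) := by
      intro n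
      induction n with
      | zero => rw [pow_one]; exact fun k => hLF 1 (hp k)
      | succ n ih =>
        rw [_root_.pow_succ]
        exact mul_mem_polyCoeffs (hF (n + 1) 1) ih fun k => hLF 1 (hp k)
    ext k
    have := this N k
    rwa [hN, Submodule.mem_bot] at this
  have mono : ∀ {i j}, i ≤ j → polyCoeffs (L j) ≤ polyCoeffs (L i) := fun h p hp n => hLa h (hp n)
  -- The differential equation `(exp p)' = x exp p` with `p(0) = y` amounts to `logDer p = x`. It is
  -- solved by polynomials in the variable with coefficients in the Lie algebra; each correction is
  -- an antiderivative of the error and gains one step of the filtration.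
  have key : ∀ k, ∃ p ∈ polyCoeffs (L 1), p.coeff 0 = y ∧
      C x - logDer polyDer (2 * (N + 1)) p ∈ polyCoeffs (L (k + 1)) := by
    intro k
    induction k with
    | zero =>
      refine ⟨C y, C_mem_polyCoeffs hy, coeff_C_zero, ?_⟩
      have : logDer polyDer (2 * (N + 1)) (C y) = 0 := by simp [logDer, polyDer]
      rw [this, sub_zero]
      exact C_mem_polyCoeffs hx
    | succ k ih =>
      obtain ⟨p, hp, hp₀, hr⟩ := ih
      obtain ⟨q, hq, hq', hq₀⟩ := exists_derivative_eq hr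
      refine ⟨p + q, add_mem hp (mono (by omega) hq), by rw [coeff_add, hp₀, hq₀, add_zero], ?_⟩
      have h := logDer_add_sub_mem hLa hL (by omega) hp hq (2 * N + 1)
      rw [hq'] at h
      have := neg_mem h
      convert this using 1
      rw [show 2 * N + 1 + 1 = 2 * (N + 1) by ring]
      abel
  obtain ⟨p, hp, hp₀, hr⟩ := key N
  have hr' : logDer polyDer (2 * (N + 1)) p = C x := by
    rw [eq_comm, ← sub_eq_zero]
    ext k
    have := hLF _ (hr k)
    rwa [hN, Submodule.mem_bot] at this
  have hX : ∀ a : E, a ∈ L 1 → C a * X ∈ polyCoeffs (L 1) := by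
    intro a ha n
    rcases n with _ | n
    · rw [coeff_mul_X_zero]; exact Submodule.zero_mem _
    · rw [coeff_mul_X]; exact C_mem_polyCoeffs ha n
  set b : E[X] := C (-x) * X with hb
  have hbm : b ∈ polyCoeffs (L 1) := hX _ (neg_mem hx)
  have hcomm : Commute b (C x) := by
    rw [hb, commute_iff_eq, mul_assoc, X_mul_C, ← mul_assoc, ← mul_assoc, ← C_mul, ← C_mul,
      neg_mul, mul_neg]
  have hcomm' : Commute (exp b) (C x) := by
    rw [exp_eq_sum (hpow b hbm)]
    exact Commute.sum_left _ _ _ fun i _ => (hcomm.pow_left i).smul_left _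
  have hdb : polyDer b = -C x := by
    change derivative b = _
    rw [hb, derivative_C_mul, derivative_X, mul_one, C_neg]
  have h₁ : polyDer (exp b) = -C x * exp b := by
    rw [derivation_exp (D := polyDer (E := E)) polyDer_mul (hpow b hbm)]
    congr 1
    rw [logDer, show 2 * (N + 1) = 2 * N + 1 + 1 by ring, Finset.sum_range_succ',
      Finset.sum_eq_zero]
    · simp [hdb]
    · intro n _
      rw [_root_.pow_succ, Module.End.mul_apply, hdb, commEnd_apply, mul_neg, neg_mul, hcomm.eq, sub_self,
        map_zero, smul_zero]
  have h₂ : polyDer (exp p) = C x * exp p := by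
    rw [derivation_exp (D := polyDer (E := E)) polyDer_mul (hpow p hp), hr']
  -- `exp(-tx) exp(p(t))` is constant; comparing its values at `t = 0` and `t = 1` gives `exp(p(1))
  -- = exp(x) exp(y)`.
  have h₃ : derivative (exp b * exp p) = 0 := by
    change polyDer _ = 0
    rw [polyDer_mul, h₁, h₂, ← mul_assoc, hcomm'.eq]
    noncomm_ring
  have h₄ : exp b * exp p = C ((exp b * exp p).coeff 0) := by
    refine eq_C_of_natDegree_eq_zero ?_
    have : IsAddTorsionFree E := .of_module_rat E
    exact derivative_eq_zero.1 h₃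
  -- Over a noncommutative ring, evaluation is multiplicative at central elements, such as `0` and
  -- `1`.
  let ev (r : E) (hr : ∀ a : E, Commute a r) : E[X] →+* E := eval₂RingHom' (RingHom.id E) r hr
  have h₀ : ∀ a : E, Commute a 0 := fun a => Commute.zero_right a
  have h₅ : ∀ a : E, Commute a 1 := fun a => Commute.one_right a
  have evb : ∀ r hr, ev r hr b = -x * r := fun r hr => by
    simp [ev, eval₂RingHom', hb]
  have e₀ : ev 0 h₀ (exp b * exp p) = exp y := by
    rw [map_mul, map_exp ⟨_, hpow b hbm⟩, map_exp ⟨_, hpow p hp⟩, evb, mul_zero, exp_zero, one_mul,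
      ← hp₀]
    congr 1
    simp [ev, eval₂RingHom', coeff_zero_eq_eval_zero]
  have e₁ : ev 1 h₅ (exp b * exp p) = exp (-x) * exp (ev 1 h₅ p) := by
    rw [map_mul, map_exp ⟨_, hpow b hbm⟩, map_exp ⟨_, hpow p hp⟩, evb, mul_one]
  have e₂ : ev 0 h₀ (exp b * exp p) = ev 1 h₅ (exp b * exp p) := by
    rw [h₄]
    simp [ev, eval₂RingHom']
  have hxn : IsNilpotent x := by
    refine ⟨N + 1, ?_⟩
    have := hpow _ (C_mem_polyCoeffs hx)
    rwa [← C_pow, C_eq_zero] at this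
  refine ⟨ev 1 h₅ p, ?_, ?_⟩
  · have : ev 1 h₅ p = ∑ i ∈ Finset.range (p.natDegree + 1), p.coeff i := by
      simp [ev, eval₂RingHom', eval₂_eq_sum_range]
    rw [this]
    exact Submodule.sum_mem _ fun i _ => hp i
  · rw [← e₀, e₂, e₁, ← mul_assoc, exp_mul_exp_neg_self hxn, one_mul]

end BCH

/-! ### Exponentials of nilpotent operators and of derivations -/

section ComplexExponential

variable {R : Type u} [Ring R] [Algebra ℂ R]

/-- The exponential of a nilpotent element of a complex algebra. -/
noncomputable def nexp (x : R) : R :=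
  letI : Algebra ℚ R := Algebra.compHom R (algebraMap ℚ ℂ)
  IsNilpotent.exp x

lemma nexp_eq_sum {x : R} {k : ℕ} (h : x ^ k = 0) :
    nexp x = ∑ i ∈ Finset.range k, (i.factorial : ℂ)⁻¹ • x ^ i := by
  let : Algebra ℚ R := Algebra.compHom R (algebraMap ℚ ℂ)
  refine (IsNilpotent.exp_eq_sum h).trans (Finset.sum_congr rfl fun i _ => ?_)
  have : (i.factorial : ℂ)⁻¹ = algebraMap ℚ ℂ (i.factorial : ℚ)⁻¹ := by simp
  rw [this]
  rfl

lemma nexp_add_of_commute {x y : R} (h : Commute x y) (hx : IsNilpotent x) (hy : IsNilpotent y) :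
    nexp (x + y) = nexp x * nexp y :=
  letI : Algebra ℚ R := Algebra.compHom R (algebraMap ℚ ℂ)
  IsNilpotent.exp_add_of_commute h hx hy

lemma nexp_mul_nexp_neg {x : R} (h : IsNilpotent x) : nexp x * nexp (-x) = 1 :=
  letI : Algebra ℚ R := Algebra.compHom R (algebraMap ℚ ℂ)
  IsNilpotent.exp_mul_exp_neg_self h

lemma nexp_neg_mul_nexp {x : R} (h : IsNilpotent x) : nexp (-x) * nexp x = 1 :=
  letI : Algebra ℚ R := Algebra.compHom R (algebraMap ℚ ℂ)
  IsNilpotent.exp_neg_mul_exp_self h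

theorem exists_nexp_eq_nexp_mul_nexp {L F : ℕ → Submodule ℂ R} (hLF : ∀ k, L k ≤ F k)
    (hLa : Antitone L) (hL : ∀ i j, ∀ a ∈ L i, ∀ b ∈ L j, a * b - b * a ∈ L (i + j))
    (hF : ∀ i j, ∀ a ∈ F i, ∀ b ∈ F j, a * b ∈ F (i + j)) {N : ℕ} (hN : F (N + 1) = ⊥) {x y : R}
    (hx : x ∈ L 1) (hy : y ∈ L 1) : ∃ z ∈ L 1, nexp z = nexp x * nexp y := by
  let : Algebra ℚ R := Algebra.compHom R (algebraMap ℚ ℂ)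
  have : IsScalarTower ℚ ℂ R := ⟨fun a b c => by
    change (a • b) • c = (algebraMap ℚ ℂ a) • b • c
    rw [show a • b = algebraMap ℚ ℂ a * b from Algebra.smul_def a b, mul_smul]⟩
  exact exists_exp_eq_exp_mul_exp (L := fun k => (L k).restrictScalars ℚ)
    (F := fun k => (F k).restrictScalars ℚ) hLF (fun _ _ h _ hx => hLa h hx) hL hF
    (N := N) (by rw [hN]; rfl) hx hy

variable {A : Type t} [CommRing A] [Algebra ℂ A] {P Q T : Type*} [AddCommGroup P]
  [AddCommGroup Q] [AddCommGroup T] [Module A P] [Module A Q] [Module A T] [Module ℂ P]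
  [Module ℂ Q] [Module ℂ T] [IsScalarTower ℂ A P] [IsScalarTower ℂ A Q] [IsScalarTower ℂ A T]

lemma nexp_apply {f : Module.End A P} {k : ℕ} (h : f ^ k = 0) (x : P) :
    nexp f x = ∑ i ∈ Finset.range k, (i.factorial : ℂ)⁻¹ • (f ^ i) x := by
  rw [nexp_eq_sum h, LinearMap.sum_apply]
  rfl

lemma nexp_intertwine {f : Module.End A P} {g : Module.End A Q} {k l : ℕ} (hf : f ^ k = 0)
    (hg : g ^ l = 0) (φ : P →ₗ[A] Q) (h : ∀ x, φ (f x) = g (φ x)) (x : P) :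
    φ (nexp f x) = nexp g (φ x) := by
  have e : ∀ i, φ ((f ^ i) x) = (g ^ i) (φ x) := by
    intro i
    induction i with
    | zero => rfl
    | succ i ih => rw [pow_succ', pow_succ', Module.End.mul_apply, Module.End.mul_apply, h, ih]
  rw [nexp_apply (pow_eq_zero_of_le (le_max_left k l) hf),
    nexp_apply (pow_eq_zero_of_le (le_max_right k l) hg), map_sum]
  exact Finset.sum_congr rfl fun i _ => by rw [LinearMap.map_smul_of_tower, e]

/-- The exponential of a derivation is compatible with products. -/
lemma nexp_bilin (B : P →ₗ[A] Q →ₗ[A] T) {DP : Module.End A P} {DQ : Module.End A Q}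
    {DT : Module.End A T} {k : ℕ} (hP : DP ^ k = 0) (hQ : DQ ^ k = 0) (hT : DT ^ k = 0)
    (H : ∀ p q, DT (B p q) = B (DP p) q + B p (DQ q)) (p : P) (q : Q) :
    nexp DT (B p q) = B (nexp DP p) (nexp DQ q) := by
  -- On `Hom(Q, T)`, composition with `DT` and precomposition with `-DQ` commute, and the derivation
  -- rule says that `B` intertwines `DP` with their sum.
  let post : Module.End A (Q →ₗ[A] T) := LinearMap.llcomp A Q T T DT
  let pre : Module.End A (Q →ₗ[A] T) := LinearMap.lcomp A T (-DQ)
  have hQ' : (-DQ) ^ k = 0 := by rw [neg_pow, hQ, mul_zero]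
  have epost : ∀ i (b : Q →ₗ[A] T), (post ^ i) b = (DT ^ i : Module.End A T) ∘ₗ b := by
    intro i b
    induction i with
    | zero => rfl
    | succ i ih => rw [pow_succ', Module.End.mul_apply, ih, pow_succ']; rfl
  have epre : ∀ i (b : Q →ₗ[A] T), (pre ^ i) b = b ∘ₗ ((-DQ) ^ i : Module.End A Q) := by
    intro i b
    induction i with
    | zero => rfl
    | succ i ih => rw [pow_succ', Module.End.mul_apply, ih, pow_succ]; rfl
  have hpost : post ^ k = 0 := LinearMap.ext fun b => by rw [epost, hT]; rfl
  have hpre : pre ^ k = 0 := LinearMap.ext fun b => by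
    rw [epre, hQ']
    exact LinearMap.comp_zero b
  have hcomm : Commute post pre := LinearMap.ext fun b => rfl
  have hsum : (post + pre) ^ (2 * k) = 0 :=
    Commute.add_pow_eq_zero_of_add_le_succ_of_pow_eq_zero hcomm hpost hpre (by omega)
  have h₁ : B (nexp DP p) = nexp (post + pre) (B p) := by
    refine nexp_intertwine hP hsum B (fun x => LinearMap.ext fun y => ?_) p
    change _ = DT (B x y) + B x (-DQ y)
    rw [H, map_neg, add_neg_cancel_right]
  have h₂ : nexp post (nexp pre (B p)) = (nexp DT : Module.End A T) ∘ₗ B p ∘ₗ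
      (nexp (-DQ) : Module.End A Q) := by
    refine LinearMap.ext fun y => ?_
    rw [nexp_apply hpost, nexp_apply hpre, LinearMap.sum_apply, LinearMap.comp_apply, nexp_apply hT]
    refine Finset.sum_congr rfl fun i _ => ?_
    rw [LinearMap.smul_apply, epost, LinearMap.comp_apply, LinearMap.comp_apply, nexp_apply hQ',
      LinearMap.sum_apply, map_sum, map_sum, map_sum]
    refine congrArg _ (Finset.sum_congr rfl fun j _ => ?_)
    rw [LinearMap.smul_apply, epre, LinearMap.map_smul_of_tower (B p)]
    rfl
  rw [h₁, nexp_add_of_commute hcomm ⟨k, hpost⟩ ⟨k, hpre⟩, Module.End.mul_apply, h₂,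
    LinearMap.comp_apply, LinearMap.comp_apply]
  have := LinearMap.congr_fun (nexp_neg_mul_nexp ⟨k, hQ⟩) q
  rw [Module.End.mul_apply] at this
  rw [this]
  rfl

/-- The form that computes curvature satisfies the derivation rule on the degree one part, where the
bracket is symmetric; hence the restriction to a stable submodule. -/
lemma nexp_bilin_of_mem (B : P →ₗ[A] P →ₗ[A] T) {D : Module.End A P} {DT : Module.End A T} {k : ℕ}
    (hD : D ^ k = 0) (hT : DT ^ k = 0) (S : Submodule A P) (hS : ∀ p ∈ S, D p ∈ S)
    (H : ∀ p ∈ S, ∀ q ∈ S, DT (B p q) = B (D p) q + B p (D q)) {p q : P} (hp : p ∈ S)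
    (hq : q ∈ S) : nexp DT (B p q) = B (nexp D p) (nexp D q) := by
  have hD' : (D.restrict hS) ^ k = 0 := by
    refine LinearMap.ext fun x => Subtype.ext ?_
    rw [Module.End.pow_restrict]
    exact LinearMap.congr_fun hD x.1
  have e := fun x : S => nexp_intertwine hD' hD S.subtype (fun x => rfl) x
  have := nexp_bilin (B.domRestrict₁₂ S S) hD' hD' hT (fun p q => H p.1 p.2 q.1 q.2) ⟨p, hp⟩ ⟨q, hq⟩
  rw [LinearMap.domRestrict₁₂_apply, LinearMap.domRestrict₁₂_apply] at this
  rw [this]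
  exact congrArg₂ (fun x y => B x y) (e ⟨p, hp⟩) (e ⟨q, hq⟩)

end ComplexExponential

/-! ### Graded Lie identities with coefficients in an algebra -/

namespace DGLA

variable (C : DGLA.{u})

lemma mem_iSup_gr (x : C.carrier) : x ∈ ⨆ i, C.gr i := by
  rw [C.internal.submodule_iSup_eq_top]
  exact Submodule.mem_top

lemma bracket_skew_zero {l : C.carrier} (hl : l ∈ C.gr 0) (x : C.carrier) :
    C.bracket x l = -C.bracket l x := by
  refine Submodule.iSup_induction (motive := fun x => C.bracket x l = -C.bracket l x) _
    (C.mem_iSup_gr x) (fun i x hx => ?_) (by simp) fun x y hx hy => by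
      rw [map_add, map_add, LinearMap.add_apply, hx, hy, neg_add]
  have := C.bracket_skew hl hx
  rw [zero_mul, pow_zero, one_smul] at this
  rw [eq_neg_iff_add_eq_zero, add_comm]
  exact this

/-- For `l` of degree 0 the graded Jacobi identity carries no sign from `l` and says that `ad l` is
a derivation. Homogeneous `x` and `y` suffice by additivity. -/
lemma bracket_bracket {l : C.carrier} (hl : l ∈ C.gr 0) (x y : C.carrier) :
    C.bracket l (C.bracket x y) = C.bracket (C.bracket l x) y + C.bracket x (C.bracket l y) := by
  refine Submodule.iSup_induction (motive := fun x => C.bracket l (C.bracket x y) =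
    C.bracket (C.bracket l x) y + C.bracket x (C.bracket l y)) _
    (C.mem_iSup_gr x) (fun j x hx => ?_) (by simp) fun x x' hx hx' => by
      simp only [map_add, LinearMap.add_apply, hx, hx']
      abel
  refine Submodule.iSup_induction (motive := fun y => C.bracket l (C.bracket x y) =
    C.bracket (C.bracket l x) y + C.bracket x (C.bracket l y)) _
    (C.mem_iSup_gr y) (fun k y hy => ?_) (by simp) fun y y' hy hy' => by
      simp only [map_add, hy, hy']
      abel
  have h₁ := C.jacobi hl hx hy
  have h₂ := C.bracket_skew (C.bracket_mem hl hx) hy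
  rw [zero_add] at h₂
  rw [mul_zero, zero_mul, pow_zero, one_smul, one_smul, C.bracket_skew_zero hl y, map_neg] at h₁
  rw [eq_neg_of_add_eq_zero_left h₂, ← sub_eq_zero, ← h₁]
  abel

variable (A : Type t) [CommRing A] [Algebra ℂ A]

lemma bracketTensor_skew_zero {l : A ⊗[ℂ] C.carrier} (hl : l ∈ (C.gr 0).baseChange A)
    (x : A ⊗[ℂ] C.carrier) : C.bracketTensor A x l = -C.bracketTensor A l x := by
  have key : (C.gr 0).baseChange A ≤
      LinearMap.eqLocus (C.bracketTensor A x) (-(C.bracketTensor A).flip x) := by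
    rw [baseChange_le_iff]
    intro l hl
    rw [LinearMap.mem_eqLocus, LinearMap.neg_apply, LinearMap.flip_apply]
    induction x using TensorProduct.induction_on with
    | zero => simp
    | add x y hx hy => rw [map_add, map_add, LinearMap.add_apply, hx, hy, neg_add]
    | tmul a x =>
      rw [bracketTensor, extendBilin_tmul, extendBilin_tmul, C.bracket_skew_zero hl, one_mul,
        mul_one, TensorProduct.tmul_neg]
  exact key hl

lemma bracketTensor_bracketTensor {l : A ⊗[ℂ] C.carrier} (hl : l ∈ (C.gr 0).baseChange A)
    (x y : A ⊗[ℂ] C.carrier) : C.bracketTensor A l (C.bracketTensor A x y) =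
      C.bracketTensor A (C.bracketTensor A l x) y + C.bracketTensor A x (C.bracketTensor A l y) := by
  have key : (C.gr 0).baseChange A ≤
      LinearMap.eqLocus ((C.bracketTensor A).flip (C.bracketTensor A x y))
        ((C.bracketTensor A).flip y ∘ₗ (C.bracketTensor A).flip x +
          C.bracketTensor A x ∘ₗ (C.bracketTensor A).flip y) := by
    rw [baseChange_le_iff]
    intro l hl
    simp only [LinearMap.mem_eqLocus, LinearMap.add_apply, LinearMap.flip_apply,
      LinearMap.comp_apply]
    induction x using TensorProduct.induction_on with
    | zero => simp
    | add x x' hx hx' =>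
      simp only [map_add, LinearMap.add_apply, hx, hx']
      abel
    | tmul a x =>
      induction y using TensorProduct.induction_on with
      | zero => simp
      | add y y' hy hy' =>
        simp only [map_add, hy, hy']
        abel
      | tmul b y =>
        simp only [bracketTensor, extendBilin_tmul, C.bracket_bracket hl, one_mul,
          TensorProduct.tmul_add]
  exact key hl

lemma dTensor_bracketTensor {l : A ⊗[ℂ] C.carrier} (hl : l ∈ (C.gr 0).baseChange A)
    (y : A ⊗[ℂ] C.carrier) : C.dTensor A (C.bracketTensor A l y) =
      C.bracketTensor A (C.dTensor A l) y + C.bracketTensor A l (C.dTensor A y) := by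
  have key : (C.gr 0).baseChange A ≤
      LinearMap.eqLocus (C.dTensor A ∘ₗ (C.bracketTensor A).flip y)
        ((C.bracketTensor A).flip y ∘ₗ C.dTensor A +
          (C.bracketTensor A).flip (C.dTensor A y)) := by
    rw [baseChange_le_iff]
    intro l hl
    simp only [LinearMap.mem_eqLocus, LinearMap.add_apply, LinearMap.flip_apply,
      LinearMap.comp_apply]
    induction y using TensorProduct.induction_on with
    | zero => simp
    | add y y' hy hy' =>
      simp only [map_add, hy, hy']
      abel
    | tmul b y =>
      simp [bracketTensor, dTensor, extendBilin_tmul, C.leibniz 0 l hl, TensorProduct.tmul_add]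
  exact key hl

lemma dTensor_dTensor (x : A ⊗[ℂ] C.carrier) : C.dTensor A (C.dTensor A x) = 0 := by
  rw [dTensor, ← LinearMap.comp_apply, ← LinearMap.baseChange_comp,
    show C.d ∘ₗ C.d = 0 from LinearMap.ext C.d_d, LinearMap.baseChange_zero, LinearMap.zero_apply]

lemma dTensor_mem {i : ℕ} {x : A ⊗[ℂ] C.carrier} (hx : x ∈ (C.gr i).baseChange A) :
    C.dTensor A x ∈ (C.gr (i + 1)).baseChange A :=
  baseChange_apply_mem A C.d _ _ (fun _ h => C.d_mem h) hx

lemma bracketTensor_mem {i j : ℕ} {x y : A ⊗[ℂ] C.carrier} (hx : x ∈ (C.gr i).baseChange A)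
    (hy : y ∈ (C.gr j).baseChange A) :
    C.bracketTensor A x y ∈ (C.gr (i + j)).baseChange A :=
  extendBilin_mem A C.bracket _ _ _ (fun _ h _ h' => C.bracket_mem h h') hx hy

lemma bracketTensor_comm {x y : A ⊗[ℂ] C.carrier} (hx : x ∈ (C.gr 1).baseChange A)
    (hy : y ∈ (C.gr 1).baseChange A) : C.bracketTensor A x y = C.bracketTensor A y x := by
  have key₁ : ∀ x ∈ C.gr 1, (C.gr 1).baseChange A ≤
      LinearMap.eqLocus (C.bracketTensor A (1 ⊗ₜ x)) ((C.bracketTensor A).flip (1 ⊗ₜ x)) := by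
    intro x hx
    rw [baseChange_le_iff]
    intro y hy
    have := C.bracket_skew hx hy
    rw [mul_one, pow_one, neg_smul, one_smul, ← sub_eq_add_neg, sub_eq_zero] at this
    rw [LinearMap.mem_eqLocus, LinearMap.flip_apply, bracketTensor, extendBilin_tmul,
      extendBilin_tmul, this]
  have key₂ : (C.gr 1).baseChange A ≤
      LinearMap.eqLocus ((C.bracketTensor A).flip y) (C.bracketTensor A y) := by
    rw [baseChange_le_iff]
    exact fun x hx => key₁ x hx hy
  exact key₂ hx

end DGLA

/-! ### The filtration by powers of the maximal ideal -/

section PowersOfMaximalIdeal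

variable {V : Type u} {W : Type v} {U : Type w} [AddCommGroup V] [Module ℂ V] [AddCommGroup W]
  [Module ℂ W] [AddCommGroup U] [Module ℂ U]

/-- The subspace `V ⊗ mᵏ` of `V ⊗ A`. -/
abbrev mpow (A : ArtAlg) (k : ℕ) (V : Type u) [AddCommGroup V] [Module ℂ V] :
    Submodule A.carrier (A.carrier ⊗[ℂ] V) := A.m ^ k • ⊤

lemma mpow_anti (A : ArtAlg) {i j : ℕ} (h : i ≤ j) : mpow A j V ≤ mpow A i V :=
  Submodule.smul_mono (Ideal.pow_le_pow_right h) le_rfl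

lemma mpow_eq_bot {A : ArtAlg} {N : ℕ} (h : A.m ^ N = ⊥) : mpow A N V = ⊥ := by
  rw [mpow, h, Submodule.bot_smul]

lemma map_mem_mpow {A : ArtAlg} (f : A.carrier ⊗[ℂ] V →ₗ[A.carrier] A.carrier ⊗[ℂ] W) {k : ℕ}
    {x : A.carrier ⊗[ℂ] V} (hx : x ∈ mpow A k V) : f x ∈ mpow A k W :=
  smul_top_map_le _ f hx

lemma smul_apply_mem {A : Type t} [CommRing A] {X Y : Type*} [AddCommGroup X] [Module A X]
    [AddCommGroup Y] [Module A Y] {I J : Ideal A} {f : X →ₗ[A] Y}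
    (hf : ∀ x, f x ∈ I • (⊤ : Submodule A Y)) {x : X} (hx : x ∈ J • (⊤ : Submodule A X)) :
    f x ∈ (I * J) • (⊤ : Submodule A Y) := by
  have : J • (⊤ : Submodule A X) ≤ ((I * J) • (⊤ : Submodule A Y)).comap f := by
    refine Submodule.smul_le.2 fun a ha z _ => ?_
    rw [Submodule.mem_comap, map_smul, mul_comm, Submodule.mul_smul]
    exact Submodule.smul_mem_smul ha (hf z)
  exact this hx

lemma extendBilin_mem_mpow {A : ArtAlg} (β : V →ₗ[ℂ] W →ₗ[ℂ] U) {i j : ℕ}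
    {x : A.carrier ⊗[ℂ] V} (hx : x ∈ mpow A i V) {y : A.carrier ⊗[ℂ] W} (hy : y ∈ mpow A j W) :
    extendBilin A.carrier β x y ∈ mpow A (i + j) U := by
  rw [mpow, pow_add]
  exact smul_apply_mem (f := extendBilin A.carrier β x)
    (fun z => smul_top_map_le (A.m ^ i) ((extendBilin A.carrier β).flip z) hx) hy

/-- A linear retraction onto `S` shows that `S ⊗ A` is a direct summand, so the grading and the
filtration by ideals can be checked separately. -/
lemma mem_smul_baseChange_iff {A : Type t} [CommRing A] [Algebra ℂ A] (S : Submodule ℂ V)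
    (I : Ideal A) (x : A ⊗[ℂ] V) :
    x ∈ I • S.baseChange A ↔ x ∈ S.baseChange A ∧ x ∈ I • (⊤ : Submodule A (A ⊗[ℂ] V)) := by
  refine ⟨fun h => ⟨Submodule.smul_le_right h, Submodule.smul_mono le_rfl le_top h⟩, fun h => ?_⟩
  obtain ⟨r, hr⟩ := LinearMap.exists_leftInverse_of_injective S.subtype
    (LinearMap.ker_eq_bot.2 S.injective_subtype)
  have e := baseChange_apply_eq A (f := S.subtype ∘ₗ r) (g := LinearMap.id) (S := S)
    (fun y hy => congrArg Subtype.val (LinearMap.congr_fun hr ⟨y, hy⟩)) h.1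
  rw [LinearMap.baseChange_id, LinearMap.id_apply] at e
  rw [← e]
  refine baseChange_smul_mem A (S.subtype ∘ₗ r) (S := ⊤) (fun y _ => (r y).2) I ?_
  rw [Submodule.baseChange_top]
  exact h.2

lemma mem_nilTensor_iff {A : ArtAlg} (S : Submodule ℂ V) (x : A.carrier ⊗[ℂ] V) :
    x ∈ nilTensor A S ↔ x ∈ S.baseChange A.carrier ∧ x ∈ mpow A 1 V := by
  rw [mpow, pow_one]
  exact mem_smul_baseChange_iff S A.m x

end PowersOfMaximalIdeal

lemma exists_nexp_end {A : ArtAlg} {X : Type u} [AddCommGroup X] [Module A.carrier X] [Module ℂ X]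
    [IsScalarTower ℂ A.carrier X] {L F : ℕ → Submodule ℂ (Module.End A.carrier X)}
    (hLF : ∀ k, L k ≤ F k)
    (hLa : Antitone L) (hL : ∀ i j, ∀ a ∈ L i, ∀ b ∈ L j, a * b - b * a ∈ L (i + j))
    (hF : ∀ i j, ∀ a ∈ F i, ∀ b ∈ F j, a * b ∈ F (i + j)) {N : ℕ} (hN : F (N + 1) = ⊥)
    {x y : Module.End A.carrier X}
    (hx : x ∈ L 1) (hy : y ∈ L 1) : ∃ z ∈ L 1, nexp z = nexp x * nexp y :=
  exists_nexp_eq_nexp_mul_nexp (R := Module.End A.carrier X) hLF hLa hL hF hN hx hy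

/-! ### The gauge action order by order -/

namespace DGLA

variable (C : DGLA.{u}) {A : ArtAlg}

lemma dTensor_mem_mpow {k : ℕ} {x : A.carrier ⊗[ℂ] C.carrier} (hx : x ∈ mpow A k C.carrier) :
    C.dTensor A.carrier x ∈ mpow A k C.carrier := map_mem_mpow _ hx

lemma bracketTensor_mem_mpow {i j : ℕ} {x y : A.carrier ⊗[ℂ] C.carrier}
    (hx : x ∈ mpow A i C.carrier) (hy : y ∈ mpow A j C.carrier) :
    C.bracketTensor A.carrier x y ∈ mpow A (i + j) C.carrier :=
  extendBilin_mem_mpow C.bracket hx hy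

lemma ad_pow_apply_eq_zero {l : A.carrier ⊗[ℂ] C.carrier} (hl : l ∈ mpow A 1 C.carrier) {N n : ℕ}
    (hN : A.m ^ N = ⊥) (hn : N ≤ n) (x : A.carrier ⊗[ℂ] C.carrier) :
    ((C.bracketTensor A.carrier l) ^ n) x = 0 := by
  have h : (C.bracketTensor A.carrier l : Module.End A.carrier _) ^ N = 0 := by
    refine pow_eq_zero_of_forall_mem hN fun y => ?_
    rw [mpow, pow_one] at hl
    exact extendBilin_mem_smul_top C.bracket A.m hl y
  rw [pow_eq_zero_of_le hn h, LinearMap.zero_apply]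

/-- The two truncations are independent, so that the two series can be shifted against each other.
-/
lemma gauge_eq_sum {l : A.carrier ⊗[ℂ] C.carrier} (hl : l ∈ mpow A 1 C.carrier) {K K' : ℕ}
    (hK : A.m ^ K = ⊥) (hK' : A.m ^ K' = ⊥) (ω : A.carrier ⊗[ℂ] C.carrier) :
    C.gauge A l ω =
      ∑ n ∈ Finset.range K, (n.factorial : ℂ)⁻¹ • ((C.bracketTensor A.carrier l) ^ n) ω -
      ∑ n ∈ Finset.range K', ((n + 1).factorial : ℂ)⁻¹ •
        ((C.bracketTensor A.carrier l) ^ n) (C.dTensor A.carrier l) := by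
  have key : ∀ (c : ℕ → ℂ) (x : A.carrier ⊗[ℂ] C.carrier) (K : ℕ), A.m ^ K = ⊥ →
      ∑ᶠ n : ℕ, c n • ((C.bracketTensor A.carrier l) ^ n) x =
      ∑ n ∈ Finset.range K, c n • ((C.bracketTensor A.carrier l) ^ n) x := by
    intro c x K hK
    refine finsum_eq_sum_of_support_subset _ fun n hn => ?_
    rw [Finset.coe_range, Set.mem_Iio]
    by_contra h
    refine hn ?_
    change c n • ((C.bracketTensor A.carrier l) ^ n) x = 0
    rw [C.ad_pow_apply_eq_zero hl hK (not_lt.1 h), smul_zero]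
  rw [gauge, key _ _ _ hK, key _ _ _ hK']

lemma gauge_zero (ω : A.carrier ⊗[ℂ] C.carrier) : C.gauge A 0 ω = ω := by
  obtain ⟨N, hN⟩ := A.exists_m_pow_eq_bot
  have hN' : A.m ^ (N + 1) = ⊥ := by rw [pow_succ, hN, Ideal.bot_mul]
  rw [C.gauge_eq_sum (Submodule.zero_mem _) hN' hN, Finset.sum_range_succ', Finset.sum_eq_zero]
  · simp
  · intro n _
    rw [map_zero, pow_succ, mul_zero, LinearMap.zero_apply, smul_zero]

lemma ad_pow_mem_gr {l x : A.carrier ⊗[ℂ] C.carrier} (hl : l ∈ (C.gr 0).baseChange A.carrier)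
    {i : ℕ} (hx : x ∈ (C.gr i).baseChange A.carrier) (n : ℕ) :
    ((C.bracketTensor A.carrier l) ^ n) x ∈ (C.gr i).baseChange A.carrier := by
  induction n with
  | zero => exact hx
  | succ n ih =>
    rw [pow_succ', Module.End.mul_apply]
    have := C.bracketTensor_mem A.carrier hl ih
    rwa [zero_add] at this

lemma ad_pow_mem_mpow (l : A.carrier ⊗[ℂ] C.carrier) {k : ℕ}
    {x : A.carrier ⊗[ℂ] C.carrier} (hx : x ∈ mpow A k C.carrier) (n : ℕ) :
    ((C.bracketTensor A.carrier l) ^ n) x ∈ mpow A k C.carrier := map_mem_mpow _ hx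

lemma gauge_mem {l ω : A.carrier ⊗[ℂ] C.carrier} (hl : l ∈ nilTensor A (C.gr 0))
    (hω : ω ∈ nilTensor A (C.gr 1)) : C.gauge A l ω ∈ nilTensor A (C.gr 1) := by
  obtain ⟨N, hN⟩ := A.exists_m_pow_eq_bot
  rw [mem_nilTensor_iff] at hl hω ⊢
  rw [C.gauge_eq_sum hl.2 hN hN]
  constructor
  · refine sub_mem (Submodule.sum_mem _ fun n _ => ?_) (Submodule.sum_mem _ fun n _ => ?_)
    · exact Submodule.smul_of_tower_mem _ _ (C.ad_pow_mem_gr hl.1 hω.1 n)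
    · exact Submodule.smul_of_tower_mem _ _ (C.ad_pow_mem_gr hl.1 (C.dTensor_mem _ hl.1) n)
  · refine sub_mem (Submodule.sum_mem _ fun n _ => ?_) (Submodule.sum_mem _ fun n _ => ?_)
    · exact Submodule.smul_of_tower_mem _ _ (C.ad_pow_mem_mpow l hω.2 n)
    · exact Submodule.smul_of_tower_mem _ _ (C.ad_pow_mem_mpow l (C.dTensor_mem_mpow hl.2) n)

/-- Each occurrence of `δ` contributes `mᵏ`, and it is bracketed with an element of order at least
one. -/
lemma ad_pow_add_sub_mem {l δ y : A.carrier ⊗[ℂ] C.carrier} {k : ℕ}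
    (hδ : δ ∈ mpow A k C.carrier) (hy : y ∈ mpow A 1 C.carrier) (n : ℕ) :
    ((C.bracketTensor A.carrier (l + δ)) ^ n) y - ((C.bracketTensor A.carrier l) ^ n) y ∈
      mpow A (k + 1) C.carrier := by
  induction n with
  | zero => simp
  | succ n ih =>
    rw [pow_succ', pow_succ', Module.End.mul_apply, Module.End.mul_apply, map_add,
      LinearMap.add_apply, ← map_add] at *
    rw [add_sub_right_comm, ← map_sub]
    exact add_mem (map_mem_mpow _ ih)
      (C.bracketTensor_mem_mpow hδ (C.ad_pow_mem_mpow (l + δ) hy n))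

/-- The gauge action to first order. -/
lemma gauge_add_sub_mem {l δ ω : A.carrier ⊗[ℂ] C.carrier} {k : ℕ} (hk : 1 ≤ k)
    (hl : l ∈ mpow A 1 C.carrier) (hδ : δ ∈ mpow A k C.carrier) (hω : ω ∈ mpow A 1 C.carrier) :
    C.gauge A (l + δ) ω - (C.gauge A l ω - C.dTensor A.carrier δ) ∈ mpow A (k + 1) C.carrier := by
  obtain ⟨N, hN⟩ := A.exists_m_pow_eq_bot
  have hN' : A.m ^ (N + 1) = ⊥ := by rw [pow_succ, hN, Ideal.bot_mul]
  have hlδ := add_mem hl (mpow_anti A hk hδ)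
  have e : C.gauge A (l + δ) ω - (C.gauge A l ω - C.dTensor A.carrier δ) =
      ∑ n ∈ Finset.range N, (n.factorial : ℂ)⁻¹ •
        (((C.bracketTensor A.carrier (l + δ)) ^ n) ω - ((C.bracketTensor A.carrier l) ^ n) ω) -
      ∑ n ∈ Finset.range (N + 1), ((n + 1).factorial : ℂ)⁻¹ •
        (((C.bracketTensor A.carrier (l + δ)) ^ n) (C.dTensor A.carrier l) -
          ((C.bracketTensor A.carrier l) ^ n) (C.dTensor A.carrier l)) -
      ∑ n ∈ Finset.range N, ((n + 1 + 1).factorial : ℂ)⁻¹ •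
        ((C.bracketTensor A.carrier (l + δ)) ^ (n + 1)) (C.dTensor A.carrier δ) := by
    -- The only first-order effect of `δ` is the `n = 0` term of the second series; all remaining
    -- terms contain a bracket.
    have e₁ : C.dTensor A.carrier δ + ∑ n ∈ Finset.range N, ((n + 1 + 1).factorial : ℂ)⁻¹ •
        ((C.bracketTensor A.carrier (l + δ)) ^ (n + 1)) (C.dTensor A.carrier δ) =
        ∑ n ∈ Finset.range (N + 1), ((n + 1).factorial : ℂ)⁻¹ •
        ((C.bracketTensor A.carrier (l + δ)) ^ n) (C.dTensor A.carrier δ) := by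
      rw [Finset.sum_range_succ' _ N, add_comm]
      simp
    rw [C.gauge_eq_sum hlδ hN hN', C.gauge_eq_sum hl hN hN']
    simp only [smul_sub, Finset.sum_sub_distrib, map_add, smul_add, Finset.sum_add_distrib] at e₁ ⊢
    rw [← e₁]
    abel
  rw [e]
  refine sub_mem (sub_mem (Submodule.sum_mem _ fun n _ => ?_) (Submodule.sum_mem _ fun n _ => ?_))
    (Submodule.sum_mem _ fun n _ => ?_)
  · exact Submodule.smul_of_tower_mem _ _ (C.ad_pow_add_sub_mem hδ hω n)
  · exact Submodule.smul_of_tower_mem _ _ (C.ad_pow_add_sub_mem hδ (C.dTensor_mem_mpow hl) n)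
  · refine Submodule.smul_of_tower_mem _ _ ?_
    rw [pow_succ', Module.End.mul_apply, add_comm k]
    exact C.bracketTensor_mem_mpow hlδ (C.ad_pow_mem_mpow _ (C.dTensor_mem_mpow hδ) n)

lemma gauge_sub_mem {δ ω : A.carrier ⊗[ℂ] C.carrier} {k : ℕ} (hk : 1 ≤ k)
    (hδ : δ ∈ mpow A k C.carrier) (hω : ω ∈ mpow A 1 C.carrier) :
    C.gauge A δ ω - (ω - C.dTensor A.carrier δ) ∈ mpow A (k + 1) C.carrier := by
  have := C.gauge_add_sub_mem hk (Submodule.zero_mem _) hδ hω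
  rwa [zero_add, gauge_zero] at this

/-- The inhomogeneous part cancels in the difference, and every further bracket with `l` gains an
order. -/
lemma gauge_congr_mem {l ω ω' : A.carrier ⊗[ℂ] C.carrier} {k : ℕ} (hl : l ∈ mpow A 1 C.carrier)
    (h : ω' - ω ∈ mpow A k C.carrier) :
    (C.gauge A l ω' - C.gauge A l ω) - (ω' - ω) ∈ mpow A (k + 1) C.carrier := by
  obtain ⟨N, hN⟩ := A.exists_m_pow_eq_bot
  have hN' : A.m ^ (N + 1) = ⊥ := by rw [pow_succ, hN, Ideal.bot_mul]
  have e : (C.gauge A l ω' - C.gauge A l ω) - (ω' - ω) =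
      ∑ n ∈ Finset.range N, ((n + 1).factorial : ℂ)⁻¹ •
        ((C.bracketTensor A.carrier l) ^ (n + 1)) (ω' - ω) := by
    rw [C.gauge_eq_sum hl hN' hN, C.gauge_eq_sum hl hN' hN]
    simp only [map_sub, smul_sub, Finset.sum_sub_distrib, Finset.sum_range_succ' _ N]
    simp
    abel
  rw [e]
  refine Submodule.sum_mem _ fun n _ => Submodule.smul_of_tower_mem _ _ ?_
  rw [pow_succ', Module.End.mul_apply, add_comm k]
  exact C.bracketTensor_mem_mpow hl (C.ad_pow_mem_mpow _ h n)

variable {C} in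
lemma Hom.map_gauge {D : DGLA.{v}} (f : C.Hom D) {l : A.carrier ⊗[ℂ] C.carrier}
    (hl : l ∈ mpow A 1 C.carrier) (ω : A.carrier ⊗[ℂ] C.carrier) :
    f.toFun.baseChange A.carrier (C.gauge A l ω) =
      D.gauge A (f.toFun.baseChange A.carrier l) (f.toFun.baseChange A.carrier ω) := by
  obtain ⟨N, hN⟩ := A.exists_m_pow_eq_bot
  have ead : ∀ n x, f.toFun.baseChange A.carrier (((C.bracketTensor A.carrier l) ^ n) x) =
      ((D.bracketTensor A.carrier (f.toFun.baseChange A.carrier l)) ^ n)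
        (f.toFun.baseChange A.carrier x) := by
    intro n x
    induction n with
    | zero => rfl
    | succ n ih =>
      rw [pow_succ', pow_succ', Module.End.mul_apply, Module.End.mul_apply, ← ih]
      exact baseChange_extendBilin A.carrier f.map_bracket _ _
  have ed : f.toFun.baseChange A.carrier (C.dTensor A.carrier l) =
      D.dTensor A.carrier (f.toFun.baseChange A.carrier l) := by
    rw [dTensor, dTensor, ← LinearMap.comp_apply, ← LinearMap.comp_apply,
      ← LinearMap.baseChange_comp, ← LinearMap.baseChange_comp]
    exact congrArg (fun φ : C.carrier →ₗ[ℂ] D.carrier => φ.baseChange A.carrier l)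
      (LinearMap.ext f.map_d)
  rw [C.gauge_eq_sum hl hN hN, D.gauge_eq_sum (map_mem_mpow _ hl) hN hN, map_sub, map_sum, map_sum]
  simp only [LinearMap.map_smul_of_tower, ead, ed]

/-! ### The gauge action as an exponential -/

/-- The affine vector field `ω ↦ [l, ω] - dl`, in homogeneous coordinates. -/
noncomputable def gaugeField (A : ArtAlg) : A.carrier ⊗[ℂ] C.carrier →ₗ[A.carrier]
    Module.End A.carrier ((A.carrier ⊗[ℂ] C.carrier) × A.carrier) :=
  LinearMap.mk₂ A.carrier
    (fun l p => (C.bracketTensor A.carrier l p.1 - p.2 • C.dTensor A.carrier l, 0))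
    (fun l l' p => by
      ext1
      · simp only [map_add, LinearMap.add_apply, smul_add, Prod.fst_add]
        abel
      · simp)
    (fun c l p => by
      ext1
      · simp only [map_smul, LinearMap.smul_apply, smul_sub, Prod.smul_fst, smul_comm p.2 c]
      · simp)
    (fun l p p' => by
      ext1
      · simp only [map_add, Prod.fst_add, Prod.snd_add, add_smul]
        abel
      · simp)
    (fun c l p => by
      ext1
      · simp only [map_smul, Prod.smul_fst, Prod.smul_snd, smul_sub, smul_eq_mul, mul_smul]
      · simp)

lemma gaugeField_apply (l : A.carrier ⊗[ℂ] C.carrier)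
    (p : (A.carrier ⊗[ℂ] C.carrier) × A.carrier) : C.gaugeField A l p =
      (C.bracketTensor A.carrier l p.1 - p.2 • C.dTensor A.carrier l, 0) := rfl

lemma gaugeField_mem {l : A.carrier ⊗[ℂ] C.carrier} {k : ℕ} (hl : l ∈ mpow A k C.carrier)
    (p : (A.carrier ⊗[ℂ] C.carrier) × A.carrier) :
    C.gaugeField A l p ∈ A.m ^ k • (⊤ : Submodule A.carrier _) :=
  smul_top_map_le _ ((C.gaugeField A).flip p) hl

lemma gaugeField_pow_eq_zero {l : A.carrier ⊗[ℂ] C.carrier} (hl : l ∈ mpow A 1 C.carrier) {N : ℕ}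
    (hN : A.m ^ N = ⊥) : (C.gaugeField A l) ^ N = 0 :=
  pow_eq_zero_of_forall_mem hN fun p => by
    have := C.gaugeField_mem hl p
    rwa [pow_one] at this

/-- In homogeneous coordinates the affine field is linear. Its power `n + 1` at `(ω, 1)` is `adⁿ⁺¹ ω
- adⁿ dl`, so both series of the gauge action appear at once. -/
lemma nexp_gaugeField {l : A.carrier ⊗[ℂ] C.carrier} (hl : l ∈ mpow A 1 C.carrier)
    (ω : A.carrier ⊗[ℂ] C.carrier) :
    nexp (C.gaugeField A l) (ω, 1) = (C.gauge A l ω, 1) := by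
  obtain ⟨N, hN⟩ := A.exists_m_pow_eq_bot
  have hN' : A.m ^ (N + 1) = ⊥ := by rw [pow_succ, hN, Ideal.bot_mul]
  have e : ∀ n, ((C.gaugeField A l) ^ (n + 1)) (ω, 1) =
      (((C.bracketTensor A.carrier l) ^ (n + 1)) ω -
        ((C.bracketTensor A.carrier l) ^ n) (C.dTensor A.carrier l), 0) := by
    intro n
    induction n with
    | zero => rw [zero_add, pow_one, gaugeField_apply]; simp
    | succ n ih =>
      have e₁ : (C.gaugeField A l) ^ (n + 1 + 1) = C.gaugeField A l * (C.gaugeField A l) ^ (n + 1) :=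
        pow_succ' _ _
      have e₂ : ∀ k x, ((C.bracketTensor A.carrier l) ^ (k + 1)) x =
          C.bracketTensor A.carrier l (((C.bracketTensor A.carrier l) ^ k) x) := fun k x => by
        rw [pow_succ', Module.End.mul_apply]
      rw [e₁, Module.End.mul_apply, ih, gaugeField_apply, zero_smul, sub_zero, map_sub,
        e₂ (n + 1), e₂ n (C.dTensor A.carrier l)]
  rw [nexp_apply (C.gaugeField_pow_eq_zero hl hN'), Finset.sum_range_succ',
    C.gauge_eq_sum hl hN' hN, Finset.sum_range_succ' _ N]
  simp only [e]
  refine Prod.ext ?_ ?_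
  · simp only [Prod.fst_add, Prod.fst_sum, Prod.smul_fst, smul_sub, Finset.sum_sub_distrib]
    simp
    abel
  · simp [Prod.snd_sum]

/-- The fields form a representation of the Lie algebra `C⁰ ⊗ A`, so the Baker–Campbell–Hausdorff
theorem applies to gauge transformations. -/
lemma gaugeField_bracket {l l' : A.carrier ⊗[ℂ] C.carrier}
    (hl : l ∈ (C.gr 0).baseChange A.carrier) (hl' : l' ∈ (C.gr 0).baseChange A.carrier) :
    C.gaugeField A l * C.gaugeField A l' - C.gaugeField A l' * C.gaugeField A l =
      C.gaugeField A (C.bracketTensor A.carrier l l') := by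
  refine LinearMap.ext fun p => ?_
  rw [LinearMap.sub_apply, Module.End.mul_apply, Module.End.mul_apply]
  simp only [gaugeField_apply]
  refine Prod.ext ?_ (by simp)
  simp only [Prod.fst_sub, zero_smul, sub_zero, map_sub, map_smul]
  rw [C.bracketTensor_bracketTensor _ hl l' p.1, C.dTensor_bracketTensor _ hl,
    C.bracketTensor_skew_zero _ hl' (C.dTensor A.carrier l)]
  simp only [smul_add, smul_neg]
  abel

/-- The endomorphisms `ω ↦ [l, ω] - dl` for `l ∈ C⁰ ⊗ mᵏ`. -/
noncomputable def gaugeLie (A : ArtAlg) (k : ℕ) :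
    Submodule ℂ (Module.End A.carrier ((A.carrier ⊗[ℂ] C.carrier) × A.carrier)) :=
  ((A.m ^ k • (C.gr 0).baseChange A.carrier).map (C.gaugeField A)).restrictScalars ℂ

lemma mem_gaugeLie {k : ℕ}
    {f : Module.End A.carrier ((A.carrier ⊗[ℂ] C.carrier) × A.carrier)} :
    f ∈ C.gaugeLie A k ↔ ∃ l, l ∈ (C.gr 0).baseChange A.carrier ∧ l ∈ mpow A k C.carrier ∧
      C.gaugeField A l = f := by
  constructor
  · rintro ⟨l, hl, rfl⟩
    have := (mem_smul_baseChange_iff _ _ _).1 hl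
    exact ⟨l, this.1, this.2, rfl⟩
  · rintro ⟨l, h, h', rfl⟩
    exact ⟨l, (mem_smul_baseChange_iff _ _ _).2 ⟨h, h'⟩, rfl⟩

/-- The endomorphisms with image in `mᵏ`. -/
def endFiltration (A : ArtAlg) (X : Type u) [AddCommGroup X] [Module A.carrier X] [Module ℂ X]
    [IsScalarTower ℂ A.carrier X] (k : ℕ) : Submodule ℂ (Module.End A.carrier X) where
  carrier := {f | ∀ x, f x ∈ A.m ^ k • (⊤ : Submodule A.carrier X)}
  add_mem' hf hg x := add_mem (hf x) (hg x)
  zero_mem' _ := Submodule.zero_mem _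
  smul_mem' c _ hf x := Submodule.smul_of_tower_mem _ c (hf x)

lemma gaugeLie_commutator {i j : ℕ}
    {a b : Module.End A.carrier ((A.carrier ⊗[ℂ] C.carrier) × A.carrier)}
    (ha : a ∈ C.gaugeLie A i) (hb : b ∈ C.gaugeLie A j) :
    a * b - b * a ∈ C.gaugeLie A (i + j) := by
  rw [mem_gaugeLie] at ha hb ⊢
  obtain ⟨l, hl, hl', rfl⟩ := ha
  obtain ⟨m, hm, hm', rfl⟩ := hb
  have h := C.bracketTensor_mem A.carrier hl hm
  rw [zero_add] at h
  exact ⟨_, h, C.bracketTensor_mem_mpow hl' hm', (C.gaugeField_bracket hl hm).symm⟩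

lemma endFiltration_eq_bot {N : ℕ} (hN : A.m ^ N = ⊥) (X : Type u) [AddCommGroup X]
    [Module A.carrier X] [Module ℂ X] [IsScalarTower ℂ A.carrier X] :
    endFiltration A X N = ⊥ := by
  rw [eq_bot_iff]
  intro f hf
  rw [Submodule.mem_bot]
  refine LinearMap.ext fun x => ?_
  have := hf x
  rwa [hN, Submodule.bot_smul, Submodule.mem_bot] at this

lemma mul_mem_endFiltration {X : Type u} [AddCommGroup X] [Module A.carrier X] [Module ℂ X]
    [IsScalarTower ℂ A.carrier X] {i j : ℕ} {a b : Module.End A.carrier X}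
    (ha : a ∈ endFiltration A X i) (hb : b ∈ endFiltration A X j) :
    a * b ∈ endFiltration A X (i + j) := by
  intro x
  have := smul_apply_mem (f := a) ha (hb x)
  rwa [← pow_add] at this

lemma gaugeLie_le (A : ArtAlg) (k : ℕ) : C.gaugeLie A k ≤ endFiltration A _ k := by
  intro f hf x
  obtain ⟨l, -, hl, rfl⟩ := C.mem_gaugeLie.1 hf
  exact C.gaugeField_mem hl x

lemma gaugeLie_antitone (A : ArtAlg) : Antitone (C.gaugeLie A) := by
  intro i j h f hf
  obtain ⟨l, hl, hl', rfl⟩ := C.mem_gaugeLie.1 hf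
  exact C.mem_gaugeLie.2 ⟨l, hl, mpow_anti A h hl', rfl⟩

/-- Baker–Campbell–Hausdorff, with the gauge fields filtered by powers of `m` inside the
endomorphisms filtered in the same way. -/
lemma exists_gaugeField_nexp {l l' : A.carrier ⊗[ℂ] C.carrier} {N : ℕ} (hN : A.m ^ (N + 1) = ⊥)
    (hl : C.gaugeField A l ∈ C.gaugeLie A 1) (hl' : C.gaugeField A l' ∈ C.gaugeLie A 1) :
    ∃ z ∈ C.gaugeLie A 1, nexp z = nexp (C.gaugeField A l) * nexp (C.gaugeField A l') := by
  have h₁ : ∀ i j, ∀ a ∈ C.gaugeLie A i, ∀ b ∈ C.gaugeLie A j,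
      a * b - b * a ∈ C.gaugeLie A (i + j) := fun i j a ha b hb => C.gaugeLie_commutator ha hb
  have h₂ : ∀ i j, ∀ a ∈ endFiltration A ((A.carrier ⊗[ℂ] C.carrier) × A.carrier) i,
      ∀ b ∈ endFiltration A ((A.carrier ⊗[ℂ] C.carrier) × A.carrier) j,
        a * b ∈ endFiltration A _ (i + j) := fun i j a ha b hb => mul_mem_endFiltration ha hb
  exact exists_nexp_end (C.gaugeLie_le A) (C.gaugeLie_antitone A) h₁ h₂
    (endFiltration_eq_bot hN _) hl hl'

/-- The gauge transformations form a group. -/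
lemma exists_gauge_gauge {l l' : A.carrier ⊗[ℂ] C.carrier} (hl : l ∈ nilTensor A (C.gr 0))
    (hl' : l' ∈ nilTensor A (C.gr 0)) :
    ∃ l'' ∈ nilTensor A (C.gr 0), ∀ ω, C.gauge A l'' ω = C.gauge A l (C.gauge A l' ω) := by
  obtain ⟨N, hN⟩ := A.exists_m_pow_eq_bot
  have hN' : A.m ^ (N + 1) = ⊥ := by rw [pow_succ, hN, Ideal.bot_mul]
  rw [mem_nilTensor_iff] at hl hl'
  obtain ⟨f, hf, e⟩ := C.exists_gaugeField_nexp hN' (C.mem_gaugeLie.2 ⟨l, hl.1, hl.2, rfl⟩)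
    (C.mem_gaugeLie.2 ⟨l', hl'.1, hl'.2, rfl⟩)
  obtain ⟨m, hm, hm', rfl⟩ := C.mem_gaugeLie.1 hf
  refine ⟨m, (mem_nilTensor_iff _ _).2 ⟨hm, hm'⟩, fun ω => ?_⟩
  have := LinearMap.congr_fun e (ω, 1)
  rw [Module.End.mul_apply, C.nexp_gaugeField hl'.2, C.nexp_gaugeField hl.2,
    C.nexp_gaugeField hm'] at this
  exact congrArg Prod.fst this

lemma gauge_neg_gauge {l : A.carrier ⊗[ℂ] C.carrier} (hl : l ∈ mpow A 1 C.carrier)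
    (ω : A.carrier ⊗[ℂ] C.carrier) : C.gauge A (-l) (C.gauge A l ω) = ω := by
  obtain ⟨N, hN⟩ := A.exists_m_pow_eq_bot
  have := LinearMap.congr_fun (nexp_neg_mul_nexp (x := C.gaugeField A l) ⟨N, C.gaugeField_pow_eq_zero hl hN⟩) (ω, 1)
  rw [Module.End.mul_apply, C.nexp_gaugeField hl, ← map_neg, C.nexp_gaugeField (neg_mem hl)] at this
  exact congrArg Prod.fst this

/-- The gauge action preserves the Maurer–Cartan equation. -/
lemma curvature_gauge {l ω : A.carrier ⊗[ℂ] C.carrier} (hl : l ∈ nilTensor A (C.gr 0))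
    (hω : ω ∈ (C.gr 1).baseChange A.carrier) (h : C.curvature A.carrier ω = 0) :
    C.curvature A.carrier (C.gauge A l ω) = 0 := by
  rw [mem_nilTensor_iff] at hl
  obtain ⟨N, hN⟩ := A.exists_m_pow_eq_bot
  let S : Submodule A.carrier ((A.carrier ⊗[ℂ] C.carrier) × A.carrier) :=
    ((C.gr 1).baseChange A.carrier).prod ⊤
  have hS : ∀ p ∈ S, C.gaugeField A l p ∈ S := by
    rintro ⟨x, a⟩ ⟨hx, -⟩
    refine ⟨sub_mem ?_ (Submodule.smul_mem _ _ (C.dTensor_mem _ hl.1)), Submodule.mem_top⟩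
    have := C.bracketTensor_mem A.carrier hl.1 hx
    rwa [zero_add] at this
  -- The polarization of twice the curvature in homogeneous coordinates: `B ((x, 1), (x, 1)) = 2
  -- F(x)`. Since `ad l` acts on `B` through the gauge field, `F` of the gauge transform is `exp(ad
  -- l) F`.
  let B : ((A.carrier ⊗[ℂ] C.carrier) × A.carrier) →ₗ[A.carrier]
      ((A.carrier ⊗[ℂ] C.carrier) × A.carrier) →ₗ[A.carrier] A.carrier ⊗[ℂ] C.carrier :=
    LinearMap.mk₂ A.carrier (fun p q => C.bracketTensor A.carrier p.1 q.1 +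
        p.2 • C.dTensor A.carrier q.1 + q.2 • C.dTensor A.carrier p.1)
      (fun p p' q => by
        simp only [Prod.fst_add, Prod.snd_add, map_add, LinearMap.add_apply, add_smul, smul_add]
        abel)
      (fun c p q => by
        simp only [Prod.smul_fst, Prod.smul_snd, map_smul, LinearMap.smul_apply, smul_eq_mul,
          mul_smul, smul_add, smul_comm q.2 c])
      (fun p q q' => by
        simp only [Prod.fst_add, Prod.snd_add, map_add, add_smul, smul_add]
        abel)
      (fun c p q => by
        simp only [Prod.smul_fst, Prod.smul_snd, map_smul, smul_eq_mul,
          mul_smul, smul_add, smul_comm p.2 c])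
  have hX := C.gaugeField_pow_eq_zero hl.2 hN
  have hT : (C.bracketTensor A.carrier l : Module.End A.carrier _) ^ N = 0 :=
    LinearMap.ext fun x => C.ad_pow_apply_eq_zero hl.2 hN le_rfl x
  have hωS : ((ω, 1) : (A.carrier ⊗[ℂ] C.carrier) × A.carrier) ∈ S := ⟨hω, Submodule.mem_top⟩
  have e₂ := nexp_bilin_of_mem B hX hT S hS (by
    rintro ⟨x, a⟩ ⟨hx, -⟩ ⟨y, b⟩ ⟨hy, -⟩
    change C.bracketTensor A.carrier l (C.bracketTensor A.carrier x y +
        a • C.dTensor A.carrier y + b • C.dTensor A.carrier x) =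
      (C.bracketTensor A.carrier (C.bracketTensor A.carrier l x - a • C.dTensor A.carrier l) y +
        (0 : A.carrier) • C.dTensor A.carrier y +
        b • C.dTensor A.carrier (C.bracketTensor A.carrier l x - a • C.dTensor A.carrier l)) +
      (C.bracketTensor A.carrier x (C.bracketTensor A.carrier l y - b • C.dTensor A.carrier l) +
        a • C.dTensor A.carrier (C.bracketTensor A.carrier l y - b • C.dTensor A.carrier l) +
        (0 : A.carrier) • C.dTensor A.carrier x)
    have hxd := C.bracketTensor_comm A.carrier hx (C.dTensor_mem _ hl.1)
    dsimp only at hxd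
    simp only [map_add, map_sub, map_smul, LinearMap.sub_apply, LinearMap.smul_apply,
      C.dTensor_dTensor, C.bracketTensor_bracketTensor _ hl.1 x y, C.dTensor_bracketTensor _ hl.1,
      hxd, zero_smul, smul_zero, sub_zero, smul_add]
    abel) hωS hωS
  have e₃ : ∀ x, B (x, 1) (x, 1) = (2 : ℂ) • C.curvature A.carrier x := by
    intro x
    change C.bracketTensor A.carrier x x + (1 : A.carrier) • C.dTensor A.carrier x +
      (1 : A.carrier) • C.dTensor A.carrier x = _
    rw [curvature, smul_add, smul_smul, one_smul]
    norm_num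
    rw [two_smul]
    abel
  rw [C.nexp_gaugeField hl.2, e₃, e₃, h, smul_zero, map_zero] at e₂
  exact (smul_eq_zero.1 e₂.symm).resolve_left two_ne_zero

variable {C}

/-- The gauge transformation of a Maurer–Cartan element. -/
noncomputable def MC.gauge (ω : C.MC A) (l : A.carrier ⊗[ℂ] C.carrier)
    (hl : l ∈ nilTensor A (C.gr 0)) : C.MC A :=
  ⟨C.gauge A l ω.1, C.gauge_mem hl ω.2.1, C.curvature_gauge hl (nilTensor_le A _ ω.2.1) ω.2.2⟩

/-- Transitivity is the group property of gauge transformations. Consequently equality of classes in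
`Def` means a single gauge transformation, not a chain of them. -/
lemma MC.iso_equivalence : Equivalence (MC.Iso (C := C) (A := A)) where
  refl ω := ⟨0, Submodule.zero_mem _, C.gauge_zero ω.1⟩
  symm := by
    rintro ω η ⟨l, hl, e⟩
    exact ⟨-l, neg_mem hl, by rw [← e, C.gauge_neg_gauge ((mem_nilTensor_iff _ _).1 hl).2]⟩
  trans := by
    rintro ω η ζ ⟨l, hl, e⟩ ⟨l', hl', e'⟩
    obtain ⟨l'', hl'', h⟩ := C.exists_gauge_gauge hl' hl
    exact ⟨l'', hl'', by rw [h, e, e']⟩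

lemma MC.mk_eq_mk {ω η : C.MC A} :
    (Quot.mk MC.Iso ω = Quot.mk MC.Iso η) ↔ ω.Iso η :=
  ⟨fun h => (MC.iso_equivalence.eqvGen_iff).1 (Quot.eqvGen_exact h), Quot.sound⟩

end DGLA

/-! ### Gauge invariance of Aomoto complexes -/

namespace DGModule

variable {C : DGLA.{u}} (M : DGModule.{u, v} C)

lemma act_bracket_zero {l : C.carrier} (hl : l ∈ C.gr 0) (a : C.carrier) (x : M.carrier) :
    M.act (C.bracket l a) x = M.act l (M.act a x) - M.act a (M.act l x) := by
  refine Submodule.iSup_induction (motive := fun a => M.act (C.bracket l a) x =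
    M.act l (M.act a x) - M.act a (M.act l x)) _
    (C.mem_iSup_gr a) (fun j a ha => ?_) (by simp) fun a a' h h' => by
      simp only [map_add, LinearMap.add_apply, h, h']
      abel
  have := M.act_bracket hl ha x
  rwa [zero_mul, pow_zero, one_smul] at this

section

variable (A : Type t) [CommRing A] [Algebra ℂ A]

lemma actTensor_bracketTensor {l : A ⊗[ℂ] C.carrier} (hl : l ∈ (C.gr 0).baseChange A)
    (a : A ⊗[ℂ] C.carrier) (x : A ⊗[ℂ] M.carrier) :
    extendBilin A M.act (C.bracketTensor A l a) x =
      extendBilin A M.act l (extendBilin A M.act a x) -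
        extendBilin A M.act a (extendBilin A M.act l x) := by
  have key : (C.gr 0).baseChange A ≤
      LinearMap.eqLocus ((extendBilin A M.act).flip x ∘ₗ (C.bracketTensor A).flip a)
        ((extendBilin A M.act).flip (extendBilin A M.act a x) -
          extendBilin A M.act a ∘ₗ (extendBilin A M.act).flip x) := by
    rw [baseChange_le_iff]
    intro l hl
    simp only [LinearMap.mem_eqLocus, LinearMap.sub_apply, LinearMap.flip_apply,
      LinearMap.comp_apply]
    induction a using TensorProduct.induction_on with
    | zero => simp
    | add a a' ha ha' =>
      simp only [map_add, LinearMap.add_apply, ha, ha']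
      abel
    | tmul b a =>
      induction x using TensorProduct.induction_on with
      | zero => simp
      | add y y' hy hy' =>
        simp only [map_add, hy, hy']
        abel
      | tmul c y =>
        simp only [DGLA.bracketTensor, extendBilin_tmul, M.act_bracket_zero hl, one_mul,
          TensorProduct.tmul_sub]
  exact key hl

lemma dTensor_actTensor {l : A ⊗[ℂ] C.carrier} (hl : l ∈ (C.gr 0).baseChange A)
    (x : A ⊗[ℂ] M.carrier) : M.d.baseChange A (extendBilin A M.act l x) =
      extendBilin A M.act (C.dTensor A l) x + extendBilin A M.act l (M.d.baseChange A x) := by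
  have key : (C.gr 0).baseChange A ≤
      LinearMap.eqLocus (M.d.baseChange A ∘ₗ (extendBilin A M.act).flip x)
        ((extendBilin A M.act).flip x ∘ₗ C.dTensor A +
          (extendBilin A M.act).flip (M.d.baseChange A x)) := by
    rw [baseChange_le_iff]
    intro l hl
    simp only [LinearMap.mem_eqLocus, LinearMap.add_apply, LinearMap.flip_apply,
      LinearMap.comp_apply]
    induction x using TensorProduct.induction_on with
    | zero => simp
    | add y y' hy hy' =>
      simp only [map_add, hy, hy']
      abel
    | tmul b y =>
      simp [DGLA.dTensor, extendBilin_tmul, M.leibniz 0 l hl, TensorProduct.tmul_add]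
  exact key hl

end

variable {A : ArtAlg}

lemma actTensor_pow_eq_zero {l : A.carrier ⊗[ℂ] C.carrier} (hl : l ∈ mpow A 1 C.carrier) {N : ℕ}
    (hN : A.m ^ N = ⊥) : (extendBilin A.carrier M.act l : Module.End A.carrier _) ^ N = 0 :=
  pow_eq_zero_of_forall_mem hN fun y => by
    rw [mpow, pow_one] at hl
    exact extendBilin_mem_smul_top M.act A.m hl y

/-- The exponential of `l ∈ C⁰ ⊗ m` carries the Aomoto differential of `ω` to that of its gauge
transform. -/
lemma nexp_dAomoto {l : A.carrier ⊗[ℂ] C.carrier} (hl : l ∈ nilTensor A (C.gr 0))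
    (ω : A.carrier ⊗[ℂ] C.carrier) (x : A.carrier ⊗[ℂ] M.carrier) :
    nexp (R := Module.End A.carrier _) (extendBilin A.carrier M.act l) (M.dAomoto A.carrier ω x) =
      M.dAomoto A.carrier (C.gauge A l ω)
        (nexp (R := Module.End A.carrier _) (extendBilin A.carrier M.act l) x) := by
  rw [mem_nilTensor_iff] at hl
  obtain ⟨N, hN⟩ := A.exists_m_pow_eq_bot
  -- The Aomoto differential in homogeneous coordinates, `(ω, t) ↦ ω + t d`. The action of `l` is a
  -- derivation for it together with the gauge field, and derivation rules exponentiate.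
  let B : ((A.carrier ⊗[ℂ] C.carrier) × A.carrier) →ₗ[A.carrier] (A.carrier ⊗[ℂ] M.carrier) →ₗ[A.carrier]
      A.carrier ⊗[ℂ] M.carrier :=
    extendBilin A.carrier M.act ∘ₗ LinearMap.fst A.carrier _ _ +
      (LinearMap.snd A.carrier _ _).smulRight (M.d.baseChange A.carrier)
  have hB : ∀ p x, B p x = extendBilin A.carrier M.act p.1 x + p.2 • M.d.baseChange A.carrier x :=
    fun p x => rfl
  have e : ∀ ω x, B (ω, 1) x = M.dAomoto A.carrier ω x := fun ω x => by
    rw [hB, one_smul, add_comm]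
    rfl
  have hT := M.actTensor_pow_eq_zero hl.2 hN
  rw [← e, ← e, ← C.nexp_gaugeField hl.2]
  refine nexp_bilin B (C.gaugeField_pow_eq_zero hl.2 hN) hT hT (fun p q => ?_) _ _
  rw [hB, hB, hB, DGLA.gaugeField_apply]
  simp only [map_add, map_sub, map_smul, LinearMap.sub_apply, LinearMap.smul_apply, zero_smul,
    M.actTensor_bracketTensor _ hl.1, M.dTensor_actTensor _ hl.1, smul_add]
  abel

lemma nexp_act_mem {l : A.carrier ⊗[ℂ] C.carrier} (hl : l ∈ nilTensor A (C.gr 0)) {n : ℤ}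
    {x : A.carrier ⊗[ℂ] M.carrier} (hx : x ∈ M.grTensor A.carrier n) :
    nexp (R := Module.End A.carrier _) (extendBilin A.carrier M.act l) x ∈ M.grTensor A.carrier n := by
  rw [mem_nilTensor_iff] at hl
  obtain ⟨N, hN⟩ := A.exists_m_pow_eq_bot
  rw [nexp_apply (M.actTensor_pow_eq_zero hl.2 hN)]
  refine Submodule.sum_mem _ fun i hi => Submodule.smul_of_tower_mem _ _ ?_
  clear hi
  induction i with
  | zero => exact hx
  | succ i ih =>
    rw [pow_succ', Module.End.mul_apply]
    unfold grTensor at ih ⊢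
    split_ifs at ih ⊢ with h
    · exact extendBilin_mem A.carrier M.act _ _ _
        (fun a ha y hy => by simpa using M.act_mem ha hy) hl.1 ih
    · rw [Submodule.mem_bot] at ih ⊢
      rw [ih, map_zero]

/-- The Aomoto complexes of gauge equivalent Maurer–Cartan elements are isomorphic. -/
lemma heq_aomoto_of_iso {ω η : C.MC A} (h : ω.Iso η) (i : ℤ) :
    (ThreeTerm.ofComplex (M.aomoto ω.isFlat) i).HEq
      (ThreeTerm.ofComplex (M.aomoto η.isFlat) i) := by
  obtain ⟨l, hl, e⟩ := h
  obtain ⟨N, hN⟩ := A.exists_m_pow_eq_bot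
  have hnil : IsNilpotent (R := Module.End A.carrier _) (extendBilin A.carrier M.act l) :=
    ⟨N, M.actTensor_pow_eq_zero ((mem_nilTensor_iff _ _).1 hl).2 hN⟩
  have e₁ : ∀ x, nexp (R := Module.End A.carrier _) (extendBilin A.carrier M.act l)
      (nexp (R := Module.End A.carrier _) (extendBilin A.carrier M.act (-l)) x) = x := fun x => by
    have := LinearMap.congr_fun (nexp_mul_nexp_neg (R := Module.End A.carrier _) hnil) x
    rw [← map_neg] at this
    exact this
  have e₂ : ∀ x, nexp (R := Module.End A.carrier _) (extendBilin A.carrier M.act (-l))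
      (nexp (R := Module.End A.carrier _) (extendBilin A.carrier M.act l) x) = x := fun x => by
    have := LinearMap.congr_fun (nexp_neg_mul_nexp (R := Module.End A.carrier _) hnil) x
    rw [← map_neg] at this
    exact this
  refine ThreeTerm.HEq.of_graded i
    (nexp (R := Module.End A.carrier _) (extendBilin A.carrier M.act l))
    (fun n x hx => M.nexp_act_mem hl hx) (fun n x _ => ?_)
    (nexp (R := Module.End A.carrier _) (extendBilin A.carrier M.act (-l)))
    (nexp (R := Module.End A.carrier _) (extendBilin A.carrier M.act (-l)))
    (nexp (R := Module.End A.carrier _) (extendBilin A.carrier M.act (-l)))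
    (fun x hx => M.nexp_act_mem (neg_mem hl) hx) (fun x hx => M.nexp_act_mem (neg_mem hl) hx)
    (fun x hx => M.nexp_act_mem (neg_mem hl) hx) (fun x _ => e₁ x) (fun x _ => e₁ x)
    (fun x _ => e₂ x) (fun x _ => e₂ x)
  rw [M.nexp_dAomoto hl, e]

end DGModule

/-! ### Cocycles modulo powers of the maximal ideal -/

namespace GrComplex.Contraction

variable {E : GrComplex.{u}} (c : E.Contraction) {F : GrComplex.{v}} (c' : F.Contraction)
  (f : E.Hom F) {A : ArtAlg}

lemma baseChange_comm {V₁ V₂ V₃ V₄ : Type*} [AddCommGroup V₁] [Module ℂ V₁] [AddCommGroup V₂]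
    [Module ℂ V₂] [AddCommGroup V₃] [Module ℂ V₃] [AddCommGroup V₄] [Module ℂ V₄]
    (A : Type t) [CommRing A] [Algebra ℂ A] {f : V₁ →ₗ[ℂ] V₂} {g : V₂ →ₗ[ℂ] V₃} {f' : V₁ →ₗ[ℂ] V₄}
    {g' : V₄ →ₗ[ℂ] V₃} (h : ∀ x, g (f x) = g' (f' x)) (x : A ⊗[ℂ] V₁) :
    g.baseChange A (f.baseChange A x) = g'.baseChange A (f'.baseChange A x) := by
  rw [← LinearMap.comp_apply, ← LinearMap.comp_apply, ← LinearMap.baseChange_comp,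
    ← LinearMap.baseChange_comp, show g ∘ₗ f = g' ∘ₗ f' from LinearMap.ext h]

lemma baseChange_proj_d (x : A.carrier ⊗[ℂ] E.carrier) :
    c.proj.baseChange A.carrier (E.d.baseChange A.carrier x) = 0 := by
  rw [← LinearMap.comp_apply, ← LinearMap.baseChange_comp,
    show c.proj ∘ₗ E.d = 0 from LinearMap.ext c.proj_d, LinearMap.baseChange_zero,
    LinearMap.zero_apply]

lemma baseChange_proj (x : A.carrier ⊗[ℂ] E.carrier) :
    c.proj.baseChange A.carrier x =
      x - E.d.baseChange A.carrier (c.h.baseChange A.carrier x) -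
        c.h.baseChange A.carrier (E.d.baseChange A.carrier x) := by
  rw [proj, LinearMap.baseChange_sub, LinearMap.baseChange_sub, LinearMap.baseChange_comp,
    LinearMap.baseChange_comp, LinearMap.baseChange_id]
  rfl

/-- A cocycle modulo `mᴷ` whose image is a coboundary modulo `mᴷ` is a coboundary modulo `mᴷ`. -/
lemma sub_d_h_mem {j K : ℕ} (hf : Set.InjOn f.cohMap (E.cohGr j)) {e : A.carrier ⊗[ℂ] E.carrier}
    (he : e ∈ (E.gr j).baseChange A.carrier)
    (hde : E.d.baseChange A.carrier e ∈ mpow A K E.carrier) (δ : A.carrier ⊗[ℂ] F.carrier)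
    (hδ : f.toFun.baseChange A.carrier e + F.d.baseChange A.carrier δ ∈ mpow A K F.carrier) :
    e - E.d.baseChange A.carrier (c.h.baseChange A.carrier e) ∈ mpow A K E.carrier := by
  obtain ⟨c'⟩ := F.exists_contraction
  obtain ⟨r, -, hr⟩ := c.exists_leftInverse c' f j hf
  have h₁ : c.proj.baseChange A.carrier e ∈ (c.harm j).baseChange A.carrier :=
    baseChange_apply_mem A.carrier c.proj _ _ (fun _ h => c.proj_mem_harm h) he
  have h₂ := baseChange_apply_eq A.carrier (f := r ∘ₗ c'.proj ∘ₗ f.toFun) (g := LinearMap.id) hr h₁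
  rw [LinearMap.baseChange_id, LinearMap.id_apply, LinearMap.baseChange_comp,
    LinearMap.baseChange_comp, LinearMap.comp_apply, LinearMap.comp_apply] at h₂
  have h₃ : c'.proj.baseChange A.carrier (f.toFun.baseChange A.carrier
      (c.proj.baseChange A.carrier e)) = c'.proj.baseChange A.carrier
        (f.toFun.baseChange A.carrier e + F.d.baseChange A.carrier δ) -
      c'.proj.baseChange A.carrier (f.toFun.baseChange A.carrier
        (c.h.baseChange A.carrier (E.d.baseChange A.carrier e))) := by
    rw [c.baseChange_proj, map_sub, map_sub, map_sub, map_sub, map_add,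
      baseChange_comm A.carrier f.map_d, c'.baseChange_proj_d, c'.baseChange_proj_d, sub_zero,
      add_zero]
  have h₄ : c.proj.baseChange A.carrier e ∈ mpow A K E.carrier := by
    rw [← h₂, h₃]
    exact map_mem_mpow _ (sub_mem (map_mem_mpow _ hδ)
      (map_mem_mpow _ (map_mem_mpow _ (map_mem_mpow _ hde))))
  have h₅ := add_mem h₄ (map_mem_mpow (c.h.baseChange A.carrier) hde)
  rwa [c.baseChange_proj, sub_add_cancel] at h₅

/-- A cocycle modulo `mᴷ` is the image of a cocycle, up to a coboundary modulo `mᴷ`. -/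
lemma exists_sub_d_h_mem {j k K : ℕ} (hf : Set.SurjOn f.cohMap (E.cohGr j) (F.cohGr j))
    {y : A.carrier ⊗[ℂ] F.carrier} (hy : y ∈ (F.gr j).baseChange A.carrier)
    (hyk : y ∈ mpow A k F.carrier) (hdy : F.d.baseChange A.carrier y ∈ mpow A K F.carrier) :
    ∃ z ∈ (E.gr j).baseChange A.carrier, z ∈ mpow A k E.carrier ∧ E.d.baseChange A.carrier z = 0 ∧
      y - f.toFun.baseChange A.carrier z - F.d.baseChange A.carrier (c'.h.baseChange A.carrier
        (y - f.toFun.baseChange A.carrier z)) ∈ mpow A K F.carrier := by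
  obtain ⟨c⟩ := E.exists_contraction
  obtain ⟨r, hr', hr⟩ := c.exists_rightInverse c' f j hf
  have h₁ : c'.proj.baseChange A.carrier y ∈ (c'.harm j).baseChange A.carrier :=
    baseChange_apply_mem A.carrier c'.proj _ _ (fun _ h => c'.proj_mem_harm h) hy
  have h₂ := baseChange_apply_eq A.carrier (f := c'.proj ∘ₗ f.toFun ∘ₗ r) (g := LinearMap.id) hr h₁
  rw [LinearMap.baseChange_id, LinearMap.id_apply, LinearMap.baseChange_comp,
    LinearMap.baseChange_comp, LinearMap.comp_apply, LinearMap.comp_apply] at h₂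
  have h₃ : E.d.baseChange A.carrier (r.baseChange A.carrier (c'.proj.baseChange A.carrier y)) =
      0 := by
    rw [← LinearMap.comp_apply, ← LinearMap.baseChange_comp,
      show E.d ∘ₗ r = 0 from LinearMap.ext fun y => (hr' y).2.1, LinearMap.baseChange_zero,
      LinearMap.zero_apply]
  refine ⟨r.baseChange A.carrier (c'.proj.baseChange A.carrier y),
    baseChange_apply_mem A.carrier r _ _ (fun x _ => (hr' x).1) h₁,
    map_mem_mpow _ (map_mem_mpow _ hyk), h₃, ?_⟩
  set z := r.baseChange A.carrier (c'.proj.baseChange A.carrier y) with hz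
  have h₄ : F.d.baseChange A.carrier (y - f.toFun.baseChange A.carrier z) =
      F.d.baseChange A.carrier y := by
    rw [map_sub, ← baseChange_comm A.carrier f.map_d, h₃, map_zero, sub_zero]
  have h₅ := c'.baseChange_proj (y - f.toFun.baseChange A.carrier z)
  rw [h₄, map_sub, h₂, sub_self, eq_comm, sub_eq_zero] at h₅
  rw [h₅]
  exact map_mem_mpow _ hdy

end GrComplex.Contraction

/-! ### The Bianchi identity and the curvature to first order -/

namespace DGLA

variable (C : DGLA.{u})

section

variable (A : Type t) [CommRing A] [Algebra ℂ A]

/-- Between elements of degree one all three signs of the graded Jacobi identity are `-1` and drop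
out. -/
lemma bracket_self_bracket {x y z : A ⊗[ℂ] C.carrier} (hx : x ∈ (C.gr 1).baseChange A)
    (hy : y ∈ (C.gr 1).baseChange A) (hz : z ∈ (C.gr 1).baseChange A) :
    C.bracketTensor A x (C.bracketTensor A y z) + C.bracketTensor A y (C.bracketTensor A z x) +
      C.bracketTensor A z (C.bracketTensor A x y) = 0 := by
  have key₁ : ∀ x ∈ C.gr 1, ∀ y ∈ C.gr 1, (C.gr 1).baseChange A ≤ LinearMap.ker
      (C.bracketTensor A (1 ⊗ₜ x) ∘ₗ C.bracketTensor A (1 ⊗ₜ y) +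
        C.bracketTensor A (1 ⊗ₜ y) ∘ₗ (C.bracketTensor A).flip (1 ⊗ₜ x) +
        (C.bracketTensor A).flip (C.bracketTensor A (1 ⊗ₜ x) (1 ⊗ₜ y))) := by
    intro x hx y hy
    rw [baseChange_le_iff]
    intro z hz
    have := C.jacobi hx hy hz
    simp only [mul_one, pow_one, neg_smul, one_smul] at this
    simp only [LinearMap.mem_ker, LinearMap.add_apply, LinearMap.comp_apply, LinearMap.flip_apply,
      bracketTensor, extendBilin_tmul, mul_one, ← TensorProduct.tmul_add]
    rw [← neg_eq_zero, ← TensorProduct.tmul_neg, neg_add, neg_add, this, TensorProduct.tmul_zero]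
  have key₂ : ∀ x ∈ C.gr 1, (C.gr 1).baseChange A ≤ LinearMap.ker
      (C.bracketTensor A (1 ⊗ₜ x) ∘ₗ (C.bracketTensor A).flip z +
        (C.bracketTensor A).flip (C.bracketTensor A z (1 ⊗ₜ x)) +
        C.bracketTensor A z ∘ₗ C.bracketTensor A (1 ⊗ₜ x)) := by
    intro x hx
    rw [baseChange_le_iff]
    exact fun y hy => key₁ x hx y hy hz
  have key₃ : (C.gr 1).baseChange A ≤ LinearMap.ker
      ((C.bracketTensor A).flip (C.bracketTensor A y z) +
        C.bracketTensor A y ∘ₗ C.bracketTensor A z +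
        C.bracketTensor A z ∘ₗ (C.bracketTensor A).flip y) := by
    rw [baseChange_le_iff]
    exact fun x hx => key₂ x hx hy
  exact key₃ hx

lemma dTensor_bracketTensor_one {x y : A ⊗[ℂ] C.carrier} (hx : x ∈ (C.gr 1).baseChange A) :
    C.dTensor A (C.bracketTensor A x y) =
      C.bracketTensor A (C.dTensor A x) y - C.bracketTensor A x (C.dTensor A y) := by
  have key : (C.gr 1).baseChange A ≤
      LinearMap.eqLocus (C.dTensor A ∘ₗ (C.bracketTensor A).flip y)
        ((C.bracketTensor A).flip y ∘ₗ C.dTensor A -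
          (C.bracketTensor A).flip (C.dTensor A y)) := by
    rw [baseChange_le_iff]
    intro l hl
    simp only [LinearMap.mem_eqLocus, LinearMap.sub_apply, LinearMap.flip_apply,
      LinearMap.comp_apply]
    induction y using TensorProduct.induction_on with
    | zero => simp
    | add y y' hy hy' =>
      simp only [map_add, hy, hy']
      abel
    | tmul b y =>
      simp [bracketTensor, dTensor, extendBilin_tmul, C.leibniz 1 l hl, TensorProduct.tmul_add,
        sub_eq_add_neg, TensorProduct.tmul_neg]
  exact key hx

lemma bracketTensor_skew_one_two {x y : A ⊗[ℂ] C.carrier} (hx : x ∈ (C.gr 1).baseChange A)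
    (hy : y ∈ (C.gr 2).baseChange A) : C.bracketTensor A x y = -C.bracketTensor A y x := by
  have key₁ : ∀ x ∈ C.gr 1, (C.gr 2).baseChange A ≤
      LinearMap.eqLocus (C.bracketTensor A (1 ⊗ₜ x)) (-(C.bracketTensor A).flip (1 ⊗ₜ x)) := by
    intro x hx
    rw [baseChange_le_iff]
    intro y hy
    have := C.bracket_skew hx hy
    rw [one_mul, neg_one_sq, one_smul] at this
    rw [LinearMap.mem_eqLocus, LinearMap.neg_apply, LinearMap.flip_apply, bracketTensor,
      extendBilin_tmul, extendBilin_tmul, eq_neg_of_add_eq_zero_left this, TensorProduct.tmul_neg]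
  have key₂ : (C.gr 1).baseChange A ≤
      LinearMap.eqLocus ((C.bracketTensor A).flip y) (-C.bracketTensor A y) := by
    rw [baseChange_le_iff]
    exact fun x hx => key₁ x hx hy
  exact key₂ hx

lemma curvature_mem {ω : A ⊗[ℂ] C.carrier} (hω : ω ∈ (C.gr 1).baseChange A) :
    C.curvature A ω ∈ (C.gr 2).baseChange A := by
  have h₁ := C.dTensor_mem A hω
  have h₂ := C.bracketTensor_mem A hω hω
  rw [curvature]
  exact add_mem h₁ (Submodule.smul_of_tower_mem _ (1 / 2 : ℂ) h₂)

/-- The Bianchi identity. -/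
lemma dTensor_curvature {ω : A ⊗[ℂ] C.carrier} (hω : ω ∈ (C.gr 1).baseChange A) :
    C.dTensor A (C.curvature A ω) = -C.bracketTensor A ω (C.curvature A ω) := by
  have h₁ : C.bracketTensor A ω (C.bracketTensor A ω ω) = 0 := by
    have h := C.bracket_self_bracket A hω hω hω
    have h' : (3 : ℂ) • C.bracketTensor A ω (C.bracketTensor A ω ω) = 0 := by
      rw [← h]
      module
    exact (smul_eq_zero.1 h').resolve_left (by norm_num)
  have h₂ := neg_eq_iff_eq_neg.2 (C.bracketTensor_skew_one_two A hω (C.dTensor_mem A hω))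
  rw [curvature, map_add, C.dTensor_dTensor, LinearMap.map_smul_of_tower,
    C.dTensor_bracketTensor_one A hω, map_add, LinearMap.map_smul_of_tower, h₁, ← h₂]
  module

end

variable {A : ArtAlg}

/-- All quadratic terms in which `δ` occurs have order at least `k + 1`. -/
lemma curvature_add_sub_mem {ω δ : A.carrier ⊗[ℂ] C.carrier} {k : ℕ} (hk : 1 ≤ k)
    (hω : ω ∈ mpow A 1 C.carrier) (hδ : δ ∈ mpow A k C.carrier) :
    C.curvature A.carrier (ω + δ) - (C.curvature A.carrier ω + C.dTensor A.carrier δ) ∈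
      mpow A (k + 1) C.carrier := by
  have e : C.curvature A.carrier (ω + δ) - (C.curvature A.carrier ω + C.dTensor A.carrier δ) =
      (1 / 2 : ℂ) • (C.bracketTensor A.carrier ω δ + C.bracketTensor A.carrier δ ω +
        C.bracketTensor A.carrier δ δ) := by
    simp only [curvature, map_add, LinearMap.add_apply]
    module
  rw [e]
  refine Submodule.smul_of_tower_mem _ _ (add_mem (add_mem ?_ ?_) ?_)
  · rw [add_comm k]
    exact C.bracketTensor_mem_mpow hω hδ
  · exact C.bracketTensor_mem_mpow hδ hω
  · exact C.bracketTensor_mem_mpow hδ (mpow_anti A hk hδ)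

end DGLA

/-! ### Deformations under 1-equivalences -/

namespace DGLA

variable {C : DGLA.{u}} {D : DGLA.{v}} (f : C.Hom D) {A : ArtAlg}

lemma Hom.map_dTensor (A : Type t) [CommRing A] [Algebra ℂ A] (x : A ⊗[ℂ] C.carrier) :
    f.toFun.baseChange A (C.dTensor A x) = D.dTensor A (f.toFun.baseChange A x) :=
  GrComplex.Contraction.baseChange_comm A f.map_d x

/-- To leading order the curvature changes by `d` of the difference. -/
lemma dTensor_sub_mem {ω η : A.carrier ⊗[ℂ] C.carrier} {k : ℕ} (hk : 1 ≤ k)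
    (hω : ω ∈ mpow A 1 C.carrier) (h : η - ω ∈ mpow A k C.carrier)
    (hc : C.curvature A.carrier ω = 0) (hc' : C.curvature A.carrier η = 0) :
    C.dTensor A.carrier (η - ω) ∈ mpow A (k + 1) C.carrier := by
  have := C.curvature_add_sub_mem hk hω h
  rw [add_sub_cancel, hc, hc', zero_add, zero_sub] at this
  exact neg_mem_iff.1 this

lemma mem_baseChange_and_mem {S : Submodule ℂ C.carrier} {k : ℕ} (hk : 1 ≤ k)
    {x : A.carrier ⊗[ℂ] C.carrier} (h : x ∈ S.baseChange A.carrier) (h' : x ∈ mpow A k C.carrier) :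
    x ∈ nilTensor A S :=
  (mem_nilTensor_iff S x).2 ⟨h, mpow_anti A hk h'⟩

lemma gauge_base {l ω : A.carrier ⊗[ℂ] C.carrier} (hl : l ∈ nilTensor A (C.gr 0))
    (hω : ω ∈ nilTensor A (C.gr 1)) : C.gauge A l ω ∈ (C.gr 1).baseChange A.carrier :=
  nilTensor_le A _ (C.gauge_mem hl hω)

/-- Obstruction theory, with error `e` between the transform of `η` and `f(ω)`. The curvature of `ω`
is a cocycle to order `k + 1` by the Bianchi identity, and its image is `-de`; injectivity on `H²`
makes it `db`. After replacing `ω` by `ω - b` the error is a cocycle to that order; by surjectivity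
on `H¹` it is the image of a cocycle `z` plus a coboundary `dμ`. These are absorbed into `ω` and
into the gauge parameter. -/
lemma Hom.surj_step (hf : f.toHom.IsEquivalence 1) {k : ℕ} (hk : 1 ≤ k) (η : D.MC A)
    {ω : A.carrier ⊗[ℂ] C.carrier} {l : A.carrier ⊗[ℂ] D.carrier} (hω : ω ∈ nilTensor A (C.gr 1))
    (hl : l ∈ nilTensor A (D.gr 0)) (hc : C.curvature A.carrier ω ∈ mpow A k C.carrier)
    (he : D.gauge A l η.1 - f.toFun.baseChange A.carrier ω ∈ mpow A k D.carrier) :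
    ∃ ω' ∈ nilTensor A (C.gr 1), ∃ l' ∈ nilTensor A (D.gr 0),
      C.curvature A.carrier ω' ∈ mpow A (k + 1) C.carrier ∧
      D.gauge A l' η.1 - f.toFun.baseChange A.carrier ω' ∈ mpow A (k + 1) D.carrier := by
  obtain ⟨c⟩ := C.exists_contraction
  obtain ⟨c'⟩ := D.exists_contraction
  have hω' := (mem_nilTensor_iff _ _).1 hω
  have hl' := (mem_nilTensor_iff _ _).1 hl
  have hη := (mem_nilTensor_iff _ _).1 η.2.1
  set e := D.gauge A l η.1 - f.toFun.baseChange A.carrier ω with hedef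
  have hfω : f.toFun.baseChange A.carrier ω ∈ mpow A 1 D.carrier := map_mem_mpow _ hω'.2
  have hfω₁ : f.toFun.baseChange A.carrier ω ∈ (D.gr 1).baseChange A.carrier :=
    baseChange_apply_mem A.carrier f.toFun _ _ (fun _ h => f.map_mem h) hω'.1
  have he₁ : e ∈ (D.gr 1).baseChange A.carrier := sub_mem (gauge_base hl η.2.1) hfω₁
  have hc₂ := C.curvature_mem A.carrier hω'.1
  have hdc : C.dTensor A.carrier (C.curvature A.carrier ω) ∈ mpow A (k + 1) C.carrier := by
    rw [C.dTensor_curvature A.carrier hω'.1, add_comm k]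
    exact neg_mem (C.bracketTensor_mem_mpow hω'.2 hc)
  have hfc : f.toFun.baseChange A.carrier (C.curvature A.carrier ω) + D.dTensor A.carrier e ∈
      mpow A (k + 1) D.carrier := by
    have := D.curvature_add_sub_mem hk hfω he
    rw [hedef, add_sub_cancel, D.curvature_gauge hl (nilTensor_le A _ η.2.1) η.2.2, zero_sub,
      neg_mem_iff, ← hedef, ← f.map_curvature] at this
    exact this
  -- A 1-equivalence is injective on `H²`, the degree of the obstruction.
  have hb := c.sub_d_h_mem f.toHom (j := 2) (hf.2 2 rfl) hc₂ hdc e hfc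
  set b := c.h.baseChange A.carrier (C.curvature A.carrier ω) with hbdef
  have hbk : b ∈ mpow A k C.carrier := map_mem_mpow _ hc
  have hb₁ : b ∈ (C.gr 1).baseChange A.carrier :=
    baseChange_apply_mem A.carrier c.h _ _ (fun _ h => c.h_mem h) hc₂
  change C.curvature A.carrier ω - C.dTensor A.carrier b ∈ mpow A (k + 1) C.carrier at hb
  have hfb : f.toFun.baseChange A.carrier b ∈ (D.gr 1).baseChange A.carrier :=
    baseChange_apply_mem A.carrier f.toFun _ _ (fun _ h => f.map_mem h) hb₁
  have hde : D.dTensor A.carrier (e + f.toFun.baseChange A.carrier b) ∈ mpow A (k + 1) D.carrier := by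
    rw [map_add, ← f.map_dTensor]
    have h₁ := sub_mem hfc (map_mem_mpow (f.toFun.baseChange A.carrier) hb)
    rw [map_sub (f.toFun.baseChange A.carrier) (C.curvature A.carrier ω)] at h₁
    convert h₁ using 1
    abel
  obtain ⟨z, hz₁, hzk, hdz, hz⟩ := c'.exists_sub_d_h_mem f.toHom (j := 1) (hf.1 1 le_rfl).surjOn
    (add_mem he₁ hfb) (add_mem he (map_mem_mpow _ hbk)) hde
  set y := e + f.toFun.baseChange A.carrier b - f.toFun.baseChange A.carrier z with hy
  have hyk : y ∈ mpow A k D.carrier :=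
    sub_mem (add_mem he (map_mem_mpow _ hbk)) (map_mem_mpow _ hzk)
  have hy₁ : y ∈ (D.gr 1).baseChange A.carrier := sub_mem (add_mem he₁ hfb)
    (baseChange_apply_mem A.carrier f.toFun _ _ (fun _ h => f.map_mem h) hz₁)
  set μ := c'.h.baseChange A.carrier y with hμ
  have hμk : μ ∈ mpow A k D.carrier := map_mem_mpow _ hyk
  have hμ₀ : μ ∈ (D.gr 0).baseChange A.carrier :=
    baseChange_apply_mem A.carrier c'.h _ _ (fun _ h => c'.h_mem h) hy₁
  refine ⟨ω + (z - b), add_mem hω (mem_baseChange_and_mem hk (sub_mem hz₁ hb₁) (sub_mem hzk hbk)),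
    l + μ, add_mem hl (mem_baseChange_and_mem hk hμ₀ hμk), ?_, ?_⟩
  · have h := add_mem (C.curvature_add_sub_mem hk hω'.2 (sub_mem hzk hbk)) hb
    have hdz' : C.dTensor A.carrier z = 0 := hdz
    rw [map_sub, hdz'] at h
    convert h using 1
    abel
  · have h := add_mem (D.gauge_add_sub_mem hk hl'.2 hμk hη.2) hz
    change _ + (y - D.dTensor A.carrier μ) ∈ _ at h
    convert h using 1
    rw [hy, hedef, map_add, map_sub]
    abel

/-- The same scheme one degree lower. The error `e` is a cocycle to order `k + 1` whose image is a
coboundary, so injectivity on `H¹` gives `e = db`. Controlling `l' - f(l)` as well is what allows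
the induction to continue; its new error is a cocycle of degree 0, removed by surjectivity on `H⁰`.
-/
lemma Hom.inj_step (hf : f.toHom.IsEquivalence 1) {k : ℕ} (hk : 1 ≤ k) (ω₁ ω₂ : C.MC A)
    {l : A.carrier ⊗[ℂ] C.carrier} {l' : A.carrier ⊗[ℂ] D.carrier} (hl : l ∈ nilTensor A (C.gr 0))
    (hl' : l' ∈ nilTensor A (D.gr 0))
    (h : D.gauge A l' (f.mapMC ω₁).1 = (f.mapMC ω₂).1)
    (hll : l' - f.toFun.baseChange A.carrier l ∈ mpow A k D.carrier)
    (he : ω₂.1 - C.gauge A l ω₁.1 ∈ mpow A k C.carrier) :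
    ∃ l₂ ∈ nilTensor A (C.gr 0),
      l' - f.toFun.baseChange A.carrier l₂ ∈ mpow A (k + 1) D.carrier ∧
      ω₂.1 - C.gauge A l₂ ω₁.1 ∈ mpow A (k + 1) C.carrier := by
  obtain ⟨c⟩ := C.exists_contraction
  obtain ⟨c'⟩ := D.exists_contraction
  have hl₀ := (mem_nilTensor_iff _ _).1 hl
  have hl₀' := (mem_nilTensor_iff _ _).1 hl'
  have h₁ := (mem_nilTensor_iff _ _).1 ω₁.2.1
  have hf₁ := (mem_nilTensor_iff _ _).1 (f.mapMC ω₁).2.1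
  set e := ω₂.1 - C.gauge A l ω₁.1 with hedef
  set δ := l' - f.toFun.baseChange A.carrier l with hδ
  have he₁ : e ∈ (C.gr 1).baseChange A.carrier :=
    sub_mem (nilTensor_le A _ ω₂.2.1) (gauge_base hl ω₁.2.1)
  have hde : C.dTensor A.carrier e ∈ mpow A (k + 1) C.carrier :=
    dTensor_sub_mem hk ((mem_nilTensor_iff _ _).1 (C.gauge_mem hl ω₁.2.1)).2 he
      (C.curvature_gauge hl (nilTensor_le A _ ω₁.2.1) ω₁.2.2) ω₂.2.2
  have hfe : f.toFun.baseChange A.carrier e + D.dTensor A.carrier δ ∈ mpow A (k + 1) D.carrier := by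
    have := D.gauge_add_sub_mem hk (map_mem_mpow (f.toFun.baseChange A.carrier) hl₀.2) hll hf₁.2
    rw [hδ, add_sub_cancel, h] at this
    have e₂ : (f.mapMC ω₂).1 = f.toFun.baseChange A.carrier ω₂.1 := rfl
    have e₃ : (f.mapMC ω₁).1 = f.toFun.baseChange A.carrier ω₁.1 := rfl
    rw [e₂, e₃, ← f.map_gauge hl₀.2] at this
    convert this using 1
    rw [hedef, hδ, map_sub]
    abel
  have hb := c.sub_d_h_mem f.toHom (j := 1) (hf.1 1 le_rfl).injOn he₁ hde δ hfe
  set b := c.h.baseChange A.carrier e with hbdef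
  have hbk : b ∈ mpow A k C.carrier := map_mem_mpow _ he
  have hb₀ : b ∈ (C.gr 0).baseChange A.carrier :=
    baseChange_apply_mem A.carrier c.h _ _ (fun _ h => c.h_mem h) he₁
  change e - C.dTensor A.carrier b ∈ mpow A (k + 1) C.carrier at hb
  have hfb : f.toFun.baseChange A.carrier b ∈ (D.gr 0).baseChange A.carrier :=
    baseChange_apply_mem A.carrier f.toFun _ _ (fun _ h => f.map_mem h) hb₀
  have hδ₀ : δ ∈ (D.gr 0).baseChange A.carrier := sub_mem hl₀'.1
    (baseChange_apply_mem A.carrier f.toFun _ _ (fun _ h => f.map_mem h) hl₀.1)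
  have hdδ : D.dTensor A.carrier (δ + f.toFun.baseChange A.carrier b) ∈
      mpow A (k + 1) D.carrier := by
    rw [map_add, ← f.map_dTensor]
    have h₁ := sub_mem hfe (map_mem_mpow (f.toFun.baseChange A.carrier) hb)
    rw [map_sub (f.toFun.baseChange A.carrier) e] at h₁
    convert h₁ using 1
    abel
  obtain ⟨z, hz₀, hzk, hdz, hz⟩ := c'.exists_sub_d_h_mem f.toHom (j := 0)
    (hf.1 0 zero_le).surjOn (add_mem hδ₀ hfb) (add_mem hll (map_mem_mpow _ hbk)) hdδ
  -- There are no coboundaries in degree 0, so the correction by `h` is zero.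
  have hh : c'.h.baseChange A.carrier (δ + f.toFun.baseChange A.carrier b -
      f.toFun.baseChange A.carrier z) = 0 := by
    have := baseChange_apply_eq A.carrier (f := c'.h) (g := 0) (S := D.gr 0)
      (fun x hx => c'.h_zero hx) (sub_mem (add_mem hδ₀ hfb)
        (baseChange_apply_mem A.carrier f.toFun _ _ (fun _ h => f.map_mem h) hz₀))
    rwa [LinearMap.baseChange_zero, LinearMap.zero_apply] at this
  rw [hh, map_zero, sub_zero] at hz
  refine ⟨l + (z - b), add_mem hl (mem_baseChange_and_mem hk (sub_mem hz₀ hb₀) (sub_mem hzk hbk)),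
    ?_, ?_⟩
  · convert hz using 1
    rw [hδ, map_add, map_sub]
    abel
  · have h := sub_mem hb (C.gauge_add_sub_mem hk hl₀.2 (sub_mem hzk hbk) h₁.2)
    have hdz' : C.dTensor A.carrier z = 0 := hdz
    rw [map_sub, hdz'] at h
    convert h using 1
    rw [hedef]
    abel

/-- A 1-equivalence is essentially surjective on Maurer–Cartan elements. -/
lemma Hom.exists_mapMC_iso (hf : f.toHom.IsEquivalence 1) (η : D.MC A) :
    ∃ ω : C.MC A, (f.mapMC ω).Iso η := by
  have key : ∀ k, ∃ ω ∈ nilTensor A (C.gr 1), ∃ l ∈ nilTensor A (D.gr 0),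
      C.curvature A.carrier ω ∈ mpow A (k + 1) C.carrier ∧
      D.gauge A l η.1 - f.toFun.baseChange A.carrier ω ∈ mpow A (k + 1) D.carrier := by
    intro k
    induction k with
    | zero =>
      refine ⟨0, zero_mem _, 0, zero_mem _, ?_, ?_⟩
      · simp [curvature]
      · rw [gauge_zero, map_zero, sub_zero]
        exact ((mem_nilTensor_iff _ _).1 η.2.1).2
    | succ k ih =>
      obtain ⟨ω, hω, l, hl, h, h'⟩ := ih
      exact f.surj_step hf (by omega) η hω hl h h'
  obtain ⟨N, hN⟩ := A.exists_m_pow_eq_bot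
  have hN' : A.m ^ (N + 1) = ⊥ := by rw [pow_succ, hN, Ideal.bot_mul]
  obtain ⟨ω, hω, l, hl, h, h'⟩ := key N
  rw [mpow_eq_bot hN', Submodule.mem_bot] at h h'
  exact ⟨⟨ω, hω, h⟩, MC.iso_equivalence.symm ⟨l, hl, sub_eq_zero.1 h'⟩⟩

/-- A 1-equivalence reflects isomorphism of Maurer–Cartan elements. -/
lemma Hom.iso_of_mapMC_iso (hf : f.toHom.IsEquivalence 1) {ω₁ ω₂ : C.MC A}
    (h : (f.mapMC ω₁).Iso (f.mapMC ω₂)) : ω₁.Iso ω₂ := by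
  obtain ⟨l', hl', h⟩ := h
  have key : ∀ k, ∃ l ∈ nilTensor A (C.gr 0),
      l' - f.toFun.baseChange A.carrier l ∈ mpow A (k + 1) D.carrier ∧
      ω₂.1 - C.gauge A l ω₁.1 ∈ mpow A (k + 1) C.carrier := by
    intro k
    induction k with
    | zero =>
      refine ⟨0, zero_mem _, ?_, ?_⟩
      · rw [map_zero, sub_zero]
        exact ((mem_nilTensor_iff _ _).1 hl').2
      · rw [gauge_zero]
        exact sub_mem ((mem_nilTensor_iff _ _).1 ω₂.2.1).2 ((mem_nilTensor_iff _ _).1 ω₁.2.1).2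
    | succ k ih =>
      obtain ⟨l, hl, h₁, h₂⟩ := ih
      exact f.inj_step hf (by omega) ω₁ ω₂ hl hl' h h₁ h₂
  obtain ⟨N, hN⟩ := A.exists_m_pow_eq_bot
  have hN' : A.m ^ (N + 1) = ⊥ := by rw [pow_succ, hN, Ideal.bot_mul]
  obtain ⟨l, hl, -, h₂⟩ := key N
  rw [mpow_eq_bot hN', Submodule.mem_bot] at h₂
  exact ⟨l, hl, (sub_eq_zero.1 h₂).symm⟩

lemma Hom.mapMC_iso_mapMC {ω₁ ω₂ : C.MC A} (h : ω₁.Iso ω₂) : (f.mapMC ω₁).Iso (f.mapMC ω₂) := by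
  obtain ⟨l, hl, e⟩ := h
  refine ⟨f.toFun.baseChange A.carrier l,
    baseChange_smul_mem _ f.toFun (fun _ h => f.map_mem h) _ hl, ?_⟩
  have := f.map_gauge ((mem_nilTensor_iff _ _).1 hl).2 ω₁.1
  rw [e] at this
  exact this.symm

lemma Hom.mapMC_push {B : ArtAlg} (p : A ⟶ B) (ω : C.MC A) :
    f.mapMC (ω.push p) = (f.mapMC ω).push p :=
  Subtype.ext (pushTensor_baseChange p.1 f.toFun ω.1).symm

end DGLA

/-! ### Deformations and Aomoto complexes of a formal pair -/

namespace DGLAPair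

/-- `P` and `Q` have isomorphic deformation functors, and Maurer–Cartan elements that correspond
to each other have Aomoto complexes that are homotopy equivalent near the degrees up to `q`. -/
def DefEquiv (q : ℕ∞) (P Q : DGLAPair.{u, v}) : Prop :=
  ∃ Ψ : P.C.Def ≅ Q.C.Def, ∀ (A : ArtAlg) (ω : P.C.MC A) (η : Q.C.MC A),
    Ψ.hom.app A (Quot.mk _ ω) = Quot.mk _ η → ∀ i : ℕ, (i : ℕ∞) ≤ q →
      (ThreeTerm.ofComplex (P.M.aomoto ω.isFlat) i).HEq
        (ThreeTerm.ofComplex (Q.M.aomoto η.isFlat) i)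

lemma DefEquiv.refl (q : ℕ∞) (P : DGLAPair.{u, v}) : DefEquiv q P P :=
  ⟨Iso.refl _, fun _ _ _ h i _ => P.M.heq_aomoto_of_iso (DGLA.MC.mk_eq_mk.1 h) i⟩

lemma DefEquiv.symm {q : ℕ∞} {P Q : DGLAPair.{u, v}} (h : DefEquiv q P Q) : DefEquiv q Q P := by
  obtain ⟨Ψ, h⟩ := h
  refine ⟨Ψ.symm, fun A ω η e i hi => (h A η ω ?_ i hi).symm⟩
  rw [← e]
  exact congrFun (congrArg (fun φ => (φ.app A : _ → _)) Ψ.inv_hom_id) _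

lemma DefEquiv.trans {q : ℕ∞} {P Q R : DGLAPair.{u, v}} (h : DefEquiv q P Q)
    (h' : DefEquiv q Q R) : DefEquiv q P R := by
  obtain ⟨Ψ, h⟩ := h
  obtain ⟨Ψ', h'⟩ := h'
  refine ⟨Ψ ≪≫ Ψ', fun A ω ζ e i hi => ?_⟩
  obtain ⟨η, hη⟩ := Quot.exists_rep (Ψ.hom.app A (Quot.mk _ ω))
  refine (h A ω η hη.symm i hi).trans (h' A η ζ ?_ i hi)
  rw [hη]
  exact e

lemma Hom.defEquiv {q : ℕ∞} {P Q : DGLAPair.{u, v}} (g : P.Hom Q) (hg : g.IsEquivalence q) :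
    DefEquiv q P Q := by
  let Ψ : P.C.Def ⟶ Q.C.Def :=
    { app A := ↾Quot.map g.toDGLA.mapMC fun _ _ h => g.toDGLA.mapMC_iso_mapMC h
      naturality A B p := by
        ext x
        induction x using Quot.ind with
        | mk ω => exact congrArg (Quot.mk _) (g.toDGLA.mapMC_push p ω) }
  have hΨ : ∀ A, IsIso (Ψ.app A) := by
    intro A
    rw [isIso_iff_bijective]
    constructor
    · intro x y h
      induction x using Quot.ind with
      | mk ω₁ =>
        induction y using Quot.ind with
        | mk ω₂ => exact Quot.sound (g.toDGLA.iso_of_mapMC_iso hg.1 (DGLA.MC.mk_eq_mk.1 h))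
    · intro y
      induction y using Quot.ind with
      | mk η =>
        obtain ⟨ω, hω⟩ := g.toDGLA.exists_mapMC_iso hg.1 η
        exact ⟨Quot.mk _ ω, Quot.sound hω⟩
  have := NatIso.isIso_of_isIso_app Ψ
  refine ⟨asIso Ψ, fun A ω η h i hi => ?_⟩
  exact (g.heq_aomoto ω hg.2 hi).trans (Q.M.heq_aomoto_of_iso (DGLA.MC.mk_eq_mk.1 h) i)

/-- The arrows of the zig-zag point both ways, so there need be no homomorphism from `P` to its
cohomology. What passes along the zig-zag is the symmetric and transitive relation `DefEquiv`. -/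
lemma IsFormal.defEquiv {q : ℕ∞} {P : DGLAPair.{u, v}} (h : P.IsFormal q) :
    DefEquiv q P P.cohomology := by
  have key : ∀ {P Q : DGLAPair.{u, v}}, SameHomotopyType q P Q → DefEquiv q P Q := by
    intro P Q h
    induction h with
    | rel P Q h =>
      obtain ⟨-, -, g, hg⟩ := h
      exact g.defEquiv hg
    | refl P => exact DefEquiv.refl q P
    | symm P Q _ h => exact h.symm
    | trans P Q R _ _ h h' => exact h.trans h'
  exact key h

end DGLAPair

/-! ### Coordinates of tensors -/

section Coordinates

variable {V : Type u} {W : Type v} [AddCommGroup V] [Module ℂ V] [AddCommGroup W] [Module ℂ W]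

/-- The map `V ⊗ A → A` given by a linear form on `V`. -/
noncomputable def tensorCoord (A : Type t) [CommRing A] [Algebra ℂ A] (l : Module.Dual ℂ V) :
    A ⊗[ℂ] V →ₗ[A] A :=
  (TensorProduct.AlgebraTensorModule.rid ℂ A A).toLinearMap ∘ₗ LinearMap.baseChange A l

variable {A : Type t} [CommRing A] [Algebra ℂ A] {B : Type s} [CommRing B] [Algebra ℂ B]

lemma tensorCoord_apply (l : Module.Dual ℂ V) (x : A ⊗[ℂ] V) :
    tensorCoord A l x = TensorProduct.rid ℂ A (LinearMap.lTensor A l x) := rfl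

lemma tensorCoord_tmul (l : Module.Dual ℂ V) (a : A) (x : V) :
    tensorCoord A l (a ⊗ₜ x) = l x • a := by
  rw [tensorCoord_apply, LinearMap.lTensor_tmul, TensorProduct.rid_tmul]

lemma tensorCoord_push (p : A →ₐ[ℂ] B) (l : Module.Dual ℂ V) (x : A ⊗[ℂ] V) :
    tensorCoord B l (pushTensor p V x) = p (tensorCoord A l x) :=
  rid_lTensor_pushTensor p l x

lemma tensorCoord_baseChange (f : V →ₗ[ℂ] W) (l : Module.Dual ℂ W) (x : A ⊗[ℂ] V) :
    tensorCoord A l (f.baseChange A x) = tensorCoord A (l ∘ₗ f) x := by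
  rw [tensorCoord, tensorCoord, LinearMap.baseChange_comp]
  rfl

lemma tensorCoord_ext {x y : A ⊗[ℂ] V} (h : ∀ l, tensorCoord A l x = tensorCoord A l y) :
    x = y := by
  rw [← sub_eq_zero]
  refine eq_zero_of_forall_dual A _ fun l => ?_
  rw [← tensorCoord_apply, map_sub, h, sub_self]

/-- Expand in a basis of `V`: only finitely many coordinates are nonzero, and each is the value of a
linear form. -/
lemma mem_smul_top_iff_coord (J : Ideal A) (x : A ⊗[ℂ] V) :
    x ∈ J • (⊤ : Submodule A (A ⊗[ℂ] V)) ↔ ∀ l, tensorCoord A l x ∈ J := by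
  constructor
  · intro hx l
    have := smul_top_map_le J (tensorCoord A l) hx
    rwa [smul_eq_mul, Ideal.mul_top] at this
  · intro h
    classical
    let b := Module.Free.chooseBasis ℂ V
    rw [← (TensorProduct.equivFinsuppOfBasisRight (M := A) b).symm_apply_apply x,
      TensorProduct.equivFinsuppOfBasisRight_symm_apply]
    refine Submodule.sum_mem _ fun i _ => ?_
    rw [TensorProduct.equivFinsuppOfBasisRight_apply]
    have : ∀ a : A, ∀ y : V, a ∈ J → a ⊗ₜ[ℂ] y ∈ J • (⊤ : Submodule A (A ⊗[ℂ] V)) := by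
      intro a y ha
      rw [← mul_one a, ← smul_eq_mul, ← TensorProduct.smul_tmul']
      exact Submodule.smul_mem_smul ha Submodule.mem_top
    exact this _ _ (h (b.coord i))

/-- An element of `V ⊗ A` may be given by its coordinates. -/
lemma exists_tensorCoord [FiniteDimensional ℂ V] (f : Module.Dual ℂ V →ₗ[ℂ] A) :
    ∃ x : A ⊗[ℂ] V, ∀ l, tensorCoord A l x = f l := by
  let b := Module.finBasis ℂ V
  refine ⟨∑ i, f (b.coord i) ⊗ₜ b i, fun l => ?_⟩
  rw [map_sum]
  simp only [tensorCoord_tmul]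
  rw [← b.sum_dual_apply_smul_coord l, map_sum]
  simp only [map_smul]
  refine Finset.sum_congr rfl fun i _ => ?_
  rw [b.sum_dual_apply_smul_coord l]

lemma mem_smul_top_of_push_eq_zero {p : A →ₐ[ℂ] B} {J : Ideal A} (hJ : ∀ a, p a = 0 → a ∈ J)
    {x : A ⊗[ℂ] V} (hx : pushTensor p V x = 0) : x ∈ J • (⊤ : Submodule A (A ⊗[ℂ] V)) := by
  rw [mem_smul_top_iff_coord]
  intro l
  refine hJ _ ?_
  rw [← tensorCoord_push, hx, map_zero]

lemma pushTensor_comp {D : Type*} [CommRing D] [Algebra ℂ D] (p : A →ₐ[ℂ] B) (r : B →ₐ[ℂ] D)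
    (x : A ⊗[ℂ] V) : pushTensor (r.comp p) V x = pushTensor r V (pushTensor p V x) := by
  change LinearMap.rTensor V (r.toLinearMap ∘ₗ p.toLinearMap) x = _
  rw [LinearMap.rTensor_comp]
  rfl

end Coordinates

/-! ### Residue fields and truncations -/

namespace ArtAlg

lemma isNilpotent_of_mem {A : ArtAlg} {a : A.carrier} (ha : a ∈ A.m) : IsNilpotent a := by
  obtain ⟨N, hN⟩ := A.exists_m_pow_eq_bot
  exact ⟨N, by simpa [hN] using Ideal.pow_mem_pow ha N⟩

lemma mem_of_isNilpotent {A : ArtAlg} {a : A.carrier} (ha : IsNilpotent a) : a ∈ A.m :=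
  fun h => ha.not_isUnit h

/-- Every homomorphism of Artinian local algebras is local. -/
def ofHom {A B : ArtAlg} (f : A.carrier →ₐ[ℂ] B.carrier) : A ⟶ B :=
  ⟨f, ⟨fun a h => by
    by_contra ha
    exact mem_of_isNilpotent ((isNilpotent_of_mem (A := A) (a := a) ha).map f) h⟩⟩

/-- By the Nullstellensatz the residue field of an algebra of finite type is finite over `ℂ`, hence
equal to `ℂ`. -/
lemma exists_augmentation (A : ArtAlg) : ∃ α : A.carrier →ₐ[ℂ] ℂ, RingHom.ker α = A.m := by
  have : Algebra.FiniteType ℂ (IsLocalRing.ResidueField A.carrier) :=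
    Algebra.FiniteType.of_surjective (Ideal.Quotient.mkₐ ℂ A.m) (Ideal.Quotient.mkₐ_surjective ℂ _)
  have : Module.Finite ℂ (IsLocalRing.ResidueField A.carrier) :=
    finite_of_finite_type_of_isJacobsonRing _ _
  have hb := IsAlgClosed.algebraMap_bijective_of_isIntegral (k := ℂ)
    (K := IsLocalRing.ResidueField A.carrier)
  let e : ℂ ≃ₐ[ℂ] IsLocalRing.ResidueField A.carrier :=
    AlgEquiv.ofBijective (Algebra.ofId ℂ _) hb
  refine ⟨e.symm.toAlgHom.comp (Ideal.Quotient.mkₐ ℂ A.m), ?_⟩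
  ext a
  rw [RingHom.mem_ker]
  exact (EmbeddingLike.map_eq_zero_iff (f := e.symm)).trans Ideal.Quotient.eq_zero_iff_mem

/-- Modulo a power of the ideal of a `ℂ`-point, every element is a scalar plus a nilpotent. This
yields integrality, hence finite dimension, and locality. -/
lemma exists_truncation {B : Type u} [CommRing B] [Algebra ℂ B] [Algebra.FiniteType ℂ B]
    (α : B →ₐ[ℂ] ℂ) (N : ℕ) : ∃ (R : ArtAlg) (π : B →ₐ[ℂ] R.carrier), Function.Surjective π ∧
      RingHom.ker π = RingHom.ker α ^ (N + 1) := by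
  let I := RingHom.ker α
  let Q := B ⧸ I ^ (N + 1)
  have hI : I ≠ ⊤ := RingHom.ker_ne_top α
  have hQ : Nontrivial Q := Ideal.Quotient.nontrivial_iff.2 fun h =>
    hI (eq_top_iff.2 (h.ge.trans (Ideal.pow_le_self (by omega))))
  have hnil : ∀ b ∈ I, IsNilpotent (Ideal.Quotient.mk (I ^ (N + 1)) b) := fun b hb =>
    ⟨N + 1, by rw [← map_pow, Ideal.Quotient.eq_zero_iff_mem]; exact Ideal.pow_mem_pow hb _⟩
  have hdec : ∀ x : Q, ∃ c : ℂ, IsNilpotent (x - algebraMap ℂ Q c) := by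
    intro x
    obtain ⟨b, rfl⟩ := Ideal.Quotient.mk_surjective x
    refine ⟨α b, ?_⟩
    have := hnil (b - algebraMap ℂ B (α b)) (by rw [RingHom.mem_ker, map_sub, AlgHom.commutes]; simp)
    rwa [map_sub] at this
  have hint : Algebra.IsIntegral ℂ Q := ⟨fun x => by
    obtain ⟨c, h⟩ := hdec x
    have h' : IsIntegral ℂ (x - algebraMap ℂ Q c) := by
      obtain ⟨n, hn⟩ := h
      refine IsIntegral.of_pow (n := n + 1) (by omega) ?_
      rw [pow_succ (x - algebraMap ℂ Q c) n, hn, zero_mul]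
      exact isIntegral_zero
    have := h'.add (isIntegral_algebraMap (R := ℂ) (x := c))
    rwa [sub_add_cancel] at this⟩
  have hft : Algebra.FiniteType ℂ Q :=
    Algebra.FiniteType.of_surjective (Ideal.Quotient.mkₐ ℂ _) (Ideal.Quotient.mkₐ_surjective ℂ _)
  have hfin : Module.Finite ℂ Q := Algebra.IsIntegral.finite
  have hloc : IsLocalRing Q := IsLocalRing.of_isUnit_or_isUnit_one_sub_self fun x => by
    obtain ⟨c, h⟩ := hdec x
    by_cases hc : c = 0
    · rw [hc, map_zero, sub_zero] at h
      exact Or.inr h.isUnit_one_sub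
    · refine Or.inl ?_
      have := h.isUnit_add_left_of_commute ((isUnit_iff_ne_zero.2 hc).map (algebraMap ℂ Q))
        (Commute.all _ _)
      rwa [add_sub_cancel] at this
  -- A finite-dimensional space is in bijection with some `ℂⁿ`, which lives in the lowest universe,
  -- as `ArtAlg` demands.
  have hsmall : Small.{0} Q := by
    let b := Module.finBasis ℂ Q
    exact ⟨_, ⟨b.equivFun.toEquiv⟩⟩
  let e : Q ≃ₐ[ℂ] Shrink.{0} Q := (Shrink.algEquiv ℂ Q).symm
  have : IsLocalRing (Shrink.{0} Q) := e.toRingEquiv.isLocalRing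
  have : Module.Finite ℂ (Shrink.{0} Q) := Module.Finite.equiv e.toLinearEquiv
  have : IsArtinianRing (Shrink.{0} Q) := IsArtinianRing.of_finite ℂ _
  refine ⟨⟨Shrink.{0} Q⟩, e.toAlgHom.comp (Ideal.Quotient.mkₐ ℂ _), ?_, ?_⟩
  · exact e.surjective.comp (Ideal.Quotient.mkₐ_surjective ℂ _)
  · ext b
    rw [RingHom.mem_ker]
    change e (Ideal.Quotient.mk _ b) = 0 ↔ _
    rw [EmbeddingLike.map_eq_zero_iff, Ideal.Quotient.eq_zero_iff_mem]

/-- The dual numbers. -/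
noncomputable def dual : ArtAlg :=
  have : Module.Finite ℂ (DualNumber ℂ) := inferInstanceAs (Module.Finite ℂ (ℂ × ℂ))
  have : IsArtinianRing (DualNumber ℂ) := IsArtinianRing.of_finite ℂ _
  { carrier := DualNumber ℂ }

end ArtAlg

/-! ### Lifting tensors along surjections -/

section Surjective

variable {V : Type u} [AddCommGroup V] [Module ℂ V] {A B : ArtAlg}

lemma exists_mem_m {p : A ⟶ B} (hp : Function.Surjective p.1) {b : B.carrier} (hb : b ∈ B.m) :
    ∃ a ∈ A.m, p.1 a = b := by
  obtain ⟨a, rfl⟩ := hp b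
  exact ⟨a, fun h => hb (h.map p.1), rfl⟩

lemma exists_pushTensor_eq {p : A ⟶ B} (hp : Function.Surjective p.1) (S : Submodule ℂ V)
    {y : B.carrier ⊗[ℂ] V} (hy : y ∈ nilTensor B S) :
    ∃ x ∈ nilTensor A S, pushTensor p.1 V x = y := by
  have key : ∀ z ∈ S.baseChange B.carrier, ∃ x ∈ S.baseChange A.carrier, pushTensor p.1 V x = z := by
    intro z hz
    rw [Submodule.baseChange_eq_span] at hz
    induction hz using Submodule.span_induction with
    | mem x hx =>
      obtain ⟨x, hx, rfl⟩ := hx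
      exact ⟨1 ⊗ₜ x, Submodule.tmul_mem_baseChange_of_mem 1 hx, by
        rw [pushTensor_tmul, map_one]
        rfl⟩
    | zero => exact ⟨0, zero_mem _, map_zero _⟩
    | add x y _ _ hx hy =>
      obtain ⟨x, hx, rfl⟩ := hx
      obtain ⟨y, hy, rfl⟩ := hy
      exact ⟨x + y, add_mem hx hy, map_add _ _ _⟩
    | smul b x _ hx =>
      obtain ⟨x, hx, rfl⟩ := hx
      obtain ⟨a, rfl⟩ := hp b
      exact ⟨a • x, Submodule.smul_mem _ _ hx, pushTensor_smul _ _ _⟩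
  induction hy using Submodule.smul_induction_on' with
  | smul b hb z hz =>
    obtain ⟨x, hx, rfl⟩ := key z hz
    obtain ⟨a, ha, rfl⟩ := exists_mem_m hp hb
    exact ⟨a • x, Submodule.smul_mem_smul ha hx, pushTensor_smul _ _ _⟩
  | add x _ y _ hx hy =>
    obtain ⟨x, hx, rfl⟩ := hx
    obtain ⟨y, hy, rfl⟩ := hy
    exact ⟨x + y, add_mem hx hy, map_add _ _ _⟩

end Surjective

/-! ### Maurer–Cartan elements as points of the space of flat connections -/

namespace DGLA

lemma push_isFlat {C : DGLA.{u}} {A : Type t} [CommRing A] [Algebra ℂ A] {B : Type s} [CommRing B]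
    [Algebra ℂ B] (φ : A →ₐ[ℂ] B) {ω : A ⊗[ℂ] C.carrier}
    (hω : C.IsFlat A ω) : C.IsFlat B (pushTensor φ C.carrier ω) :=
  ⟨pushTensor_mem _ _ hω.mem, by rw [curvature_push, hω.curvature_eq, map_zero]⟩

variable (C : DGLA.{u}) [FiniteDimensional ℂ (C.gr 1)]

lemma tensorCoord_tautPoly (l : Module.Dual ℂ C.carrier) :
    tensorCoord C.PolyRing l C.tautPoly =
      SymmetricAlgebra.ι ℂ (Module.Dual ℂ (C.gr 1)) (l ∘ₗ (C.gr 1).subtype) := by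
  let b := Module.Basis.ofVectorSpace ℂ (C.gr 1)
  have e := coevaluation_apply_one ℂ (C.gr 1)
  simp only at e
  rw [tautPoly, e, map_sum, map_sum, map_sum]
  simp only [TensorProduct.comm_tmul, TensorProduct.map_tmul, tensorCoord_tmul]
  simp only [← map_smul, ← map_sum]
  exact congrArg _ (b.sum_dual_apply_smul_coord (l ∘ₗ (C.gr 1).subtype))

lemma tensorCoord_taut (l : Module.Dual ℂ C.carrier) :
    tensorCoord C.FlatRing l C.taut = C.flatCoord (l ∘ₗ (C.gr 1).subtype) := by
  rw [taut, tensorCoord_push, tensorCoord_tautPoly]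
  rfl

variable {C} {A : Type t} [CommRing A] [Algebra ℂ A]

lemma tensorCoord_push_taut (φ : C.FlatRing →ₐ[ℂ] A) (l : Module.Dual ℂ C.carrier) :
    tensorCoord A l (pushTensor φ C.carrier C.taut) = φ (C.flatCoord (l ∘ₗ (C.gr 1).subtype)) := by
  rw [tensorCoord_push, tensorCoord_taut]

lemma flatHom_ext {φ ψ : C.FlatRing →ₐ[ℂ] A}
    (h : ∀ l, φ (C.flatCoord l) = ψ (C.flatCoord l)) : φ = ψ := by
  refine Ideal.Quotient.algHom_ext _ (SymmetricAlgebra.algHom_ext (LinearMap.ext fun l => ?_))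
  exact h l

/-- The coordinates of the tautological element generate the coordinate ring. -/
lemma flatHom_ext_taut {φ ψ : C.FlatRing →ₐ[ℂ] A}
    (h : pushTensor φ C.carrier C.taut = pushTensor ψ C.carrier C.taut) : φ = ψ := by
  refine flatHom_ext fun l => ?_
  obtain ⟨L, rfl⟩ := LinearMap.exists_extend l
  rw [← tensorCoord_push_taut, h, tensorCoord_push_taut]

/-- The universal property of the space of flat connections. -/
lemma exists_flatHom {ω : A ⊗[ℂ] C.carrier} (hω : C.IsFlat A ω) :
    ∃ φ : C.FlatRing →ₐ[ℂ] A, pushTensor φ C.carrier C.taut = ω := by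
  obtain ⟨r, hr⟩ := LinearMap.exists_leftInverse_of_injective (C.gr 1).subtype
    (LinearMap.ker_eq_bot.2 (C.gr 1).injective_subtype)
  have hω' : ∀ l : Module.Dual ℂ C.carrier,
      tensorCoord A ((l ∘ₗ (C.gr 1).subtype) ∘ₗ r) ω = tensorCoord A l ω := by
    intro l
    have e := baseChange_apply_eq A (f := (C.gr 1).subtype ∘ₗ r) (g := LinearMap.id) (S := C.gr 1)
      (fun y hy => congrArg Subtype.val (LinearMap.congr_fun hr ⟨y, hy⟩)) hω.mem
    rw [LinearMap.baseChange_id, LinearMap.id_apply] at e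
    nth_rewrite 2 [← e]
    rw [tensorCoord_baseChange]
    rfl
  let f : Module.Dual ℂ (C.gr 1) →ₗ[ℂ] A :=
    { toFun l := tensorCoord A (l ∘ₗ r) ω
      map_add' l l' := by
        rw [LinearMap.add_comp, tensorCoord_apply, LinearMap.lTensor_add, LinearMap.add_apply,
          map_add]
        rfl
      map_smul' c l := by
        rw [LinearMap.smul_comp, tensorCoord_apply, LinearMap.lTensor_smul, LinearMap.smul_apply,
          map_smul]
        rfl }
  let ψ : C.PolyRing →ₐ[ℂ] A := SymmetricAlgebra.lift f
  have hψ : ∀ l, ψ (SymmetricAlgebra.ι ℂ _ l) = tensorCoord A (l ∘ₗ r) ω := fun l =>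
    SymmetricAlgebra.lift_ι_apply ..
  have e : pushTensor ψ C.carrier C.tautPoly = ω := by
    refine tensorCoord_ext fun l => ?_
    rw [tensorCoord_push, tensorCoord_tautPoly, hψ, hω']
  refine ⟨Ideal.Quotient.liftₐ C.flatIdeal ψ fun x hx => ?_, ?_⟩
  · have : C.flatIdeal ≤ RingHom.ker ψ := by
      refine Ideal.span_le.2 ?_
      rintro _ ⟨l, rfl⟩
      rw [SetLike.mem_coe, RingHom.mem_ker]
      beta_reduce
      rw [← tensorCoord_apply, ← tensorCoord_push,
        ← curvature_push, e, hω.curvature_eq, map_zero]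
    exact this hx
  · rw [taut, ← pushTensor_comp]
    exact e

lemma push_taut_mem_iff {A : ArtAlg} (φ : C.FlatRing →ₐ[ℂ] A.carrier) :
    pushTensor φ C.carrier C.taut ∈ nilTensor A (C.gr 1) ↔ ∀ l, φ (C.flatCoord l) ∈ A.m := by
  rw [mem_nilTensor_iff, mpow, pow_one, mem_smul_top_iff_coord]
  constructor
  · rintro ⟨-, h⟩ l
    obtain ⟨L, rfl⟩ := LinearMap.exists_extend l
    rw [← tensorCoord_push_taut]
    exact h L
  · intro h
    refine ⟨(push_isFlat φ C.taut_isFlat).mem, fun l => ?_⟩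
    rw [tensorCoord_push_taut]
    exact h _

/-- The Maurer–Cartan element given by a homomorphism `𝒪(ℱ(C)) → A`. -/
noncomputable def MC.ofHom {A : ArtAlg} (φ : C.FlatRing →ₐ[ℂ] A.carrier)
    (h : ∀ l, φ (C.flatCoord l) ∈ A.m) : C.MC A :=
  ⟨pushTensor φ C.carrier C.taut, (push_taut_mem_iff φ).2 h,
    (push_isFlat φ C.taut_isFlat).curvature_eq⟩

lemma MC.exists_ofHom {A : ArtAlg} (ω : C.MC A) : ∃ φ h, ω = MC.ofHom φ h := by
  obtain ⟨φ, hφ⟩ := exists_flatHom ω.isFlat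
  refine ⟨φ, (push_taut_mem_iff φ).1 ?_, Subtype.ext hφ.symm⟩
  rw [hφ]
  exact ω.2.1

variable (C) in
/-- The ideal of the origin in `ℱ(C)`. -/
noncomputable def flatOrigin : Ideal C.FlatRing := Ideal.span (Set.range C.flatCoord)

variable (C) in
-- The zero connection is flat and gives the point. Modulo the coordinates the universal property
-- leaves only scalars, so the coordinates generate the whole kernel.
lemma exists_flatRing_augmentation : ∃ α : C.FlatRing →ₐ[ℂ] ℂ,
    RingHom.ker α = C.flatOrigin := by
  have h0 : C.IsFlat ℂ (0 : ℂ ⊗[ℂ] C.carrier) := ⟨zero_mem _, by simp [curvature]⟩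
  obtain ⟨α, hα⟩ := exists_flatHom h0
  have hα' : ∀ l, α (C.flatCoord l) = 0 := fun l => by
    obtain ⟨L, rfl⟩ := LinearMap.exists_extend l
    rw [← tensorCoord_push_taut, hα, map_zero]
  refine ⟨α, le_antisymm (fun b hb => ?_) (Ideal.span_le.2 ?_)⟩
  · have e : (Ideal.Quotient.mkₐ ℂ C.flatOrigin) =
        (Algebra.ofId ℂ _).comp α := by
      refine flatHom_ext (A := C.FlatRing ⧸ C.flatOrigin) fun l => ?_
      rw [AlgHom.comp_apply, hα', map_zero]
      exact Ideal.Quotient.eq_zero_iff_mem.2 (Ideal.subset_span ⟨l, rfl⟩)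
    have := DFunLike.congr_fun e b
    rw [AlgHom.comp_apply, show α b = 0 from hb, map_zero] at this
    exact Ideal.Quotient.eq_zero_iff_mem.1 this
  · rintro _ ⟨l, rfl⟩
    exact hα' l

instance : Algebra.FiniteType ℂ C.PolyRing :=
  Algebra.FiniteType.equiv inferInstance
    (SymmetricAlgebra.equivMvPolynomial (Module.finBasis ℂ (Module.Dual ℂ (C.gr 1)))).symm

instance : Algebra.FiniteType ℂ C.FlatRing :=
  Algebra.FiniteType.of_surjective (Ideal.Quotient.mkₐ ℂ C.flatIdeal)
    (Ideal.Quotient.mkₐ_surjective ℂ _)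

lemma map_flatOrigin_pow_eq_zero {A : ArtAlg} {φ : C.FlatRing →ₐ[ℂ] A.carrier}
    (h : ∀ l, φ (C.flatCoord l) ∈ A.m) {N : ℕ} (hN : A.m ^ N = ⊥) {b : C.FlatRing}
    (hb : b ∈ C.flatOrigin ^ N) : φ b = 0 := by
  have h₁ : C.flatOrigin ≤ A.m.comap φ := by
    refine Ideal.span_le.2 ?_
    rintro _ ⟨l, rfl⟩
    exact h l
  have h₂ := (Ideal.pow_right_mono h₁ N).trans (Ideal.le_comap_pow φ N) hb
  rwa [hN] at h₂

lemma exists_algHom_comp_eq {B : Type u} [CommRing B] [Algebra ℂ B] {R : Type s} [CommRing R]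
    [Algebra ℂ R] {π : B →ₐ[ℂ] R} (hπ : Function.Surjective π) (φ : B →ₐ[ℂ] A)
    (h : ∀ b, π b = 0 → φ b = 0) : ∃ g : R →ₐ[ℂ] A, g.comp π = φ := by
  refine ⟨(Ideal.Quotient.liftₐ (RingHom.ker π) φ h).comp
    (Ideal.quotientKerAlgEquivOfSurjective hπ).symm.toAlgHom, AlgHom.ext fun b => ?_⟩
  have : (Ideal.quotientKerAlgEquivOfSurjective hπ).symm (π b) =
      Ideal.Quotient.mk (RingHom.ker π) b := by
    rw [AlgEquiv.symm_apply_eq]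
    rfl
  rw [AlgHom.comp_apply, AlgHom.comp_apply]
  exact congrArg _ this

variable (C) in
/-- The infinitesimal neighbourhoods of the origin in `ℱ(C)`. -/
structure Truncations where
  R : ℕ → ArtAlg
  π : ∀ N, C.FlatRing →ₐ[ℂ] (R N).carrier
  surj : ∀ N, Function.Surjective (π N)
  ker : ∀ N b, π N b = 0 ↔ b ∈ C.flatOrigin ^ (N + 1)

variable (C) in
lemma nonempty_truncations : Nonempty C.Truncations := by
  obtain ⟨α, hα⟩ := C.exists_flatRing_augmentation
  choose R π hπ h using ArtAlg.exists_truncation α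
  refine ⟨⟨R, π, hπ, fun N b => ?_⟩⟩
  rw [← RingHom.mem_ker, h, hα]

namespace Truncations

variable (T : C.Truncations)

lemma π_mem (N : ℕ) {b : C.FlatRing} (hb : b ∈ C.flatOrigin) : T.π N b ∈ (T.R N).m :=
  ArtAlg.mem_of_isNilpotent ⟨N + 1, by
    rw [← map_pow, T.ker]
    exact Ideal.pow_mem_pow hb _⟩

/-- The universal Maurer–Cartan element. -/
noncomputable def univ (N : ℕ) : C.MC (T.R N) :=
  MC.ofHom (T.π N) fun l => T.π_mem N (Ideal.subset_span ⟨l, rfl⟩)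

/-- Together with `exists_hom`: on algebras with `m^(N+1) = 0`, the Maurer–Cartan functor is
represented by `T.R N` with universal element `T.univ N`. -/
lemma hom_ext {N : ℕ} {g h : (T.R N).carrier →ₐ[ℂ] A}
    (e : pushTensor g C.carrier (T.univ N).1 = pushTensor h C.carrier (T.univ N).1) : g = h := by
  have : g.comp (T.π N) = h.comp (T.π N) := flatHom_ext_taut (by
    rw [pushTensor_comp, pushTensor_comp]
    exact e)
  refine AlgHom.ext fun x => ?_
  obtain ⟨b, rfl⟩ := T.surj N x
  exact DFunLike.congr_fun this b

lemma exists_hom {A : ArtAlg} {N : ℕ} (hN : A.m ^ (N + 1) = ⊥) (η : C.MC A) :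
    ∃ g : T.R N ⟶ A, (T.univ N).push g = η := by
  obtain ⟨φ, h, rfl⟩ := η.exists_ofHom
  obtain ⟨g, hg⟩ := exists_algHom_comp_eq (T.surj N) φ fun b hb =>
    map_flatOrigin_pow_eq_zero h hN ((T.ker N b).1 hb)
  refine ⟨ArtAlg.ofHom g, Subtype.ext ?_⟩
  change pushTensor g C.carrier (pushTensor (T.π N) C.carrier C.taut) = _
  rw [← pushTensor_comp, hg]
  rfl

lemma exists_transition (N : ℕ) : ∃ τ : T.R (N + 1) ⟶ T.R N, Function.Surjective τ.1 ∧
    (T.univ (N + 1)).push τ = T.univ N := by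
  obtain ⟨g, hg⟩ := exists_algHom_comp_eq (T.surj (N + 1)) (T.π N) fun b hb =>
    (T.ker N b).2 (Ideal.pow_le_pow_right (by omega) ((T.ker (N + 1) b).1 hb))
  refine ⟨ArtAlg.ofHom g, fun x => ?_, Subtype.ext ?_⟩
  · obtain ⟨b, rfl⟩ := T.surj N x
    exact ⟨T.π (N + 1) b, DFunLike.congr_fun hg b⟩
  · change pushTensor g C.carrier (pushTensor (T.π (N + 1)) C.carrier C.taut) = _
    rw [← pushTensor_comp, hg]
    rfl

/-- The coordinates span `m / m²`: in a combination of coordinates, replacing each coefficient by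
its value at the origin costs only an element of `m²`. -/
lemma exists_sub_coord_mem {N : ℕ} {a : (T.R N).carrier} (ha : a ∈ (T.R N).m) :
    ∃ l : Module.Dual ℂ C.carrier, a - tensorCoord _ l (T.univ N).1 ∈ (T.R N).m ^ 2 := by
  obtain ⟨α, hα⟩ := C.exists_flatRing_augmentation
  have hsub : ∀ b, b - algebraMap ℂ C.FlatRing (α b) ∈ C.flatOrigin := fun b => by
    rw [← hα, RingHom.mem_ker, map_sub, AlgHom.commutes]
    exact sub_self _
  obtain ⟨b, rfl⟩ := T.surj N a
  have hb : b ∈ C.flatOrigin := by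
    have h₁ := sub_mem ha (T.π_mem N (hsub b))
    rw [map_sub, sub_sub_cancel, AlgHom.commutes] at h₁
    have h₂ : α b = 0 := by
      by_contra h
      exact h₁ ((isUnit_iff_ne_zero.2 h).map (algebraMap ℂ (T.R N).carrier))
    rw [← hα]
    exact h₂
  have hcoord : ∀ l : Module.Dual ℂ C.carrier, tensorCoord _ l (T.univ N).1 =
      T.π N (C.flatCoord (l ∘ₗ (C.gr 1).subtype)) := fun l => tensorCoord_push_taut (T.π N) l
  suffices h : ∃ l : Module.Dual ℂ (C.gr 1), T.π N b - T.π N (C.flatCoord l) ∈ (T.R N).m ^ 2 by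
    obtain ⟨l, h⟩ := h
    obtain ⟨L, rfl⟩ := LinearMap.exists_extend l
    exact ⟨L, by rwa [hcoord]⟩
  clear ha
  induction hb using Submodule.span_induction with
  | mem x hx =>
    obtain ⟨l, rfl⟩ := hx
    exact ⟨l, by rw [sub_self]; exact zero_mem _⟩
  | zero => exact ⟨0, by rw [map_zero, map_zero, map_zero, sub_self]; exact zero_mem _⟩
  | add x y _ _ hx hy =>
    obtain ⟨l, hx⟩ := hx
    obtain ⟨l', hy⟩ := hy
    refine ⟨l + l', ?_⟩
    rw [map_add, map_add, map_add, add_sub_add_comm]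
    exact add_mem hx hy
  | smul r x hx' hx =>
    obtain ⟨l, hx⟩ := hx
    refine ⟨α r • l, ?_⟩
    have h₁ := Ideal.mul_mem_mul (T.π_mem N (hsub r)) (T.π_mem N hx')
    rw [← pow_two] at h₁
    have h₂ := Ideal.mul_mem_left _ (algebraMap ℂ (T.R N).carrier (α r)) hx
    convert add_mem h₁ h₂ using 1
    rw [map_smul C.flatCoord, map_smul (T.π N) (α r), smul_eq_mul, map_mul, map_sub,
      AlgHom.commutes, Algebra.smul_def]
    ring

/-- A tensor in `V ⊗ m` is a linear image of the universal element, modulo `m²`. -/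
lemma exists_linear {N : ℕ} {V : Type v} [AddCommGroup V] [Module ℂ V]
    {x : (T.R N).carrier ⊗[ℂ] V} (hx : x ∈ (T.R N).m • (⊤ : Submodule (T.R N).carrier _)) :
    ∃ θ : C.carrier →ₗ[ℂ] V, x - θ.baseChange _ (T.univ N).1 ∈ mpow (T.R N) 2 V := by
  have hadd : ∀ x y : (T.R N).carrier ⊗[ℂ] V,
      (∃ θ : C.carrier →ₗ[ℂ] V, x - θ.baseChange _ (T.univ N).1 ∈ mpow (T.R N) 2 V) →
      (∃ θ : C.carrier →ₗ[ℂ] V, y - θ.baseChange _ (T.univ N).1 ∈ mpow (T.R N) 2 V) →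
      ∃ θ : C.carrier →ₗ[ℂ] V, x + y - θ.baseChange _ (T.univ N).1 ∈ mpow (T.R N) 2 V := by
    rintro x y ⟨θ, hx⟩ ⟨θ', hy⟩
    refine ⟨θ + θ', ?_⟩
    rw [LinearMap.baseChange_add, LinearMap.add_apply, add_sub_add_comm]
    exact add_mem hx hy
  induction hx using Submodule.smul_induction_on' with
  | add x _ y _ hx hy => exact hadd x y hx hy
  | smul a ha x _ =>
    induction x using TensorProduct.induction_on with
    | zero => exact ⟨0, by simp⟩
    | add x y hx hy =>
      rw [smul_add]
      exact hadd _ _ (hx trivial) (hy trivial)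
    | tmul b v =>
      obtain ⟨l, hl⟩ := T.exists_sub_coord_mem (Ideal.mul_mem_right b _ ha)
      refine ⟨l.smulRight v, ?_⟩
      have e : ∀ y : (T.R N).carrier ⊗[ℂ] C.carrier,
          (l.smulRight v).baseChange _ y = tensorCoord _ l y ⊗ₜ[ℂ] v := by
        intro y
        induction y using TensorProduct.induction_on with
        | zero => simp
        | add y y' hy hy' => rw [map_add, map_add, TensorProduct.add_tmul, hy, hy']
        | tmul c y =>
          rw [LinearMap.baseChange_tmul, tensorCoord_tmul, LinearMap.smulRight_apply,
            TensorProduct.smul_tmul]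
      rw [e, TensorProduct.smul_tmul', smul_eq_mul, ← TensorProduct.sub_tmul,
        mem_smul_top_iff_coord]
      intro l'
      rw [tensorCoord_tmul, Algebra.smul_def]
      exact Ideal.mul_mem_left _ _ hl

end Truncations

end DGLA

/-! ### A functorial section over the Maurer–Cartan functor -/

namespace DGLA

variable {C : DGLA.{u}} {H : DGLA.{u}}

lemma MC.push_comp {A B D : ArtAlg} (p : A ⟶ B) (r : B ⟶ D) (ω : C.MC A) :
    ω.push (p ≫ r) = (ω.push p).push r :=
  Subtype.ext (pushTensor_comp p.1 r.1 ω.1)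

lemma MC.push_gauge {A B : ArtAlg} (p : A ⟶ B) (ω : C.MC A) {l : A.carrier ⊗[ℂ] C.carrier}
    (hl : l ∈ nilTensor A (C.gr 0)) : (ω.gauge l hl).push p =
      (ω.push p).gauge (pushTensor p.1 C.carrier l) (pushTensor_nilTensor p _ hl) :=
  Subtype.ext (DGLA.push_gauge C p hl ω.1)

/-- Isomorphisms of Maurer–Cartan elements lift along surjections. -/
lemma MC.exists_iso_push_eq {A B : ArtAlg} {p : A ⟶ B} (hp : Function.Surjective p.1) (ω : C.MC A)
    {η : C.MC B} (h : (ω.push p).Iso η) : ∃ ω' : C.MC A, ω.Iso ω' ∧ ω'.push p = η := by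
  obtain ⟨l, hl, e⟩ := h
  obtain ⟨l', hl', rfl⟩ := exists_pushTensor_eq hp (C.gr 0) hl
  refine ⟨ω.gauge l' hl', ⟨l', hl', rfl⟩, ?_⟩
  rw [MC.push_gauge]
  exact Subtype.ext e

/-- The components of a natural isomorphism, on classes of Maurer–Cartan elements. -/
lemma Def.app_push (Ψ : C.Def ≅ H.Def) {A B : ArtAlg} (p : A ⟶ B) {ω : C.MC A} {η : H.MC A}
    (h : Ψ.hom.app A (Quot.mk _ ω) = Quot.mk _ η) :
    Ψ.hom.app B (Quot.mk _ (ω.push p)) = Quot.mk _ (η.push p) := by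
  have h₁ := ConcreteCategory.congr_hom (Ψ.hom.naturality p) (Quot.mk _ ω)
  refine h₁.trans ?_
  change H.Def.map p (Ψ.hom.app A (Quot.mk _ ω)) = _
  rw [h]
  rfl

lemma Def.app_injective (Ψ : C.Def ≅ H.Def) {A : ArtAlg} {ω ω' : C.MC A}
    (h : Ψ.hom.app A (Quot.mk _ ω) = Ψ.hom.app A (Quot.mk _ ω')) : ω.Iso ω' := by
  have hb : Function.Bijective (Ψ.hom.app A) := (isIso_iff_bijective _).1 inferInstance
  exact MC.mk_eq_mk.1 (hb.1 h)

lemma Def.exists_app_eq (Ψ : C.Def ≅ H.Def) {A : ArtAlg} (η : H.MC A) :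
    ∃ ω : C.MC A, Ψ.hom.app A (Quot.mk _ ω) = Quot.mk _ η := by
  have hb : Function.Bijective (Ψ.hom.app A) := (isIso_iff_bijective _).1 inferInstance
  obtain ⟨x, hx⟩ := hb.2 (Quot.mk _ η)
  obtain ⟨ω, rfl⟩ := Quot.exists_rep x
  exact ⟨ω, hx⟩

variable [FiniteDimensional ℂ (H.gr 1)]

/-- Any representative over the next truncation agrees with the previous choice up to gauge, and the
gauge transformation lifts along the surjection; so the representative can be corrected to restrict
on the nose. The quantifier over `τ` is harmless, as the universal element determines it. -/
lemma Truncations.exists_lifts (T : H.Truncations) (Ψ : C.Def ≅ H.Def) :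
    ∃ ω : ∀ N, C.MC (T.R N), (∀ N, Ψ.hom.app _ (Quot.mk _ (ω N)) = Quot.mk _ (T.univ N)) ∧
      ∀ N (τ : T.R (N + 1) ⟶ T.R N), (T.univ (N + 1)).push τ = T.univ N →
        (ω (N + 1)).push τ = ω N := by
  have step : ∀ N (ω : {ω : C.MC (T.R N) // Ψ.hom.app _ (Quot.mk _ ω) = Quot.mk _ (T.univ N)}),
      ∃ ω' : {ω : C.MC (T.R (N + 1)) // Ψ.hom.app _ (Quot.mk _ ω) = Quot.mk _ (T.univ (N + 1))},
        ∀ τ : T.R (N + 1) ⟶ T.R N, (T.univ (N + 1)).push τ = T.univ N → ω'.1.push τ = ω.1 := by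
    rintro N ⟨ω, hω⟩
    obtain ⟨τ, hτ, e⟩ := T.exists_transition N
    obtain ⟨ω₁, h₁⟩ := Def.exists_app_eq Ψ (T.univ (N + 1))
    have h₂ := Def.app_push Ψ τ h₁
    rw [e, ← hω] at h₂
    obtain ⟨ω₂, h₃, h₄⟩ := MC.exists_iso_push_eq hτ ω₁ (Def.app_injective Ψ h₂)
    refine ⟨⟨ω₂, by rw [← h₁, MC.mk_eq_mk.2 h₃]⟩, fun τ' e' => ?_⟩
    refine Eq.trans ?_ h₄
    refine congrArg (fun g => MC.push g ω₂) (Subtype.ext (T.hom_ext ?_))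
    exact congrArg Subtype.val (e'.trans e.symm)
  choose next hnext using step
  obtain ⟨ω₀, h₀⟩ := Def.exists_app_eq Ψ (T.univ 0)
  let ω : ∀ N, {ω : C.MC (T.R N) // Ψ.hom.app _ (Quot.mk _ ω) = Quot.mk _ (T.univ N)} :=
    fun N => Nat.rec ⟨ω₀, h₀⟩ (fun N ω => next N ω) N
  exact ⟨fun N => (ω N).1, fun N => (ω N).2, fun N => hnext N (ω N)⟩

/-- A section of `MC(C) → Def(C) ≅ Def(H)` over `MC(H)` that is functorial. -/
structure NatSection (Ψ : C.Def ≅ H.Def) where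
  σ : ∀ {A : ArtAlg}, H.MC A → C.MC A
  push : ∀ {A B : ArtAlg} (p : A ⟶ B) (η : H.MC A), σ (η.push p) = (σ η).push p
  app : ∀ {A : ArtAlg} (η : H.MC A), Ψ.hom.app A (Quot.mk _ (σ η)) = Quot.mk _ η
  linear : ∀ N : ℕ, ∃ θ : H.carrier →ₗ[ℂ] C.carrier, ∀ (A : ArtAlg), A.m ^ (N + 1) = ⊥ →
    ∀ (η η' : H.MC A) (k : ℕ), 1 ≤ k → η'.1 - η.1 ∈ mpow A k H.carrier →
      (σ η').1 - (σ η).1 - θ.baseChange A.carrier (η'.1 - η.1) ∈ mpow A (k + 1) C.carrier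

/-- Two points that agree to order `k` agree to order `k + 1` on products of two elements of `m`. So
only the linear part of a section matters at the next order. -/
lemma Truncations.push_sub_push_mem (T : H.Truncations) {N : ℕ} {A : ArtAlg}
    (g g' : T.R N ⟶ A) {k : ℕ}
    (h : ((T.univ N).push g').1 - ((T.univ N).push g).1 ∈ mpow A k H.carrier)
    {V : Type v} [AddCommGroup V] [Module ℂ V] {x : (T.R N).carrier ⊗[ℂ] V}
    (hx : x ∈ mpow (T.R N) 2 V) : pushTensor g'.1 V x - pushTensor g.1 V x ∈ mpow A (k + 1) V := by
  have h₁ : ∀ a, g'.1 a - g.1 a ∈ A.m ^ k := by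
    have e : (Ideal.Quotient.mkₐ ℂ (A.m ^ k)).comp g'.1 =
        (Ideal.Quotient.mkₐ ℂ (A.m ^ k)).comp g.1 := T.hom_ext (by
      refine tensorCoord_ext fun l => ?_
      rw [tensorCoord_push, tensorCoord_push, AlgHom.comp_apply, AlgHom.comp_apply]
      refine Ideal.Quotient.eq.2 ?_
      have := (mem_smul_top_iff_coord _ _).1 h l
      rw [map_sub] at this
      rwa [← tensorCoord_push, ← tensorCoord_push])
    exact fun a => Ideal.Quotient.eq.1 (DFunLike.congr_fun e a)
  rw [mem_smul_top_iff_coord] at hx ⊢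
  intro l
  rw [map_sub, tensorCoord_push, tensorCoord_push]
  have h₂ : ∀ a ∈ (T.R N).m ^ 2, g'.1 a - g.1 a ∈ A.m ^ (k + 1) := by
    intro a ha
    rw [pow_two] at ha
    induction ha using Submodule.mul_induction_on' with
    | mem_mul_mem a ha b hb =>
      have e : g'.1 (a * b) - g.1 (a * b) = (g'.1 b - g.1 b) * g'.1 a +
          (g'.1 a - g.1 a) * g.1 b := by
        rw [map_mul, map_mul]
        ring
      rw [e, pow_succ]
      exact add_mem (Ideal.mul_mem_mul (h₁ b) (ArtAlg.map_mem_m g' ha))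
        (Ideal.mul_mem_mul (h₁ a) (ArtAlg.map_mem_m g hb))
    | add a _ b _ ha hb =>
      rw [map_add, map_add, add_sub_add_comm]
      exact add_mem ha hb
  exact h₂ _ (hx l)

/-- An element `η` is the pushforward of a universal element along a unique map, and `σ η` is the
pushforward of the chosen lift along that map. The linear part `θ` of the section is read off from
the lift modulo `m²`. -/
lemma nonempty_natSection (Ψ : C.Def ≅ H.Def) : Nonempty (NatSection Ψ) := by
  obtain ⟨T⟩ := H.nonempty_truncations
  obtain ⟨ω, hω, hτ⟩ := T.exists_lifts Ψ
  choose n hn using fun A : ArtAlg => (A.exists_m_pow_eq_bot.imp fun N hN =>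
    show A.m ^ (N + 1) = ⊥ by rw [pow_succ, hN, Ideal.bot_mul])
  choose g hg using fun (A : ArtAlg) (η : H.MC A) => T.exists_hom (hn A) η
  have huniq : ∀ {A : ArtAlg} {N : ℕ} (f f' : T.R N ⟶ A),
      (T.univ N).push f = (T.univ N).push f' → f = f' := fun f f' h =>
    Subtype.ext (T.hom_ext (congrArg Subtype.val h))
  -- Independence of the truncation used to classify `η`, by compatibility of the lifts;
  -- functoriality follows by passing to a common truncation.
  have key : ∀ (A : ArtAlg) (η : H.MC A) M (_ : A.m ^ (M + 1) = ⊥) (f : T.R M ⟶ A)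
      (_ : (T.univ M).push f = η) N (_ : M ≤ N) (f' : T.R N ⟶ A) (_ : (T.univ N).push f' = η),
      (ω N).push f' = (ω M).push f := by
    intro A η M hM f hf N hN
    induction N, hN using Nat.le_induction with
    | base =>
      intro f' hf'
      rw [huniq f' f (hf'.trans hf.symm)]
    | succ N hN ih =>
      intro f' hf'
      obtain ⟨τ, -, e⟩ := T.exists_transition N
      obtain ⟨f'', hf''⟩ := T.exists_hom (N := N)
        (le_bot_iff.1 ((Ideal.pow_le_pow_right (by omega)).trans hM.le)) η
      rw [huniq f' (τ ≫ f'') (by rw [MC.push_comp, e, hf'', hf']), MC.push_comp, hτ N τ e,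
        ih f'' hf'']
  have key' : ∀ (A : ArtAlg) (η : H.MC A) N (_ : A.m ^ (N + 1) = ⊥) (f : T.R N ⟶ A)
      (_ : (T.univ N).push f = η), (ω (n A)).push (g A η) = (ω N).push f := by
    intro A η N hN f hf
    obtain h | h := le_total (n A) N
    · exact (key A η _ (hn A) _ (hg A η) N h f hf).symm
    · exact key A η N hN f hf _ h _ (hg A η)
  refine ⟨⟨fun {A} η => (ω (n A)).push (g A η), fun {A B} p η => ?_, fun {A} η => ?_, fun N => ?_⟩⟩
  · have h₁ : A.m ^ (max (n A) (n B) + 1) = ⊥ :=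
      le_bot_iff.1 ((Ideal.pow_le_pow_right (by omega)).trans (hn A).le)
    have h₂ : B.m ^ (max (n A) (n B) + 1) = ⊥ :=
      le_bot_iff.1 ((Ideal.pow_le_pow_right (by omega)).trans (hn B).le)
    obtain ⟨f, hf⟩ := T.exists_hom h₁ η
    rw [key' A η _ h₁ f hf, ← MC.push_comp]
    exact key' B _ _ h₂ (f ≫ p) (by rw [MC.push_comp, hf])
  · rw [Def.app_push Ψ (g A η) (hω _), hg]
  · obtain ⟨θ, hθ⟩ := T.exists_linear (N := N) (by
      have := ((mem_nilTensor_iff _ _).1 (ω N).2.1).2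
      rwa [mpow, pow_one] at this)
    refine ⟨θ, fun A hN η η' k hk h => ?_⟩
    obtain ⟨f, hf⟩ := T.exists_hom hN η
    obtain ⟨f', hf'⟩ := T.exists_hom hN η'
    rw [key' A η N hN f hf, key' A η' N hN f' hf']
    have h₁ := T.push_sub_push_mem f f' (by rw [hf, hf']; exact h) hθ
    rw [map_sub, map_sub, pushTensor_baseChange, pushTensor_baseChange] at h₁
    rw [← hf, ← hf']
    convert h₁ using 1
    change pushTensor f'.1 C.carrier (ω N).1 - pushTensor f.1 C.carrier (ω N).1 -
      θ.baseChange A.carrier (pushTensor f'.1 H.carrier (T.univ N).1 -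
        pushTensor f.1 H.carrier (T.univ N).1) = _
    rw [map_sub]
    abel

end DGLA

/-! ### The dual numbers -/

section DualNumbers

variable {V : Type u} {W : Type v} [AddCommGroup V] [Module ℂ V] [AddCommGroup W] [Module ℂ W]

namespace ArtAlg

lemma fst_of_mem_dual {a : dual.carrier} (ha : a ∈ dual.m) :
    TrivSqZeroExt.fst (show DualNumber ℂ from a) = 0 :=
  (TrivSqZeroExt.isNilpotent_iff_isNilpotent_fst.1 (isNilpotent_of_mem ha)).eq_zero

lemma dual_m_pow {k : ℕ} (hk : 2 ≤ k) : dual.m ^ k = ⊥ := by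
  refine le_bot_iff.1 ((Ideal.pow_le_pow_right hk).trans ?_)
  rw [pow_two, Ideal.mul_le]
  intro a ha b hb
  refine (Ideal.mem_bot).2 ?_
  have h₁ := fst_of_mem_dual ha
  have h₂ := fst_of_mem_dual hb
  refine TrivSqZeroExt.ext (R := ℂ) (M := ℂ) ?_ ?_
  · exact (TrivSqZeroExt.fst_mul (R := ℂ) (M := ℂ) a b).trans (by rw [h₁, zero_mul]; rfl)
  · refine (TrivSqZeroExt.snd_mul (R := ℂ) (M := ℂ) a b).trans ?_
    rw [h₁, h₂]
    simp
    rfl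

/-- The generator `ε` of the dual numbers. -/
noncomputable def eps : dual.carrier := (DualNumber.eps : DualNumber ℂ)

lemma eps_mem : eps ∈ dual.m :=
  mem_of_isNilpotent (A := dual) (DualNumber.isNilpotent_eps (R := ℂ))

lemma eps_mul_eps : eps * eps = 0 := DualNumber.eps_mul_eps (R := ℂ)

/-- The coefficient of `ε`. -/
noncomputable def epsCoeff : dual.carrier →ₗ[ℂ] ℂ := TrivSqZeroExt.sndHom ℂ ℂ

lemma epsCoeff_eps : epsCoeff eps = 1 := DualNumber.snd_eps (R := ℂ)

lemma eq_smul_eps {a : dual.carrier} (ha : a ∈ dual.m) : a = epsCoeff a • eps := by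
  refine TrivSqZeroExt.ext (R := ℂ) (M := ℂ) ?_ ?_
  · refine (fst_of_mem_dual ha).trans ?_
    refine Eq.trans ?_ (TrivSqZeroExt.fst_smul (R := ℂ) (M := ℂ) (epsCoeff a) eps).symm
    exact (mul_zero _).symm
  · refine Eq.trans ?_ (TrivSqZeroExt.snd_smul (R := ℂ) (M := ℂ) (epsCoeff a) eps).symm
    exact (mul_one _).symm

end ArtAlg

open ArtAlg

/-- The coefficient of `ε`, with values in a vector space. -/
noncomputable def epsPart (V : Type u) [AddCommGroup V] [Module ℂ V] :
    dual.carrier ⊗[ℂ] V →ₗ[ℂ] V :=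
  (TensorProduct.lid ℂ V).toLinearMap ∘ₗ LinearMap.rTensor V epsCoeff

lemma epsPart_tmul (a : dual.carrier) (x : V) : epsPart V (a ⊗ₜ x) = epsCoeff a • x := rfl

lemma epsPart_eps (x : V) : epsPart V (eps ⊗ₜ x) = x := by
  rw [epsPart_tmul, epsCoeff_eps, one_smul]

lemma epsPart_baseChange (f : V →ₗ[ℂ] W) (x : dual.carrier ⊗[ℂ] V) :
    epsPart W (f.baseChange dual.carrier x) = f (epsPart V x) := by
  induction x using TensorProduct.induction_on with
  | zero => simp only [map_zero]
  | add x y hx hy => simp only [map_add, hx, hy]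
  | tmul a x => rw [LinearMap.baseChange_tmul, epsPart_tmul, epsPart_tmul, map_smul]

lemma epsPart_mem {S : Submodule ℂ V} {x : dual.carrier ⊗[ℂ] V}
    (hx : x ∈ S.baseChange dual.carrier) : epsPart V x ∈ S := by
  obtain ⟨r, hr⟩ := LinearMap.exists_leftInverse_of_injective S.subtype
    (LinearMap.ker_eq_bot.2 S.injective_subtype)
  have e := baseChange_apply_eq dual.carrier (f := S.subtype ∘ₗ r) (g := LinearMap.id) (S := S)
    (fun y hy => congrArg Subtype.val (LinearMap.congr_fun hr ⟨y, hy⟩)) hx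
  rw [LinearMap.baseChange_id, LinearMap.id_apply] at e
  rw [← e, epsPart_baseChange]
  exact (r _).2

lemma eps_tmul_epsPart {x : dual.carrier ⊗[ℂ] V} (hx : x ∈ mpow dual 1 V) :
    eps ⊗ₜ epsPart V x = x := by
  rw [mpow, pow_one] at hx
  induction hx using Submodule.smul_induction_on' with
  | add x _ y _ hx hy => rw [map_add, TensorProduct.tmul_add, hx, hy]
  | smul a ha x _ =>
    induction x using TensorProduct.induction_on with
    | zero => rw [smul_zero, map_zero, TensorProduct.tmul_zero]
    | add x y hx hy => rw [smul_add, map_add, TensorProduct.tmul_add, hx trivial, hy trivial]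
    | tmul b x =>
      rw [TensorProduct.smul_tmul', epsPart_tmul, ← TensorProduct.smul_tmul]
      congr 1
      exact (eq_smul_eps (Ideal.mul_mem_right b _ ha)).symm

end DualNumbers

/-! ### First-order deformations and the linear part of a section -/

namespace DGLA

open ArtAlg

variable {C : DGLA.{u}} {H : DGLA.{u}}

/-- The infinitesimal Maurer–Cartan element given by a cocycle. -/
noncomputable def MC.infinitesimal {z : C.carrier} (hz : z ∈ C.gr 1) (hdz : C.d z = 0) :
    C.MC dual :=
  ⟨eps ⊗ₜ z, by
    rw [← mul_one eps, ← smul_eq_mul, ← TensorProduct.smul_tmul']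
    exact Submodule.smul_mem_smul eps_mem (Submodule.tmul_mem_baseChange_of_mem _ hz), by
    rw [curvature, dTensor, bracketTensor, LinearMap.baseChange_tmul, extendBilin_tmul, hdz,
      eps_mul_eps, TensorProduct.tmul_zero, TensorProduct.zero_tmul, smul_zero, add_zero]⟩

lemma MC.exists_eq_infinitesimal (ω : C.MC dual) :
    ∃ (z : C.carrier) (hz : z ∈ C.gr 1) (hdz : C.d z = 0), ω = MC.infinitesimal hz hdz := by
  have h := (mem_nilTensor_iff _ _).1 ω.2.1
  refine ⟨epsPart _ ω.1, epsPart_mem h.1, ?_, Subtype.ext (eps_tmul_epsPart h.2).symm⟩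
  rw [← epsPart_baseChange]
  have e : C.bracketTensor dual.carrier ω.1 ω.1 = 0 := by
    have := C.bracketTensor_mem_mpow h.2 h.2
    rwa [mpow_eq_bot (dual_m_pow le_rfl), Submodule.mem_bot] at this
  have := ω.2.2
  rw [curvature, e, smul_zero, add_zero] at this
  exact (congrArg _ this).trans (map_zero _)

/-- Brackets vanish as `ε² = 0`, and the gauge action becomes `z ↦ z - dμ`. Thus `Def` of the dual
numbers is `H¹`. -/
lemma MC.infinitesimal_iso {z z' : C.carrier} {hz : z ∈ C.gr 1} {hdz : C.d z = 0}
    {hz' : z' ∈ C.gr 1} {hdz' : C.d z' = 0} :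
    (MC.infinitesimal hz hdz).Iso (MC.infinitesimal hz' hdz') ↔ ∃ μ ∈ C.gr 0, z - z' = C.d μ := by
  have key : ∀ l ∈ nilTensor dual (C.gr 0), C.gauge dual l (MC.infinitesimal hz hdz).1 =
      eps ⊗ₜ z - C.dTensor dual.carrier l := by
    intro l hl
    have := C.gauge_sub_mem le_rfl ((mem_nilTensor_iff _ _).1 hl).2
      ((mem_nilTensor_iff _ _).1 (MC.infinitesimal hz hdz).2.1).2
    rw [mpow_eq_bot (dual_m_pow le_rfl), Submodule.mem_bot] at this
    exact sub_eq_zero.1 this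
  constructor
  · rintro ⟨l, hl, e⟩
    rw [key l hl] at e
    refine ⟨epsPart _ l, epsPart_mem ((mem_nilTensor_iff _ _).1 hl).1, ?_⟩
    have e' := congrArg (epsPart C.carrier) e
    have e₁ : epsPart C.carrier (C.dTensor dual.carrier l) = C.d (epsPart _ l) :=
      epsPart_baseChange C.d l
    have e₂ : epsPart C.carrier (MC.infinitesimal hz' hdz').1 = z' := epsPart_eps z'
    rw [map_sub, epsPart_eps, e₁, e₂] at e'
    rw [← e']
    abel
  · rintro ⟨μ, hμ, e⟩
    have hl : (eps ⊗ₜ μ : dual.carrier ⊗[ℂ] C.carrier) ∈ nilTensor dual (C.gr 0) := by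
      rw [← mul_one eps, ← smul_eq_mul, ← TensorProduct.smul_tmul']
      exact Submodule.smul_mem_smul eps_mem (Submodule.tmul_mem_baseChange_of_mem _ hμ)
    refine ⟨_, hl, ?_⟩
    rw [key _ hl, dTensor, LinearMap.baseChange_tmul, ← e, ← TensorProduct.tmul_sub, sub_sub_cancel]
    rfl

variable {Ψ : C.Def ≅ H.Def}

namespace NatSection

variable (S : NatSection Ψ)

/-- The constant endomorphism of the dual numbers. -/
noncomputable def dualConst : dual ⟶ dual :=
  ofHom ((Algebra.ofId ℂ dual.carrier).comp (TrivSqZeroExt.fstHom ℂ ℂ ℂ))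

lemma push_dualConst {V : Type v} [AddCommGroup V] [Module ℂ V] {x : dual.carrier ⊗[ℂ] V}
    (hx : x ∈ mpow dual 1 V) : pushTensor dualConst.1 V x = 0 := by
  rw [mpow, pow_one, mem_smul_top_iff_coord] at hx
  refine tensorCoord_ext fun l => ?_
  rw [tensorCoord_push, map_zero]
  refine Eq.trans (congrArg (algebraMap ℂ dual.carrier) (fst_of_mem_dual (hx l))) (map_zero _)

/-- The zero element is fixed by the endomorphism `ε ↦ 0`, which kills every tensor with
coefficients in `m`; functoriality does the rest. -/
lemma apply_zero {η : H.MC dual} (hη : η.1 = 0) : (S.σ η).1 = 0 := by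
  have e : η.push dualConst = η := Subtype.ext (by
    change pushTensor _ _ η.1 = η.1
    rw [hη, map_zero])
  have := congrArg Subtype.val (S.push dualConst η)
  rw [e] at this
  rw [this]
  exact push_dualConst ((mem_nilTensor_iff _ _).1 (S.σ η).2.1).2

/-- The linear part of a functorial section, an isomorphism on first cohomology. -/
structure Linearization (N : ℕ) where
  θ : H.carrier →ₗ[ℂ] C.carrier
  ρ : C.carrier →ₗ[ℂ] H.carrier
  approx : ∀ (A : ArtAlg), A.m ^ (N + 1) = ⊥ →
    ∀ (η η' : H.MC A) (k : ℕ), 1 ≤ k → η'.1 - η.1 ∈ mpow A k H.carrier →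
      (S.σ η').1 - (S.σ η).1 - θ.baseChange A.carrier (η'.1 - η.1) ∈ mpow A (k + 1) C.carrier
  θ_mem : ∀ x ∈ H.gr 1, θ x ∈ C.gr 1
  ρ_d : ∀ x ∈ C.gr 0, ρ (C.d x) = 0
  ρ_θ : ∀ x ∈ H.gr 1, ρ (θ x) = x
  ρ_mem : ∀ x, ρ x ∈ H.gr 1
  sub : ∀ z ∈ C.gr 1, C.d z = 0 → ∃ μ ∈ C.gr 0, z - θ (ρ z) = C.d μ

/-- Over the dual numbers `σ` is `ε ⊗ x ↦ ε ⊗ θ x`, and it induces the inverse of the bijection `Ψ`;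
hence `θ` induces an isomorphism from `H¹` of `H` onto `H¹(C)`. The condition `1 ≤ N` brings the
dual numbers within the range of `linear N`. -/
lemma nonempty_linearization [FiniteDimensional ℂ (H.gr 1)] (hd : ∀ x, H.d x = 0) {N : ℕ} (hN : 1 ≤ N) :
    Nonempty (S.Linearization N) := by
  obtain ⟨θ, hθ⟩ := S.linear N
  have h₁ : ∀ x (hx : x ∈ H.gr 1), (S.σ (MC.infinitesimal hx (hd x))).1 = eps ⊗ₜ θ x := by
    intro x hx
    have h0 : (MC.infinitesimal (C := H) (zero_mem (H.gr 1)) (hd 0)).1 = 0 :=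
      TensorProduct.tmul_zero _ _
    have := hθ dual (dual_m_pow (by omega)) (MC.infinitesimal (zero_mem _) (hd 0))
      (MC.infinitesimal hx (hd x)) 1 le_rfl (by
        rw [h0, sub_zero]
        exact ((mem_nilTensor_iff _ _).1 (MC.infinitesimal hx (hd x)).2.1).2)
    rw [mpow_eq_bot (dual_m_pow le_rfl), Submodule.mem_bot, S.apply_zero h0, h0, sub_zero,
      sub_zero, sub_eq_zero] at this
    rw [this]
    rfl
  have h₂ : ∀ x (hx : x ∈ H.gr 1), ∃ (h : θ x ∈ C.gr 1) (h' : C.d (θ x) = 0),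
      S.σ (MC.infinitesimal hx (hd x)) = MC.infinitesimal h h' := by
    intro x hx
    obtain ⟨z, hz, hdz, e⟩ := (S.σ (MC.infinitesimal hx (hd x))).exists_eq_infinitesimal
    have e₁ : z = θ x := by
      have := congrArg (epsPart _) ((h₁ x hx).symm.trans (congrArg Subtype.val e))
      rw [epsPart_eps] at this
      exact (this.trans (epsPart_eps z)).symm
    subst e₁
    exact ⟨hz, hdz, e⟩
  have hinj : ∀ x ∈ H.gr 1, ∀ μ ∈ C.gr 0, θ x = C.d μ → x = 0 := by
    intro x hx μ hμ e
    obtain ⟨h, h', e₁⟩ := h₂ x hx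
    obtain ⟨h0, h0', e₂⟩ := h₂ 0 (zero_mem _)
    have h₃ : (MC.infinitesimal h h').Iso (MC.infinitesimal h0 h0') :=
      MC.infinitesimal_iso.2 ⟨μ, hμ, by rw [map_zero, sub_zero, e]⟩
    have h₄ := congrArg (Ψ.hom.app dual) (MC.mk_eq_mk.2 h₃)
    have h₅ := S.app (MC.infinitesimal hx (hd x))
    have h₆ := S.app (MC.infinitesimal (zero_mem (H.gr 1)) (hd 0))
    rw [e₁] at h₅
    rw [e₂] at h₆
    obtain ⟨ν, -, h₇⟩ := MC.infinitesimal_iso.1 (MC.mk_eq_mk.1 (h₅.symm.trans (h₄.trans h₆)))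
    rw [sub_zero, hd] at h₇
    exact h₇
  have hsurj : ∀ z ∈ C.gr 1, C.d z = 0 → ∃ x ∈ H.gr 1, ∃ μ ∈ C.gr 0, z - θ x = C.d μ := by
    intro z hz hdz
    obtain ⟨η, hη⟩ := Quot.exists_rep (Ψ.hom.app dual (Quot.mk _ (MC.infinitesimal hz hdz)))
    obtain ⟨x, hx, hdx, rfl⟩ := η.exists_eq_infinitesimal
    obtain ⟨h, h', e₁⟩ := h₂ x hx
    have h₅ := S.app (MC.infinitesimal hx (hd x))
    have h₆ := Def.app_injective Ψ (hη.symm.trans h₅.symm)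
    rw [e₁] at h₆
    obtain ⟨μ, hμ, e⟩ := MC.infinitesimal_iso.1 h₆
    exact ⟨x, hx, μ, hμ, e⟩
  -- Working modulo `d C⁰`, a left inverse of `θ` automatically kills coboundaries, which is what
  -- `ρ` has to do.
  let Q := (C.gr 0).map C.d
  let f : H.gr 1 →ₗ[ℂ] C.carrier ⧸ Q := Q.mkQ ∘ₗ θ ∘ₗ (H.gr 1).subtype
  have hf : LinearMap.ker f = ⊥ := by
    rw [LinearMap.ker_eq_bot']
    intro x hx
    obtain ⟨μ, hμ, e⟩ := (Submodule.Quotient.mk_eq_zero Q).1 hx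
    exact Subtype.ext (hinj x.1 x.2 μ hμ e.symm)
  obtain ⟨r, hr⟩ := f.exists_leftInverse_of_injective hf
  have hρd : ∀ x ∈ C.gr 0, Q.mkQ (C.d x) = 0 := fun x hx =>
    (Submodule.Quotient.mk_eq_zero Q).2 ⟨x, hx, rfl⟩
  have hρθ : ∀ x (hx : x ∈ H.gr 1), r (Q.mkQ (θ x)) = ⟨x, hx⟩ := fun x hx =>
    LinearMap.congr_fun hr ⟨x, hx⟩
  refine ⟨⟨θ, (H.gr 1).subtype ∘ₗ r ∘ₗ Q.mkQ, hθ, fun x hx => (h₂ x hx).1, fun x hx => ?_, fun x hx => ?_, fun x => (r _).2,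
    fun z hz hdz => ?_⟩⟩
  · rw [LinearMap.comp_apply, LinearMap.comp_apply, hρd x hx, map_zero, map_zero]
  · rw [LinearMap.comp_apply, LinearMap.comp_apply, hρθ x hx]
    rfl
  · obtain ⟨x, hx, μ, hμ, e⟩ := hsurj z hz hdz
    refine ⟨μ, hμ, ?_⟩
    have e' : z = θ x + C.d μ := by rw [← e, add_sub_cancel]
    rw [LinearMap.comp_apply, LinearMap.comp_apply]
    nth_rewrite 2 [e']
    rw [map_add, hρd μ hμ, add_zero, hρθ x hx]
    exact e

end NatSection

end DGLA

lemma ArtAlg.m_pow_eq_bot_of_surjective {A B : ArtAlg} {p : A ⟶ B}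
    (hp : Function.Surjective p.1) {N : ℕ} (h : ∀ a ∈ A.m ^ N, p.1 a = 0) : B.m ^ N = ⊥ := by
  have h₁ : B.m ≤ A.m.map p.1 := fun b hb => by
    obtain ⟨a, ha, rfl⟩ := exists_mem_m hp hb
    exact Ideal.mem_map_of_mem _ ha
  refine le_bot_iff.1 ((Ideal.pow_right_mono h₁ N).trans ?_)
  rw [← Ideal.map_pow, Ideal.map_le_iff_le_comap]
  exact fun a ha => h a ha

/-! ### The map `(η, w) ↦ exp(s(w)) · σ(η)` -/

namespace DGLA

variable {C : DGLA.{u}} {H : DGLA.{u}}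

/-- A decomposition `C⁰ = (K ∩ C⁰) ⊕ W ⊕ H⁰(C)`. -/
structure Splitting (C : DGLA.{u}) (K : Submodule ℂ C.carrier) (W : Type v) [AddCommGroup W]
    [Module ℂ W] where
  s : W →ₗ[ℂ] C.carrier
  q : C.carrier →ₗ[ℂ] W
  κ : C.carrier →ₗ[ℂ] C.carrier
  s_mem : ∀ w, s w ∈ C.gr 0
  κ_mem : ∀ x ∈ C.gr 0, κ x ∈ K ⊓ C.gr 0
  d_add : ∀ x ∈ C.gr 0, C.d (κ x + s (q x)) = C.d x
  q_s : ∀ w, q (s w) = w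
  κ_s : ∀ w, κ (s w) = 0
  q_of_mem : ∀ x ∈ K, q x = 0
  κ_of_mem : ∀ x ∈ K, κ x = x
  q_cocycle : ∀ x ∈ C.gr 0, C.d x = 0 → q x = 0
  κ_cocycle : ∀ x ∈ C.gr 0, C.d x = 0 → κ x = 0

namespace Splitting

variable {K : Submodule ℂ C.carrier} {W : Type v} [AddCommGroup W] [Module ℂ W]
  (Z : C.Splitting K W)

lemma s_mem_nilTensor {A : ArtAlg} {w : A.carrier ⊗[ℂ] W} (hw : w ∈ mpow A 1 W) :
    Z.s.baseChange A.carrier w ∈ nilTensor A (C.gr 0) := by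
  refine (mem_nilTensor_iff _ _).2 ⟨?_, map_mem_mpow _ hw⟩
  refine baseChange_apply_mem _ Z.s ⊤ _ (fun w _ => Z.s_mem w) ?_
  rw [Submodule.baseChange_top]
  exact Submodule.mem_top

lemma q_s_baseChange {A : ArtAlg} (w : A.carrier ⊗[ℂ] W) :
    Z.q.baseChange A.carrier (Z.s.baseChange A.carrier w) = w := by
  rw [← LinearMap.comp_apply, ← LinearMap.baseChange_comp,
    show Z.q ∘ₗ Z.s = LinearMap.id from LinearMap.ext Z.q_s, LinearMap.baseChange_id,
    LinearMap.id_apply]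

lemma κ_s_baseChange {A : ArtAlg} (w : A.carrier ⊗[ℂ] W) :
    Z.κ.baseChange A.carrier (Z.s.baseChange A.carrier w) = 0 := by
  rw [← LinearMap.comp_apply, ← LinearMap.baseChange_comp,
    show Z.κ ∘ₗ Z.s = 0 from LinearMap.ext Z.κ_s, LinearMap.baseChange_zero,
    LinearMap.zero_apply]

lemma nilTensor_le_gr_zero {A : ArtAlg} {l : A.carrier ⊗[ℂ] C.carrier}
    (hl : l ∈ nilTensor A (K ⊓ C.gr 0)) : l ∈ nilTensor A (C.gr 0) :=
  Submodule.smul_mono le_rfl (baseChange_mono _ inf_le_right) hl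

/-- If `du = 0` to order `k`, then so are the components of `u` in `K` and `W`. -/
lemma mem_mpow_of_d_mem {A : ArtAlg} {u : A.carrier ⊗[ℂ] C.carrier}
    (hu : u ∈ (C.gr 0).baseChange A.carrier) {k : ℕ}
    (h : C.dTensor A.carrier u ∈ mpow A k C.carrier) :
    Z.q.baseChange A.carrier u ∈ mpow A k W ∧
      Z.κ.baseChange A.carrier u ∈ mpow A k C.carrier := by
  obtain ⟨c⟩ := C.exists_contraction
  -- `u` is the cocycle `p u` plus `h d u`; the latter has order `k`, and both components vanish on
  -- cocycles.
  let p : C.carrier →ₗ[ℂ] C.carrier := LinearMap.id - c.h ∘ₗ C.d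
  have hp : ∀ x ∈ C.gr 0, p x ∈ C.gr 0 ∧ C.d (p x) = 0 := fun x hx =>
    ⟨sub_mem hx (c.h_mem (C.d_mem hx)), by
      change C.d (x - c.h (C.d x)) = 0
      rw [map_sub, c.d_h_d, sub_self]⟩
  have e : u = p.baseChange A.carrier u + c.h.baseChange A.carrier (C.dTensor A.carrier u) := by
    change u = (LinearMap.id - c.h ∘ₗ C.d).baseChange A.carrier u + _
    rw [LinearMap.baseChange_sub, LinearMap.baseChange_id, LinearMap.baseChange_comp]
    exact (sub_add_cancel _ _).symm
  have key : ∀ {U : Type _} [AddCommGroup U] [Module ℂ U] (f : C.carrier →ₗ[ℂ] U),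
      (∀ x ∈ C.gr 0, C.d x = 0 → f x = 0) → f.baseChange A.carrier u ∈ mpow A k U := by
    intro U _ _ f hf
    have e₁ : f.baseChange A.carrier (p.baseChange A.carrier u) = 0 := by
      rw [← LinearMap.comp_apply, ← LinearMap.baseChange_comp,
        baseChange_apply_eq A.carrier (g := 0) (f := f ∘ₗ p) (fun x hx => hf _ (hp x hx).1 (hp x hx).2) hu,
        LinearMap.baseChange_zero, LinearMap.zero_apply]
    rw [e, map_add, e₁, zero_add]
    exact map_mem_mpow _ (map_mem_mpow _ h)
  constructor
  · obtain ⟨f, hf⟩ := LinearMap.exists_leftInverse_of_injective Z.s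
      (LinearMap.ker_eq_bot.2 (Function.LeftInverse.injective Z.q_s))
    have := key (Z.s ∘ₗ Z.q) fun x hx hd => by
      rw [LinearMap.comp_apply, Z.q_cocycle x hx hd, map_zero]
    rw [LinearMap.baseChange_comp] at this
    have h' := map_mem_mpow (Z.q.baseChange A.carrier) this
    rwa [LinearMap.comp_apply, q_s_baseChange] at h'
  · exact key Z.κ Z.κ_cocycle

variable {Ψ : C.Def ≅ H.Def} (S : NatSection Ψ)

/-- The Maurer–Cartan element `exp(s(w)) · σ(η)`. -/
noncomputable def theta {A : ArtAlg} (η : H.MC A) {w : A.carrier ⊗[ℂ] W} (hw : w ∈ mpow A 1 W) :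
    C.MC A :=
  (S.σ η).gauge (Z.s.baseChange A.carrier w) (Z.s_mem_nilTensor hw)

lemma theta_push {A B : ArtAlg} (p : A ⟶ B) (η : H.MC A) {w : A.carrier ⊗[ℂ] W}
    (hw : w ∈ mpow A 1 W) (hw' : pushTensor p.1 W w ∈ mpow B 1 W) :
    Z.theta S (η.push p) hw' = (Z.theta S η hw).push p := by
  rw [theta, theta, MC.push_gauge, ← S.push]
  congr 1
  rw [pushTensor_baseChange]

lemma theta_iso {A : ArtAlg} (η : H.MC A) {w : A.carrier ⊗[ℂ] W} (hw : w ∈ mpow A 1 W) :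
    (S.σ η).Iso (Z.theta S η hw) :=
  ⟨_, Z.s_mem_nilTensor hw, rfl⟩

lemma _root_.DGLA.NatSection.sub_mem {N : ℕ} (L : S.Linearization N) {A : ArtAlg}
    (hA : A.m ^ (N + 1) = ⊥) {η η' : H.MC A} {k : ℕ} (hk : 1 ≤ k) (h : η'.1 - η.1 ∈ mpow A k H.carrier) :
    (S.σ η').1 - (S.σ η).1 ∈ mpow A k C.carrier := by
  have := add_mem (mpow_anti A (Nat.le_succ k) (L.approx A hA η η' k hk h))
    (map_mem_mpow (L.θ.baseChange A.carrier) h)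
  rwa [sub_add_cancel] at this

/-- The first-order variation, gathered from three sources: the gauge action in its parameter, the
gauge action in its argument, and the linear part of `σ`. -/
lemma theta_sub_mem {N : ℕ} (L : S.Linearization N) {A : ArtAlg} (hA : A.m ^ (N + 1) = ⊥)
    {η η' : H.MC A} {w w₁ : A.carrier ⊗[ℂ] W} (hw : w ∈ mpow A 1 W) {k : ℕ} (hk : 1 ≤ k)
    (hη : η'.1 - η.1 ∈ mpow A k H.carrier) (hw₁ : w₁ ∈ mpow A k W)
    (hw' : w + w₁ ∈ mpow A 1 W) :
    (Z.theta S η' hw').1 - (Z.theta S η hw).1 - (L.θ.baseChange A.carrier (η'.1 - η.1) -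
      C.dTensor A.carrier (Z.s.baseChange A.carrier w₁)) ∈ mpow A (k + 1) C.carrier := by
  have hs := ((mem_nilTensor_iff _ _).1 (Z.s_mem_nilTensor hw)).2
  have h₁ := C.gauge_add_sub_mem hk hs (map_mem_mpow (Z.s.baseChange A.carrier) hw₁)
    ((mem_nilTensor_iff _ _).1 (S.σ η').2.1).2
  have h₂ := C.gauge_congr_mem hs (S.sub_mem L hA hk hη)
  have h₃ := L.approx A hA η η' k hk hη
  have := add_mem (add_mem h₁ h₂) h₃
  convert this using 1
  change C.gauge A (Z.s.baseChange A.carrier (w + w₁)) (S.σ η').1 -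
    C.gauge A (Z.s.baseChange A.carrier w) (S.σ η).1 - _ = _
  rw [map_add]
  abel

variable [FiniteDimensional ℂ (H.gr 1)]

/-- The classes of the `exp(s(w)) · σ(η)` modulo gauge transformations in `K` are distinct. -/
lemma theta_injective (hd : ∀ x, H.d x = 0) {A : ArtAlg} {η η' : H.MC A}
    {w w' : A.carrier ⊗[ℂ] W} (hw : w ∈ mpow A 1 W) (hw' : w' ∈ mpow A 1 W)
    {l : A.carrier ⊗[ℂ] C.carrier} (hl : l ∈ nilTensor A (K ⊓ C.gr 0))
    (h : C.gauge A l (Z.theta S η hw).1 = (Z.theta S η' hw').1) : η = η' ∧ w = w' := by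
  obtain ⟨N, hN⟩ := A.exists_m_pow_eq_bot
  have hA : A.m ^ ((N + 1) + 1) = ⊥ := le_bot_iff.1 ((Ideal.pow_le_pow_right (by omega)).trans hN.le)
  obtain ⟨L⟩ := S.nonempty_linearization hd (N := N + 1) (by omega)
  have hl0 := (mem_nilTensor_iff _ _).1 (nilTensor_le_gr_zero hl)
  have hη1 : η'.1 - η.1 ∈ (H.gr 1).baseChange A.carrier :=
    sub_mem η'.isFlat.mem η.isFlat.mem
  have key : ∀ k, 1 ≤ k → η'.1 - η.1 ∈ mpow A k H.carrier ∧ w' - w ∈ mpow A k W ∧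
      l ∈ mpow A k C.carrier := by
    intro k hk
    induction k, hk using Nat.le_induction with
    | base =>
      exact ⟨sub_mem ((mem_nilTensor_iff _ _).1 η'.2.1).2 ((mem_nilTensor_iff _ _).1 η.2.1).2,
        sub_mem hw' hw, hl0.2⟩
    | succ k hk ih =>
      obtain ⟨i₁, i₂, i₃⟩ := ih
      have h₁ := C.gauge_sub_mem hk i₃ ((mem_nilTensor_iff _ _).1 (Z.theta S η hw).2.1).2
      have hw'' : w + (w' - w) ∈ mpow A 1 W := by rwa [add_sub_cancel]
      have h₂ := Z.theta_sub_mem S L hA hw hk i₁ i₂ hw''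
      have e : (Z.theta S η' hw'').1 = (Z.theta S η' hw').1 := by
        congr 2
        exact add_sub_cancel _ _
      rw [e, ← h] at h₂
      have h₃ : L.θ.baseChange A.carrier (η'.1 - η.1) -
          C.dTensor A.carrier (Z.s.baseChange A.carrier (w' - w) - l) ∈
            mpow A (k + 1) C.carrier := by
        have := sub_mem h₁ h₂
        convert this using 1
        rw [map_sub (C.dTensor A.carrier)]
        abel
      have hu : Z.s.baseChange A.carrier (w' - w) - l ∈ (C.gr 0).baseChange A.carrier :=
        sub_mem ((mem_nilTensor_iff _ _).1 (Z.s_mem_nilTensor (sub_mem hw' hw))).1 hl0.1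
      -- `ρ` kills the coboundary term and inverts `θ`, which isolates `η' - η`.
      have h₄ : η'.1 - η.1 ∈ mpow A (k + 1) H.carrier := by
        have := map_mem_mpow (L.ρ.baseChange A.carrier) h₃
        have e₁ : L.ρ.baseChange A.carrier (L.θ.baseChange A.carrier (η'.1 - η.1)) =
            η'.1 - η.1 := by
          rw [← LinearMap.comp_apply, ← LinearMap.baseChange_comp,
            baseChange_apply_eq A.carrier (g := LinearMap.id) (fun x hx => L.ρ_θ x hx) hη1,
            LinearMap.baseChange_id, LinearMap.id_apply]
        have e₂ : L.ρ.baseChange A.carrier (C.dTensor A.carrier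
            (Z.s.baseChange A.carrier (w' - w) - l)) = 0 := by
          rw [dTensor, ← LinearMap.comp_apply, ← LinearMap.baseChange_comp,
            baseChange_apply_eq A.carrier (g := 0) (fun x hx => L.ρ_d x hx) hu,
            LinearMap.baseChange_zero, LinearMap.zero_apply]
        rwa [map_sub, e₁, e₂, sub_zero] at this
      have h₅ := sub_mem (map_mem_mpow (L.θ.baseChange A.carrier) h₄) h₃
      rw [sub_sub_cancel] at h₅
      -- What remains is `d(s(w' - w) - l) = 0` to order `k + 1`; the components of the splitting
      -- separate `w' - w` from `l`.
      obtain ⟨h₆, h₇⟩ := Z.mem_mpow_of_d_mem hu h₅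
      have e₃ : Z.q.baseChange A.carrier l = 0 := by
        rw [baseChange_apply_eq A.carrier (g := 0) (fun x (hx : x ∈ K ⊓ C.gr 0) => Z.q_of_mem x hx.1)
          ((mem_nilTensor_iff _ _).1 hl).1, LinearMap.baseChange_zero, LinearMap.zero_apply]
      have e₄ : Z.κ.baseChange A.carrier l = l := by
        rw [baseChange_apply_eq A.carrier (g := LinearMap.id) (fun x (hx : x ∈ K ⊓ C.gr 0) => Z.κ_of_mem x hx.1)
          ((mem_nilTensor_iff _ _).1 hl).1, LinearMap.baseChange_id, LinearMap.id_apply]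
      rw [map_sub, q_s_baseChange, e₃, sub_zero] at h₆
      rw [map_sub, κ_s_baseChange, e₄, zero_sub, neg_mem_iff] at h₇
      exact ⟨h₄, h₆, h₇⟩
  obtain ⟨h₁, h₂, -⟩ := key (N + 1) (by omega)
  have hN' : A.m ^ (N + 1) = ⊥ := le_bot_iff.1 ((Ideal.pow_le_pow_right (by omega)).trans hN.le)
  rw [mpow_eq_bot hN', Submodule.mem_bot, sub_eq_zero] at h₁ h₂
  exact ⟨Subtype.ext h₁.symm, h₂.symm⟩

/-- In the last nonzero order all first-order formulas are exact. The error `e` is a cocycle, equal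
to `θ(ρ e) - dμ`; the first part is absorbed into `η`. Up to a cocycle `μ` is a sum of elements of
`K` and of `s(W)`, absorbed into `l` and `w`. -/
lemma theta_surjective_step (hd : ∀ x, H.d x = 0) {N : ℕ} {A : ArtAlg}
    (hA : A.m ^ (N + 1 + 1) = ⊥) (x : C.MC A) (η : H.MC A) {w : A.carrier ⊗[ℂ] W}
    (hw : w ∈ mpow A 1 W) {l : A.carrier ⊗[ℂ] C.carrier} (hl : l ∈ nilTensor A (K ⊓ C.gr 0))
    (hx : x.1 - C.gauge A l (Z.theta S η hw).1 ∈ mpow A (N + 1) C.carrier) :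
    ∃ (η : H.MC A) (w : A.carrier ⊗[ℂ] W) (hw : w ∈ mpow A 1 W),
      ∃ l ∈ nilTensor A (K ⊓ C.gr 0), C.gauge A l (Z.theta S η hw).1 = x.1 := by
  obtain ⟨L⟩ := S.nonempty_linearization hd (N := N + 1) (by omega)
  obtain ⟨c⟩ := C.exists_contraction
  have hl0 := nilTensor_le_gr_zero hl
  let X := (Z.theta S η hw).gauge l hl0
  set e := x.1 - C.gauge A l (Z.theta S η hw).1 with he
  have hz : ∀ {V : Type _} [AddCommGroup V] [Module ℂ V] {y : A.carrier ⊗[ℂ] V},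
      y ∈ mpow A (N + 1 + 1) V → y = 0 := by
    intro V _ _ y hy
    rwa [mpow_eq_bot hA, Submodule.mem_bot] at hy
  have hde : C.dTensor A.carrier e = 0 := hz (dTensor_sub_mem (by omega)
    ((mem_nilTensor_iff _ _).1 X.2.1).2 hx X.2.2 x.2.2)
  have he1 : e ∈ (C.gr 1).baseChange A.carrier := sub_mem x.isFlat.mem X.isFlat.mem
  have h1e : L.ρ.baseChange A.carrier e ∈ (H.gr 1).baseChange A.carrier := by
    refine baseChange_apply_mem A.carrier L.ρ ⊤ _ (fun z _ => L.ρ_mem z) ?_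
    rw [Submodule.baseChange_top]
    exact Submodule.mem_top
  have hρ := map_mem_mpow (L.ρ.baseChange A.carrier) hx
  -- `H` has no differential and `m^(N+2) = 0`, so a change of order `N + 1` does not affect the
  -- Maurer–Cartan equation.
  have hcurv : H.curvature A.carrier (η.1 + L.ρ.baseChange A.carrier e) = 0 := by
    have h₁ := hz (H.curvature_add_sub_mem (by omega) ((mem_nilTensor_iff _ _).1 η.2.1).2 hρ)
    rw [η.2.2, zero_add, sub_eq_zero] at h₁
    rw [h₁, dTensor, show H.d = 0 from LinearMap.ext hd, LinearMap.baseChange_zero,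
      LinearMap.zero_apply]
  let η' : H.MC A := ⟨η.1 + L.ρ.baseChange A.carrier e, (mem_nilTensor_iff _ _).2
    ⟨add_mem η.isFlat.mem h1e, add_mem ((mem_nilTensor_iff _ _).1 η.2.1).2
      (mpow_anti A (by omega) hρ)⟩, hcurv⟩
  have hη' : η'.1 - η.1 = L.ρ.baseChange A.carrier e := add_sub_cancel_left _ _
  let μ := -c.h.baseChange A.carrier (e - L.θ.baseChange A.carrier (L.ρ.baseChange A.carrier e))
  have hμk : μ ∈ mpow A (N + 1) C.carrier :=
    neg_mem (map_mem_mpow _ (sub_mem hx (map_mem_mpow _ hρ)))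
  have hμ0 : μ ∈ (C.gr 0).baseChange A.carrier :=
    neg_mem (baseChange_apply_mem A.carrier c.h (C.gr 1) _ (fun z hz => c.h_mem hz)
      (sub_mem he1 (baseChange_apply_mem A.carrier L.θ (H.gr 1) _ L.θ_mem h1e)))
  -- `e - θ(ρ e)` is a coboundary since `θ` and `ρ` are inverse on `H¹`; the contraction `h` picks a
  -- primitive.
  have hdμ : C.dTensor A.carrier μ =
      -(e - L.θ.baseChange A.carrier (L.ρ.baseChange A.carrier e)) := by
    have he2 : e ∈ (C.gr 1 ⊓ LinearMap.ker C.d).baseChange A.carrier := by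
      have h₁ : (LinearMap.id - c.h ∘ₗ C.d).baseChange A.carrier e = e := by
        rw [LinearMap.baseChange_sub, LinearMap.baseChange_id, LinearMap.baseChange_comp,
          LinearMap.sub_apply, LinearMap.comp_apply,
          show C.d.baseChange A.carrier e = 0 from hde, map_zero, sub_zero, LinearMap.id_apply]
      rw [← h₁]
      refine baseChange_apply_mem A.carrier _ (C.gr 1) _ (fun z hz => ?_) he1
      refine ⟨sub_mem hz (c.h_mem (C.d_mem hz)), ?_⟩
      change C.d (z - c.h (C.d z)) = 0
      rw [map_sub, c.d_h_d, sub_self]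
    have h₁ := baseChange_apply_eq A.carrier (f := C.d ∘ₗ c.h ∘ₗ (LinearMap.id - L.θ ∘ₗ L.ρ))
      (g := LinearMap.id - L.θ ∘ₗ L.ρ) (fun z hz => by
        obtain ⟨ν, -, h⟩ := L.sub z hz.1 hz.2
        change C.d (c.h (z - L.θ (L.ρ z))) = z - L.θ (L.ρ z)
        rw [h, c.d_h_d]) he2
    simp only [LinearMap.baseChange_comp, LinearMap.baseChange_sub, LinearMap.baseChange_id,
      LinearMap.comp_apply, LinearMap.sub_apply, LinearMap.id_apply] at h₁
    rw [map_neg]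
    exact congrArg Neg.neg h₁
  have hd' : C.dTensor A.carrier (Z.κ.baseChange A.carrier μ) +
      C.dTensor A.carrier (Z.s.baseChange A.carrier (Z.q.baseChange A.carrier μ)) =
        C.dTensor A.carrier μ := by
    have h₁ := baseChange_apply_eq A.carrier (f := C.d ∘ₗ (Z.κ + Z.s ∘ₗ Z.q))
      (g := C.d) (fun z hz => Z.d_add z hz) hμ0
    simp only [LinearMap.baseChange_comp, LinearMap.baseChange_add,
      LinearMap.comp_apply, LinearMap.add_apply] at h₁
    rw [← map_add]
    exact h₁
  have hw₁ : Z.q.baseChange A.carrier μ ∈ mpow A (N + 1) W := map_mem_mpow _ hμk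
  have hl₁ : Z.κ.baseChange A.carrier μ ∈ mpow A (N + 1) C.carrier := map_mem_mpow _ hμk
  have hw' : w + Z.q.baseChange A.carrier μ ∈ mpow A 1 W :=
    add_mem hw (mpow_anti A (by omega) hw₁)
  refine ⟨η', _, hw', l + Z.κ.baseChange A.carrier μ, add_mem hl ((mem_nilTensor_iff _ _).2
    ⟨baseChange_apply_mem A.carrier Z.κ _ _ Z.κ_mem hμ0, mpow_anti A (by omega) hl₁⟩), ?_⟩
  have hl0' := ((mem_nilTensor_iff _ _).1 hl0).2
  have h₁ := hz (Z.theta_sub_mem S L hA hw (η := η) (η' := η') (by omega) (hη' ▸ hρ) hw₁ hw')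
  have h₂ := hz (C.gauge_add_sub_mem (by omega) hl0' hl₁
    ((mem_nilTensor_iff _ _).1 (Z.theta S η' hw').2.1).2)
  rw [sub_eq_zero] at h₁
  have h₃ : (Z.theta S η' hw').1 - (Z.theta S η hw).1 ∈ mpow A (N + 1) C.carrier := by
    rw [h₁, hη']
    exact sub_mem (map_mem_mpow _ hρ) (C.dTensor_mem_mpow (map_mem_mpow _ hw₁))
  have h₄ := hz (C.gauge_congr_mem hl0' h₃)
  rw [sub_eq_zero] at h₂ h₄
  rw [h₁, hη'] at h₄
  rw [h₂, sub_eq_iff_eq_add.1 h₄]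
  rw [hdμ, ← eq_sub_iff_add_eq] at hd'
  rw [hd', show x.1 = e + C.gauge A l (Z.theta S η hw).1 from (sub_add_cancel _ _).symm]
  abel

/-- Every class modulo gauge transformations in `K` contains some `exp(s(w)) · σ(η)`. -/
lemma theta_surjective (hd : ∀ x, H.d x = 0) {A : ArtAlg} (x : C.MC A) :
    ∃ (η : H.MC A) (w : A.carrier ⊗[ℂ] W) (hw : w ∈ mpow A 1 W),
      ∃ l ∈ nilTensor A (K ⊓ C.gr 0), C.gauge A l (Z.theta S η hw).1 = x.1 := by
  obtain ⟨N, hN⟩ := A.exists_m_pow_eq_bot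
  replace hN : A.m ^ (N + 1) = ⊥ := by rw [pow_succ, hN, Ideal.bot_mul]
  induction N generalizing A with
  | zero =>
    have hz : ∀ y ∈ mpow A 1 C.carrier, y = 0 := fun y hy => by
      rwa [mpow_eq_bot hN, Submodule.mem_bot] at hy
    refine ⟨⟨0, zero_mem _, by simp [curvature]⟩, 0, zero_mem _, 0, zero_mem _, ?_⟩
    rw [hz x.1 ((mem_nilTensor_iff _ _).1 x.2.1).2]
    exact hz _ ((mem_nilTensor_iff _ _).1 (C.gauge_mem (zero_mem _) (MC.gauge _ _ _).2.1)).2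
  | succ N ih =>
    -- Induction over the quotient `A / m^(N+1)`, where the solution exists already.
    obtain ⟨α, hα⟩ := A.exists_augmentation
    obtain ⟨R, π, hπ, hker⟩ := ArtAlg.exists_truncation α N
    rw [hα] at hker
    let p : A ⟶ R := ArtAlg.ofHom π
    have hp : Function.Surjective p.1 := hπ
    have hR : R.m ^ (N + 1) = ⊥ := ArtAlg.m_pow_eq_bot_of_surjective hp fun a ha => by
      rw [← hker] at ha
      exact ha
    obtain ⟨η₀, w₀, hw₀, l₀, hl₀, e₀⟩ := ih (x.push p) hR
    -- Lifting `η₀` to `A` is not automatic, as `𝒬` may be singular. The class of `x` provides an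
    -- element `η₁` over `A` whose reduction is gauge equivalent to `η₀`, and this equivalence
    -- lifts.
    obtain ⟨η₁, hη₁⟩ := Quot.exists_rep (Ψ.hom.app A (Quot.mk _ x))
    have h₁ := Def.app_push Ψ p hη₁.symm
    have h₂ : (S.σ η₀).Iso (x.push p) := MC.mk_eq_mk.1
      ((MC.mk_eq_mk.2 (Z.theta_iso S η₀ hw₀)).trans
        (MC.mk_eq_mk.2 ⟨l₀, nilTensor_le_gr_zero hl₀, e₀⟩))
    rw [← MC.mk_eq_mk.2 h₂, S.app] at h₁
    obtain ⟨η, -, rfl⟩ := MC.exists_iso_push_eq hp η₁ (MC.mk_eq_mk.1 h₁.symm)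
    obtain ⟨w, hw, rfl⟩ := exists_pushTensor_eq hp (⊤ : Submodule ℂ W)
      ((mem_nilTensor_iff _ _).2 ⟨by rw [Submodule.baseChange_top]; exact Submodule.mem_top, hw₀⟩)
    replace hw := ((mem_nilTensor_iff _ _).1 hw).2
    obtain ⟨l, hl, rfl⟩ := exists_pushTensor_eq hp _ hl₀
    refine Z.theta_surjective_step S hd hN x η hw hl ?_
    refine mem_smul_top_of_push_eq_zero (p := p.1) (fun a ha => ?_) ?_
    · rw [← hker]
      exact ha
    · rw [map_sub, sub_eq_zero, DGLA.push_gauge C p (nilTensor_le_gr_zero hl)]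
      rw [Z.theta_push S p η hw hw₀] at e₀
      exact e₀.symm

end Splitting

end DGLA

/-! ### Homomorphisms from a completion to Artinian algebras -/

section Completion

variable {R : Type u} [CommRing R] [Algebra ℂ R] {I : Ideal R} {A : ArtAlg}

/-- Homomorphisms from a completion to Artinian local algebras are local. -/
lemma AdicCompletion.map_of_mem_m (hI : I.FG) (f : AdicCompletion I R →ₐ[ℂ] A.carrier) {x : R}
    (hx : x ∈ I) : f (algebraMap R (AdicCompletion I R) x) ∈ A.m := by
  have := AdicCompletion.isAdicComplete_self I hI
  have hJ := IsAdicComplete.le_jacobson_bot (I.map (algebraMap R (AdicCompletion I R)))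
    (Ideal.mem_map_of_mem _ hx)
  obtain ⟨α, hα⟩ := A.exists_augmentation
  rw [← hα, RingHom.mem_ker]
  -- If `x` had residue `c ≠ 0`, then `1 - x / c` would be a unit, because `I` lies in the Jacobson
  -- radical of the completion, and yet it would map to zero in `ℂ`.
  by_contra h
  have h₁ := (Ideal.mem_jacobson_bot.1 hJ (algebraMap ℂ _
    (-(α (f (algebraMap R (AdicCompletion I R) x)))⁻¹))).map (α.comp f)
  rw [map_add, map_mul, map_one, AlgHom.commutes, AlgHom.comp_apply] at h₁
  refine h₁.ne_zero ?_
  change α (f _) * -(α (f _))⁻¹ + 1 = 0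
  rw [mul_neg, mul_inv_cancel₀ h, neg_add_cancel]

/-- Continuity is automatic: locality forces homomorphisms to kill `Iᴺ` times the completion, and
modulo that every element comes from `R`. -/
lemma AdicCompletion.algHom_ext_artAlg (hI : I.FG) {f f' : AdicCompletion I R →ₐ[ℂ] A.carrier}
    (h : ∀ x, f (algebraMap R (AdicCompletion I R) x) = f' (algebraMap R (AdicCompletion I R) x)) :
    f = f' := by
  obtain ⟨N, hN⟩ := A.exists_m_pow_eq_bot
  have key : ∀ (f : AdicCompletion I R →ₐ[ℂ] A.carrier) (y : AdicCompletion I R),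
      y ∈ (I ^ N • ⊤ : Submodule R (AdicCompletion I R)) → f y = 0 := by
    intro f y hy
    have h₁ : ∀ a ∈ I ^ N, f (algebraMap R (AdicCompletion I R) a) = 0 := by
      intro a ha
      have h₂ : I ≤ A.m.comap (f.toRingHom.comp (algebraMap R (AdicCompletion I R))) :=
        fun x hx => AdicCompletion.map_of_mem_m hI f hx
      have h₃ := (Ideal.pow_right_mono h₂ N).trans (Ideal.le_comap_pow _ N) ha
      rw [Ideal.mem_comap, hN] at h₃
      exact h₃
    induction hy using Submodule.smul_induction_on' with
    | smul a ha y _ => rw [Algebra.smul_def, map_mul, h₁ a ha, zero_mul]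
    | add x _ y _ hx hy => rw [map_add, hx, hy, add_zero]
  refine AlgHom.ext fun y => ?_
  obtain ⟨r, hr⟩ := Ideal.Quotient.mk_surjective (evalₐ I N y)
  have hy : y - algebraMap R (AdicCompletion I R) r ∈
      (I ^ N • ⊤ : Submodule R (AdicCompletion I R)) := by
    rw [pow_smul_top_eq_ker_eval hI, LinearMap.mem_ker,
      ← factor_evalₐ_eq_eval (I := I) _ (by rw [smul_eq_mul, Ideal.mul_top]), map_sub, ← hr,
      AlgHom.commutes]
    exact (congrArg _ (sub_self _)).trans (RingHom.map_zero _)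
  have h₁ := key f _ hy
  have h₂ := key f' _ hy
  rw [map_sub, sub_eq_zero] at h₁ h₂
  rw [h₁, h₂, h]

lemma AdicCompletion.exists_algHom_artAlg (χ : R →ₐ[ℂ] A.carrier) (h : ∀ x ∈ I, χ x ∈ A.m) :
    ∃ f : AdicCompletion I R →ₐ[ℂ] A.carrier, ∀ x, f (algebraMap R (AdicCompletion I R) x) = χ x := by
  obtain ⟨N, hN⟩ := A.exists_m_pow_eq_bot
  have h₁ : ∀ x ∈ I ^ N, χ x = 0 := fun x hx => by
    have h₃ := (Ideal.pow_right_mono (show I ≤ A.m.comap χ from h) N).trans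
      (Ideal.le_comap_pow _ N) hx
    rw [Ideal.mem_comap, hN] at h₃
    exact h₃
  refine ⟨(Ideal.Quotient.liftₐ (I ^ N) χ h₁).comp ((evalₐ I N).restrictScalars ℂ), fun x => ?_⟩
  change Ideal.Quotient.liftₐ (I ^ N) χ h₁ (evalₐ I N (algebraMap R _ x)) = _
  rw [AlgHom.commutes]
  rfl

lemma completionMap_algebraMap {S : Type v} [CommRing S] [Algebra ℂ S] (f : R →ₐ[ℂ] S)
    (J : Ideal S) (h : I ≤ J.comap f) (x : R) :
    completionMap f I J h (algebraMap R _ x) = algebraMap S _ (f x) := by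
  refine AdicCompletion.ext fun n => ?_
  rfl

end Completion

/-! ### Points of the germ at the origin -/

section Germs

variable {V : Type u} [AddCommGroup V] [Module ℂ V] {B : Type v} [CommRing B] [Algebra ℂ B]
  {c : Module.Dual ℂ V →ₗ[ℂ] B} {W : Type w} [AddCommGroup W] [Module ℂ W] {A : ArtAlg}

lemma Ideal.fg_span_range {U : Type s} [AddCommGroup U] [Module ℂ U] [FiniteDimensional ℂ U]
    {R : Type t} [CommRing R] [Algebra ℂ R] (f : U →ₗ[ℂ] R) : (Ideal.span (Set.range f)).FG := by
  obtain ⟨s, hs⟩ := Module.Finite.iff_fg.1 (inferInstance : Module.Finite ℂ (LinearMap.range f))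
  refine ⟨s, ?_⟩
  rw [← LinearMap.coe_range, ← hs]
  exact (Submodule.span_span_of_tower ℂ R _).symm

/-- Finite generation is what makes the completion complete for the extended ideal. -/
lemma originIdeal_fg [FiniteDimensional ℂ V] [FiniteDimensional ℂ W] : (originIdeal c W).FG := by
  rw [originIdeal, Ideal.span_union]
  refine Submodule.FG.sup ?_ ?_
  · exact Ideal.fg_span_range 
      ((Algebra.TensorProduct.includeLeft : B →ₐ[ℂ] ProdRing B W).toLinearMap ∘ₗ c)
  · exact Ideal.fg_span_range
      ((Algebra.TensorProduct.includeRight : _ →ₐ[ℂ] ProdRing B W).toLinearMap ∘ₗ SymmetricAlgebra.ι ℂ (Module.Dual ℂ W))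

/-- The component in `X` of a point of the germ of `X × W`. -/
noncomputable def germFst (f : GermRing c W →ₐ[ℂ] A.carrier) : B →ₐ[ℂ] A.carrier :=
  (f.comp (IsScalarTower.toAlgHom ℂ (ProdRing B W) (GermRing c W))).comp
    Algebra.TensorProduct.includeLeft

/-- The component in `W` of a point of the germ of `X × W`. -/
noncomputable def germSnd (f : GermRing c W →ₐ[ℂ] A.carrier) : Module.Dual ℂ W →ₗ[ℂ] A.carrier :=
  ((f.comp (IsScalarTower.toAlgHom ℂ (ProdRing B W) (GermRing c W))).comp
    Algebra.TensorProduct.includeRight).toLinearMap ∘ₗ SymmetricAlgebra.ι ℂ (Module.Dual ℂ W)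

lemma germ_ext [FiniteDimensional ℂ V] [FiniteDimensional ℂ W]
    {f f' : GermRing c W →ₐ[ℂ] A.carrier} (h₁ : germFst f = germFst f')
    (h₂ : germSnd f = germSnd f') : f = f' := by
  refine AdicCompletion.algHom_ext_artAlg originIdeal_fg fun x => ?_
  have : f.comp (IsScalarTower.toAlgHom ℂ (ProdRing B W) (GermRing c W)) =
      f'.comp (IsScalarTower.toAlgHom ℂ (ProdRing B W) (GermRing c W)) :=
    Algebra.TensorProduct.ext h₁ (SymmetricAlgebra.algHom_ext h₂)
  exact DFunLike.congr_fun this x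

lemma germFst_mem [FiniteDimensional ℂ V] [FiniteDimensional ℂ W]
    (f : GermRing c W →ₐ[ℂ] A.carrier) (l : Module.Dual ℂ V) : germFst f (c l) ∈ A.m :=
  AdicCompletion.map_of_mem_m originIdeal_fg f (Ideal.subset_span (Or.inl ⟨l, rfl⟩))

lemma germSnd_mem [FiniteDimensional ℂ V] [FiniteDimensional ℂ W]
    (f : GermRing c W →ₐ[ℂ] A.carrier) (l : Module.Dual ℂ W) : germSnd f l ∈ A.m :=
  AdicCompletion.map_of_mem_m originIdeal_fg f (Ideal.subset_span (Or.inr ⟨l, rfl⟩))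

lemma exists_germ (φ : B →ₐ[ℂ] A.carrier) (hφ : ∀ l, φ (c l) ∈ A.m)
    (ψ : Module.Dual ℂ W →ₗ[ℂ] A.carrier) (hψ : ∀ l, ψ l ∈ A.m) :
    ∃ f : GermRing c W →ₐ[ℂ] A.carrier, germFst f = φ ∧ germSnd f = ψ := by
  let χ : ProdRing B W →ₐ[ℂ] A.carrier :=
    Algebra.TensorProduct.lift φ (SymmetricAlgebra.lift ψ) fun _ _ => Commute.all _ _
  obtain ⟨f, hf⟩ := AdicCompletion.exists_algHom_artAlg (I := originIdeal c W) χ (by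
    intro x hx
    refine (Ideal.span_le (I := A.m.comap χ)).2 ?_ hx
    rintro _ (⟨l, rfl⟩ | ⟨l, rfl⟩)
    · change χ _ ∈ A.m
      rw [Algebra.TensorProduct.lift_tmul, map_one, mul_one]
      exact hφ l
    · change χ _ ∈ A.m
      rw [Algebra.TensorProduct.lift_tmul, map_one, one_mul, SymmetricAlgebra.lift_ι_apply]
      exact hψ l)
  refine ⟨f, AlgHom.ext fun b => ?_, LinearMap.ext fun l => ?_⟩
  · refine (hf _).trans ?_
    change χ (b ⊗ₜ 1) = φ b
    rw [Algebra.TensorProduct.lift_tmul, map_one, mul_one]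
  · refine (hf _).trans ?_
    change χ (1 ⊗ₜ SymmetricAlgebra.ι ℂ (Module.Dual ℂ W) l) = ψ l
    rw [Algebra.TensorProduct.lift_tmul, map_one, one_mul, SymmetricAlgebra.lift_ι_apply]

variable {J : Ideal B}

lemma germFst_restrict (f : SubGermRing c J W →ₐ[ℂ] A.carrier) :
    germFst (f.comp (germRestrict c J W)) = (germFst f).comp (Ideal.Quotient.mkₐ ℂ J) := by
  refine AlgHom.ext fun b => ?_
  refine congrArg f ((completionMap_algebraMap _ _ (originIdeal_le c J W) _).trans ?_)
  rw [prodQuot]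
  exact congrArg _ (Algebra.TensorProduct.map_tmul _ _ _ _)

lemma germSnd_restrict (f : SubGermRing c J W →ₐ[ℂ] A.carrier) :
    germSnd (f.comp (germRestrict c J W)) = germSnd f := by
  refine LinearMap.ext fun l => ?_
  refine congrArg f ((completionMap_algebraMap _ _ (originIdeal_le c J W) _).trans ?_)
  rw [prodQuot]
  exact congrArg _ ((Algebra.TensorProduct.map_tmul _ _ _ _).trans (by rw [map_one]; rfl))

lemma comp_germRestrict_injective [FiniteDimensional ℂ V] [FiniteDimensional ℂ W] :
    Function.Injective fun f : SubGermRing c J W →ₐ[ℂ] A.carrier => f.comp (germRestrict c J W) := by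
  intro f f' h
  have h₁ := congrArg germFst h
  have h₂ := congrArg germSnd h
  simp only [germFst_restrict, germSnd_restrict] at h₁ h₂
  exact germ_ext (Ideal.Quotient.algHom_ext _ h₁) h₂

/-- The points of the germ of `X' × W`, as points of the germ of `X × W`. -/
lemma exists_comp_germRestrict_eq_iff [FiniteDimensional ℂ V] [FiniteDimensional ℂ W]
    (f : GermRing c W →ₐ[ℂ] A.carrier) :
    (∃ f' : SubGermRing c J W →ₐ[ℂ] A.carrier, f'.comp (germRestrict c J W) = f) ↔
      ∀ b ∈ J, germFst f b = 0 := by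
  constructor
  · rintro ⟨f', rfl⟩ b hb
    rw [germFst_restrict]
    change germFst f' (Ideal.Quotient.mk J b) = 0
    rw [Ideal.Quotient.eq_zero_iff_mem.2 hb, map_zero]
  · intro h
    obtain ⟨f', h₁, h₂⟩ := exists_germ (c := (Ideal.Quotient.mkₐ ℂ J).toLinearMap ∘ₗ c)
      (Ideal.Quotient.liftₐ J (germFst f) h) (fun l => germFst_mem f l) (germSnd f) (germSnd_mem f)
    refine ⟨f', germ_ext ?_ ?_⟩
    · rw [germFst_restrict, h₁]
      rfl
    · rw [germSnd_restrict, h₂]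

end Germs

/-! ### Tensors with coefficients in a subspace -/

section Subtype

variable {V : Type u} [AddCommGroup V] [Module ℂ V] (K S : Submodule ℂ V) {A : ArtAlg}

lemma baseChange_subtype_injective :
    Function.Injective (K.subtype.baseChange A.carrier) := by
  obtain ⟨r, hr⟩ := LinearMap.exists_leftInverse_of_injective K.subtype
    (LinearMap.ker_eq_bot.2 K.injective_subtype)
  refine Function.LeftInverse.injective (g := r.baseChange A.carrier) fun x => ?_
  rw [← LinearMap.comp_apply, ← LinearMap.baseChange_comp, hr, LinearMap.baseChange_id,
    LinearMap.id_apply]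

lemma baseChange_subtype_mem {x : A.carrier ⊗[ℂ] K} (hx : x ∈ nilTensor A (S.comap K.subtype)) :
    K.subtype.baseChange A.carrier x ∈ nilTensor A (K ⊓ S) := by
  rw [mem_nilTensor_iff] at hx ⊢
  exact ⟨baseChange_apply_mem _ _ (S.comap K.subtype) (K ⊓ S) (fun y hy => ⟨y.2, hy⟩) hx.1, map_mem_mpow _ hx.2⟩

lemma exists_baseChange_subtype_eq {x : A.carrier ⊗[ℂ] V} (hx : x ∈ nilTensor A (K ⊓ S)) :
    ∃ y ∈ nilTensor A (S.comap K.subtype), K.subtype.baseChange A.carrier y = x := by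
  obtain ⟨r, hr⟩ := LinearMap.exists_leftInverse_of_injective (K ⊓ S).subtype
    (LinearMap.ker_eq_bot.2 (K ⊓ S).injective_subtype)
  let r' : V →ₗ[ℂ] K := Submodule.inclusion inf_le_left ∘ₗ r
  rw [mem_nilTensor_iff] at hx
  refine ⟨r'.baseChange A.carrier x, (mem_nilTensor_iff _ _).2
    ⟨baseChange_apply_mem _ _ (K ⊓ S) _ (fun y _ => (r y).2.2) hx.1, map_mem_mpow _ hx.2⟩, ?_⟩
  rw [← LinearMap.comp_apply, ← LinearMap.baseChange_comp,
    baseChange_apply_eq A.carrier (g := LinearMap.id) (fun y hy =>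
      congrArg Subtype.val (LinearMap.congr_fun hr ⟨y, hy⟩)) hx.1, LinearMap.baseChange_id,
    LinearMap.id_apply]

end Subtype

/-! ### Deformations of the augmentation ideal -/

namespace DGLA

variable {C : DGLA.{u}} {g : Type u} [LieRing g] [LieAlgebra ℂ g] (ε : C.Hom (ofLie g))
  {A : ArtAlg}

/-- `g` is concentrated in degree 0. Hence `C₀` and `C` have the same Maurer–Cartan elements. -/
lemma gr_one_le_ker : C.gr 1 ≤ LinearMap.ker ε.toFun := fun x hx => by
  have := ε.map_mem hx
  simpa using this

/-- A Maurer–Cartan element of `C`, as one of the augmentation ideal. -/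
lemma exists_mapMC_kerInclusion_eq (x : C.MC A) :
    ∃ y : ε.ker.MC A, ε.kerInclusion.mapMC y = x := by
  have hx : x.1 ∈ nilTensor A (LinearMap.ker ε.toFun ⊓ C.gr 1) :=
    Submodule.smul_mono le_rfl (baseChange_mono _ (le_inf (gr_one_le_ker ε) le_rfl)) x.2.1
  obtain ⟨y, hy, e⟩ := exists_baseChange_subtype_eq _ _ hx
  refine ⟨⟨y, hy, ?_⟩, Subtype.ext e⟩
  refine baseChange_subtype_injective _ ?_
  refine (ε.kerInclusion.map_curvature A.carrier y).trans ?_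
  refine (congrArg (C.curvature A.carrier) e).trans ?_
  exact x.2.2.trans (map_zero _).symm

lemma mapMC_kerInclusion_injective :
    Function.Injective (ε.kerInclusion.mapMC : ε.ker.MC A → C.MC A) := fun _ _ h =>
  Subtype.ext (baseChange_subtype_injective _ (congrArg Subtype.val h))

/-- Passing to the kernel changes only the group of gauge transformations, which can thus be studied
inside `C`. -/
lemma iso_kerInclusion_iff {x y : ε.ker.MC A} :
    x.Iso y ↔ ∃ l ∈ nilTensor A (LinearMap.ker ε.toFun ⊓ C.gr 0),
      C.gauge A l (ε.kerInclusion.mapMC x).1 = (ε.kerInclusion.mapMC y).1 := by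
  constructor
  · rintro ⟨l, hl, e⟩
    refine ⟨_, baseChange_subtype_mem _ _ hl, ?_⟩
    refine (ε.kerInclusion.map_gauge ((mem_nilTensor_iff _ _).1 hl).2 x.1).symm.trans ?_
    rw [e]
    rfl
  · rintro ⟨l, hl, e⟩
    obtain ⟨l, hl', rfl⟩ := exists_baseChange_subtype_eq _ _ hl
    refine ⟨l, hl', baseChange_subtype_injective _ ?_⟩
    exact (ε.kerInclusion.map_gauge ((mem_nilTensor_iff _ _).1 hl').2 x.1).trans e

/-- The Maurer–Cartan element of the augmentation ideal given by one of `C`. -/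
noncomputable def MC.toKer (x : C.MC A) : ε.ker.MC A :=
  (exists_mapMC_kerInclusion_eq ε x).choose

lemma MC.mapMC_toKer (x : C.MC A) : ε.kerInclusion.mapMC (x.toKer ε) = x :=
  (exists_mapMC_kerInclusion_eq ε x).choose_spec

lemma MC.toKer_push {B : ArtAlg} (p : A ⟶ B) (x : C.MC A) :
    (x.push p).toKer ε = (x.toKer ε).push p := by
  refine mapMC_kerInclusion_injective ε ?_
  rw [MC.mapMC_toKer, Hom.mapMC_push, MC.mapMC_toKer]

/-- A Lie algebra augmentation that is injective on `H⁰` gives a decomposition of `C⁰`. -/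
lemma nonempty_splitting (hsurj : ∀ y : g, ∃ x ∈ C.gr 0, ε.toFun x = y)
    (hinj : Set.InjOn ε.toFun (C.cocycles ⊓ C.gr 0 : Submodule ℂ C.carrier)) :
    Nonempty (C.Splitting (LinearMap.ker ε.toFun)
      (g ⧸ ((C.cocycles ⊓ C.gr 0).map ε.toFun : Submodule ℂ g))) := by
  let Z : Submodule ℂ C.carrier := C.cocycles ⊓ C.gr 0
  let e : C.carrier →ₗ[ℂ] g := ε.toFun
  let q : C.carrier →ₗ[ℂ] g ⧸ Z.map e := (Z.map e).mkQ ∘ₗ e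
  obtain ⟨s₀, hs₀⟩ := LinearMap.exists_rightInverse_of_surjective (q ∘ₗ (C.gr 0).subtype) (by
    rw [LinearMap.range_eq_top]
    intro w
    obtain ⟨y, rfl⟩ := (Z.map e).mkQ_surjective w
    obtain ⟨x, hx, rfl⟩ := hsurj y
    exact ⟨⟨x, hx⟩, rfl⟩)
  obtain ⟨r, hr⟩ := LinearMap.exists_leftInverse_of_injective (e ∘ₗ Z.subtype) (by
    rw [LinearMap.ker_eq_bot]
    intro x y h
    exact Subtype.ext (hinj x.2 y.2 h))
  let s : (g ⧸ Z.map e) →ₗ[ℂ] C.carrier := (C.gr 0).subtype ∘ₗ s₀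
  have hqs : ∀ w, q (s w) = w := fun w => LinearMap.congr_fun hs₀ w
  have hre : ∀ x ∈ Z, (r (e x) : C.carrier) = x := fun x hx =>
    congrArg Subtype.val (LinearMap.congr_fun hr ⟨x, hx⟩)
  -- After the part of `x` along `W` is removed, its image under `ε` lies in `ε(H⁰(C))`; `t x` is
  -- the unique cocycle of degree 0 with this image. The component in the kernel is then the
  -- remainder.
  let t : C.carrier →ₗ[ℂ] C.carrier := Z.subtype ∘ₗ r ∘ₗ e ∘ₗ (LinearMap.id - s ∘ₗ q)
  have ht : ∀ x, t x = (r (e (x - s (q x))) : C.carrier) := fun _ => rfl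
  have htZ : ∀ x, t x ∈ Z := fun x => (r _).2
  have het : ∀ x, e (t x) = e (x - s (q x)) := by
    intro x
    have h₁ : q (x - s (q x)) = 0 := by rw [map_sub, hqs, sub_self]
    obtain ⟨z, hz, h₂⟩ := (Submodule.Quotient.mk_eq_zero (Z.map e)).1 h₁
    rw [ht, ← h₂, hre z hz]
  have hq0 : ∀ x ∈ C.gr 0, C.d x = 0 → q x = 0 := fun x hx hd =>
    (Submodule.Quotient.mk_eq_zero (Z.map e)).2 ⟨x, ⟨hd, hx⟩, rfl⟩
  have hqK : ∀ x ∈ LinearMap.ker e, q x = 0 := fun x hx => by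
    change (Z.map e).mkQ (e x) = 0
    rw [LinearMap.mem_ker.1 hx, map_zero]
  exact ⟨{
    s := s
    q := q
    κ := LinearMap.id - s ∘ₗ q - t
    s_mem := fun w => (s₀ w).2
    κ_mem := fun x hx => by
      refine ⟨?_, sub_mem (sub_mem hx (s₀ _).2) (htZ x).2⟩
      change e (x - s (q x) - t x) = 0
      rw [map_sub, het, sub_self]
    d_add := fun x hx => by
      have : (LinearMap.id - s ∘ₗ q - t : C.carrier →ₗ[ℂ] C.carrier) x + s (q x) = x - t x := by
        change x - s (q x) - t x + s (q x) = x - t x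
        abel
      rw [this, map_sub, show C.d (t x) = 0 from (htZ x).1, sub_zero]
    q_s := hqs
    κ_s := fun w => by
      change s w - s (q (s w)) - t (s w) = 0
      rw [ht, hqs, sub_self, map_zero, map_zero]
      exact sub_zero _
    q_of_mem := hqK
    κ_of_mem := fun x hx => by
      change x - s (q x) - t x = x
      rw [ht, hqK x hx, map_zero, sub_zero, LinearMap.mem_ker.1 hx, map_zero]
      exact sub_zero _
    q_cocycle := hq0
    κ_cocycle := fun x hx hd => by
      change x - s (q x) - t x = 0
      rw [ht, hq0 x hx hd, map_zero, sub_zero, hre x ⟨hd, hx⟩, sub_self] }⟩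

section Germ

variable {ε} {H : DGLA.{u}} [FiniteDimensional ℂ (H.gr 1)] {W : Type u} [AddCommGroup W]
  [Module ℂ W] [FiniteDimensional ℂ W]

/-- The Maurer–Cartan element given by a point of the germ of `ℱ(H) × W`. -/
noncomputable def germMC (f : GermRing H.flatCoord W →ₐ[ℂ] A.carrier) : H.MC A :=
  MC.ofHom (germFst f) (germFst_mem f)

/-- The vector given by a point of the germ of `ℱ(H) × W`. -/
noncomputable def germVec (f : GermRing H.flatCoord W →ₐ[ℂ] A.carrier) : A.carrier ⊗[ℂ] W :=
  (exists_tensorCoord (germSnd f)).choose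

lemma tensorCoord_germVec (f : GermRing H.flatCoord W →ₐ[ℂ] A.carrier) (l : Module.Dual ℂ W) :
    tensorCoord A.carrier l (germVec f) = germSnd f l :=
  (exists_tensorCoord (germSnd f)).choose_spec l

lemma germVec_mem (f : GermRing H.flatCoord W →ₐ[ℂ] A.carrier) : germVec f ∈ mpow A 1 W := by
  rw [mpow, pow_one, mem_smul_top_iff_coord]
  intro l
  rw [tensorCoord_germVec]
  exact germSnd_mem f l

lemma germMC_comp {B : ArtAlg} (p : A ⟶ B) (f : GermRing H.flatCoord W →ₐ[ℂ] A.carrier) :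
    germMC (p.1.comp f) = (germMC f).push p :=
  Subtype.ext (pushTensor_comp (germFst f) p.1 H.taut)

lemma germVec_comp {B : ArtAlg} (p : A ⟶ B) (f : GermRing H.flatCoord W →ₐ[ℂ] A.carrier) :
    germVec (p.1.comp f) = pushTensor p.1 W (germVec f) := by
  refine tensorCoord_ext fun l => ?_
  rw [tensorCoord_germVec, tensorCoord_push, tensorCoord_germVec]
  rfl

lemma germ_ext_MC {f f' : GermRing H.flatCoord W →ₐ[ℂ] A.carrier} (h₁ : germMC f = germMC f')
    (h₂ : germVec f = germVec f') : f = f' := by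
  refine germ_ext (flatHom_ext_taut (congrArg Subtype.val h₁)) (LinearMap.ext fun l => ?_)
  rw [← tensorCoord_germVec, h₂, tensorCoord_germVec]

lemma exists_germMC_eq (η : H.MC A) {w : A.carrier ⊗[ℂ] W} (hw : w ∈ mpow A 1 W) :
    ∃ f : GermRing H.flatCoord W →ₐ[ℂ] A.carrier, germMC f = η ∧ germVec f = w := by
  obtain ⟨φ, hφ, rfl⟩ := η.exists_ofHom
  let ψ : Module.Dual ℂ W →ₗ[ℂ] A.carrier :=
    { toFun := fun l => tensorCoord A.carrier l w
      map_add' := fun l l' => by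
        simp only [tensorCoord_apply, LinearMap.lTensor_add, LinearMap.add_apply, map_add]
      map_smul' := fun a l => by
        simp only [tensorCoord_apply, LinearMap.lTensor_smul, LinearMap.smul_apply, map_smul,
          RingHom.id_apply] }
  rw [mpow, pow_one, mem_smul_top_iff_coord] at hw
  obtain ⟨f, h₁, h₂⟩ := exists_germ (c := H.flatCoord) φ hφ ψ hw
  refine ⟨f, Subtype.ext ?_, tensorCoord_ext fun l => ?_⟩
  · exact congrArg (fun φ => pushTensor φ H.carrier H.taut) h₁
  · rw [tensorCoord_germVec, h₂]
    rfl

variable (Z : C.Splitting (LinearMap.ker ε.toFun) W) {Ψ : C.Def ≅ H.Def} (S : NatSection Ψ)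

/-- The deformation of the augmentation ideal given by a point of the germ of `ℱ(H) × W`. -/
noncomputable def germToKer (f : GermRing H.flatCoord W →ₐ[ℂ] A.carrier) : ε.ker.MC A :=
  (Z.theta S (germMC f) (germVec_mem f)).toKer ε

lemma germToKer_comp {B : ArtAlg} (p : A ⟶ B) (f : GermRing H.flatCoord W →ₐ[ℂ] A.carrier) :
    germToKer Z S (p.1.comp f) = (germToKer Z S f).push p := by
  have e : Z.theta S (germMC (p.1.comp f)) (germVec_mem (p.1.comp f)) =
      (Z.theta S (germMC f) (germVec_mem f)).push p := by
    rw [← Z.theta_push S p _ _ (by rw [← germVec_comp]; exact germVec_mem (p.1.comp f))]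
    congr 1
    · exact germMC_comp p f
    · exact germVec_comp p f
  exact (congrArg (MC.toKer ε) e).trans (MC.toKer_push ε p _)

lemma mapMC_germToKer (f : GermRing H.flatCoord W →ₐ[ℂ] A.carrier) :
    ε.kerInclusion.mapMC (germToKer Z S f) = Z.theta S (germMC f) (germVec_mem f) :=
  MC.mapMC_toKer ε _

/-- The map from the germ of `ℱ(H) × W` to the deformation functor of the augmentation ideal. -/
noncomputable def germToDef : ArtAlg.homFunctor (GermRing H.flatCoord W) ⟶ ε.ker.Def where
  app A := ↾fun f : GermRing H.flatCoord W →ₐ[ℂ] A.carrier => Quot.mk _ (germToKer Z S f)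
  naturality A B p := by
    ext f
    exact congrArg (Quot.mk _) (germToKer_comp Z S p f)

/-- A point of the germ is a pair `(η, w)`, and gauge equivalence over the kernel is gauge
equivalence in `C` by elements of `K ∩ C⁰`, so the two halves are `theta_injective` and
`theta_surjective`. -/
lemma isIso_germToDef (hd : ∀ x, H.d x = 0) : IsIso (germToDef Z S) := by
  rw [NatTrans.isIso_iff_isIso_app]
  intro A
  rw [isIso_iff_bijective]
  constructor
  · intro f f' h
    obtain ⟨l, hl, e⟩ := (iso_kerInclusion_iff ε).1 (MC.mk_eq_mk.1 h)
    erw [mapMC_germToKer, mapMC_germToKer] at e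
    obtain ⟨h₁, h₂⟩ := Z.theta_injective S hd _ _ hl e
    exact germ_ext_MC h₁ h₂
  · intro y
    obtain ⟨y, rfl⟩ := Quot.exists_rep y
    obtain ⟨η, w, hw, l, hl, e⟩ := Z.theta_surjective S hd (ε.kerInclusion.mapMC y)
    obtain ⟨f, rfl, rfl⟩ := exists_germMC_eq η hw
    refine ⟨f, MC.mk_eq_mk.2 ((iso_kerInclusion_iff ε).2 ⟨l, hl, ?_⟩)⟩
    rw [mapMC_germToKer]
    exact e

end Germ

end DGLA

/-! ### Matrices of Aomoto differentials under change of rings -/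

section IntegerBasis

variable {V : Type u} [AddCommGroup V] [Module ℂ V] (gr : ℕ → Submodule ℂ V)

/-- The degree `n` part, for `n ∈ ℤ`, of a space graded by `ℕ`. -/
def extendGr (n : ℤ) : Submodule ℂ V := if 0 ≤ n then gr n.toNat else ⊥

lemma baseChange_extendGr (A : Type t) [CommRing A] [Algebra ℂ A] (n : ℤ) :
    (extendGr gr n).baseChange A = intGr A gr n := by
  rw [extendGr, intGr]
  split_ifs
  · rfl
  · exact Submodule.baseChange_bot A

lemma finite_extendGr (hgr : ∀ i, FiniteDimensional ℂ (gr i)) (n : ℤ) :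
    FiniteDimensional ℂ (extendGr gr n) := by
  by_cases h : 0 ≤ n
  · rw [extendGr, if_pos h]
    exact hgr _
  · rw [extendGr, if_neg h]
    infer_instance

variable {gr} (A : Type t) [CommRing A] [Algebra ℂ A]

/-- The basis of `Vⁿ ⊗ A` given by a basis of `Vⁿ`. -/
noncomputable def intBasis {n : ℤ} {ι : Type*} (b : Module.Basis ι ℂ (extendGr gr n)) :
    Module.Basis ι A (intGr A gr n) :=
  (baseChangeBasis A _ b).map (LinearEquiv.ofEq _ _ (baseChange_extendGr gr A n))

lemma intBasis_apply {n : ℤ} {ι : Type*} (b : Module.Basis ι ℂ (extendGr gr n)) (i : ι) :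
    (intBasis A b i : A ⊗[ℂ] V) = 1 ⊗ₜ[ℂ] (b i : V) := by
  rw [intBasis, Module.Basis.map_apply, LinearEquiv.coe_ofEq_apply, baseChangeBasis_apply]

variable {A} {B : Type s} [CommRing B] [Algebra ℂ B]

lemma intBasis_repr_push (φ : A →ₐ[ℂ] B) {n : ℤ} {ι : Type*} [Finite ι]
    (b : Module.Basis ι ℂ (extendGr gr n)) (x : intGr A gr n) (y : intGr B gr n)
    (h : pushTensor φ V x.1 = y.1) (i : ι) :
    (intBasis B b).repr y i = φ ((intBasis A b).repr x i) := by
  have := Fintype.ofFinite ι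
  have e : y = ∑ i, φ ((intBasis A b).repr x i) • intBasis B b i := by
    refine Subtype.ext ?_
    rw [← h]
    conv_lhs => rw [← (intBasis A b).sum_repr x]
    simp only [AddSubmonoidClass.coe_finsetSum, Submodule.coe_smul, map_sum, pushTensor_smul,
      intBasis_apply, pushTensor_tmul, map_one]
  rw [e, Module.Basis.repr_sum_self]

/-- Bases coming from `ℂ` are carried to each other by `φ`, so matrix entries specialize along `φ`.
-/
lemma toMatrix_intBasis (φ : A →ₐ[ℂ] B) {m n : ℤ} {ι κ : Type*} [Fintype ι] [DecidableEq ι]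
    [Finite κ] (b : Module.Basis ι ℂ (extendGr gr m)) (c : Module.Basis κ ℂ (extendGr gr n))
    (f : intGr A gr m →ₗ[A] intGr A gr n) (f' : intGr B gr m →ₗ[B] intGr B gr n)
    (h : ∀ x y, pushTensor φ V x.1 = y.1 → pushTensor φ V (f x).1 = (f' y).1) :
    LinearMap.toMatrix (intBasis B b) (intBasis B c) f' =
      (LinearMap.toMatrix (intBasis A b) (intBasis A c) f).map φ := by
  ext i j
  rw [LinearMap.toMatrix_apply, Matrix.map_apply, LinearMap.toMatrix_apply]
  refine intBasis_repr_push φ c _ _ (h _ _ ?_) i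
  rw [intBasis_apply, intBasis_apply, pushTensor_tmul, map_one]

lemma extendBilin_comp {W : Type v} {U : Type w} [AddCommGroup W] [Module ℂ W] [AddCommGroup U]
    [Module ℂ U] {V' : Type*} [AddCommGroup V'] [Module ℂ V'] (β : V →ₗ[ℂ] W →ₗ[ℂ] U)
    (f : V' →ₗ[ℂ] V) (y : A ⊗[ℂ] V') (x : A ⊗[ℂ] W) :
    extendBilin A (β ∘ₗ f) y x = extendBilin A β (f.baseChange A y) x := by
  induction y using TensorProduct.induction_on with
  | zero => simp only [map_zero, LinearMap.zero_apply]
  | add y z hy hz => simp only [map_add, LinearMap.add_apply, hy, hz]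
  | tmul a y =>
    induction x using TensorProduct.induction_on with
    | zero => simp only [map_zero]
    | add x z hx hz => simp only [map_add, hx, hz]
    | tmul b x =>
      rw [LinearMap.baseChange_tmul, extendBilin_tmul, extendBilin_tmul, LinearMap.comp_apply]

end IntegerBasis

namespace DGModule

variable {C : DGLA.{u}} (M : DGModule.{u, v} C) {A : Type t} [CommRing A] [Algebra ℂ A]
  {B : Type s} [CommRing B] [Algebra ℂ B]

lemma pushTensor_dAomoto (φ : A →ₐ[ℂ] B) (ω : A ⊗[ℂ] C.carrier) (x : A ⊗[ℂ] M.carrier) :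
    pushTensor φ M.carrier (M.dAomoto A ω x) =
      M.dAomoto B (pushTensor φ C.carrier ω) (pushTensor φ M.carrier x) := by
  rw [dAomoto, dAomoto, LinearMap.add_apply, LinearMap.add_apply, map_add, pushTensor_baseChange,
    pushTensor_extendBilin]

lemma toMatrix_aomoto (φ : A →ₐ[ℂ] B) {ω : A ⊗[ℂ] C.carrier} (hω : C.IsFlat A ω)
    {η : B ⊗[ℂ] C.carrier} (hη : C.IsFlat B η) (e : pushTensor φ C.carrier ω = η) {m n : ℤ}
    (hmn : m + 1 = n) {ι κ : Type*} [Fintype ι] [DecidableEq ι] [Finite κ]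
    (b : Module.Basis ι ℂ (extendGr M.gr m)) (c : Module.Basis κ ℂ (extendGr M.gr n)) :
    LinearMap.toMatrix (intBasis B b) (intBasis B c) ((M.aomoto hη).d m n).hom =
      (LinearMap.toMatrix (intBasis A b) (intBasis A c) ((M.aomoto hω).d m n).hom).map φ := by
  refine toMatrix_intBasis φ b c _ _ fun x y hxy => ?_
  have h₁ := complexOfGraded_d_apply (hD := fun _ _ hx => M.dAomoto_mem hω.mem hx)
    (hDD := M.dAomoto_dAomoto hω) m n hmn x
  have h₂ := complexOfGraded_d_apply (hD := fun _ _ hx => M.dAomoto_mem hη.mem hx)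
    (hDD := M.dAomoto_dAomoto hη) m n hmn y
  refine (congrArg (pushTensor φ M.carrier) h₁).trans (Eq.trans ?_ h₂.symm)
  rw [pushTensor_dAomoto, e, hxy]

/-- Specialization of a family: pushing `ω` forward along `φ` applies `φ` to the matrices of the
differentials, hence to their minors. -/
lemma minors_aomoto (φ : A →ₐ[ℂ] B) {ω : A ⊗[ℂ] C.carrier} (hω : C.IsFlat A ω)
    {η : B ⊗[ℂ] C.carrier} (hη : C.IsFlat B η) (e : pushTensor φ C.carrier ω = η) (i : ℤ)
    {ι₀ ι₁ ι₂ : Type*} [Fintype ι₀] [Fintype ι₁] [DecidableEq ι₀] [DecidableEq ι₁] [Fintype ι₂]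
    (b₀ : Module.Basis ι₀ ℂ (extendGr M.gr (i - 1))) (b₁ : Module.Basis ι₁ ℂ (extendGr M.gr i))
    (b₂ : Module.Basis ι₂ ℂ (extendGr M.gr (i + 1))) (k : ℕ) :
    (ThreeTerm.ofComplex (M.aomoto hη) i).minors (intBasis B b₀) (intBasis B b₁) (intBasis B b₂) k =
      ((ThreeTerm.ofComplex (M.aomoto hω) i).minors (intBasis A b₀) (intBasis A b₁)
        (intBasis A b₂) k).map φ := by
  have h := minorIdeal_map φ.toRingHom (Matrix.fromBlocks
    (LinearMap.toMatrix (intBasis A b₀) (intBasis A b₁) ((M.aomoto hω).d (i - 1) i).hom) 0 0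
    (LinearMap.toMatrix (intBasis A b₁) (intBasis A b₂) ((M.aomoto hω).d i (i + 1)).hom))
    (Fintype.card ι₁ + 1 - k)
  refine Eq.trans ?_ h
  rw [Matrix.fromBlocks_map, Matrix.map_zero _ (map_zero _), Matrix.map_zero _ (map_zero _)]
  refine congrArg (fun N => minorIdeal N _) ?_
  exact congrArg₂ (fun N N' => Matrix.fromBlocks N 0 0 N')
    (M.toMatrix_aomoto φ hω hη e (by omega) b₀ b₁) (M.toMatrix_aomoto φ hω hη e rfl b₁ b₂)

/-- If every `Mⁱ` is finite-dimensional, an Aomoto complex is its own resolution. -/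
lemma nonempty_freeResolution_of_finite {ω : A ⊗[ℂ] C.carrier} (hω : C.IsFlat A ω)
    (hb : ∃ n : ℕ, ∀ i : ℕ, n < i → M.gr i = ⊥) (hf : ∀ j, FiniteDimensional ℂ (M.gr j)) :
    Nonempty (FreeResolution (M.aomoto hω)) :=
  ⟨⟨M.aomoto hω, fun n => free_intGr n, fun n => finite_intGr hf n, M.subsingleton_aomoto hω hb,
    𝟙 _, inferInstance⟩⟩

/-- The two differentials are literally equal on `M ⊗ A`. -/
lemma heq_aomoto_restrict {D : DGLA.{u}} (f : D.Hom C) {A : ArtAlg} (ω : D.MC A) (i : ℤ) :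
    (ThreeTerm.ofComplex ((M.restrict f).aomoto ω.isFlat) i).HEq
      (ThreeTerm.ofComplex (M.aomoto (f.mapMC ω).isFlat) i) := by
  have e : (M.restrict f).dAomoto A.carrier ω.1 = M.dAomoto A.carrier (f.mapMC ω).1 := by
    refine LinearMap.ext fun x => ?_
    have h := extendBilin_comp (A := A.carrier) M.act f.toFun ω.1 x
    exact congrArg (M.d.baseChange A.carrier x + ·) h
  exact .of_graded i LinearMap.id (fun _ _ h => h) (fun _ x _ => LinearMap.congr_fun e x)
    LinearMap.id LinearMap.id LinearMap.id (fun _ h => h) (fun _ h => h) (fun _ h => h)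
    (fun _ _ => rfl) (fun _ _ => rfl) (fun _ _ => rfl) (fun _ _ => rfl)

end DGModule

/-! ### Jump ideals and the resonance ideal -/

namespace DGLAPair

variable (P : DGLAPair.{u, v})

lemma IsAdmissible.cohomology_bounded (hP : P.IsAdmissible) :
    ∃ n : ℕ, ∀ i : ℕ, n < i → P.cohomology.M.gr i = ⊥ := by
  obtain ⟨n, hn⟩ := hP.bounded
  refine ⟨n, fun i hi => ?_⟩
  change P.M.toGrComplex.cohGr i = ⊥
  rw [eq_bot_iff]
  rintro _ ⟨x, hx, rfl⟩
  have h : (x : P.M.carrier) ∈ P.M.gr i := hx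
  rw [hn i hi, Submodule.mem_bot] at h
  rw [show x = 0 from Subtype.ext h, map_zero]
  exact Submodule.zero_mem _

variable {P} [FiniteDimensional ℂ (P.cohomology.C.gr 1)] {A : ArtAlg}

/-- The cohomology jump ideals of a Maurer–Cartan element whose Aomoto complex is equivalent to a
resonance complex. -/
lemma jumpIdeal_eq_map_resonanceIdeal (hP : P.IsAdmissible) {D : DGLA.{u}} (f : D.Hom P.C)
    (ω : D.MC A) {η : P.cohomology.C.MC A} (φ : P.cohomology.C.FlatRing →ₐ[ℂ] A.carrier)
    (hφ : pushTensor φ _ P.cohomology.C.taut = η.1) (i : ℤ) (k : ℕ)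
    (h : (ThreeTerm.ofComplex ((P.M.restrict f).aomoto ω.isFlat) i).HEq
      (ThreeTerm.ofComplex (P.cohomology.M.aomoto η.isFlat) i)) :
    jumpIdeal ((P.M.restrict f).aomoto ω.isFlat) i k =
      (P.cohomology.resonanceIdeal i k).map φ := by
  have hf : ∀ j, FiniteDimensional ℂ (P.cohomology.M.gr j) := hP.finite
  have hb := hP.cohomology_bounded
  have hfin := finite_extendGr P.cohomology.M.gr hf
  let b := fun n : ℤ => Module.finBasis ℂ (extendGr P.cohomology.M.gr n)
  have h₁ := jumpIdeal_eq_minors ((P.M.restrict f).nonempty_freeResolution_aomoto ω hP.bounded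
    hP.finite) ((P.M.restrict f).subsingleton_aomoto ω.isFlat hP.bounded)
    ((P.M.restrict f).projective_aomoto ω.isFlat) i h (intBasis A.carrier (b (i - 1)))
    (intBasis A.carrier (b i)) (intBasis A.carrier (b (i + 1))) k
  -- The cohomology module is finite-dimensional in each degree and bounded, so the universal
  -- complex over `ℱ(H)` is its own free resolution and its jump ideal is given by its own minors.
  have h₂ := jumpIdeal_eq_minors
    (P.cohomology.M.nonempty_freeResolution_of_finite P.cohomology.C.taut_isFlat hb hf)
    (P.cohomology.M.subsingleton_aomoto P.cohomology.C.taut_isFlat hb)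
    (P.cohomology.M.projective_aomoto P.cohomology.C.taut_isFlat) i (.refl _)
    (intBasis P.cohomology.C.FlatRing (b (i - 1))) (intBasis P.cohomology.C.FlatRing (b i))
    (intBasis P.cohomology.C.FlatRing (b (i + 1))) k
  rw [h₁, resonanceIdeal, h₂]
  exact P.cohomology.M.minors_aomoto φ P.cohomology.C.taut_isFlat η.isFlat hφ i (b (i - 1)) (b i)
    (b (i + 1)) k

variable {g : Type u} [LieRing g] [LieAlgebra ℂ g] {ε : P.C.Hom (DGLA.ofLie g)} {W : Type u}
  [AddCommGroup W] [Module ℂ W] [FiniteDimensional ℂ W]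
  (Z : P.C.Splitting (LinearMap.ker ε.toFun) W) {Ψ : P.C.Def ≅ P.cohomology.C.Def}
  (S : DGLA.NatSection Ψ)

/-- The points of the germ of `𝒬(C) × W` that give deformations in `Def^i_k`. -/
lemma germToDef_mem_jumpSet_iff (hP : P.IsAdmissible) {i : ℕ}
    (hΨ : ∀ (A : ArtAlg) (ω : P.C.MC A) (η : P.cohomology.C.MC A),
      Ψ.hom.app A (Quot.mk _ ω) = Quot.mk _ η →
        (ThreeTerm.ofComplex (P.M.aomoto ω.isFlat) i).HEq
          (ThreeTerm.ofComplex (P.cohomology.M.aomoto η.isFlat) i)) (k : ℕ)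
    (f : GermRing P.cohomology.C.flatCoord W →ₐ[ℂ] A.carrier) :
    (DGLA.germToDef Z S).app A f ∈ (P.augmented ε).jumpSet i k A ↔
      ∀ b ∈ P.cohomology.resonanceIdeal i k, germFst f b = 0 := by
  -- Within `C`, such an `ω` is gauge equivalent to `exp(s(w)) · σ(η)` and so to `σ(η)`: the
  -- coordinate `w` has no influence on the jump ideal. This also shows that vanishing does not
  -- depend on the representative.
  have key : ∀ ω : ε.ker.MC A, ω.Iso (DGLA.germToKer Z S f) →
      jumpIdeal ((P.M.restrict ε.kerInclusion).aomoto ω.isFlat) i k =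
        (P.cohomology.resonanceIdeal i k).map (germFst f) := by
    intro ω hω
    refine jumpIdeal_eq_map_resonanceIdeal hP ε.kerInclusion ω (η := DGLA.germMC f) (germFst f) rfl
      i k ?_
    refine (P.M.heq_aomoto_restrict ε.kerInclusion ω i).trans (hΨ A _ _ ?_)
    have h₁ := DGLA.Hom.mapMC_iso_mapMC ε.kerInclusion hω
    rw [DGLA.mapMC_germToKer] at h₁
    rw [DGLA.MC.mk_eq_mk.2 h₁, ← DGLA.MC.mk_eq_mk.2 (Z.theta_iso S _ (DGLA.germVec_mem f))]
    exact S.app _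
  have hmap : (P.cohomology.resonanceIdeal i k).map (germFst f) = ⊥ ↔
      ∀ b ∈ P.cohomology.resonanceIdeal i k, germFst f b = 0 := Ideal.map_eq_bot_iff_le_ker _
  rw [← hmap]
  constructor
  · rintro ⟨ω, hω, e⟩
    rw [← key ω (DGLA.MC.mk_eq_mk.1 e)]
    exact hω
  · intro h
    exact ⟨DGLA.germToKer Z S f, (key _ (DGLA.MC.mk_eq_mk.1 rfl)).trans h, rfl⟩

/-- If a germ is isomorphic to `Def(C₀)` so that its points in a closed subgerm give the
deformations in `Def^i_k`, then these form a subfunctor that is isomorphic to the subgerm. -/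
lemma exists_jumpFunctor_iso {i : ℤ} {k : ℕ} {Q : DGLAPair.{u, v}}
    {V : Type u} [AddCommGroup V] [Module ℂ V] [FiniteDimensional ℂ V] {B : Type u} [CommRing B]
    [Algebra ℂ B] {c : Module.Dual ℂ V →ₗ[ℂ] B} (J : Ideal B)
    (T : ArtAlg.homFunctor (GermRing c W) ≅ Q.C.Def)
    (hT : ∀ (A : ArtAlg) (f : GermRing c W →ₐ[ℂ] A.carrier),
      T.hom.app A f ∈ Q.jumpSet i k A ↔ ∀ b ∈ J, germFst f b = 0) :
    ∃ h : Q.JumpStable i k,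
      ∃ Φ : (Q.jumpFunctor i k h).toFunctor ≅ ArtAlg.homFunctor (SubGermRing c J W),
        Φ.hom ≫ ArtAlg.homFunctorMap (germRestrict c J W) =
          (Q.jumpFunctor i k h).ι ≫ T.inv := by
  have hbij : ∀ A, Function.Bijective (T.hom.app A) := fun A =>
    (isIso_iff_bijective _).1 inferInstance
  have hstable : Q.JumpStable i k := by
    intro A B p y hy
    obtain ⟨f, rfl⟩ := (hbij A).2 y
    have e : Q.C.Def.map p (T.hom.app A f) = T.hom.app B (p.1.comp f) :=
      (ConcreteCategory.congr_hom (T.hom.naturality p) f).symm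
    rw [Set.mem_preimage, e]
    refine (hT B (p.1.comp f)).2 fun b hb => ?_
    exact (congrArg p.1 ((hT A f).1 hy b hb)).trans (map_zero p.1)
  let R : ArtAlg.homFunctor (SubGermRing c J W) ⟶ ArtAlg.homFunctor (GermRing c W) :=
    ArtAlg.homFunctorMap (germRestrict c J W)
  have hR : ∀ A (f : SubGermRing c J W →ₐ[ℂ] A.carrier),
      (R ≫ T.hom).app A f ∈ Q.jumpSet i k A := fun A f =>
    (hT A (f.comp (germRestrict c J W))).2 ((exists_comp_germRestrict_eq_iff _).1 ⟨f, rfl⟩)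
  -- Points of the subgerm are exactly the points of the germ that kill `J`, so `T` restricts to a
  -- bijection onto the jump sets.
  let Θ : ArtAlg.homFunctor (SubGermRing c J W) ⟶ (Q.jumpFunctor i k hstable).toFunctor :=
    Subfunctor.lift (R ≫ T.hom) (by
      rintro A _ ⟨f, rfl⟩
      exact hR A f)
  have hΘ : IsIso Θ := by
    rw [NatTrans.isIso_iff_isIso_app]
    intro A
    rw [isIso_iff_bijective]
    constructor
    · intro f f' h
      exact comp_germRestrict_injective ((hbij A).1 (congrArg Subtype.val h))
    · rintro ⟨y, hy⟩
      obtain ⟨f, rfl⟩ := (hbij A).2 y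
      obtain ⟨f', rfl⟩ := (exists_comp_germRestrict_eq_iff (J := J) f).2 ((hT A f).1 hy)
      exact ⟨f', rfl⟩
  refine ⟨hstable, (asIso Θ).symm, ?_⟩
  rw [Iso.symm_hom, asIso_inv, IsIso.inv_comp_eq, ← Category.assoc, Iso.eq_comp_inv]
  rfl

end DGLAPair

theorem mainTheorem5 (P : DGLAPair.{u, v}) (hP : P.IsAdmissible)
    [FiniteDimensional ℂ (P.cohomology.C.gr 1)]
    (g : Type u) [LieRing g] [LieAlgebra ℂ g] (ε : P.C.Hom (DGLA.ofLie g))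
    (hsurj : ∀ y : g, ∃ x ∈ P.C.gr 0, ε.toFun x = y)
    (hinj : Set.InjOn ε.toFun (P.C.cocycles ⊓ P.C.gr 0 : Submodule ℂ P.C.carrier))
    [FiniteDimensional ℂ (g ⧸ P.augH0 ε)]
    (q : ℕ∞) (hq : 1 ≤ q) (hformal : P.IsFormal q) :
    ∃ Ψ : (P.augmented ε).C.Def ≅ P.quadGerm (g ⧸ P.augH0 ε),
      ∀ i : ℕ, (i : ℕ∞) ≤ q → ∀ k : ℕ,
        ∃ h : (P.augmented ε).JumpStable i k,
          ∃ Φ : ((P.augmented ε).jumpFunctor i k h).toFunctor ≅ P.resGerm i k (g ⧸ P.augH0 ε),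
            Φ.hom ≫ P.resGermInclusion i k (g ⧸ P.augH0 ε) =
              ((P.augmented ε).jumpFunctor i k h).ι ≫ Ψ.hom := by
  obtain ⟨Ψ, hΨ⟩ := hformal.defEquiv
  obtain ⟨S⟩ := DGLA.nonempty_natSection Ψ
  obtain ⟨Z⟩ : Nonempty (P.C.Splitting (LinearMap.ker ε.toFun) (g ⧸ P.augH0 ε)) :=
    DGLA.nonempty_splitting ε hsurj hinj
  -- The differential of the cohomology DGLA is zero by construction.
  have hiso : IsIso (DGLA.germToDef Z S) := DGLA.isIso_germToDef Z S fun _ => rfl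
  let T : ArtAlg.homFunctor (GermRing P.cohomology.C.flatCoord (g ⧸ P.augH0 ε)) ≅ ε.ker.Def :=
    asIso (DGLA.germToDef Z S)
  refine ⟨T.symm, fun i hi k => ?_⟩
  exact DGLAPair.exists_jumpFunctor_iso (Q := P.augmented ε) _ T
    fun A f => DGLAPair.germToDef_mem_jumpSet_iff Z S hP (fun A ω η h => hΨ A ω η h i hi) k f
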